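/- Let $M$ be a compact complex manifold of dimension $n$ with a Kähler form $\omega=i\,g_{j\bar k}\,dz^j\wedge d\bar z^k$; the class $[\omega]$ is not assumed to be polarized (it need not be the first Chern class of a line bundle). Let $$\mathcal K_\omega=\{\varphi\in C^\infty(M,\mathbb R):\ \omega_\varphi:=\omega+i\partial\bar\partial\varphi>0\},\qquad T_\varphi\mathcal K_\omega=C^\infty(M,\mathbb R).$$ For a Hermitian metric $h=(h_{p\bar q})$ on $T^{1,0}M$ let $R(h)=\bar\partial(\partial h\cdot h^{-1})$, i.e. $R_p{}^q=R_p{}^q{}_{j\bar k}\,dz^j\wedge d\bar z^k$ with $R_p{}^q{}_{j\bar k}=-\partial_{\bar k}(h^{q\bar r}\partial_j h_{p\bar r})$, be its Chern curvature. For $\varphi\in\mathcal K_\omega$ let $R_\varphi$ be the curvature of the metric of $\omega_\varphi$, $\mathrm{Ric}_\varphi$ its Ricci curvature $R_p{}^p{}_{j\bar k}$, $S_\varphi=g_\varphi^{j\bar k}(\mathrm{Ric}_\varphi)_{j\bar k}$, and $\Delta_\varphi f=g_\varphi^{j\bar k}\partial_j\partial_{\bar k}f$, the norms being $|\mathrm{Ric}|^2=g^{j\bar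 k}g^{r\bar l}\mathrm{Ric}_{j\bar l}\mathrm{Ric}_{r\bar k}$ and $|R|^2=g^{p\bar a}g^{b\bar q}g^{j\bar c}g^{d\bar k}R_{p\bar qj\bar k}\overline{R_{a\bar bc\bar d}}$. Define a $1$-form on $\mathcal K_\omega$ by $$\gamma^{(2)}_\varphi(\psi)=\int_M\psi\Big(\tfrac16\Delta_\varphi S_\varphi-\tfrac1{24}\big(|R_\varphi|^2-4|\mathrm{Ric}_\varphi|^2+3S_\varphi^2\big)\Big)\frac{\omega_\varphi^n}{n!}.$$ **(Closedness.)** $\gamma^{(2)}$ is closed: for all $\varphi\in\mathcal K_\omega$ and $\psi_1,\psi_2\in C^\infty(M,\mathbb R)$ the following derivatives exist and $$\frac{d}{dt}\Big|_{t=0}\gamma^{(2)}_{\varphi+t\psi_1}(\psi_2)=\frac{d}{dt}\Big|_{t=0}\gamma^{(2)}_{\varphi+t\psi_2}(\psi_1).$$ **(Exactness.)** Let $\mathrm{Td}_2=\tfrac1{12}(\mathrm c_1^2+\mathrm c_2)=\tfrac1{24}\big(\mathrm{Tr}(A^2)-3(\mathrm{Tr}A)^2\big)$, where $\mathrm c(A)=\det(I+iA)$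 (no factors of $2\pi$), with polarization $\mathrm{Td}_2(\cdot,\cdot)$. For $\varphi\in\mathcal K_\omega$ choose a smooth path $h_t$, $0\le t\le1$, of Hermitian metrics on $T^{1,0}M$ from the metric of $\omega$ to the metric of $\omega_\varphi$ (such paths exist), and put $$BC(\mathrm{Td}_2;\omega_\varphi,\omega)=\int_0^1\Big(\mathrm{Td}_2\big(\dot h_th_t^{-1},R(h_t)\big)+\mathrm{Td}_2\big(R(h_t),\dot h_th_t^{-1}\big)\Big)dt.$$ Then $$\widetilde S(\varphi)=\int_M-i\,BC(\mathrm{Td}_2;\omega_\varphi,\omega)\wedge\frac{\omega^{n-1}}{(n-1)!}+\mathrm{Td}_2(R_\varphi)\wedge\frac{-1}{(n-1)!}\sum_{s=0}^{n-2}\varphi\,\omega_\varphi^s\wedge\omega^{n-2-s}$$ is real and does not depend on the chosen path, and $\widetilde S:\mathcal K_\omega\to\mathbb R$ satisfies $d\widetilde S=\gamma^{(2)}$: $$\frac{d}{dt}\Big|_{t=0}\widetilde S(\varphi+t\psi)=\gamma^{(2)}_\varphi(\psi)\qquad(\varphi\in\mathcal K_\omega,\ \psi\in C^\infty(M,\mathbb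 R)).$$ (For $n=0$ all curvature terms, and hence $\gamma^{(2)}$ and $\widetilde S$, are zero.) -/

import Mathlib

open scoped Manifold ContDiff ComplexOrder

noncomputable section

namespace KahlerGeom

/-- The model space `ℂⁿ`, with coordinates `z¹, …, zⁿ`. Its `volume` is the Lebesgue measure
`∏ dxʲ dyʲ`. -/
abbrev Cn (n : ℕ) : Type := Fin n → ℂ

/-- A holomorphic atlas is in particular a smooth atlas. -/
theorem isManifold_real (n : ℕ) (M : Type*) [TopologicalSpace M] [ChartedSpace (Cn n) M]
    [IsManifold 𝓘(ℂ, Cn n) ω M] : IsManifold 𝓘(ℝ, Cn n) ∞ M := by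
  apply isManifold_of_contDiffOn
  intro e e' he he'
  have h := (contDiffGroupoid ω 𝓘(ℂ, Cn n)).compatible he he'
  rw [contDiffGroupoid, mem_groupoid_of_pregroupoid] at h
  exact (h.1.restrict_scalars ℝ).of_le le_top

/-! ### Pointwise exterior algebra in a holomorphic coordinate system -/

/-- The algebra of complex-valued forms at a point of a coordinate domain: the exterior algebra
on the basis `dz¹, dz̄¹, …, dzⁿ, dz̄ⁿ`. Multiplication is the wedge product. -/
abbrev Forms (n : ℕ) : Type := ExteriorAlgebra ℂ (Fin n × Fin 2 → ℂ)

variable {n : ℕ}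

/-- `dzʲ`. -/
def dz (j : Fin n) : Forms n := ExteriorAlgebra.ι ℂ (Pi.single (j, 0) 1)

/-- `dz̄ʲ`. -/
def dzbar (j : Fin n) : Forms n := ExteriorAlgebra.ι ℂ (Pi.single (j, 1) 1)

/-- The `(1,1)`-form `∑ A_{jk̄} dzʲ ∧ dz̄ᵏ`. -/
def form11 (A : Matrix (Fin n) (Fin n) ℂ) : Forms n :=
  ∑ j, ∑ k, A j k • (dz j * dzbar k)

/-- The coefficient of `dz¹ ∧ dz̄¹ ∧ ⋯ ∧ dzⁿ ∧ dz̄ⁿ` in a form; it only sees the component of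
degree `2n`. -/
def topCoeff : Forms n →ₗ[ℂ] ℂ :=
  ExteriorAlgebra.liftAlternating fun k =>
    if h : k = n * 2 then
      AlternatingMap.domDomCongr (finProdFinEquiv.trans (finCongr h.symm))
        (Matrix.detRowAlternating (n := Fin n × Fin 2) (R := ℂ))
    else 0

/-! ### Wirtinger derivatives -/

/-- `∂f/∂zʲ`. -/
def dd (j : Fin n) (f : Cn n → ℂ) (z : Cn n) : ℂ :=
  (1 / 2) * (fderiv ℝ f z (Pi.single j 1) - Complex.I * fderiv ℝ f z (Pi.single j Complex.I))

/-- `∂f/∂z̄ʲ`. -/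
def ddbar (j : Fin n) (f : Cn n → ℂ) (z : Cn n) : ℂ :=
  (1 / 2) * (fderiv ℝ f z (Pi.single j 1) + Complex.I * fderiv ℝ f z (Pi.single j Complex.I))

/-- The matrix `∂²f/∂zʲ∂z̄ᵏ`, so that `∂∂̄f = form11 (hess f z)`. -/
def hess (f : Cn n → ℂ) (z : Cn n) : Matrix (Fin n) (Fin n) ℂ :=
  Matrix.of fun j k => dd j (fun w => ddbar k f w) z

/-! ### Local formulas for a metric `h = (h_{pq̄})` on a coordinate domain

The inverse metric is `h^{jk̄} = (h⁻¹)_{kj}`, that is `∑ₖ h_{lk̄} h^{jk̄} = δ`. -/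

/-- The matrix `(∂_j h · h⁻¹)_p^q = Γ^q_{jp}` of the `dzʲ`-part of the Chern connection. -/
def chern (h : Cn n → Matrix (Fin n) (Fin n) ℂ) (j : Fin n) (z : Cn n) :
    Matrix (Fin n) (Fin n) ℂ :=
  (Matrix.of fun p q => dd j (fun w => h w p q) z) * (h z)⁻¹

/-- The matrix (indexed by `p`, `q`) of the curvature components
`R_p^q_{jk̄} = -∂Γ^q_{jp}/∂z̄ᵏ`. -/
def curv (h : Cn n → Matrix (Fin n) (Fin n) ℂ) (z : Cn n) (j k : Fin n) :
    Matrix (Fin n) (Fin n) ℂ :=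
  Matrix.of fun p q => -ddbar k (fun w => chern h j w p q) z

/-- The curvature form `R = ∂̄(∂h · h⁻¹)`, the matrix of `(1,1)`-forms
`R_p^q = ∑ R_p^q_{jk̄} dzʲ ∧ dz̄ᵏ`. -/
def curvForm (h : Cn n → Matrix (Fin n) (Fin n) ℂ) (z : Cn n) :
    Matrix (Fin n) (Fin n) (Forms n) :=
  Matrix.of fun p q => form11 (Matrix.of fun j k => curv h z j k p q)

/-- The Ricci curvature `Ric_{jk̄} = R_p^p_{jk̄}`. -/
def ricci (h : Cn n → Matrix (Fin n) (Fin n) ℂ) (z : Cn n) : Matrix (Fin n) (Fin n) ℂ :=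
  Matrix.of fun j k => (curv h z j k).trace

/-- `tr α = h^{jk̄} α_{jk̄}`. -/
def tr (H A : Matrix (Fin n) (Fin n) ℂ) : ℂ := ∑ j, ∑ k, H⁻¹ k j * A j k

/-- `⟨α, β⟩ = h^{jk̄} h^{rl̄} α_{jl̄} β_{rk̄}`. -/
def pairing (H A B : Matrix (Fin n) (Fin n) ℂ) : ℂ :=
  ∑ j, ∑ k, ∑ r, ∑ l, H⁻¹ k j * H⁻¹ l r * A j l * B r k

/-- The scalar curvature `S = h^{jk̄} Ric_{jk̄}`. -/
def scal (h : Cn n → Matrix (Fin n) (Fin n) ℂ) (z : Cn n) : ℂ := tr (h z) (ricci h z)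

/-- The Laplacian `Δf = h^{jk̄} ∂_j ∂_k̄ f`. -/
def lap (h : Cn n → Matrix (Fin n) (Fin n) ℂ) (f : Cn n → ℂ) (z : Cn n) : ℂ :=
  tr (h z) (hess f z)

/-- The curvature with lowered index, `R_{pq̄jk̄} = R_p^s_{jk̄} h_{sq̄}`. -/
def curvLow (h : Cn n → Matrix (Fin n) (Fin n) ℂ) (z : Cn n) (p q j k : Fin n) : ℂ :=
  (curv h z j k * h z) p q

/-- `|R|² = h^{pā} h^{bq̄} h^{jc̄} h^{dk̄} R_{pq̄jk̄} conj(R_{ab̄cd̄})`. -/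
def normSqCurv (h : Cn n → Matrix (Fin n) (Fin n) ℂ) (z : Cn n) : ℂ :=
  ∑ p, ∑ q, ∑ j, ∑ k, ∑ a, ∑ b, ∑ c, ∑ d,
    (h z)⁻¹ a p * (h z)⁻¹ q b * (h z)⁻¹ c j * (h z)⁻¹ k d *
      curvLow h z p q j k * star (curvLow h z a b c d)

/-- The fundamental form `i h_{jk̄} dzʲ ∧ dz̄ᵏ`. -/
def fundForm (H : Matrix (Fin n) (Fin n) ℂ) : Forms n := form11 (Complex.I • H)

/-- The (polarized) second Todd polynomial. With `c(A) = det (1 + iA)` and without factors of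
`2π`, `Td₂ = (c₁² + c₂) / 12 = (Tr(A²) - 3 (Tr A)²) / 24`. -/
def td2 {R : Type*} [Ring R] [Algebra ℂ R] (A B : Matrix (Fin n) (Fin n) R) : R :=
  (1 / 24 : ℂ) • ((A * B).trace - (3 : ℂ) • (A.trace * B.trace))

/-! ### Forms and metrics on a complex manifold -/

variable {M : Type*} [TopologicalSpace M] [ChartedSpace (Cn n) M]

/-- The matrix `B(∂_j, ∂_k)` of a family of sesquilinear forms on the holomorphic tangent spaces
in the coordinate system `e`, at the point with coordinates `z`. -/
def localMatrix
    (B : ∀ x : M, TangentSpace 𝓘(ℂ, Cn n) x →ₗ[ℂ] TangentSpace 𝓘(ℂ, Cn n) x →ₗ⋆[ℂ] ℂ)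
    (e : OpenPartialHomeomorph M (Cn n)) (z : Cn n) : Matrix (Fin n) (Fin n) ℂ :=
  Matrix.of fun j k =>
    B (e.symm z)
      (mfderiv 𝓘(ℂ, Cn n) 𝓘(ℂ, Cn n) e.symm z (Pi.single j 1 : Cn n))
      (mfderiv 𝓘(ℂ, Cn n) 𝓘(ℂ, Cn n) e.symm z (Pi.single k 1 : Cn n))

variable (n M) in
/-- A smooth Hermitian metric on the holomorphic tangent bundle. -/
structure HermitianMetric where
  /-- the Hermitian product on each tangent space -/
  form : ∀ x : M, TangentSpace 𝓘(ℂ, Cn n) x →ₗ[ℂ] TangentSpace 𝓘(ℂ, Cn n) x →ₗ⋆[ℂ] ℂ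
  conj_symm : ∀ x v w, star (form x v w) = form x w v
  pos : ∀ x v, v ≠ 0 → 0 < form x v v
  smooth : ∀ e ∈ atlas (Cn n) M, ∀ j k,
    ContDiffOn ℝ ∞ (fun z => localMatrix form e z j k) e.target

/-- The matrix `g_{jk̄}` of a Hermitian metric in the coordinate system `e`. -/
def HermitianMetric.mat (g : HermitianMetric n M) (e : OpenPartialHomeomorph M (Cn n))
    (z : Cn n) : Matrix (Fin n) (Fin n) ℂ :=
  localMatrix g.form e z

/-- The metric is Kähler: its fundamental form is closed, i.e. `∂_l g_{jk̄} = ∂_j g_{lk̄}`. -/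
def HermitianMetric.IsKahler (g : HermitianMetric n M) : Prop :=
  ∀ e ∈ atlas (Cn n) M, ∀ z ∈ e.target, ∀ j k l,
    dd l (fun w => g.mat e w j k) z = dd j (fun w => g.mat e w l k) z

/-- The local expression in the coordinate system `e` of a smooth real function. -/
def locFun (φ : C^∞⟮𝓘(ℝ, Cn n), M; ℝ⟯) (e : OpenPartialHomeomorph M (Cn n)) (z : Cn n) : ℂ :=
  (φ (e.symm z) : ℂ)

/-- The matrix of `ω_φ = ω + i∂∂̄φ`, that is `g_{jk̄} + ∂_j ∂_k̄ φ`, in the coordinate system `e`. -/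
def HermitianMetric.matPot (g : HermitianMetric n M) (φ : C^∞⟮𝓘(ℝ, Cn n), M; ℝ⟯)
    (e : OpenPartialHomeomorph M (Cn n)) (z : Cn n) : Matrix (Fin n) (Fin n) ℂ :=
  g.mat e z + hess (locFun φ e) z

/-- The space `𝒦_ω` of Kähler potentials: smooth real functions `φ` with `ω + i∂∂̄φ > 0`. -/
def HermitianMetric.potentials (g : HermitianMetric n M) : Set C^∞⟮𝓘(ℝ, Cn n), M; ℝ⟯ :=
  {φ | ∀ e ∈ atlas (Cn n) M, ∀ z ∈ e.target, (g.matPot φ e z).PosDef}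

/-- A smooth path `h_t` of Hermitian metrics on the holomorphic tangent bundle with `h_0` the
metric of `ω` and `h_1` the metric of `ω_φ`. (The parameter runs through `ℝ`; every smooth path
over `[0,1]` extends, and only its restriction to `[0,1]` matters.) -/
structure MetricPath (g : HermitianMetric n M) (φ : C^∞⟮𝓘(ℝ, Cn n), M; ℝ⟯) where
  /-- the metric at time `t` -/
  metric : ℝ → HermitianMetric n M
  smooth : ∀ e ∈ atlas (Cn n) M, ∀ j k,
    ContDiffOn ℝ ∞ (fun p : ℝ × Cn n => (metric p.1).mat e p.2 j k) (Set.univ ×ˢ e.target)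
  start : ∀ e ∈ atlas (Cn n) M, ∀ z ∈ e.target, (metric 0).mat e z = g.mat e z
  finish : ∀ e ∈ atlas (Cn n) M, ∀ z ∈ e.target, (metric 1).mat e z = g.matPot φ e z

/-- `ḣ_t h_t⁻¹`. -/
def MetricPath.velocity {g : HermitianMetric n M} {φ : C^∞⟮𝓘(ℝ, Cn n), M; ℝ⟯}
    (P : MetricPath g φ) (e : OpenPartialHomeomorph M (Cn n)) (z : Cn n) (t : ℝ) :
    Matrix (Fin n) (Fin n) ℂ :=
  (Matrix.of fun p q => deriv (fun s => (P.metric s).mat e z p q) t) * ((P.metric t).mat e z)⁻¹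

/-- The Bott–Chern form `BC(Td₂; ω_φ, ω) = ∫₀¹ Td₂'(R(h_t); ḣ_t h_t⁻¹) dt` computed along the
path `h_t`, where `Td₂'(A; B) = Td₂(B, A) + Td₂(A, B)`; it is a `(1,1)`-form. -/
def MetricPath.bottChern {g : HermitianMetric n M} {φ : C^∞⟮𝓘(ℝ, Cn n), M; ℝ⟯}
    (P : MetricPath g φ) (e : OpenPartialHomeomorph M (Cn n)) (z : Cn n) : Forms n :=
  form11 (Matrix.of fun j k => ∫ t in (0 : ℝ)..1,
    (td2 (P.velocity e z t) (curv ((P.metric t).mat e) z j k) +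
      td2 (curv ((P.metric t).mat e) z j k) (P.velocity e z t)))

section Integration

variable [T2Space M] [CompactSpace M] [IsManifold 𝓘(ℂ, Cn n) ω M]

variable (n M) in
theorem exists_partition : ∃ f : SmoothPartitionOfUnity M 𝓘(ℝ, Cn n) M Set.univ,
    f.IsSubordinate (fun x => (chartAt (Cn n) x).source) :=
  haveI := isManifold_real n M
  SmoothPartitionOfUnity.exists_isSubordinate_chartAt_source 𝓘(ℝ, Cn n) M

variable (n M) in
/-- A smooth partition of unity subordinate to the coordinate domains. -/
def partition : SmoothPartitionOfUnity M 𝓘(ℝ, Cn n) M Set.univ := (exists_partition n M).choose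

/-- `∫_M η` for a form `η` given by its local expressions `η e` in the coordinate systems `e` of
the atlas: the sum of the integrals of `ρ_x η` over the coordinate domains, where `(ρ_x)` is a
partition of unity (on compact `M` almost all terms vanish) and
`dz¹ ∧ dz̄¹ ∧ ⋯ ∧ dzⁿ ∧ dz̄ⁿ = (-2i)ⁿ dx¹ ∧ dy¹ ∧ ⋯ ∧ dxⁿ ∧ dyⁿ`. -/
def integralForm (η : OpenPartialHomeomorph M (Cn n) → Cn n → Forms n) : ℂ :=
  ∑ᶠ x : M, ∫ z in (chartAt (Cn n) x).target,
    (partition n M x ((chartAt (Cn n) x).symm z) : ℂ) *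
      ((-2 * Complex.I) ^ n * topCoeff (η (chartAt (Cn n) x) z))

/-- `γ⁽²⁾_φ(ψ) = ∫_M ψ (Δ_φ S_φ / 6 - (|R_φ|² - 4 |Ric_φ|² + 3 S_φ²) / 24) ω_φⁿ / n!`. -/
def HermitianMetric.gamma (g : HermitianMetric n M) (φ ψ : C^∞⟮𝓘(ℝ, Cn n), M; ℝ⟯) : ℂ :=
  integralForm (M := M) fun e z =>
    let h := g.matPot φ e
    (locFun ψ e z *
        ((1 / 6) * lap h (scal h) z -
          (1 / 24) * (normSqCurv h z - 4 * pairing (h z) (ricci h z) (ricci h z)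
            + 3 * scal h z ^ 2))) •
      ((1 / (n.factorial : ℂ)) • fundForm (h z) ^ n)

/-- `∫_M -i BC(Td₂; ω_φ, ω) ∧ ωⁿ⁻¹/(n-1)!
  + Td₂(R_φ) ∧ (-1/(n-1)!) ∑_{s=0}^{n-2} φ ω_φˢ ∧ ωⁿ⁻²⁻ˢ`,
with the Bott–Chern form computed along the path `P`. (For `n = 0` both `BC(Td₂)` and
`Td₂(R_φ)` vanish.) -/
def MetricPath.functional {g : HermitianMetric n M} {φ : C^∞⟮𝓘(ℝ, Cn n), M; ℝ⟯}
    (P : MetricPath g φ) : ℂ :=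
  integralForm (M := M) fun e z =>
    let h := g.matPot φ e
    (-Complex.I) • (P.bottChern e z *
        ((1 / ((n - 1).factorial : ℂ)) • fundForm (g.mat e z) ^ (n - 1))) +
      td2 (curvForm h z) (curvForm h z) *
        ((-1 / ((n - 1).factorial : ℂ)) • ∑ s ∈ Finset.range (n - 1),
          locFun φ e z • (fundForm (h z) ^ s * fundForm (g.mat e z) ^ (n - 2 - s)))

end Integration

end KahlerGeom

end

/-! Write U = ḣh⁻¹ for the velocity of a family of Hermitian metrics and ∇ for the (1,0)-part of its
Chern connection. Everything rests on the ad-invariance of the polarized Td₂, on DR = -∂̄∇U for a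
parameter derivative D, and on the Bianchi identity.

(1) Modulo the images of ∂ and ∂̄, δh ↦ Td₂(δh·h⁻¹, R(h)) is a closed 1-form on the space of
metrics. For commuting parameter derivatives D, E with velocities U, V the Maurer–Cartan equation DV
- EU = [U, V] and invariance give D Td₂(V, R) - E Td₂(U, R) = ∂ Td₂(U, ∂̄V) + ∂̄ Td₂(∇U, V)
(`DiffRing.der_form11_toddVariation`). After wedging with the closed form ωⁿ⁻¹ and applying Stokes,
this becomes closedness of an honest 1-form. Since two paths with common endpoints can be
interpolated through positive matrices, the Bott–Chern term does not depend on the path. Its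
derivative in φ is the endpoint term 2 Td₂(U, R) ∧ ωⁿ⁻¹ at ω_φ.

(2) In the second term, D Td₂(R, R) = 2 Td₂(-∂̄∇U, R). Integration by parts moves ∂∂̄ from U to φ;
derivatives that fall on R disappear by Bianchi. As i∂∂̄φ = ω_φ - ω, the geometric sum telescopes
and replaces the ωⁿ⁻¹ of (1) by ω_φⁿ⁻¹ (`DiffRing.der_toddForm_mul`). With U = ∂∂̄ψ·h⁻¹ at ω_φ, what
remains of (n-1)! dS̃(ψ) is -2i ∫ Td₂(U, R) ∧ ω_φⁿ⁻¹ - (n-1) ∫ ψ Td₂(R, R) ∧ ω_φⁿ⁻².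

(3) The Kähler symmetries of the curvature turn both integrands into contractions. The first gives
-(1/12)(⟨∂∂̄ψ, Ric⟩ - 3 S Δψ). Because Ric ∧ ω_φⁿ⁻² is closed, ∫⟨∂∂̄ψ, Ric⟩ = ∫ S Δψ, and
self-adjointness of Δ turns the total into ∫ ψ ΔS / 6. The second gives the quadratic curvature
terms (`mint_gammaDensity`). This is dS̃ = γ⁽²⁾.

(4) The density of γ⁽²⁾ is invariant under conjugation, so Im S̃ is constant along τφ; it vanishes
at 0, hence S̃ is real. Closedness of γ⁽²⁾ is the symmetry of the mixed partials of S̃ on the planes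
φ + sψ₁ + tψ₂, on which potentials form an open set.

To make these computations algebra, functions on a coordinate domain carry two extra real
parameters, so that D, ∂_j and ∂_k̄ are commuting derivations of one commutative ring (`DiffRing`,
`Sm`). Forms are tensors of that ring with a constant exterior algebra (`FA`), and covariance under
holomorphic changes of coordinates is proved once for abstract pull-backs (`Transition`). Integrals
over M are sums over a partition of unity (`mint`), for which Stokes and differentiation in the
parameters are proved. The `_eq_ev` lemmas identify these objects with the explicit local formulas.
-/

noncomputable section

set_option linter.unusedSectionVars false

namespace KahlerGeom

/-! ### Chern–Weil identities over a ring with commuting derivations -/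

/-- Commuting families of derivations `d j = ∂_j` and `db k = ∂_k̄` of a commutative algebra. -/
structure DiffRing (ι C : Type*) [CommRing C] [Algebra ℂ C] where
  /-- the holomorphic derivations -/
  d : ι → Derivation ℂ C C
  /-- the antiholomorphic derivations -/
  db : ι → Derivation ℂ C C
  d_d : ∀ j k f, d j (d k f) = d k (d j f)
  db_db : ∀ j k f, db j (db k f) = db k (db j f)
  d_db : ∀ j k f, d j (db k f) = db k (d j f)

section ChernWeil

variable {ι C m : Type*} [CommRing C] [Algebra ℂ C] [Fintype m] [DecidableEq m]

theorem map_mul_derivation (D : Derivation ℂ C C) (X Y : Matrix m m C) :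
    (X * Y).map D = X.map D * Y + X * Y.map D := by
  ext p q
  simp only [Matrix.map_apply, Matrix.mul_apply, map_sum, Derivation.leibniz, Matrix.add_apply,
    smul_eq_mul, Finset.sum_add_distrib]
  rw [add_comm]
  congr 1
  exact Finset.sum_congr rfl fun _ _ => mul_comm _ _

theorem map_add_derivation (D : Derivation ℂ C C) (X Y : Matrix m m C) :
    (X + Y).map D = X.map D + Y.map D := by ext; simp

theorem map_sub_derivation (D : Derivation ℂ C C) (X Y : Matrix m m C) :
    (X - Y).map D = X.map D - Y.map D := by ext; simp

theorem map_neg_derivation (D : Derivation ℂ C C) (X : Matrix m m C) :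
    (-X).map D = -X.map D := by ext; simp

theorem map_smul_derivation (D : Derivation ℂ C C) (f : C) (X : Matrix m m C) :
    (f • X).map D = D f • X + f • X.map D := by
  ext p q
  simp only [Matrix.map_apply, Matrix.smul_apply, smul_eq_mul, Derivation.leibniz, Matrix.add_apply]
  ring

theorem trace_map_derivation (D : Derivation ℂ C C) (X : Matrix m m C) :
    (X.map D).trace = D X.trace := by simp [Matrix.trace]

theorem map_one_derivation (D : Derivation ℂ C C) : (1 : Matrix m m C).map D = 0 := by
  ext p q
  by_cases h : p = q
  · subst h; simp
  · simp [Matrix.one_apply_ne h]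

theorem map_inv_derivation (D : Derivation ℂ C C) {h : Matrix m m C} (hh : IsUnit h.det) :
    h⁻¹.map D = -(h⁻¹ * h.map D * h⁻¹) := by
  have h1 := map_mul_derivation D h h⁻¹
  rw [Matrix.mul_nonsing_inv _ hh, map_one_derivation] at h1
  have h2 : h⁻¹ * (h * h⁻¹.map D) = h⁻¹.map D := by
    rw [← Matrix.mul_assoc, Matrix.nonsing_inv_mul _ hh, Matrix.one_mul]
  rw [← h2, eq_neg_of_add_eq_zero_right h1.symm]
  simp [Matrix.mul_assoc]

variable (𝒟 : DiffRing ι C)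

namespace DiffRing

/-- The connection matrices `Γ_j = ∂_j h · h⁻¹`. -/
def conn (h : Matrix m m C) (j : ι) : Matrix m m C := h.map (𝒟.d j) * h⁻¹

/-- The curvature matrices `R_{jk̄} = -∂_k̄ Γ_j`. -/
def curvature (h : Matrix m m C) (j k : ι) : Matrix m m C := -(𝒟.conn h j).map (𝒟.db k)

/-- The covariant derivative `D_j X = ∂_j X + [X, Γ_j]`. -/
def cov (h : Matrix m m C) (j : ι) (X : Matrix m m C) : Matrix m m C :=
  X.map (𝒟.d j) + X * 𝒟.conn h j - 𝒟.conn h j * X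

/-- Infinitesimal gauge calculus: the variation of the Chern connection is the covariant derivative
of the velocity `h.map D * h⁻¹`. Only commutation of `D` with `∂_j` enters. -/
theorem conn_map {h : Matrix m m C} (hh : IsUnit h.det) (D : Derivation ℂ C C) (j : ι)
    (hD : ∀ f, D (𝒟.d j f) = 𝒟.d j (D f)) :
    (𝒟.conn h j).map D = 𝒟.cov h j (h.map D * h⁻¹) := by
  have hc : (h.map (𝒟.d j)).map D = (h.map D).map (𝒟.d j) := by ext; simp [hD]
  simp only [conn, cov, map_mul_derivation, map_inv_derivation _ hh, hc]
  noncomm_ring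

theorem curvature_map {h : Matrix m m C} (hh : IsUnit h.det) (D : Derivation ℂ C C) (j k : ι)
    (hD : ∀ f, D (𝒟.d j f) = 𝒟.d j (D f)) (hDb : ∀ f, D (𝒟.db k f) = 𝒟.db k (D f)) :
    (𝒟.curvature h j k).map D = -(𝒟.cov h j (h.map D * h⁻¹)).map (𝒟.db k) := by
  rw [← 𝒟.conn_map hh D j hD, curvature, map_neg_derivation]
  ext; simp [hDb]

/-- The connection `∂h · h⁻¹` is pure gauge in the holomorphic directions, so its (2,0)-curvature
vanishes. -/
theorem conn_map_d {h : Matrix m m C} (hh : IsUnit h.det) (j l : ι) :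
    (𝒟.conn h j).map (𝒟.d l) - (𝒟.conn h l).map (𝒟.d j)
      = 𝒟.conn h l * 𝒟.conn h j - 𝒟.conn h j * 𝒟.conn h l := by
  have hc : (h.map (𝒟.d j)).map (𝒟.d l) = (h.map (𝒟.d l)).map (𝒟.d j) := by
    ext; simp [𝒟.d_d l j]
  simp only [conn, map_mul_derivation, map_inv_derivation _ hh, hc]
  noncomm_ring

theorem map_db_d (X : Matrix m m C) (j k : ι) :
    (X.map (𝒟.d j)).map (𝒟.db k) = (X.map (𝒟.db k)).map (𝒟.d j) := by
  ext; simp [𝒟.d_db]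

/-- The second Bianchi identity. -/
theorem bianchi {h : Matrix m m C} (hh : IsUnit h.det) (j k l : ι) :
    𝒟.cov h l (𝒟.curvature h j k) = 𝒟.cov h j (𝒟.curvature h l k) := by
  -- The Bianchi identity is the `∂_k̄`-derivative of the vanishing (2,0)-curvature.
  have h1 := congrArg (fun X : Matrix m m C => X.map (𝒟.db k)) (𝒟.conn_map_d hh j l)
  simp only [map_sub_derivation, map_mul_derivation, map_db_d] at h1
  simp only [cov, curvature, map_neg_derivation]
  rw [sub_eq_iff_eq_add] at h1
  rw [h1]
  noncomm_ring

theorem curvature_map_db (h : Matrix m m C) (j k l : ι) :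
    (𝒟.curvature h j k).map (𝒟.db l) = (𝒟.curvature h j l).map (𝒟.db k) := by
  ext p q
  simp [curvature, 𝒟.db_db l k]

/-- The commutator of `∇_j` with `∂_k̄` is the commutator with the curvature. -/
theorem cov_map_db (h : Matrix m m C) (j k : ι) (X : Matrix m m C) :
    𝒟.cov h j (X.map (𝒟.db k)) = (𝒟.cov h j X).map (𝒟.db k) + X * 𝒟.curvature h j k
      - 𝒟.curvature h j k * X := by
  simp only [cov, curvature, map_add_derivation, map_sub_derivation, map_mul_derivation, map_db_d]
  noncomm_ring

/-- Green's identity before integration: the difference is a divergence because the products of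
first derivatives cancel. -/
theorem hess_symm (f g : C) (j k : ι) :
    f * 𝒟.d j (𝒟.db k g) - g * 𝒟.d j (𝒟.db k f)
      = 𝒟.d j (f * 𝒟.db k g) - 𝒟.db k (g * 𝒟.d j f) := by
  simp only [Derivation.leibniz, smul_eq_mul, 𝒟.d_db]
  ring

/-- The Maurer–Cartan equation of `dh · h⁻¹` on the parameter space. -/
theorem velocity_map_sub {h : Matrix m m C} (hh : IsUnit h.det) (D E : Derivation ℂ C C)
    (hDE : ∀ f, D (E f) = E (D f)) :
    (h.map E * h⁻¹).map D - (h.map D * h⁻¹).map E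
      = (h.map D * h⁻¹) * (h.map E * h⁻¹) - (h.map E * h⁻¹) * (h.map D * h⁻¹) := by
  have hc : (h.map E).map D = (h.map D).map E := by ext; simp [hDE]
  simp only [map_mul_derivation, map_inv_derivation _ hh, hc]
  noncomm_ring

end DiffRing

end ChernWeil

end KahlerGeom
end

noncomputable section

namespace KahlerGeom

/-! ### Rings of smooth functions on open sets -/

section Smooth

open TopologicalSpace

variable {X : Type*} [NormedAddCommGroup X] [NormedSpace ℝ X]

/-- The algebra of smooth complex functions on an open subset of a normed space. -/
def smoothSubalgebra (W : Opens X) : Subalgebra ℂ (W → ℂ) where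
  carrier := {f | ∃ F : X → ℂ, ContDiffOn ℝ ∞ F W ∧ ∀ x : W, f x = F x}
  mul_mem' := by
    rintro f g ⟨F, hF, hf⟩ ⟨G, hG, hg⟩
    exact ⟨fun x => F x * G x, hF.mul hG, fun x => by simp [hf, hg]⟩
  add_mem' := by
    rintro f g ⟨F, hF, hf⟩ ⟨G, hG, hg⟩
    exact ⟨fun x => F x + G x, hF.add hG, fun x => by simp [hf, hg]⟩
  algebraMap_mem' c := ⟨fun _ => c, contDiffOn_const, fun x => rfl⟩

/-- The ring of smooth complex functions on `W`. -/
def Sm (W : Opens X) : Type _ := smoothSubalgebra W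

variable {W W' : Opens X}

namespace Sm

instance : CommRing (Sm W) := inferInstanceAs (CommRing (smoothSubalgebra W))

instance : Algebra ℂ (Sm W) := inferInstanceAs (Algebra ℂ (smoothSubalgebra W))

/-- Extension by zero. -/
def ext (f : Sm W) (x : X) : ℂ := by
  classical exact if h : x ∈ W then f.1 ⟨x, h⟩ else 0

theorem ext_of_mem (f : Sm W) {x : X} (h : x ∈ W) : f.ext x = f.1 ⟨x, h⟩ := by simp [ext, h]

@[simp] theorem ext_coe (f : Sm W) (x : W) : f.ext x = f.1 x := ext_of_mem f x.2

theorem contDiffOn_ext (f : Sm W) : ContDiffOn ℝ ∞ f.ext W := by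
  obtain ⟨F, hF, hf⟩ := f.2
  exact hF.congr fun x hx => by rw [ext_of_mem f hx, hf]

theorem contDiffAt_ext (f : Sm W) {x : X} (hx : x ∈ W) : ContDiffAt ℝ ∞ f.ext x :=
  f.contDiffOn_ext.contDiffAt (W.isOpen.mem_nhds hx)

theorem differentiableAt_ext (f : Sm W) {x : X} (hx : x ∈ W) : DifferentiableAt ℝ f.ext x :=
  (f.contDiffAt_ext hx).differentiableAt (by simp)

theorem ext_eq {f g : Sm W} (h : ∀ x ∈ W, f.ext x = g.ext x) : f = g :=
  Subtype.ext <| funext fun x => by simpa using h x x.2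

/-- The element of `Sm W` given by a function smooth on `W`. -/
def of (F : X → ℂ) (hF : ContDiffOn ℝ ∞ F W) : Sm W := ⟨fun x => F x, F, hF, fun _ => rfl⟩

theorem ext_of {F : X → ℂ} (hF : ContDiffOn ℝ ∞ F W) {x : X} (hx : x ∈ W) :
    (of F hF).ext x = F x := by rw [ext_of_mem _ hx]; rfl

theorem ext_add (f g : Sm W) (x : X) : (f + g).ext x = f.ext x + g.ext x := by
  by_cases h : x ∈ W
  · simp only [ext_of_mem _ h]; rfl
  · simp [ext, h]

theorem ext_mul (f g : Sm W) (x : X) : (f * g).ext x = f.ext x * g.ext x := by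
  by_cases h : x ∈ W
  · simp only [ext_of_mem _ h]; rfl
  · simp [ext, h]

theorem ext_smul (c : ℂ) (g : Sm W) (x : X) : (c • g).ext x = c * g.ext x := by
  by_cases h : x ∈ W
  · simp only [ext_of_mem _ h]; rfl
  · simp [ext, h]

theorem ext_neg (f : Sm W) (x : X) : (-f).ext x = -f.ext x := by
  by_cases h : x ∈ W
  · simp only [ext_of_mem _ h]; rfl
  · simp [ext, h]

theorem ext_zero (x : X) : (0 : Sm W).ext x = 0 := by
  by_cases h : x ∈ W
  · simp only [ext_of_mem _ h]; rfl
  · simp [ext, h]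

theorem ext_sub (f g : Sm W) (x : X) : (f - g).ext x = f.ext x - g.ext x := by
  rw [sub_eq_add_neg, ext_add, ext_neg, sub_eq_add_neg]

theorem ext_sum {α : Type*} (s : Finset α) (f : α → Sm W) (x : X) :
    (∑ i ∈ s, f i).ext x = ∑ i ∈ s, (f i).ext x :=
  map_sum (⟨⟨fun g : Sm W => g.ext x, ext_zero x⟩, fun f g => ext_add f g x⟩ : Sm W →+ ℂ) f s

theorem ext_algebraMap (c : ℂ) {x : X} (hx : x ∈ W) : (algebraMap ℂ (Sm W) c).ext x = c := by
  rw [ext_of_mem _ hx]; rfl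

/-- Evaluation at a point of `W`. -/
def ev (x : W) : Sm W →ₐ[ℂ] ℂ :=
  (Pi.evalAlgHom ℂ (fun _ : W => ℂ) x).comp (smoothSubalgebra W).val

theorem ev_eq_ext (x : W) (f : Sm W) : ev x f = f.ext x := by rw [ext_coe]; rfl

theorem ev_ext {f g : Sm W} (h : ∀ x : W, ev x f = ev x g) : f = g :=
  ext_eq fun x hx => by simpa [ev_eq_ext] using h ⟨x, hx⟩

theorem isUnit {f : Sm W} (h : ∀ x : W, ev x f ≠ 0) : IsUnit f := by
  have h' : ∀ x ∈ W, f.ext x ≠ 0 := fun x hx => by simpa [ev_eq_ext] using h ⟨x, hx⟩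
  refine IsUnit.of_mul_eq_one (of (fun x => (f.ext x)⁻¹) (f.contDiffOn_ext.inv h')) ?_
  refine ext_eq fun x hx => ?_
  rw [ext_mul, ext_of _ hx, mul_inv_cancel₀ (h' x hx), ← map_one (algebraMap ℂ (Sm W)),
    ext_algebraMap _ hx]

/-- The derivative in the direction `v`. -/
def derFun (v : X) (f : Sm W) : Sm W :=
  of (fun x => fderiv ℝ f.ext x v)
    ((f.contDiffOn_ext.fderiv_of_isOpen W.isOpen (m := ∞) (by simp)).clm_apply contDiffOn_const)

theorem ext_derFun (v : X) (f : Sm W) {x : X} (hx : x ∈ W) :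
    (derFun v f).ext x = fderiv ℝ f.ext x v := ext_of _ hx

theorem fderiv_ext_congr (f : Sm W) {F : X → ℂ} (hF : ∀ x ∈ W, f.ext x = F x) {x : X}
    (hx : x ∈ W) : fderiv ℝ f.ext x = fderiv ℝ F x :=
  Filter.EventuallyEq.fderiv_eq (Filter.eventually_of_mem (W.isOpen.mem_nhds hx) hF)

/-- The directional derivative as a derivation. -/
def der (v : X) : Derivation ℂ (Sm W) (Sm W) :=
  Derivation.mk'
    { toFun := derFun v
      map_add' := fun f g => ext_eq fun x hx => by
        rw [ext_add, ext_derFun _ _ hx, ext_derFun _ _ hx, ext_derFun _ _ hx,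
          fderiv_ext_congr _ (fun y _ => ext_add f g y) hx,
          fderiv_fun_add (f.differentiableAt_ext hx) (g.differentiableAt_ext hx)]
        rfl
      map_smul' := fun c f => ext_eq fun x hx => by
        rw [RingHom.id_apply, ext_smul, ext_derFun _ _ hx, ext_derFun _ _ hx,
          fderiv_ext_congr _ (fun y _ => ext_smul c f y) hx,
          fderiv_const_mul (f.differentiableAt_ext hx)]
        rfl }
    (fun f g => ext_eq fun x hx => by
      simp only [LinearMap.coe_mk, AddHom.coe_mk, smul_eq_mul]
      rw [ext_add, ext_mul, ext_mul, ext_derFun _ _ hx, ext_derFun _ _ hx, ext_derFun _ _ hx,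
        fderiv_ext_congr _ (fun y _ => ext_mul f g y) hx,
        fderiv_fun_mul (f.differentiableAt_ext hx) (g.differentiableAt_ext hx)]
      simp)

theorem ext_der (v : X) (f : Sm W) {x : X} (hx : x ∈ W) :
    (der v f).ext x = fderiv ℝ f.ext x v := ext_derFun v f hx

/-- Schwarz's theorem, which makes parameter and coordinate derivatives commute. -/
theorem der_comm (v w : X) (f : Sm W) : der v (der w f) = der w (der v f) := by
  have key : ∀ (v w : X) {x : X} (_ : x ∈ W),
      (der v (der w f)).ext x = fderiv ℝ (fderiv ℝ f.ext) x v w := by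
    intro v w x hx
    rw [ext_der v _ hx, fderiv_ext_congr _ (fun y hy => ext_der w f hy) hx, fderiv_clm_apply]
    · simp
    · exact ((f.contDiffAt_ext hx).fderiv_right (m := ∞) (by simp)).differentiableAt (by simp)
    · fun_prop
  refine ext_eq fun x hx => ?_
  rw [key v w hx, key w v hx]
  exact ((f.contDiffAt_ext hx).isSymmSndFDerivAt (by simp only [minSmoothness_of_isRCLikeNormedField]; exact WithTop.coe_le_coe.2 le_top)) v w

theorem contDiffOn_star (f : Sm W) : ContDiffOn ℝ ∞ (fun x => star (f.ext x)) W :=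
  Complex.conjCLE.contDiff.comp_contDiffOn f.contDiffOn_ext

/-- Complex conjugation of functions. -/
def conjFun (f : Sm W) : Sm W := of _ f.contDiffOn_star

theorem ext_conjFun (f : Sm W) {x : X} (hx : x ∈ W) : f.conjFun.ext x = star (f.ext x) :=
  ext_of _ hx

theorem ext_one {x : X} (hx : x ∈ W) : (1 : Sm W).ext x = 1 := by
  rw [← map_one (algebraMap ℂ (Sm W)), ext_algebraMap _ hx]

/-- Complex conjugation. -/
def conj : Sm W →+* Sm W where
  toFun := conjFun
  map_one' := ext_eq fun x hx => by rw [ext_conjFun _ hx, ext_one hx, star_one]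
  map_zero' := ext_eq fun x hx => by rw [ext_conjFun _ hx, ext_zero, star_zero]
  map_add' f g := ext_eq fun x hx => by
    rw [ext_conjFun _ hx, ext_add, ext_add, ext_conjFun _ hx, ext_conjFun _ hx, star_add]
  map_mul' f g := ext_eq fun x hx => by
    rw [ext_conjFun _ hx, ext_mul, ext_mul, ext_conjFun _ hx, ext_conjFun _ hx, star_mul']

theorem ext_conj (f : Sm W) {x : X} (hx : x ∈ W) : (conj f).ext x = star (f.ext x) :=
  ext_conjFun f hx

theorem der_conj (v : X) (f : Sm W) : der v (conj f) = conj (der v f) := by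
  refine ext_eq fun x hx => ?_
  rw [ext_der v _ hx, ext_conj _ hx, ext_der v _ hx,
    fderiv_ext_congr _ (fun y hy => ext_conj f hy) hx]
  have h := (Complex.conjCLE.toContinuousLinearMap.hasFDerivAt (x := f.ext x)).comp x
    (f.differentiableAt_ext hx).hasFDerivAt
  have h2 : fderiv ℝ (fun y => star (f.ext y)) x = _ := h.fderiv
  rw [h2]
  simp

theorem conj_smul (c : ℂ) (f : Sm W) : conj (c • f) = star c • conj f := by
  refine ext_eq fun x hx => ?_
  rw [ext_conj _ hx, ext_smul, ext_smul, ext_conj _ hx, star_mul']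

/-- Pull-back of functions along a smooth map. -/
def pullFun (Ψ : X → X) (hΨ : ContDiffOn ℝ ∞ Ψ W) (hm : Set.MapsTo Ψ W W') (f : Sm W') : Sm W :=
  of (fun x => f.ext (Ψ x)) (f.contDiffOn_ext.comp hΨ hm)

theorem ext_pullFun {Ψ : X → X} (hΨ : ContDiffOn ℝ ∞ Ψ W) (hm : Set.MapsTo Ψ W W') (f : Sm W')
    {x : X} (hx : x ∈ W) : (pullFun Ψ hΨ hm f).ext x = f.ext (Ψ x) := ext_of _ hx

/-- Pull-back along a smooth map. -/
def pull (Ψ : X → X) (hΨ : ContDiffOn ℝ ∞ Ψ W) (hm : Set.MapsTo Ψ W W') : Sm W' →ₐ[ℂ] Sm W where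
  toFun := pullFun Ψ hΨ hm
  map_one' := ext_eq fun x hx => by
    rw [ext_pullFun _ _ _ hx, ext_one hx, ext_one (hm hx)]
  map_zero' := ext_eq fun x hx => by
    rw [ext_pullFun _ _ _ hx, ext_zero, ext_zero]
  map_add' f g := ext_eq fun x hx => by
    rw [ext_pullFun _ _ _ hx, ext_add, ext_add, ext_pullFun _ _ _ hx, ext_pullFun _ _ _ hx]
  map_mul' f g := ext_eq fun x hx => by
    rw [ext_pullFun _ _ _ hx, ext_mul, ext_mul, ext_pullFun _ _ _ hx, ext_pullFun _ _ _ hx]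
  commutes' c := ext_eq fun x hx => by
    rw [ext_pullFun _ _ _ hx, ext_algebraMap _ (hm hx), ext_algebraMap _ hx]

theorem ext_pull {Ψ : X → X} (hΨ : ContDiffOn ℝ ∞ Ψ W) (hm : Set.MapsTo Ψ W W') (f : Sm W')
    {x : X} (hx : x ∈ W) : (pull Ψ hΨ hm f).ext x = f.ext (Ψ x) := ext_pullFun hΨ hm f hx

theorem ext_der_pull {Ψ : X → X} (hΨ : ContDiffOn ℝ ∞ Ψ W) (hm : Set.MapsTo Ψ W W') (f : Sm W')
    (v : X) {x : X} (hx : x ∈ W) :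
    (der v (pull Ψ hΨ hm f)).ext x = fderiv ℝ f.ext (Ψ x) (fderiv ℝ Ψ x v) := by
  rw [ext_der v _ hx, fderiv_ext_congr _ (fun y hy => ext_pull hΨ hm f hy) hx]
  have h1 : DifferentiableAt ℝ Ψ x :=
    (hΨ.contDiffAt (W.isOpen.mem_nhds hx)).differentiableAt (by simp)
  have h := (f.differentiableAt_ext (hm hx)).hasFDerivAt.comp x h1.hasFDerivAt
  have h2 : fderiv ℝ (fun y => f.ext (Ψ y)) x = _ := h.fderiv
  rw [h2]; rfl

/-- If `f` vanishes off a closed set, so do its derivatives. -/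
theorem ext_der_eq_zero (v : X) (f : Sm W) {K : Set X} (hK : IsClosed K)
    (hf : ∀ x ∈ W, x ∉ K → f.ext x = 0) {x : X} (hx : x ∈ W) (hxK : x ∉ K) :
    (der v f).ext x = 0 := by
  rw [ext_der v _ hx]
  have : f.ext =ᶠ[nhds x] fun _ => 0 := by
    filter_upwards [W.isOpen.mem_nhds hx, hK.isOpen_compl.mem_nhds hxK] with y hy hy'
    exact hf y hy hy'
  rw [this.fderiv_eq]
  simp

end Sm

end Smooth

/-! ### Wirtinger derivations with two additional real parameters -/

section Wirtinger

open TopologicalSpace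

variable {n : ℕ}

/-- Two real parameters and the coordinates. -/
abbrev PCn (n : ℕ) : Type := (ℝ × ℝ) × Cn n

variable {W W' : Opens (PCn n)}

namespace Sm

/-- The parameter derivative in the direction `v`. -/
def dp (v : ℝ × ℝ) : Derivation ℂ (Sm W) (Sm W) := der (v, 0)

/-- The derivation `∂_j`. -/
def del (j : Fin n) : Derivation ℂ (Sm W) (Sm W) :=
  (1 / 2 : ℂ) • (der (0, Pi.single j 1) - Complex.I • der (0, Pi.single j Complex.I))

/-- The derivation `∂_j̄`. -/
def delb (j : Fin n) : Derivation ℂ (Sm W) (Sm W) :=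
  (1 / 2 : ℂ) • (der (0, Pi.single j 1) + Complex.I • der (0, Pi.single j Complex.I))

theorem del_apply (j : Fin n) (f : Sm W) : del j f
    = (1 / 2 : ℂ) • (der (0, Pi.single j 1) f - Complex.I • der (0, Pi.single j Complex.I) f) := rfl

theorem delb_apply (j : Fin n) (f : Sm W) : delb j f
    = (1 / 2 : ℂ) • (der (0, Pi.single j 1) f + Complex.I • der (0, Pi.single j Complex.I) f) := rfl

theorem map_del (D : Derivation ℂ (Sm W) (Sm W)) (hD : ∀ v f, D (der v f) = der v (D f))
    (j : Fin n) (f : Sm W) : D (del j f) = del j (D f) := by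
  rw [del_apply, del_apply, D.map_smul, map_sub, D.map_smul, hD, hD]

theorem map_delb (D : Derivation ℂ (Sm W) (Sm W)) (hD : ∀ v f, D (der v f) = der v (D f))
    (j : Fin n) (f : Sm W) : D (delb j f) = delb j (D f) := by
  rw [delb_apply, delb_apply, D.map_smul, map_add, D.map_smul, hD, hD]

theorem del_der (j : Fin n) (v : PCn n) (f : Sm W) : del j (der v f) = der v (del j f) :=
  (map_del _ (der_comm v) j f).symm

theorem delb_der (j : Fin n) (v : PCn n) (f : Sm W) : delb j (der v f) = der v (delb j f) :=
  (map_delb _ (der_comm v) j f).symm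

/-- The Wirtinger derivations of `Sm W`. -/
def diffRing (W : Opens (PCn n)) : DiffRing (Fin n) (Sm W) where
  d := del
  db := delb
  d_d j := map_del _ (del_der j)
  db_db j := map_delb _ (delb_der j)
  d_db j := map_delb _ (del_der j)

theorem del_conj (j : Fin n) (f : Sm W) : del j (conj f) = conj (delb j f) := by
  simp [del, delb, der_conj, conj_smul, sub_eq_add_neg]

theorem delb_conj (j : Fin n) (f : Sm W) : delb j (conj f) = conj (del j f) := by
  simp [del, delb, der_conj, conj_smul, sub_eq_add_neg]

theorem fderiv_slice (f : Sm W) {q : ℝ × ℝ} {z : Cn n} (h : (q, z) ∈ W) (v : Cn n) :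
    fderiv ℝ (fun w => f.ext (q, w)) z v = fderiv ℝ f.ext (q, z) (0, v) := by
  have h1 : HasFDerivAt (fun w : Cn n => (q, w)) (ContinuousLinearMap.inr ℝ (ℝ × ℝ) (Cn n)) z :=
    hasFDerivAt_prodMk_right q z
  have h2 := (f.differentiableAt_ext h).hasFDerivAt.comp z h1
  have h3 : fderiv ℝ (fun w => f.ext (q, w)) z = _ := h2.fderiv
  rw [h3]; rfl

theorem ext_del (j : Fin n) (f : Sm W) {q : ℝ × ℝ} {z : Cn n} (h : (q, z) ∈ W) :
    (del j f).ext (q, z) = dd j (fun w => f.ext (q, w)) z := by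
  rw [dd, fderiv_slice f h, fderiv_slice f h, del]
  simp only [Derivation.smul_apply, Derivation.sub_apply, ext_smul, ext_sub, ext_der _ _ h]

theorem ext_delb (j : Fin n) (f : Sm W) {q : ℝ × ℝ} {z : Cn n} (h : (q, z) ∈ W) :
    (delb j f).ext (q, z) = ddbar j (fun w => f.ext (q, w)) z := by
  rw [ddbar, fderiv_slice f h, fderiv_slice f h, delb]
  simp only [Derivation.smul_apply, Derivation.add_apply, ext_smul, ext_add, ext_der _ _ h]

theorem slice_eventually (W : Opens (PCn n)) {q : ℝ × ℝ} {z : Cn n} (h : (q, z) ∈ W) :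
    ∀ᶠ w in nhds z, (q, w) ∈ W :=
  (Continuous.prodMk_right q).continuousAt.eventually_mem (W.isOpen.mem_nhds h)

/-- Links the Wirtinger derivatives of explicit formulas to the derivations of `Sm W`. Derivatives
depend on germs, so `F` has to agree with a slice of `f` only inside `W`. -/
theorem dd_eq_ext (j : Fin n) (f : Sm W) {F : Cn n → ℂ} {q : ℝ × ℝ} {z : Cn n} (h : (q, z) ∈ W)
    (hF : ∀ w, (q, w) ∈ W → F w = f.ext (q, w)) : dd j F z = (del j f).ext (q, z) := by
  rw [ext_del j f h, dd, dd, Filter.EventuallyEq.fderiv_eq ((slice_eventually W h).mono hF)]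

theorem ddbar_eq_ext (j : Fin n) (f : Sm W) {F : Cn n → ℂ} {q : ℝ × ℝ} {z : Cn n}
    (h : (q, z) ∈ W) (hF : ∀ w, (q, w) ∈ W → F w = f.ext (q, w)) :
    ddbar j F z = (delb j f).ext (q, z) := by
  rw [ext_delb j f h, ddbar, ddbar, Filter.EventuallyEq.fderiv_eq ((slice_eventually W h).mono hF)]

theorem ext_del_eq_zero (j : Fin n) (f : Sm W) {K : Set (PCn n)} (hK : IsClosed K)
    (hf : ∀ x ∈ W, x ∉ K → f.ext x = 0) {x : PCn n} (hx : x ∈ W) (hxK : x ∉ K) :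
    (del j f).ext x = 0 := by
  simp [del, ext_smul, ext_sub, ext_der_eq_zero _ f hK hf hx hxK]

theorem ext_delb_eq_zero (j : Fin n) (f : Sm W) {K : Set (PCn n)} (hK : IsClosed K)
    (hf : ∀ x ∈ W, x ∉ K → f.ext x = 0) {x : PCn n} (hx : x ∈ W) (hxK : x ∉ K) :
    (delb j f).ext x = 0 := by
  simp [delb, ext_smul, ext_add, ext_der_eq_zero _ f hK hf hx hxK]

end Sm

/-- A real-linear functional in terms of its Wirtinger components. -/
theorem clm_eq_sum (L : Cn n →L[ℝ] ℂ) (v : Cn n) :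
    L v = ∑ a, (v a * (1 / 2 * (L (Pi.single a 1) - Complex.I * L (Pi.single a Complex.I)))
      + star (v a) * (1 / 2 * (L (Pi.single a 1) + Complex.I * L (Pi.single a Complex.I)))) := by
  have h1 : v = ∑ a, ((v a).re • (Pi.single a 1 : Cn n) + (v a).im • (Pi.single a Complex.I : Cn n)) := by
    ext b
    simp only [Finset.sum_apply, Pi.add_apply, Pi.smul_apply, Pi.single_apply]
    rw [Finset.sum_eq_single b]
    · simp only [if_true, Complex.real_smul, mul_one]
      exact (Complex.re_add_im (v b)).symm
    · intro a _ hab; simp [hab.symm]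
    · simp
  conv_lhs => rw [h1]
  rw [map_sum]
  refine Finset.sum_congr rfl fun a _ => ?_
  rw [map_add, map_smul, map_smul, Complex.real_smul, Complex.real_smul]
  have h3 : star (v a) = (v a).re - (v a).im * Complex.I := by
    apply Complex.ext <;> simp
  rw [h3]
  conv_rhs => enter [1, 1]; rw [← Complex.re_add_im (v a)]
  ring_nf
  simp only [Complex.I_sq]
  ring

end Wirtinger

end KahlerGeom
end

noncomputable section

namespace KahlerGeom

/-! ### The exterior algebra -/

section Forms

variable {n : ℕ}

theorem ι_mul_ι_comm (v w : Fin n × Fin 2 → ℂ) :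
    ExteriorAlgebra.ι ℂ v * ExteriorAlgebra.ι ℂ w = -(ExteriorAlgebra.ι ℂ w * ExteriorAlgebra.ι ℂ v) :=
  eq_neg_of_add_eq_zero_left (ExteriorAlgebra.ι_add_mul_swap v w)

/-- Passing a generator through a product of two generators produces two signs, which cancel. -/
theorem ι_mul_ι_central (v w : Fin n × Fin 2 → ℂ) (x : Forms n) :
    Commute (ExteriorAlgebra.ι ℂ v * ExteriorAlgebra.ι ℂ w) x := by
  induction x using ExteriorAlgebra.induction with
  | algebraMap r => exact Algebra.commute_algebraMap_right _ _
  | ι u =>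
    rw [commute_iff_eq, mul_assoc, ι_mul_ι_comm w u, mul_neg, ← mul_assoc, ι_mul_ι_comm v u,
      neg_mul, neg_neg, mul_assoc]
  | mul a b ha hb => exact ha.mul_right hb
  | add a b ha hb => exact ha.add_right hb

theorem dz_mul_dz (j k : Fin n) : dz j * dz k = -(dz k * dz j) := ι_mul_ι_comm _ _

theorem dzbar_mul_dzbar (j k : Fin n) : dzbar j * dzbar k = -(dzbar k * dzbar j) :=
  ι_mul_ι_comm _ _

theorem dzbar_mul_dz (j k : Fin n) : dzbar j * dz k = -(dz k * dzbar j) := ι_mul_ι_comm _ _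

theorem dz_mul_dzbar_central (j k : Fin n) (x : Forms n) : Commute (dz j * dzbar k) x :=
  ι_mul_ι_central _ _ x

/-- The substitution `dzᵃ ↦ ∑ P_{aj} dzʲ`, `dz̄ᵃ ↦ ∑ Q_{aj} dz̄ʲ`. -/
def substMatrix (P Q : Matrix (Fin n) (Fin n) ℂ) : Matrix (Fin n × Fin 2) (Fin n × Fin 2) ℂ :=
  (Matrix.blockDiagonal ![P, Q]).transpose

/-- The substitution `dzᵃ ↦ ∑ P_{aj} dzʲ`, `dz̄ᵃ ↦ ∑ Q_{aj} dz̄ʲ` on forms. -/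
def subst (P Q : Matrix (Fin n) (Fin n) ℂ) : Forms n →ₐ[ℂ] Forms n :=
  ExteriorAlgebra.map (Matrix.toLin' (substMatrix P Q))

theorem single_eq_sum (f : Fin n → ℂ) (i : Fin 2) :
    (fun x : Fin n × Fin 2 => if x.2 = i then f x.1 else 0)
      = ∑ j, f j • (Pi.single (j, i) 1 : Fin n × Fin 2 → ℂ) := by
  ext ⟨a, b⟩
  simp only [Finset.sum_apply, Pi.smul_apply, Pi.single_apply, Prod.mk.injEq, smul_eq_mul, mul_ite,
    mul_one, mul_zero]
  by_cases h : b = i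
  · simp [h]
  · simp [h]

theorem subst_dz (P Q : Matrix (Fin n) (Fin n) ℂ) (a : Fin n) :
    subst P Q (dz a) = ∑ j, P a j • dz j := by
  have : Matrix.toLin' (substMatrix P Q) (Pi.single (a, 0) 1)
      = ∑ j, P a j • (Pi.single (j, 0) 1 : Fin n × Fin 2 → ℂ) := by
    rw [← single_eq_sum]
    ext ⟨j, i⟩
    fin_cases i <;> simp [substMatrix, Matrix.toLin'_apply, Matrix.blockDiagonal_apply]
  rw [subst, dz, ExteriorAlgebra.map_apply_ι, this, map_sum]
  simp [dz]

theorem subst_dzbar (P Q : Matrix (Fin n) (Fin n) ℂ) (a : Fin n) :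
    subst P Q (dzbar a) = ∑ j, Q a j • dzbar j := by
  have : Matrix.toLin' (substMatrix P Q) (Pi.single (a, 1) 1)
      = ∑ j, Q a j • (Pi.single (j, 1) 1 : Fin n × Fin 2 → ℂ) := by
    rw [← single_eq_sum]
    ext ⟨j, i⟩
    fin_cases i <;> simp [substMatrix, Matrix.toLin'_apply, Matrix.blockDiagonal_apply]
  rw [subst, dzbar, ExteriorAlgebra.map_apply_ι, this, map_sum]
  simp [dzbar]

theorem subst_form11 (P Q A : Matrix (Fin n) (Fin n) ℂ) :
    subst P Q (form11 A) = form11 (P.transpose * A * Q) := by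
  calc _ = ∑ a, ∑ b, ∑ j, ∑ k, (P a j * A a b * Q b k) • (dz j * dzbar k) := by
        simp only [form11, map_sum, map_smul, map_mul, subst_dz, subst_dzbar]
        refine Finset.sum_congr rfl fun a _ => Finset.sum_congr rfl fun b _ => ?_
        rw [Finset.sum_mul_sum, Finset.smul_sum]
        refine Finset.sum_congr rfl fun j _ => ?_
        rw [Finset.smul_sum]
        refine Finset.sum_congr rfl fun k _ => ?_
        rw [smul_mul_smul_comm, smul_smul]
        congr 1; ring
    _ = ∑ a, ∑ j, ∑ b, ∑ k, (P a j * A a b * Q b k) • (dz j * dzbar k) :=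
        Finset.sum_congr rfl fun a _ => Finset.sum_comm
    _ = ∑ j, ∑ a, ∑ b, ∑ k, (P a j * A a b * Q b k) • (dz j * dzbar k) := Finset.sum_comm
    _ = ∑ j, ∑ a, ∑ k, ∑ b, (P a j * A a b * Q b k) • (dz j * dzbar k) :=
        Finset.sum_congr rfl fun j _ => Finset.sum_congr rfl fun a _ => Finset.sum_comm
    _ = ∑ j, ∑ k, ∑ a, ∑ b, (P a j * A a b * Q b k) • (dz j * dzbar k) :=
        Finset.sum_congr rfl fun j _ => Finset.sum_comm
    _ = ∑ j, ∑ k, ∑ b, ∑ a, (P a j * A a b * Q b k) • (dz j * dzbar k) :=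
        Finset.sum_congr rfl fun j _ => Finset.sum_congr rfl fun a _ => Finset.sum_comm
    _ = _ := by
        simp only [form11, Matrix.mul_apply, Finset.sum_smul, Matrix.transpose_apply,
          Finset.sum_mul]

/-- A linear substitution acts on the top exterior power by its determinant. On decomposable
elements of degree `2n` the functional is itself a determinant, and in other degrees both sides
vanish. -/
theorem topCoeff_map (N : Matrix (Fin n × Fin 2) (Fin n × Fin 2) ℂ) (x : Forms n) :
    topCoeff (ExteriorAlgebra.map (Matrix.toLin' N) x) = N.det * topCoeff x := by
  have h : topCoeff ∘ₗ (ExteriorAlgebra.map (Matrix.toLin' N)).toLinearMap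
      = N.det • (topCoeff : Forms n →ₗ[ℂ] ℂ) := by
    apply ExteriorAlgebra.lhom_ext
    intro k
    ext v
    simp only [LinearMap.compAlternatingMap_apply, LinearMap.comp_apply, AlgHom.toLinearMap_apply,
      ExteriorAlgebra.map_apply_ιMulti, LinearMap.smul_apply, smul_eq_mul]
    rw [topCoeff, ExteriorAlgebra.liftAlternating_apply_ιMulti,
      ExteriorAlgebra.liftAlternating_apply_ιMulti]
    split_ifs with hk
    · subst hk
      simp only [AlternatingMap.domDomCongr_apply]
      set w : Matrix (Fin n × Fin 2) (Fin n × Fin 2) ℂ :=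
        fun i => v ((finProdFinEquiv.trans (finCongr rfl)) i) with hw
      have h2 : (fun i => (Matrix.toLin' N ∘ v) ((finProdFinEquiv.trans (finCongr rfl)) i))
          = w * N.transpose := by
        ext i j
        rw [Matrix.mul_apply]
        simp [hw, Matrix.toLin'_apply, Matrix.mulVec, dotProduct, mul_comm]
      change Matrix.det (fun i => (Matrix.toLin' N ∘ v) ((finProdFinEquiv.trans (finCongr rfl)) i))
        = N.det * Matrix.det w
      rw [h2, Matrix.det_mul, Matrix.det_transpose, mul_comm]
    · simp
  simpa using LinearMap.congr_fun h x

theorem topCoeff_subst (P Q : Matrix (Fin n) (Fin n) ℂ) (x : Forms n) :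
    topCoeff (subst P Q x) = P.det * Q.det * topCoeff x := by
  rw [subst, topCoeff_map, substMatrix, Matrix.det_transpose, Matrix.det_blockDiagonal]
  simp

theorem topCoeff_prod_dz_mul_dzbar :
    topCoeff (List.ofFn fun j : Fin n => dz j * dzbar j).prod = 1 := by
  have h : (List.ofFn fun j : Fin n => dz j * dzbar j).prod
      = ExteriorAlgebra.ιMulti ℂ (n * 2)
        (fun i => Pi.single (finProdFinEquiv.symm i) 1 : Fin (n * 2) → (Fin n × Fin 2 → ℂ)) := by
    rw [ExteriorAlgebra.ιMulti_apply, List.ofFn_mul, List.prod_flatten]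
    congr 1
    rw [List.map_ofFn]
    congr 1
    ext1 j
    -- `finProdFinEquiv` numbers `dzʲ` by `2j` and `dz̄ʲ` by `2j + 1`, which is the ordering of the
    -- product.
    have h0 : ∀ h, finProdFinEquiv.symm (⟨j * 2, h⟩ : Fin (n * 2)) = (j, 0) := fun h => by
      rw [Equiv.symm_apply_eq]; ext; simp [mul_comm]
    have h1 : ∀ h, finProdFinEquiv.symm (⟨j * 2 + 1, h⟩ : Fin (n * 2)) = (j, 1) := fun h => by
      rw [Equiv.symm_apply_eq]; ext; simp [mul_comm, add_comm]
    simp [List.ofFn_succ, dz, dzbar, h0, h1, -finProdFinEquiv_symm_apply]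
  rw [h, topCoeff, ExteriorAlgebra.liftAlternating_apply_ιMulti, dif_pos rfl,
    AlternatingMap.domDomCongr_apply]
  refine Eq.trans ?_ (Matrix.det_one (n := Fin n × Fin 2) (R := ℂ))
  change Matrix.det _ = _
  congr 1
  ext i j
  simp [Matrix.one_apply, Pi.single_apply, eq_comm, -finProdFinEquiv_symm_apply]

/-- Central elements of square zero leave only squarefree monomials in the multinomial expansion.
The vanishing of the next power is carried along because the induction step uses it for the tail of
the list. -/
theorem sum_pow_length {A : Type*} [Ring A] (l : List A) (hc : ∀ a ∈ l, ∀ x, Commute a x)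
    (hs : ∀ a ∈ l, a * a = 0) :
    l.sum ^ l.length = (l.length.factorial : A) * l.prod ∧ l.sum ^ (l.length + 1) = 0 := by
  have key : ∀ (a s : A) (_ : ∀ x, Commute a x) (_ : a * a = 0) (k : ℕ),
      (a + s) ^ (k + 1) = s ^ (k + 1) + ((k + 1 : ℕ) : A) * (a * s ^ k) := by
    intro a s ha hsq k
    induction k with
    | zero => simp [add_comm]
    | succ k ih =>
      rw [pow_succ, ih, add_mul, mul_add, mul_add, ← (ha (s ^ (k + 1))).eq, ← pow_succ, mul_assoc,
        mul_assoc, mul_assoc, ← (ha (s ^ k)).eq, ← mul_assoc a a, hsq, zero_mul, mul_zero, zero_add,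
        mul_assoc, ← pow_succ]
      push_cast
      noncomm_ring
  induction l with
  | nil => simp
  | cons a l ih =>
    obtain ⟨h1, h2⟩ := ih (fun b hb => hc b (by simp [hb])) (fun b hb => hs b (by simp [hb]))
    have ha := hc a (by simp)
    have hsq := hs a (by simp)
    simp only [List.sum_cons, List.length_cons, List.prod_cons]
    rw [key a _ ha hsq, key a _ ha hsq, pow_succ l.sum (l.length + 1), h2, h1]
    constructor
    · rw [zero_add, Nat.factorial_succ, ← mul_assoc a, (Nat.cast_commute _ a).symm.eq]
      push_cast
      noncomm_ring
    · simp

theorem topCoeff_form11_one_pow : topCoeff (form11 (1 : Matrix (Fin n) (Fin n) ℂ) ^ n)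
    = n.factorial := by
  have h1 : form11 (1 : Matrix (Fin n) (Fin n) ℂ) = (List.ofFn fun j : Fin n => dz j * dzbar j).sum := by
    simp [form11, Matrix.one_apply, List.sum_ofFn]
  have h2 := (sum_pow_length (List.ofFn fun j : Fin n => dz j * dzbar j) (by
      simp only [List.mem_ofFn]
      rintro _ ⟨j, rfl⟩ x
      exact dz_mul_dzbar_central j j x) (by
      simp only [List.mem_ofFn]
      rintro _ ⟨j, rfl⟩
      rw [mul_assoc, ← mul_assoc (dzbar j), dzbar_mul_dz, neg_mul, mul_assoc, mul_neg, ← mul_assoc]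
      simp [dz])).1
  rw [List.length_ofFn] at h2
  rw [h1, h2, ← nsmul_eq_mul, map_nsmul, topCoeff_prod_dz_mul_dzbar]
  simp

theorem topCoeff_form11_pow (H : Matrix (Fin n) (Fin n) ℂ) :
    topCoeff (form11 H ^ n) = n.factorial * H.det := by
  -- Substituting in the `dz̄` alone turns the standard form into the form of `H`, so the
  -- determinant appears exactly once.
  have : form11 H = subst 1 H (form11 1) := by rw [subst_form11]; simp
  rw [this, ← map_pow, topCoeff_subst, topCoeff_form11_one_pow, Matrix.det_one]
  ring

end Forms

end KahlerGeom
end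

noncomputable section

set_option linter.unusedSectionVars false

namespace KahlerGeom

/-! ### Forms with coefficients in a ring of functions -/

section FormAlgebra

open TensorProduct

variable {n : ℕ} {C : Type*} [CommRing C] [Algebra ℂ C]

variable (n C) in
/-- Forms with coefficients in `C`. -/
abbrev FA : Type _ := C ⊗[ℂ] Forms n

namespace FA

/-- A derivation of the coefficients acting on forms. -/
def der (D : Derivation ℂ C C) : FA n C →ₗ[ℂ] FA n C := LinearMap.rTensor (Forms n) (D : C →ₗ[ℂ] C)

@[simp] theorem der_tmul (D : Derivation ℂ C C) (c : C) (w : Forms n) :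
    der D (c ⊗ₜ[ℂ] w) = D c ⊗ₜ[ℂ] w := rfl

theorem der_mul (D : Derivation ℂ C C) (x y : FA n C) :
    der D (x * y) = der D x * y + x * der D y := by
  induction x using TensorProduct.induction_on with
  | zero => simp
  | add x₁ x₂ h₁ h₂ => rw [add_mul, map_add, h₁, h₂, map_add]; noncomm_ring
  | tmul c w =>
    induction y using TensorProduct.induction_on with
    | zero => simp
    | add x₁ x₂ h₁ h₂ => rw [mul_add, map_add, h₁, h₂, map_add]; noncomm_ring
    | tmul c' w' =>
      simp only [Algebra.TensorProduct.tmul_mul_tmul, der_tmul, Derivation.leibniz, smul_eq_mul,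
        TensorProduct.add_tmul]
      rw [add_comm, mul_comm c']

theorem der_smul (D : Derivation ℂ C C) (f : C) (x : FA n C) :
    der D (f • x) = D f • x + f • der D x := by
  have h : ∀ (f : C) (x : FA n C), f • x = (f ⊗ₜ[ℂ] (1 : Forms n)) * x := fun f x => by
    rw [Algebra.smul_def]; rfl
  rw [h, der_mul, der_tmul, ← h, ← h]

theorem der_one (D : Derivation ℂ C C) : der D (1 : FA n C) = 0 := by
  rw [Algebra.TensorProduct.one_def, der_tmul]
  simp

/-- Elements that commute with everything. -/
def IsCentral (x : FA n C) : Prop := ∀ y, x * y = y * x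

theorem IsCentral.mul {x y : FA n C} (hx : IsCentral x) (hy : IsCentral y) : IsCentral (x * y) :=
  fun z => by rw [mul_assoc, hy z, ← mul_assoc, hx z, mul_assoc]

theorem isCentral_one : IsCentral (1 : FA n C) := fun z => by simp

theorem IsCentral.pow {x : FA n C} (hx : IsCentral x) (k : ℕ) : IsCentral (x ^ k) := by
  induction k with
  | zero => simpa using isCentral_one
  | succ k ih => rw [pow_succ]; exact ih.mul hx

theorem isCentral_sum {α : Type*} (s : Finset α) {x : α → FA n C} (hx : ∀ a ∈ s, IsCentral (x a)) :
    IsCentral (∑ a ∈ s, x a) := fun z => by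
  rw [Finset.sum_mul, Finset.mul_sum]
  exact Finset.sum_congr rfl fun a ha => hx a ha z

/-- Differentiate the relation `x * z = z * x` and cancel the terms in which `z` is differentiated.
-/
theorem IsCentral.der {x : FA n C} (hx : IsCentral x) (D : Derivation ℂ C C) :
    IsCentral (der D x) := fun z => by
  have h := congrArg (FA.der D) (hx z)
  rw [der_mul, der_mul, hx, add_comm] at h
  exact add_left_cancel h

theorem isCentral_tmul (c : C) {w : Forms n} (hw : ∀ x, Commute w x) :
    IsCentral (c ⊗ₜ[ℂ] w : FA n C) := fun z => by
  induction z using TensorProduct.induction_on with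
  | zero => simp
  | add x₁ x₂ h₁ h₂ => rw [mul_add, add_mul, h₁, h₂]
  | tmul c' w' =>
    rw [Algebra.TensorProduct.tmul_mul_tmul, Algebra.TensorProduct.tmul_mul_tmul, mul_comm,
      (hw w').eq]

/-- At `k = 0` the truncated exponent `k - 1` is harmless because of the factor `k`. -/
theorem der_pow {x : FA n C} (hx : IsCentral x) (D : Derivation ℂ C C) (k : ℕ) :
    der D (x ^ k) = (k : ℂ) • (der D x * x ^ (k - 1)) := by
  induction k with
  | zero => simp [der_one]
  | succ k ih =>
    rw [pow_succ, der_mul, ih, hx.pow k]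
    rcases k with _ | k
    · simp
    · simp only [Nat.add_sub_cancel]
      rw [smul_mul_assoc, mul_assoc, ← pow_succ]
      push_cast
      simp only [add_smul, one_smul]

/-- The `(1,1)`-form with coefficients `A j k`. -/
def form11 (A : Matrix (Fin n) (Fin n) C) : FA n C := ∑ j, ∑ k, A j k ⊗ₜ[ℂ] (dz j * dzbar k)

/-- The form `∑ a_j dzʲ`. -/
def form10 (a : Fin n → C) : FA n C := ∑ j, a j ⊗ₜ[ℂ] dz j

/-- The form `∑ b_k dz̄ᵏ`. -/
def form01 (b : Fin n → C) : FA n C := ∑ k, b k ⊗ₜ[ℂ] dzbar k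

/-- The `(2,2)`-form with coefficients `τ j k l m`. -/
def form22 (τ : Fin n → Fin n → Fin n → Fin n → C) : FA n C :=
  ∑ j, ∑ k, ∑ l, ∑ m, τ j k l m ⊗ₜ[ℂ] (dz j * dzbar k * (dz l * dzbar m))

theorem form11_central (A : Matrix (Fin n) (Fin n) C) : IsCentral (form11 A) :=
  isCentral_sum _ fun _ _ => isCentral_sum _ fun _ _ => isCentral_tmul _ (dz_mul_dzbar_central _ _)

theorem form22_central (τ : Fin n → Fin n → Fin n → Fin n → C) : IsCentral (form22 τ) :=
  isCentral_sum _ fun _ _ => isCentral_sum _ fun _ _ => isCentral_sum _ fun _ _ =>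
    isCentral_sum _ fun _ _ => isCentral_tmul _ fun x =>
      (dz_mul_dzbar_central _ _ x).mul_left (dz_mul_dzbar_central _ _ x)

theorem form11_sub (A B : Matrix (Fin n) (Fin n) C) : form11 (A - B) = form11 A - form11 B := by
  simp [form11, TensorProduct.sub_tmul, Finset.sum_sub_distrib]

theorem form11_smul (f : C) (A : Matrix (Fin n) (Fin n) C) : form11 (f • A) = f • form11 A := by
  simp only [form11, Finset.smul_sum, TensorProduct.smul_tmul', Matrix.smul_apply]

theorem form22_add (σ τ : Fin n → Fin n → Fin n → Fin n → C) :
    form22 (σ + τ) = form22 σ + form22 τ := by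
  simp [form22, TensorProduct.add_tmul, Finset.sum_add_distrib]

theorem form22_sub (σ τ : Fin n → Fin n → Fin n → Fin n → C) :
    form22 (σ - τ) = form22 σ - form22 τ := by
  simp [form22, TensorProduct.sub_tmul, Finset.sum_sub_distrib]

theorem form22_smul (f : C) (τ : Fin n → Fin n → Fin n → Fin n → C) :
    form22 (f • τ) = f • form22 τ := by
  simp only [form22, Finset.smul_sum, TensorProduct.smul_tmul', Pi.smul_apply]

theorem form22_mul (A B : Matrix (Fin n) (Fin n) C) :
    form22 (fun j k l m => A j k * B l m) = form11 A * form11 B := by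
  rw [form11, form11]
  simp only [Finset.sum_mul]
  simp only [Finset.mul_sum, Algebra.TensorProduct.tmul_mul_tmul, form22]

theorem der_form11 (D : Derivation ℂ C C) (A : Matrix (Fin n) (Fin n) C) :
    der D (form11 A) = form11 (A.map D) := by simp [form11]

theorem der_form22 (D : Derivation ℂ C C) (τ : Fin n → Fin n → Fin n → Fin n → C) :
    der D (form22 τ) = form22 (fun j k l m => D (τ j k l m)) := by simp [form22]

/-- Evaluation of the coefficients. -/
def ev (φ : C →ₐ[ℂ] ℂ) : FA n C →ₐ[ℂ] Forms n :=
  Algebra.TensorProduct.lift ((Algebra.ofId ℂ (Forms n)).comp φ) (AlgHom.id ℂ _)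
    fun c x => show Commute (algebraMap ℂ (Forms n) (φ c)) x from
      Algebra.commute_algebraMap_left (φ c) _

@[simp] theorem ev_tmul (φ : C →ₐ[ℂ] ℂ) (c : C) (w : Forms n) :
    ev φ (c ⊗ₜ[ℂ] w) = φ c • w := by
  rw [Algebra.smul_def]
  exact Algebra.TensorProduct.lift_tmul _ _ _ c w

theorem ev_form11 (φ : C →ₐ[ℂ] ℂ) (A : Matrix (Fin n) (Fin n) C) :
    ev φ (form11 A) = KahlerGeom.form11 (A.map φ) := by simp [form11, KahlerGeom.form11]

theorem ev_smul (φ : C →ₐ[ℂ] ℂ) (f : C) (x : FA n C) : ev φ (f • x) = φ f • ev φ x := by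
  rw [Algebra.smul_def, map_mul, Algebra.TensorProduct.algebraMap_apply]
  simp

/-- The coefficient of `dz¹ ∧ dz̄¹ ∧ ⋯ ∧ dzⁿ ∧ dz̄ⁿ`. -/
def top : FA n C →ₗ[ℂ] C :=
  (TensorProduct.rid ℂ C).toLinearMap ∘ₗ LinearMap.lTensor C topCoeff

@[simp] theorem top_tmul (c : C) (w : Forms n) : top (c ⊗ₜ[ℂ] w) = topCoeff w • c := by
  simp [top]

theorem top_smul (f : C) (x : FA n C) : top (f • x) = f * top x := by
  induction x using TensorProduct.induction_on with
  | zero => simp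
  | add x₁ x₂ h₁ h₂ => rw [smul_add, map_add, h₁, h₂, map_add, mul_add]
  | tmul c w => rw [TensorProduct.smul_tmul', top_tmul, top_tmul, smul_eq_mul, mul_smul_comm]

theorem map_top (φ : C →ₐ[ℂ] ℂ) (x : FA n C) : φ (top x) = topCoeff (ev φ x) := by
  induction x using TensorProduct.induction_on with
  | zero => simp
  | add x₁ x₂ h₁ h₂ => simp only [map_add, h₁, h₂]
  | tmul c w => simp [mul_comm]

theorem derivation_top (D : Derivation ℂ C C) (x : FA n C) : D (top x) = top (der D x) := by
  induction x using TensorProduct.induction_on with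
  | zero => simp
  | add x₁ x₂ h₁ h₂ => simp only [map_add, h₁, h₂]
  | tmul c w => simp

/-! #### The operators `∂` and `∂̄` -/

variable (𝒟 : DiffRing (Fin n) C)

/-- The operator `∂`. -/
def del : FA n C →ₗ[ℂ] FA n C :=
  ∑ j, LinearMap.mulLeft ℂ ((1 : C) ⊗ₜ[ℂ] dz j) ∘ₗ der (𝒟.d j)

/-- The operator `∂̄`. -/
def delb : FA n C →ₗ[ℂ] FA n C :=
  ∑ k, LinearMap.mulLeft ℂ ((1 : C) ⊗ₜ[ℂ] dzbar k) ∘ₗ der (𝒟.db k)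

theorem del_apply (x : FA n C) : del 𝒟 x = ∑ j, ((1 : C) ⊗ₜ[ℂ] dz j) * der (𝒟.d j) x := by
  simp [del]

theorem delb_apply (x : FA n C) : delb 𝒟 x = ∑ k, ((1 : C) ⊗ₜ[ℂ] dzbar k) * der (𝒟.db k) x := by
  simp [delb]

/-- Closed forms of even degree. -/
structure IsClosedEven (w : FA n C) : Prop where
  central : IsCentral w
  del_eq : del 𝒟 w = 0
  delb_eq : delb 𝒟 w = 0

variable {𝒟}

/-- The derivatives of a central factor are central, so Leibniz gives `∂x · w + ∂w · x`, and the
second term is zero. Closed even factors can therefore be pulled out of `∂`. -/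
theorem del_mul {w : FA n C} (hw : IsClosedEven 𝒟 w) (x : FA n C) :
    del 𝒟 (x * w) = del 𝒟 x * w := by
  have h := hw.del_eq
  rw [del_apply] at h
  have : ∀ j, (1 : C) ⊗ₜ[ℂ] dz j * der (𝒟.d j) (x * w)
      = (1 : C) ⊗ₜ[ℂ] dz j * der (𝒟.d j) x * w + (1 : C) ⊗ₜ[ℂ] dz j * der (𝒟.d j) w * x := fun j => by
    rw [der_mul, mul_add, mul_assoc, ← (hw.central.der _) x, ← mul_assoc, ← mul_assoc]
  rw [del_apply, del_apply, Finset.sum_congr rfl fun j _ => this j, Finset.sum_add_distrib,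
    ← Finset.sum_mul, ← Finset.sum_mul, h, zero_mul, add_zero]

theorem delb_mul {w : FA n C} (hw : IsClosedEven 𝒟 w) (x : FA n C) :
    delb 𝒟 (x * w) = delb 𝒟 x * w := by
  have h := hw.delb_eq
  rw [delb_apply] at h
  have : ∀ j, (1 : C) ⊗ₜ[ℂ] dzbar j * der (𝒟.db j) (x * w)
      = (1 : C) ⊗ₜ[ℂ] dzbar j * der (𝒟.db j) x * w
        + (1 : C) ⊗ₜ[ℂ] dzbar j * der (𝒟.db j) w * x := fun j => by
    rw [der_mul, mul_add, mul_assoc, ← (hw.central.der _) x, ← mul_assoc, ← mul_assoc]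
  rw [delb_apply, delb_apply, Finset.sum_congr rfl fun j _ => this j, Finset.sum_add_distrib,
    ← Finset.sum_mul, ← Finset.sum_mul, h, zero_mul, add_zero]

theorem IsClosedEven.mul {v w : FA n C} (hv : IsClosedEven 𝒟 v) (hw : IsClosedEven 𝒟 w) :
    IsClosedEven 𝒟 (v * w) :=
  ⟨hv.central.mul hw.central, by rw [del_mul hw, hv.del_eq, zero_mul],
    by rw [delb_mul hw, hv.delb_eq, zero_mul]⟩

theorem IsClosedEven.smul {w : FA n C} (hw : IsClosedEven 𝒟 w) (c : ℂ) :
    IsClosedEven 𝒟 (c • w) :=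
  ⟨fun z => by rw [smul_mul_assoc, hw.central, mul_smul_comm], by rw [map_smul, hw.del_eq, smul_zero],
    by rw [map_smul, hw.delb_eq, smul_zero]⟩

theorem isClosedEven_one : IsClosedEven 𝒟 (1 : FA n C) :=
  ⟨isCentral_one, by simp [del_apply, der_one], by simp [delb_apply, der_one]⟩

theorem IsClosedEven.pow {w : FA n C} (hw : IsClosedEven 𝒟 w) (k : ℕ) :
    IsClosedEven 𝒟 (w ^ k) := by
  induction k with
  | zero => simpa using isClosedEven_one
  | succ k ih => rw [pow_succ]; exact ih.mul hw

theorem isClosedEven_sum {α : Type*} (s : Finset α) {w : α → FA n C}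
    (hw : ∀ a ∈ s, IsClosedEven 𝒟 (w a)) : IsClosedEven 𝒟 (∑ a ∈ s, w a) :=
  ⟨isCentral_sum s fun a ha => (hw a ha).central,
    by rw [map_sum]; exact Finset.sum_eq_zero fun a ha => (hw a ha).del_eq,
    by rw [map_sum]; exact Finset.sum_eq_zero fun a ha => (hw a ha).delb_eq⟩

theorem sum_eq_zero_of_antisymm {V : Type*} [AddCommGroup V] [Module ℂ V] (X : Fin n → Fin n → V)
    (h : ∀ i j, X i j = -X j i) : ∑ i, ∑ j, X i j = 0 := by
  have h2 : ∑ i, ∑ j, X i j = -∑ i, ∑ j, X i j := by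
    conv_rhs => rw [Finset.sum_comm]
    simp only [← Finset.sum_neg_distrib]
    exact Finset.sum_congr rfl fun i _ => Finset.sum_congr rfl fun j _ => h i j
  have h3 : (2 : ℂ) • ∑ i, ∑ j, X i j = 0 := by
    rw [two_smul]
    nth_rewrite 1 [h2]
    exact neg_add_cancel _
  simpa using h3

/-- The derivatives are symmetric in two indices that are paired with anticommuting generators. -/
theorem isClosedEven_form11 {A : Matrix (Fin n) (Fin n) C}
    (h1 : ∀ j k l, 𝒟.d l (A j k) = 𝒟.d j (A l k)) (h2 : ∀ j k l, 𝒟.db l (A j k) = 𝒟.db k (A j l)) :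
    IsClosedEven 𝒟 (form11 A) := by
  refine ⟨form11_central A, ?_, ?_⟩
  · simp only [del_apply, der_form11]
    simp only [form11, Finset.mul_sum, Algebra.TensorProduct.tmul_mul_tmul, one_mul,
      Matrix.map_apply]
    refine sum_eq_zero_of_antisymm _ fun l j => ?_
    rw [← Finset.sum_neg_distrib]
    refine Finset.sum_congr rfl fun k _ => ?_
    rw [h1, ← mul_assoc, dz_mul_dz, ← mul_assoc, neg_mul, TensorProduct.tmul_neg]
  · simp only [delb_apply, der_form11]
    simp only [form11, Finset.mul_sum, Algebra.TensorProduct.tmul_mul_tmul, one_mul,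
      Matrix.map_apply]
    rw [Finset.sum_congr rfl fun l _ => Finset.sum_comm]
    refine sum_eq_zero_of_antisymm _ fun l k => ?_
    rw [← Finset.sum_neg_distrib]
    refine Finset.sum_congr rfl fun j _ => ?_
    rw [h2, ← TensorProduct.tmul_neg]
    congr 1
    rw [← (dz_mul_dzbar_central j k _).eq, ← (dz_mul_dzbar_central j l _).eq, mul_assoc,
      dzbar_mul_dzbar, mul_neg, mul_assoc]

/-- Coefficients symmetric in the two `dz`-indices are contracted with an antisymmetric product.
With the Bianchi identity as the symmetry, this removes the terms in which `R` is differentiated. -/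
theorem form22_eq_zero_of_symm_d (τ : Fin n → Fin n → Fin n → Fin n → C)
    (h : ∀ j k l m, τ j k l m = τ l k j m) : form22 τ = 0 := by
  have : form22 τ = ∑ j, ∑ l, ∑ k, ∑ m, τ j k l m ⊗ₜ[ℂ] (dz j * dzbar k * (dz l * dzbar m)) :=
    Finset.sum_congr rfl fun j _ => Finset.sum_comm
  rw [this]
  refine sum_eq_zero_of_antisymm _ fun j l => ?_
  rw [← Finset.sum_neg_distrib]
  refine Finset.sum_congr rfl fun k _ => ?_
  rw [← Finset.sum_neg_distrib]
  refine Finset.sum_congr rfl fun m _ => ?_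
  rw [h, ← TensorProduct.tmul_neg]
  congr 1
  rw [mul_assoc, ← mul_assoc (dzbar k), dzbar_mul_dz, mul_assoc (dz l), ← mul_assoc (dzbar k),
    dzbar_mul_dz, neg_mul, neg_mul, mul_neg, mul_neg, ← mul_assoc, ← mul_assoc, ← mul_assoc,
    ← mul_assoc, dz_mul_dz]
  simp

theorem form22_eq_zero_of_symm_db (τ : Fin n → Fin n → Fin n → Fin n → C)
    (h : ∀ j k l m, τ j k l m = τ j m l k) : form22 τ = 0 := by
  have : form22 τ = ∑ j, ∑ l, ∑ k, ∑ m, τ j k l m ⊗ₜ[ℂ] (dz j * dzbar k * (dz l * dzbar m)) :=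
    Finset.sum_congr rfl fun j _ => Finset.sum_comm
  rw [this]
  refine Finset.sum_eq_zero fun j _ => Finset.sum_eq_zero fun l _ => ?_
  refine sum_eq_zero_of_antisymm _ fun k m => ?_
  rw [h, ← TensorProduct.tmul_neg]
  congr 1
  rw [mul_assoc, ← mul_assoc (dzbar k), dzbar_mul_dz, mul_assoc (dz j) (dzbar m),
    ← mul_assoc (dzbar m), dzbar_mul_dz, neg_mul, neg_mul, mul_assoc (dz l),
    mul_assoc (dz l), dzbar_mul_dzbar]
  simp

/-- Designed for products of two closed (1,1)-forms: Leibniz splits each derivative into a part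
acting on the first factor and a part acting on the second, and each part is symmetric in the new
index and an index of the factor it acts on. -/
theorem isClosedEven_form22 {τ : Fin n → Fin n → Fin n → Fin n → C}
    (α β α' β' : Fin n → Fin n → Fin n → Fin n → Fin n → C)
    (h : ∀ a j k l m, 𝒟.d a (τ j k l m) = α a j k l m + β a j k l m)
    (hα : ∀ a j k l m, α a j k l m = α j a k l m) (hβ : ∀ a j k l m, β a j k l m = β l j k a m)
    (h' : ∀ a j k l m, 𝒟.db a (τ j k l m) = α' a j k l m + β' a j k l m)
    (hα' : ∀ a j k l m, α' a j k l m = α' k j a l m)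
    (hβ' : ∀ a j k l m, β' a j k l m = β' m j k l a) :
    IsClosedEven 𝒟 (form22 τ) := by
  refine ⟨form22_central τ, ?_, ?_⟩
  · simp only [del_apply, der_form22, h]
    simp only [form22, TensorProduct.add_tmul, Finset.mul_sum,
      Algebra.TensorProduct.tmul_mul_tmul, one_mul, mul_add, Finset.sum_add_distrib]
    rw [sum_eq_zero_of_antisymm, zero_add]
    · rw [Finset.sum_congr rfl fun a _ => Finset.sum_congr rfl fun j _ => Finset.sum_comm,
        Finset.sum_congr rfl fun a _ => Finset.sum_comm]
      refine sum_eq_zero_of_antisymm _ fun a l => ?_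
      simp only [← Finset.sum_neg_distrib]
      refine Finset.sum_congr rfl fun j _ => Finset.sum_congr rfl fun k _ =>
        Finset.sum_congr rfl fun m _ => ?_
      rw [hβ, ← TensorProduct.tmul_neg]
      congr 1
      rw [← (dz_mul_dzbar_central l m _).eq, ← (dz_mul_dzbar_central a m _).eq]
      simp only [← mul_assoc]
      rw [dz_mul_dz]
      simp
    · intro a j
      simp only [← Finset.sum_neg_distrib]
      refine Finset.sum_congr rfl fun k _ => Finset.sum_congr rfl fun l _ =>
        Finset.sum_congr rfl fun m _ => ?_
      rw [hα, ← TensorProduct.tmul_neg]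
      congr 1
      simp only [← mul_assoc]
      rw [dz_mul_dz]
      simp
  · simp only [delb_apply, der_form22, h']
    simp only [form22, TensorProduct.add_tmul, Finset.mul_sum,
      Algebra.TensorProduct.tmul_mul_tmul, one_mul, mul_add, Finset.sum_add_distrib]
    have e : ∀ a k j : Fin n, dzbar a * (dz j * dzbar k) = -(dzbar k * (dz j * dzbar a)) := by
      intro a k j
      rw [← (dz_mul_dzbar_central j k _).eq, ← (dz_mul_dzbar_central j a _).eq, mul_assoc,
        dzbar_mul_dzbar, mul_neg, mul_assoc]
    have h1 : ∀ γ : Fin n → Fin n → Fin n → Fin n → Fin n → C,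
        ∑ a, ∑ j, ∑ k, ∑ l, ∑ m, γ a j k l m ⊗ₜ[ℂ] (dzbar a * (dz j * dzbar k * (dz l * dzbar m)))
        = ∑ j, ∑ l, ∑ a, ∑ k, ∑ m,
          γ a j k l m ⊗ₜ[ℂ] (dzbar a * (dz j * dzbar k * (dz l * dzbar m))) := by
      intro γ
      rw [Finset.sum_comm]
      refine Finset.sum_congr rfl fun j _ => ?_
      rw [Finset.sum_congr rfl fun a _ => Finset.sum_comm, Finset.sum_comm]
    rw [h1, h1]
    rw [Finset.sum_eq_zero fun j _ => Finset.sum_eq_zero fun l _ => ?_, zero_add,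
      Finset.sum_eq_zero fun j _ => Finset.sum_eq_zero fun l _ => ?_]
    · rw [Finset.sum_congr rfl fun a _ => Finset.sum_comm]
      refine sum_eq_zero_of_antisymm _ fun a m => ?_
      simp only [← Finset.sum_neg_distrib]
      refine Finset.sum_congr rfl fun k _ => ?_
      rw [hβ', ← TensorProduct.tmul_neg]
      congr 1
      rw [(dz_mul_dzbar_central j k _).eq, ← mul_assoc, e, (dz_mul_dzbar_central j k _).eq]
      simp only [neg_mul, mul_assoc]
    · refine sum_eq_zero_of_antisymm _ fun a k => ?_
      simp only [← Finset.sum_neg_distrib]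
      refine Finset.sum_congr rfl fun m _ => ?_
      rw [hα', ← TensorProduct.tmul_neg]
      congr 1
      rw [← mul_assoc, e]
      simp only [neg_mul, mul_assoc]

theorem del_form01 (b : Fin n → C) :
    del 𝒟 (form01 b) = form11 (Matrix.of fun j k => 𝒟.d j (b k)) := by
  rw [del_apply]
  simp only [form01, form11, map_sum, der_tmul, Finset.mul_sum,
    Algebra.TensorProduct.tmul_mul_tmul, one_mul, Matrix.of_apply]

theorem delb_form10 (a : Fin n → C) :
    delb 𝒟 (form10 a) = -form11 (Matrix.of fun j k => 𝒟.db k (a j)) := by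
  rw [delb_apply]
  simp only [form10, form11, map_sum, der_tmul, Finset.mul_sum,
    Algebra.TensorProduct.tmul_mul_tmul, one_mul, Matrix.of_apply, dzbar_mul_dz,
    TensorProduct.tmul_neg, Finset.sum_neg_distrib]
  rw [Finset.sum_comm]

/-- The form `∑ c_{klm} dz̄ᵏ dzˡ dz̄ᵐ`. -/
def form12 (c : Fin n → Fin n → Fin n → C) : FA n C :=
  ∑ k, ∑ l, ∑ m, c k l m ⊗ₜ[ℂ] (dzbar k * (dz l * dzbar m))

/-- The form `∑ c_{jlm} dzʲ dzˡ dz̄ᵐ`. -/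
def form21 (c : Fin n → Fin n → Fin n → C) : FA n C :=
  ∑ j, ∑ l, ∑ m, c j l m ⊗ₜ[ℂ] (dz j * (dz l * dzbar m))

theorem del_form12 (c : Fin n → Fin n → Fin n → C) :
    del 𝒟 (form12 c) = form22 (fun j k l m => 𝒟.d j (c k l m)) := by
  rw [del_apply]
  simp only [form12, form22, map_sum, der_tmul, Finset.mul_sum,
    Algebra.TensorProduct.tmul_mul_tmul, one_mul, mul_assoc]

theorem delb_form21 (c : Fin n → Fin n → Fin n → C) :
    delb 𝒟 (form21 c) = -form22 (fun j k l m => 𝒟.db k (c j l m)) := by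
  rw [delb_apply]
  simp only [form21, form22, map_sum, der_tmul, Finset.mul_sum,
    Algebra.TensorProduct.tmul_mul_tmul, one_mul]
  rw [Finset.sum_comm]
  simp only [← Finset.sum_neg_distrib, ← TensorProduct.tmul_neg]
  refine Finset.sum_congr rfl fun j _ => Finset.sum_congr rfl fun k _ =>
    Finset.sum_congr rfl fun l _ => Finset.sum_congr rfl fun m _ => ?_
  congr 1
  rw [← mul_assoc, dzbar_mul_dz, neg_mul]

theorem form01_mul_form11 (a : Fin n → C) (A : Matrix (Fin n) (Fin n) C) :
    form01 a * form11 A = form12 (fun j l m => a j * A l m) := by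
  rw [form01, form11]
  simp only [Finset.sum_mul]
  simp only [Finset.mul_sum, Algebra.TensorProduct.tmul_mul_tmul, form12]

end FA

end FormAlgebra

end KahlerGeom
end

/-! ### Top-degree coefficients as determinants and traces -/

noncomputable section

namespace KahlerGeom

section TopForms

open TopologicalSpace

variable {n : ℕ}

theorem tr_eq_trace (H A : Matrix (Fin n) (Fin n) ℂ) : tr H A = (H⁻¹ * A).trace := by
  simp only [tr, Matrix.trace, Matrix.diag_apply, Matrix.mul_apply]
  exact Finset.sum_comm

theorem pairing_eq_trace (H A B : Matrix (Fin n) (Fin n) ℂ) :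
    pairing H A B = (H⁻¹ * A * H⁻¹ * B).trace := by
  simp only [pairing, Matrix.trace, Matrix.diag_apply, Matrix.mul_apply, Finset.sum_mul]
  calc _ = ∑ k, ∑ j, ∑ r, ∑ l, H⁻¹ k j * H⁻¹ l r * A j l * B r k := Finset.sum_comm
    _ = ∑ k, ∑ r, ∑ j, ∑ l, H⁻¹ k j * H⁻¹ l r * A j l * B r k :=
        Finset.sum_congr rfl fun k _ => Finset.sum_comm
    _ = ∑ k, ∑ r, ∑ l, ∑ j, H⁻¹ k j * H⁻¹ l r * A j l * B r k :=
        Finset.sum_congr rfl fun k _ => Finset.sum_congr rfl fun r _ => Finset.sum_comm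
    _ = _ := by
        refine Finset.sum_congr rfl fun k _ => Finset.sum_congr rfl fun r _ =>
          Finset.sum_congr rfl fun l _ => Finset.sum_congr rfl fun j _ => ?_
        ring

/-- Jacobi's formula: factor out `H` and use the linear coefficient of the polynomial `det (1 + X
H⁻¹A)`. -/
theorem hasDerivAt_det (H A : Matrix (Fin n) (Fin n) ℂ) (hH : H.det ≠ 0) :
    HasDerivAt (fun t : ℝ => (H + (t : ℂ) • A).det) (H.det * tr H A) 0 := by
  have hu : IsUnit H.det := hH.isUnit
  set p : Polynomial ℂ :=
    Matrix.det (1 + (Polynomial.X : Polynomial ℂ) • (H⁻¹ * A).map Polynomial.C) with hp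
  have h1 : ∀ t : ℂ, (H + t • A).det = H.det * p.eval t := by
    intro t
    have : H + t • A = H * (1 + t • (H⁻¹ * A)) := by
      rw [Matrix.mul_add, Matrix.mul_one, Matrix.mul_smul, ← Matrix.mul_assoc,
        Matrix.mul_nonsing_inv _ hu, Matrix.one_mul]
    rw [this, Matrix.det_mul, hp, ← Polynomial.coe_evalRingHom, RingHom.map_det]
    congr 2
    ext i j
    generalize H⁻¹ * A = B
    by_cases hij : i = j
    · subst hij; simp [mul_comm t]
    · simp [Matrix.one_apply_ne hij, mul_comm t]
  have h2 : HasDerivAt (fun t : ℂ => H.det * p.eval t) (H.det * tr H A) ((0 : ℝ) : ℂ) := by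
    have := (p.hasDerivAt ((0 : ℝ) : ℂ)).const_mul H.det
    rwa [Complex.ofReal_zero, hp, Matrix.derivative_det_one_add_X_smul, ← tr_eq_trace] at this
  simpa only [h1] using h2.comp_ofReal

/-- The line `H + tA` as a matrix of smooth functions. -/
def lineMatrix (W : Opens ℝ) (H A : Matrix (Fin n) (Fin n) ℂ) : Matrix (Fin n) (Fin n) (Sm W) :=
  Matrix.of fun j k => Sm.of (fun t : ℝ => H j k + (t : ℂ) * A j k)
    (contDiffOn_const.add (Complex.ofRealCLM.contDiff.contDiffOn.mul contDiffOn_const))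

theorem lineMatrix_map_ev (W : Opens ℝ) (H A : Matrix (Fin n) (Fin n) ℂ) (x : W) :
    (lineMatrix W H A).map (Sm.ev x) = H + ((x : ℝ) : ℂ) • A := by
  ext j k
  simp only [lineMatrix, Matrix.map_apply, Matrix.of_apply, Sm.ev_eq_ext, Matrix.add_apply,
    Matrix.smul_apply, smul_eq_mul]
  exact Sm.ext_of _ x.2

theorem ev_der_eq {W : Opens ℝ} (f : Sm W) (x : W) {F : ℝ → ℂ} {F' : ℂ}
    (hF : ∀ t ∈ W, f.ext t = F t) (h : HasDerivAt F F' x) : Sm.ev x (Sm.der 1 f) = F' := by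
  rw [Sm.ev_eq_ext, Sm.ext_der _ _ x.2, Sm.fderiv_ext_congr _ hF x.2, h.hasFDerivAt.fderiv]
  simp

theorem ev_der_lineMatrix (W : Opens ℝ) (H A : Matrix (Fin n) (Fin n) ℂ) (x : W) :
    ((lineMatrix W H A).map (Sm.der 1)).map (Sm.ev x) = A := by
  ext j k
  refine ev_der_eq _ x (F := fun t : ℝ => H j k + (t : ℂ) * A j k) (fun t ht => by
    rw [lineMatrix, Matrix.of_apply, Sm.ext_of _ ht]) ?_
  simpa using ((Complex.ofRealCLM.hasDerivAt (x := (x : ℝ))).mul_const (A j k)).const_add (H j k)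

/-- Polarization of `topCoeff_form11_pow`: differentiate the top coefficient of `form11 (H + tA) ^
n`, which is `n! det (H + tA)`, at `t = 0`. -/
theorem top_form11_mul_pow (A H : Matrix (Fin n) (Fin n) ℂ) (hH : H.det ≠ 0) :
    topCoeff (form11 A * form11 H ^ (n - 1)) = (n - 1).factorial * (H.det * tr H A) := by
  rcases Nat.eq_zero_or_pos n with hn | hn
  · subst hn
    simp [form11, tr]
  let x : (⊤ : Opens ℝ) := ⟨0, trivial⟩
  set M := lineMatrix ⊤ H A with hM
  have h0 : M.map (Sm.ev x) = H := by
    rw [hM, lineMatrix_map_ev]; simp [x]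
  have h1 : Sm.ev x (Sm.der 1 (FA.top (FA.form11 M ^ n))) = n.factorial * (H.det * tr H A) := by
    refine ev_der_eq _ x (F := fun t : ℝ => n.factorial * (H + (t : ℂ) • A).det) (fun t ht => ?_) ?_
    · have := FA.map_top (Sm.ev ⟨t, ht⟩) (FA.form11 M ^ n)
      rw [map_pow (FA.ev _), FA.ev_form11, hM, lineMatrix_map_ev, topCoeff_form11_pow] at this
      rw [← this, Sm.ev_eq_ext]
    · exact (hasDerivAt_det H A hH).const_mul _
  rw [FA.derivation_top, FA.der_pow (FA.form11_central M), map_smul, map_smul, FA.map_top,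
    map_mul (FA.ev _), map_pow (FA.ev _), FA.der_form11, FA.ev_form11, FA.ev_form11, h0, hM, ev_der_lineMatrix] at h1
  -- The derivative of the `n`-th power brings a factor `n`, which is cancelled here; `n = 0` was
  -- treated separately for this reason.
  have hn' : (n : ℂ) ≠ 0 := by exact_mod_cast hn.ne'
  apply mul_left_cancel₀ hn'
  rw [← smul_eq_mul, h1, ← mul_assoc]
  rw [← Nat.mul_factorial_pred hn.ne']
  push_cast
  ring

theorem map_nonsing_inv {R S : Type*} [CommRing R] [CommRing S] (φ : R →+* S)
    {M : Matrix (Fin n) (Fin n) R} (hM : IsUnit M.det) : M⁻¹.map φ = (M.map φ)⁻¹ := by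
  refine (Matrix.inv_eq_right_inv ?_).symm
  rw [← Matrix.map_mul, Matrix.mul_nonsing_inv _ hM, Matrix.map_one _ (map_zero φ) (map_one φ)]

/-- Second polarization: differentiate the previous formula along `H + tB`. The subtracted pairing
is the derivative of `H⁻¹` inside the trace. The factor `n - 1` stays on the left so that the
identity also holds for `n ≤ 1`. -/
theorem top_form11_mul_mul_pow (A B H : Matrix (Fin n) (Fin n) ℂ) (hH : H.det ≠ 0) :
    ((n - 1 : ℕ) : ℂ) * topCoeff (form11 A * form11 B * form11 H ^ (n - 2))
      = (n - 1).factorial * (H.det * (tr H A * tr H B - pairing H A B)) := by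
  -- The inverse occurs in the formula to be differentiated, so the parameter is restricted to the
  -- open set where `H + tB` is invertible.
  have hopen : IsOpen {t : ℝ | (H + (t : ℂ) • B).det ≠ 0} := by
    refine isOpen_ne.preimage (f := fun t : ℝ => (H + (t : ℂ) • B).det) ?_
    fun_prop
  let W : Opens ℝ := ⟨_, hopen⟩
  let x : W := ⟨0, by simpa [W] using hH⟩
  set M := lineMatrix W H B with hM
  set N := lineMatrix W A 0 with hN
  have h0 : M.map (Sm.ev x) = H := by
    rw [hM, lineMatrix_map_ev]; simp [x]
  have h0' : N.map (Sm.ev x) = A := by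
    rw [hN, lineMatrix_map_ev]; simp
  have hu : IsUnit M.det := Sm.isUnit fun t => by
    rw [AlgHom.map_det, AlgHom.mapMatrix_apply, hM, lineMatrix_map_ev]
    exact t.2
  have hinv : ∀ t : W, M⁻¹.map (Sm.ev t) = (H + ((t : ℝ) : ℂ) • B)⁻¹ := fun t => by
    rw [← lineMatrix_map_ev W H B t]
    exact map_nonsing_inv (Sm.ev t).toRingHom hu
  have hinv0 : M⁻¹.map (Sm.ev x) = H⁻¹ := by rw [hinv]; simp [x]
  have htr : ∀ (t : W) (P : Matrix (Fin n) (Fin n) (Sm W)),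
      Sm.ev t P.trace = (P.map (Sm.ev t)).trace := fun t P => by simp [Matrix.trace]
  have key : FA.top (FA.form11 N * FA.form11 M ^ (n - 1))
      = ((n - 1).factorial : ℂ) • (M.det * (M⁻¹ * N).trace) := Sm.ev_ext fun t => by
    rw [FA.map_top, map_mul (FA.ev _), map_pow (FA.ev _), FA.ev_form11, FA.ev_form11, map_smul,
      map_mul (Sm.ev t), htr, Matrix.map_mul, hinv, AlgHom.map_det, AlgHom.mapMatrix_apply, hM,
      lineMatrix_map_ev, lineMatrix_map_ev, smul_zero, add_zero, top_form11_mul_pow _ _ t.2,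
      tr_eq_trace, smul_eq_mul]
  have hdet : Sm.ev x (Sm.der 1 M.det) = H.det * tr H B := by
    refine ev_der_eq _ x (F := fun t : ℝ => (H + (t : ℂ) • B).det) (fun t ht => ?_)
      (hasDerivAt_det H B hH)
    have : Sm.ev ⟨t, ht⟩ M.det = (H + (t : ℂ) • B).det := by
      rw [AlgHom.map_det, AlgHom.mapMatrix_apply, hM, lineMatrix_map_ev]
    rw [← this, Sm.ev_eq_ext]
  have hdet0 : Sm.ev x M.det = H.det := by rw [AlgHom.map_det, AlgHom.mapMatrix_apply, h0]
  have h1 := congrArg (fun f => Sm.ev x (Sm.der 1 f)) key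
  have hDN : N.map (Sm.der 1) = 0 := by
    ext j k : 2
    refine Sm.ev_ext fun t => ?_
    have := congrFun (congrFun (ev_der_lineMatrix W A 0 t) j) k
    simpa [hN] using this
  simp only [FA.derivation_top, FA.der_mul, FA.der_pow (FA.form11_central M), FA.der_form11, hDN,
    Derivation.map_smul, Derivation.leibniz, smul_eq_mul] at h1
  rw [← trace_map_derivation, map_mul_derivation, hDN, map_inv_derivation _ hu, Matrix.mul_zero,
    add_zero] at h1
  have hz : FA.form11 (0 : Matrix (Fin n) (Fin n) (Sm W)) = 0 := by simp [FA.form11]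
  rw [hz, zero_mul, zero_add, mul_smul_comm, map_smul, map_smul, map_smul, map_add, map_mul (Sm.ev x),
    map_mul (Sm.ev x), hdet, hdet0, htr, htr, FA.map_top, map_mul (FA.ev _), map_mul (FA.ev _),
    map_pow (FA.ev _), FA.ev_form11, FA.ev_form11, FA.ev_form11, h0, h0', hM, ev_der_lineMatrix,
    ← hM] at h1
  have h2 : ((-(M⁻¹ * M.map (Sm.der 1) * M⁻¹) * N).map (Sm.ev x)) = -(H⁻¹ * B * H⁻¹ * A) := by
    have hn : ∀ P : Matrix (Fin n) (Fin n) (Sm W), (-P).map (Sm.ev x) = -P.map (Sm.ev x) :=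
      fun P => by ext; simp
    rw [Matrix.neg_mul, hn, Matrix.map_mul, Matrix.map_mul, Matrix.map_mul, hinv0, h0', hM,
      ev_der_lineMatrix]
  have hc : (H⁻¹ * B * H⁻¹ * A).trace = pairing H A B := by
    rw [pairing_eq_trace, Matrix.mul_assoc _ H⁻¹, Matrix.mul_assoc _ H⁻¹, Matrix.trace_mul_comm]
  rw [h2, Matrix.map_mul, hinv0, h0', Matrix.trace_neg, hc, ← tr_eq_trace, smul_eq_mul,
    smul_eq_mul, Nat.sub_sub, ← mul_assoc (form11 A)] at h1
  rw [h1]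
  ring

end TopForms

end KahlerGeom
end

noncomputable section

set_option linter.unusedSectionVars false

namespace KahlerGeom

/-! ### Holomorphic changes of coordinates, algebraically -/

section Transition

variable {n : ℕ} {C O : Type*} [CommRing C] [Algebra ℂ C] [CommRing O] [Algebra ℂ O]

/-- A homomorphism between rings of functions that behaves like pull-back along a holomorphic
change of coordinates with Jacobian matrix `J` (and conjugate Jacobian matrix `K`). -/
structure Transition (𝒟 : DiffRing (Fin n) C) (ℰ : DiffRing (Fin n) O) where
  /-- pull-back of functions -/
  φ : C →ₐ[ℂ] O
  /-- the Jacobian matrix -/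
  J : Matrix (Fin n) (Fin n) O
  /-- the conjugate Jacobian matrix -/
  K : Matrix (Fin n) (Fin n) O
  d_φ : ∀ j f, ℰ.d j (φ f) = ∑ a, J a j * φ (𝒟.d a f)
  db_φ : ∀ j f, ℰ.db j (φ f) = ∑ a, K a j * φ (𝒟.db a f)
  db_J : ∀ k a j, ℰ.db k (J a j) = 0
  d_K : ∀ k a j, ℰ.d k (K a j) = 0
  isUnit_J : IsUnit J.det
  isUnit_K : IsUnit K.det

namespace Transition

variable {𝒟 : DiffRing (Fin n) C} {ℰ : DiffRing (Fin n) O} (T : Transition 𝒟 ℰ)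

/-- Pull-back of a sesquilinear form on the tangent bundle. -/
def tens (A : Matrix (Fin n) (Fin n) C) : Matrix (Fin n) (Fin n) O :=
  T.J.transpose * A.map T.φ * T.K

/-- Pull-back of an endomorphism of the tangent bundle. -/
def endo (X : Matrix (Fin n) (Fin n) C) : Matrix (Fin n) (Fin n) O :=
  T.J.transpose * X.map T.φ * T.J.transpose⁻¹

theorem isUnit_Jt : IsUnit T.J.transpose.det := by rw [Matrix.det_transpose]; exact T.isUnit_J

theorem endo_mul (X Y : Matrix (Fin n) (Fin n) C) : T.endo (X * Y) = T.endo X * T.endo Y := by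
  simp only [endo, Matrix.map_mul]
  calc _ = T.J.transpose * X.map T.φ * 1 * Y.map T.φ * T.J.transpose⁻¹ := by
        simp only [Matrix.mul_assoc, Matrix.one_mul]
    _ = _ := by
        rw [← Matrix.nonsing_inv_mul _ T.isUnit_Jt]
        simp only [Matrix.mul_assoc]

theorem endo_add (X Y : Matrix (Fin n) (Fin n) C) : T.endo (X + Y) = T.endo X + T.endo Y := by
  have : (X + Y).map T.φ = X.map T.φ + Y.map T.φ := by ext; simp
  simp only [endo, this]; noncomm_ring

theorem endo_sub (X Y : Matrix (Fin n) (Fin n) C) : T.endo (X - Y) = T.endo X - T.endo Y := by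
  have : (X - Y).map T.φ = X.map T.φ - Y.map T.φ := by ext; simp
  simp only [endo, this]; noncomm_ring

theorem endo_neg (X : Matrix (Fin n) (Fin n) C) : T.endo (-X) = -T.endo X := by
  have : (-X).map T.φ = -X.map T.φ := by ext; simp
  simp only [endo, this]; noncomm_ring

theorem trace_endo (X : Matrix (Fin n) (Fin n) C) : (T.endo X).trace = T.φ X.trace := by
  rw [endo, Matrix.trace_mul_comm, ← Matrix.mul_assoc, Matrix.nonsing_inv_mul _ T.isUnit_Jt,
    Matrix.one_mul]
  simp [Matrix.trace]

theorem isUnit_map {h : Matrix (Fin n) (Fin n) C} (hh : IsUnit h.det) :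
    IsUnit (h.map T.φ).det := by
  have := hh.map T.φ
  rwa [AlgHom.map_det, AlgHom.mapMatrix_apply] at this

theorem isUnit_tens {h : Matrix (Fin n) (Fin n) C} (hh : IsUnit h.det) :
    IsUnit (T.tens h).det := by
  rw [tens, Matrix.det_mul, Matrix.det_mul]
  exact (T.isUnit_Jt.mul (T.isUnit_map hh)).mul T.isUnit_K

theorem tens_inv {h : Matrix (Fin n) (Fin n) C} (hh : IsUnit h.det) :
    (T.tens h)⁻¹ = T.K⁻¹ * h⁻¹.map T.φ * T.J.transpose⁻¹ := by
  rw [tens, Matrix.mul_inv_rev, Matrix.mul_inv_rev, Matrix.mul_assoc]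
  have : h⁻¹.map T.φ = (h.map T.φ)⁻¹ := map_nonsing_inv T.φ.toRingHom hh
  rw [this]

theorem tens_mul_inv {h : Matrix (Fin n) (Fin n) C} (hh : IsUnit h.det)
    (u : Matrix (Fin n) (Fin n) C) : T.tens u * (T.tens h)⁻¹ = T.endo (u * h⁻¹) := by
  rw [T.tens_inv hh, tens, endo, Matrix.map_mul]
  calc _ = T.J.transpose * u.map T.φ * (T.K * T.K⁻¹) * h⁻¹.map T.φ * T.J.transpose⁻¹ := by
        simp only [Matrix.mul_assoc]
    _ = _ := by
        rw [Matrix.mul_nonsing_inv _ T.isUnit_K]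
        simp only [Matrix.mul_assoc, Matrix.one_mul]

theorem map_d_map (X : Matrix (Fin n) (Fin n) C) (j : Fin n) :
    (X.map T.φ).map (ℰ.d j) = ∑ a, T.J a j • (X.map (𝒟.d a)).map T.φ := by
  ext p q
  simp [Matrix.sum_apply, T.d_φ]

theorem map_db_map (X : Matrix (Fin n) (Fin n) C) (j : Fin n) :
    (X.map T.φ).map (ℰ.db j) = ∑ a, T.K a j • (X.map (𝒟.db a)).map T.φ := by
  ext p q
  simp [Matrix.sum_apply, T.db_φ]

theorem Jt_map_db (k : Fin n) : T.J.transpose.map (ℰ.db k) = 0 := by ext; simp [T.db_J]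

theorem K_map_d (k : Fin n) : T.K.map (ℰ.d k) = 0 := by ext; simp [T.d_K]

theorem Jt_inv_map_db (k : Fin n) : T.J.transpose⁻¹.map (ℰ.db k) = 0 := by
  rw [map_inv_derivation _ T.isUnit_Jt, Jt_map_db]; simp

theorem endo_map_db (X : Matrix (Fin n) (Fin n) C) (k : Fin n) :
    (T.endo X).map (ℰ.db k) = ∑ b, T.K b k • T.endo (X.map (𝒟.db b)) := by
  simp only [endo, map_mul_derivation, Jt_map_db, Jt_inv_map_db, map_db_map, Matrix.mul_zero,
    Matrix.zero_mul, zero_add, add_zero, Matrix.mul_sum, Matrix.sum_mul, Matrix.mul_smul,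
    Matrix.smul_mul]

/-- Connections transform with the inhomogeneous term `∂Jᵗ · (Jᵗ)⁻¹`; the conjugate Jacobian
contributes nothing since `∂` kills it. -/
theorem conn_tens {h : Matrix (Fin n) (Fin n) C} (hh : IsUnit h.det) (j : Fin n) :
    ℰ.conn (T.tens h) j = T.J.transpose.map (ℰ.d j) * T.J.transpose⁻¹
      + ∑ a, T.J a j • T.endo (𝒟.conn h a) := by
  have h1 : (T.tens h).map (ℰ.d j) = T.J.transpose.map (ℰ.d j) * T.J.transpose⁻¹ * T.tens h
      + ∑ a, T.J a j • T.tens (h.map (𝒟.d a)) := by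
    have : T.J.transpose.map (ℰ.d j) * T.J.transpose⁻¹ * T.tens h
        = T.J.transpose.map (ℰ.d j) * h.map T.φ * T.K := by
      rw [tens]
      calc _ = T.J.transpose.map (ℰ.d j) * (T.J.transpose⁻¹ * T.J.transpose) * h.map T.φ * T.K := by
            simp only [Matrix.mul_assoc]
        _ = _ := by rw [Matrix.nonsing_inv_mul _ T.isUnit_Jt, Matrix.mul_one]
    rw [this]
    simp only [tens, map_mul_derivation, K_map_d, map_d_map, Matrix.mul_zero, add_zero,
      Matrix.mul_sum, Matrix.sum_mul, Matrix.mul_smul, Matrix.smul_mul, Matrix.add_mul]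
  rw [DiffRing.conn, h1, Matrix.add_mul, Matrix.mul_assoc _ (T.tens h),
    Matrix.mul_nonsing_inv _ (T.isUnit_tens hh), Matrix.mul_one, Matrix.sum_mul]
  congr 1
  refine Finset.sum_congr rfl fun a _ => ?_
  rw [Matrix.smul_mul, T.tens_mul_inv hh]
  rfl

/-- The inhomogeneous term of `conn_tens` is holomorphic, so `∂̄` removes it and the curvature is a
tensor. -/
theorem curvature_tens {h : Matrix (Fin n) (Fin n) C} (hh : IsUnit h.det) (j k : Fin n) :
    ℰ.curvature (T.tens h) j k
      = ∑ a, ∑ b, (T.J a j * T.K b k) • T.endo (𝒟.curvature h a b) := by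
  have h0 : (T.J.transpose.map (ℰ.d j)).map (ℰ.db k) = 0 := by
    rw [DiffRing.map_db_d, Jt_map_db]; ext; simp
  have hs : ∀ X : Fin n → Matrix (Fin n) (Fin n) O,
      (∑ a, X a).map (ℰ.db k) = ∑ a, (X a).map (ℰ.db k) := fun X => by
    ext; simp [Matrix.sum_apply]
  rw [DiffRing.curvature, T.conn_tens hh, map_add_derivation, map_mul_derivation, h0, Jt_inv_map_db,
    Matrix.zero_mul, Matrix.mul_zero, zero_add, zero_add, hs, ← Finset.sum_neg_distrib]
  refine Finset.sum_congr rfl fun a _ => ?_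
  have hJ : ∀ X : Matrix (Fin n) (Fin n) O, (T.J a j • X).map (ℰ.db k)
      = T.J a j • X.map (ℰ.db k) := fun X => by
    rw [map_smul_derivation, T.db_J, zero_smul, zero_add]
  rw [hJ, endo_map_db, Finset.smul_sum, ← Finset.sum_neg_distrib]
  refine Finset.sum_congr rfl fun b _ => ?_
  rw [DiffRing.curvature, endo_neg, smul_smul, smul_neg]

/-- The derivative of the change of frame produces a commutator with `N` that cancels the
inhomogeneous term of the connection. -/
theorem cov_endo {h : Matrix (Fin n) (Fin n) C} (hh : IsUnit h.det) (j : Fin n)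
    (X : Matrix (Fin n) (Fin n) C) :
    ℰ.cov (T.tens h) j (T.endo X) = ∑ a, T.J a j • T.endo (𝒟.cov h a X) := by
  set N := T.J.transpose.map (ℰ.d j) * T.J.transpose⁻¹ with hN
  have h1 : (T.endo X).map (ℰ.d j) = N * T.endo X - T.endo X * N
      + ∑ a, T.J a j • T.endo (X.map (𝒟.d a)) := by
    have e1 : N * T.endo X = T.J.transpose.map (ℰ.d j) * X.map T.φ * T.J.transpose⁻¹ := by
      rw [hN, endo]
      calc _ = T.J.transpose.map (ℰ.d j) * (T.J.transpose⁻¹ * T.J.transpose) * X.map T.φ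
            * T.J.transpose⁻¹ := by simp only [Matrix.mul_assoc]
        _ = _ := by rw [Matrix.nonsing_inv_mul _ T.isUnit_Jt, Matrix.mul_one]
    rw [e1]
    simp only [endo, map_mul_derivation, map_inv_derivation _ T.isUnit_Jt, map_d_map,
      Matrix.mul_sum, Matrix.sum_mul, Matrix.mul_smul, Matrix.smul_mul, Matrix.add_mul, hN]
    noncomm_ring
  rw [DiffRing.cov, h1, T.conn_tens hh, ← hN]
  simp only [DiffRing.cov, endo_add, endo_sub, endo_mul, smul_add, smul_sub, Finset.sum_add_distrib,
    Finset.sum_sub_distrib, Matrix.mul_add, Matrix.add_mul, Matrix.mul_sum, Matrix.sum_mul,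
    Matrix.mul_smul, Matrix.smul_mul]
  abel

/-- No first-order term appears because `∂` annihilates the conjugate Jacobian. -/
theorem hess_φ (f : C) (j k : Fin n) :
    ℰ.d j (ℰ.db k (T.φ f)) = ∑ a, ∑ b, T.J a j * T.φ (𝒟.d a (𝒟.db b f)) * T.K b k := by
  rw [T.db_φ, map_sum]
  simp only [Derivation.leibniz, T.d_K, smul_eq_mul, mul_zero, add_zero, T.d_φ]
  rw [Finset.sum_comm]
  refine Finset.sum_congr rfl fun b _ => ?_
  rw [Finset.mul_sum]
  exact Finset.sum_congr rfl fun a _ => by ring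

end Transition

end Transition

end KahlerGeom
end

noncomputable section

set_option linter.unusedSectionVars false

namespace KahlerGeom

/-! ### Changes of coordinates on a complex manifold -/

section Charts

open TopologicalSpace

variable {n : ℕ} {M : Type*} [TopologicalSpace M] [ChartedSpace (Cn n) M]

/-- The coordinates `e` of the points that also have coordinates `e'`. -/
def overlap (e e' : OpenPartialHomeomorph M (Cn n)) : Set (Cn n) :=
  e.target ∩ e.symm ⁻¹' e'.source

/-- The change of coordinates. -/
def coordChange (e e' : OpenPartialHomeomorph M (Cn n)) (z : Cn n) : Cn n := e' (e.symm z)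

/-- The Jacobian matrix of the change of coordinates. -/
def jac (e e' : OpenPartialHomeomorph M (Cn n)) (z : Cn n) : Matrix (Fin n) (Fin n) ℂ :=
  Matrix.of fun a j => fderiv ℂ (coordChange e e') z (Pi.single j 1) a

theorem isOpen_overlap (e e' : OpenPartialHomeomorph M (Cn n)) : IsOpen (overlap e e') :=
  e.isOpen_inter_preimage_symm e'.open_source

theorem coordChange_mem {e e' : OpenPartialHomeomorph M (Cn n)} {z : Cn n}
    (hz : z ∈ overlap e e') : coordChange e e' z ∈ overlap e' e := by
  refine ⟨e'.map_source hz.2, ?_⟩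
  simp only [coordChange, Set.mem_preimage]
  rw [e'.left_inv hz.2]
  exact e.map_target hz.1

theorem coordChange_symm {e e' : OpenPartialHomeomorph M (Cn n)} {z : Cn n}
    (hz : z ∈ overlap e e') : e'.symm (coordChange e e' z) = e.symm z := e'.left_inv hz.2

theorem coordChange_coordChange {e e' e'' : OpenPartialHomeomorph M (Cn n)} {z : Cn n}
    (hz : z ∈ overlap e e') : coordChange e' e'' (coordChange e e' z) = coordChange e e'' z := by
  rw [coordChange, coordChange_symm hz]; rfl

theorem coordChange_self {e : OpenPartialHomeomorph M (Cn n)} {z : Cn n} (hz : z ∈ e.target) :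
    coordChange e e z = z := e.right_inv hz

section Analytic

variable [IsManifold 𝓘(ℂ, Cn n) ω M]

theorem contDiffOn_coordChange {e e' : OpenPartialHomeomorph M (Cn n)} (he : e ∈ atlas (Cn n) M)
    (he' : e' ∈ atlas (Cn n) M) : ContDiffOn ℂ ω (coordChange e e') (overlap e e') := by
  have h := (contDiffGroupoid ω 𝓘(ℂ, Cn n)).compatible he he'
  rw [contDiffGroupoid, mem_groupoid_of_pregroupoid] at h
  have h1 := h.1
  simp only [contDiffPregroupoid, modelWithCornersSelf_coe, modelWithCornersSelf_coe_symm,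
    Set.range_id, Set.inter_univ, Set.preimage_id, Function.comp_id, Function.id_comp] at h1
  exact h1

theorem contDiffOn_real_coordChange {e e' : OpenPartialHomeomorph M (Cn n)}
    (he : e ∈ atlas (Cn n) M) (he' : e' ∈ atlas (Cn n) M) :
    ContDiffOn ℝ ∞ (coordChange e e') (overlap e e') :=
  ((contDiffOn_coordChange he he').restrict_scalars ℝ).of_le le_top

theorem hasFDerivAt_coordChange {e e' : OpenPartialHomeomorph M (Cn n)}
    (he : e ∈ atlas (Cn n) M) (he' : e' ∈ atlas (Cn n) M) {z : Cn n} (hz : z ∈ overlap e e') :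
    HasFDerivAt (coordChange e e') (fderiv ℂ (coordChange e e') z) z :=
  (((contDiffOn_coordChange he he').contDiffAt ((isOpen_overlap e e').mem_nhds hz)).differentiableAt
    (by simp)).hasFDerivAt

theorem fderiv_coordChange_apply (e e' : OpenPartialHomeomorph M (Cn n)) (z v : Cn n) :
    fderiv ℂ (coordChange e e') z v = (jac e e' z).mulVec v := by
  ext a
  conv_lhs => rw [show v = ∑ j, v j • (Pi.single j 1 : Cn n) by
    ext b; simp [Finset.sum_apply, Pi.single_apply]]
  simp [Matrix.mulVec, dotProduct, jac, Finset.sum_apply, mul_comm]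

/-- The chain rule for the cocycle of coordinate changes. Its special case `e'' = e` makes the
Jacobians invertible. -/
theorem jac_comp {e e' e'' : OpenPartialHomeomorph M (Cn n)} (he : e ∈ atlas (Cn n) M)
    (he' : e' ∈ atlas (Cn n) M) (he'' : e'' ∈ atlas (Cn n) M) {z : Cn n} (hz : z ∈ overlap e e')
    (hz' : z ∈ overlap e e'') :
    jac e e'' z = jac e' e'' (coordChange e e' z) * jac e e' z := by
  have h1 : coordChange e e' z ∈ overlap e' e'' := by
    refine ⟨(coordChange_mem hz).1, ?_⟩
    rw [Set.mem_preimage, coordChange_symm hz]; exact hz'.2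
  have h2 := (hasFDerivAt_coordChange he' he'' h1).comp z (hasFDerivAt_coordChange he he' hz)
  have h3 : coordChange e' e'' ∘ coordChange e e' =ᶠ[nhds z] coordChange e e'' := by
    filter_upwards [(isOpen_overlap e e').mem_nhds hz] with w hw
    exact coordChange_coordChange hw
  have h4 := h3.fderiv_eq (𝕜 := ℂ)
  rw [h2.fderiv] at h4
  ext a j
  rw [jac, Matrix.of_apply, ← h4, Matrix.mul_apply]
  simp only [ContinuousLinearMap.comp_apply]
  rw [fderiv_coordChange_apply]
  simp only [Matrix.mulVec, dotProduct]
  rfl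

theorem jac_self {e : OpenPartialHomeomorph M (Cn n)} {z : Cn n} (hz : z ∈ e.target) :
    jac e e z = 1 := by
  have h : coordChange e e =ᶠ[nhds z] id := by
    filter_upwards [e.open_target.mem_nhds hz] with w hw
    exact coordChange_self hw
  ext a j
  rw [jac, Matrix.of_apply, h.fderiv_eq, fderiv_id]
  simp [Pi.single_apply, Matrix.one_apply]

theorem jac_mul_jac {e e' : OpenPartialHomeomorph M (Cn n)} (he : e ∈ atlas (Cn n) M)
    (he' : e' ∈ atlas (Cn n) M) {z : Cn n} (hz : z ∈ overlap e e') :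
    jac e' e (coordChange e e' z) * jac e e' z = 1 := by
  rw [← jac_comp he he' he hz ⟨hz.1, e.map_target hz.1⟩, jac_self hz.1]

theorem det_jac_ne_zero {e e' : OpenPartialHomeomorph M (Cn n)} (he : e ∈ atlas (Cn n) M)
    (he' : e' ∈ atlas (Cn n) M) {z : Cn n} (hz : z ∈ overlap e e') : (jac e e' z).det ≠ 0 := by
  have h := congrArg Matrix.det (jac_mul_jac he he' hz)
  rw [Matrix.det_mul, Matrix.det_one] at h
  exact right_ne_zero_of_mul_eq_one h

theorem contDiffOn_jac {e e' : OpenPartialHomeomorph M (Cn n)} (he : e ∈ atlas (Cn n) M)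
    (he' : e' ∈ atlas (Cn n) M) (a j : Fin n) :
    ContDiffOn ℂ ∞ (fun z => jac e e' z a j) (overlap e e') := by
  have h1 : ContDiffOn ℂ ∞ (fderiv ℂ (coordChange e e')) (overlap e e') :=
    ((contDiffOn_coordChange he he').of_le (m := ∞) le_top).fderiv_of_isOpen (isOpen_overlap e e')
      (by simp)
  exact contDiffOn_pi.1 (h1.clm_apply contDiffOn_const) a

end Analytic

/-! #### Wirtinger calculus under holomorphic maps -/

/-- In the combination of `v` and `I • v` the conjugate-linear terms cancel. With `v` a column of a
complex Jacobian this is the holomorphic chain rule for `∂_j`. -/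
theorem wirtinger_sum (L : Cn n →L[ℝ] ℂ) (v : Cn n) :
    1 / 2 * (L v - Complex.I * L (Complex.I • v))
      = ∑ a, v a * (1 / 2 * (L (Pi.single a 1) - Complex.I * L (Pi.single a Complex.I))) := by
  rw [clm_eq_sum L v, clm_eq_sum L (Complex.I • v), Finset.mul_sum, ← Finset.sum_sub_distrib,
    Finset.mul_sum]
  refine Finset.sum_congr rfl fun a _ => ?_
  have : star (Complex.I * v a) = -Complex.I * star (v a) := by
    rw [star_mul']; congr 1; exact Complex.conj_I
  rw [Pi.smul_apply, smul_eq_mul, this]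
  have h3 : Complex.I ^ 3 = -Complex.I := by rw [pow_succ, Complex.I_sq]; ring
  ring_nf
  simp only [Complex.I_sq, h3]
  ring

theorem wirtinger_bar_sum (L : Cn n →L[ℝ] ℂ) (v : Cn n) :
    1 / 2 * (L v + Complex.I * L (Complex.I • v))
      = ∑ a, star (v a) * (1 / 2 * (L (Pi.single a 1) + Complex.I * L (Pi.single a Complex.I))) := by
  rw [clm_eq_sum L v, clm_eq_sum L (Complex.I • v), Finset.mul_sum, ← Finset.sum_add_distrib,
    Finset.mul_sum]
  refine Finset.sum_congr rfl fun a _ => ?_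
  have : star (Complex.I * v a) = -Complex.I * star (v a) := by
    rw [star_mul']; congr 1; exact Complex.conj_I
  rw [Pi.smul_apply, smul_eq_mul, this]
  have h3 : Complex.I ^ 3 = -Complex.I := by rw [pow_succ, Complex.I_sq]; ring
  ring_nf
  simp only [Complex.I_sq, h3]
  ring

theorem ddbar_eq_zero {F : Cn n → ℂ} {z : Cn n} (hF : DifferentiableAt ℂ F z) (k : Fin n) :
    ddbar k F z = 0 := by
  have h : fderiv ℝ F z = (fderiv ℂ F z).restrictScalars ℝ :=
    (hF.hasFDerivAt.restrictScalars ℝ).fderiv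
  have h2 : (Pi.single k Complex.I : Cn n) = Complex.I • Pi.single k 1 := by
    rw [← Pi.single_smul]; simp
  rw [ddbar, h]
  simp only [ContinuousLinearMap.coe_restrictScalars']
  rw [h2, map_smul, smul_eq_mul, ← mul_assoc, Complex.I_mul_I]
  ring

/-! #### Rings of functions on coordinate domains -/

variable (Q : Opens (ℝ × ℝ))

/-- Parameters times a coordinate domain. -/
def dom (e : OpenPartialHomeomorph M (Cn n)) : Opens (PCn n) :=
  ⟨(Q : Set (ℝ × ℝ)) ×ˢ e.target, Q.isOpen.prod e.open_target⟩

/-- Parameters times an overlap. -/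
def ovl (e e' : OpenPartialHomeomorph M (Cn n)) : Opens (PCn n) :=
  ⟨(Q : Set (ℝ × ℝ)) ×ˢ overlap e e', Q.isOpen.prod (isOpen_overlap e e')⟩

/-- The change of coordinates, with parameters. -/
def pCoordChange (e e' : OpenPartialHomeomorph M (Cn n)) (x : PCn n) : PCn n :=
  (x.1, coordChange e e' x.2)

variable {Q}

theorem ovl_le {e e' : OpenPartialHomeomorph M (Cn n)} : Set.MapsTo id (ovl Q e e' : Set (PCn n)) (dom Q e) :=
  fun _ hx => ⟨hx.1, hx.2.1⟩

theorem ovl_mapsTo {e e' : OpenPartialHomeomorph M (Cn n)} :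
    Set.MapsTo (pCoordChange e e') (ovl Q e e' : Set (PCn n)) (dom Q e') :=
  fun _ hx => ⟨hx.1, (coordChange_mem hx.2).1⟩

section Transition

variable [IsManifold 𝓘(ℂ, Cn n) ω M]

theorem contDiffOn_pCoordChange {e e' : OpenPartialHomeomorph M (Cn n)} (he : e ∈ atlas (Cn n) M)
    (he' : e' ∈ atlas (Cn n) M) : ContDiffOn ℝ ∞ (pCoordChange e e') (ovl Q e e' : Set (PCn n)) :=
  contDiffOn_fst.prodMk ((contDiffOn_real_coordChange he he').comp contDiffOn_snd fun _ hx => hx.2)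

theorem fderiv_pCoordChange {e e' : OpenPartialHomeomorph M (Cn n)} (he : e ∈ atlas (Cn n) M)
    (he' : e' ∈ atlas (Cn n) M) {x : PCn n} (hx : x ∈ ovl Q e e') (v : Cn n) :
    fderiv ℝ (pCoordChange e e') x (0, v) = (0, (jac e e' x.2).mulVec v) := by
  have h1 := ((hasFDerivAt_coordChange he he' hx.2).restrictScalars ℝ).comp x
    (hasFDerivAt_snd (𝕜 := ℝ) (p := x))
  have h2 : fderiv ℝ (pCoordChange e e') x = _ := ((hasFDerivAt_fst (𝕜 := ℝ) (p := x)).prodMk h1).fderiv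
  rw [h2]
  simp [fderiv_coordChange_apply]

/-- The Jacobian matrix as a matrix of smooth functions. -/
def smJac {e e' : OpenPartialHomeomorph M (Cn n)} (he : e ∈ atlas (Cn n) M)
    (he' : e' ∈ atlas (Cn n) M) : Matrix (Fin n) (Fin n) (Sm (ovl Q e e')) :=
  Matrix.of fun a j => Sm.of (fun x => jac e e' x.2 a j)
    (((contDiffOn_jac he he' a j).restrict_scalars ℝ).comp contDiffOn_snd fun _ hx => hx.2)

theorem ext_smJac {e e' : OpenPartialHomeomorph M (Cn n)} (he : e ∈ atlas (Cn n) M)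
    (he' : e' ∈ atlas (Cn n) M) (a j : Fin n) {x : PCn n} (hx : x ∈ ovl Q e e') :
    (smJac (Q := Q) he he' a j).ext x = jac e e' x.2 a j := by
  rw [smJac, Matrix.of_apply, Sm.ext_of _ hx]

theorem isUnit_smJac {e e' : OpenPartialHomeomorph M (Cn n)} (he : e ∈ atlas (Cn n) M)
    (he' : e' ∈ atlas (Cn n) M) : IsUnit (smJac (Q := Q) he he').det := by
  refine Sm.isUnit fun x => ?_
  have : (smJac (Q := Q) he he').map (Sm.ev x) = jac e e' x.1.2 := by
    ext a j
    rw [Matrix.map_apply, Sm.ev_eq_ext, ext_smJac he he' a j x.2]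
  rw [AlgHom.map_det, AlgHom.mapMatrix_apply, this]
  exact det_jac_ne_zero he he' x.2.2

theorem delb_smJac {e e' : OpenPartialHomeomorph M (Cn n)} (he : e ∈ atlas (Cn n) M)
    (he' : e' ∈ atlas (Cn n) M) (k a j : Fin n) : Sm.delb k (smJac (Q := Q) he he' a j) = 0 := by
  refine Sm.ext_eq fun x hx => ?_
  obtain ⟨q, z⟩ := x
  rw [← Sm.ddbar_eq_ext k _ hx fun w hw => (ext_smJac he he' a j hw).symm, Sm.ext_zero]
  exact ddbar_eq_zero (((contDiffOn_jac he he' a j).contDiffAt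
    ((isOpen_overlap e e').mem_nhds hx.2)).differentiableAt (by simp)) k

/-- Restriction to an overlap. -/
def res (e e' : OpenPartialHomeomorph M (Cn n)) : Sm (dom Q e) →ₐ[ℂ] Sm (ovl Q e e') :=
  Sm.pull id contDiffOn_id ovl_le

theorem ext_res (e e' : OpenPartialHomeomorph M (Cn n)) (f : Sm (dom Q e)) {x : PCn n}
    (hx : x ∈ ovl Q e e') : (res e e' f).ext x = f.ext x := Sm.ext_pull _ _ f hx

/-- Restriction to an overlap commutes with derivatives. -/
theorem der_res (e e' : OpenPartialHomeomorph M (Cn n)) (v : PCn n) (f : Sm (dom Q e)) :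
    Sm.der v (res e e' f) = res e e' (Sm.der v f) := by
  refine Sm.ext_eq fun x hx => ?_
  have hx' : x ∈ dom Q e := ovl_le hx
  rw [res, Sm.ext_der_pull _ _ f v hx, ← res, ext_res e e' _ hx, Sm.ext_der v f hx']
  simp

theorem del_res (e e' : OpenPartialHomeomorph M (Cn n)) (j : Fin n) (f : Sm (dom Q e)) :
    Sm.del j (res e e' f) = res e e' (Sm.del j f) := by
  simp only [Sm.del_apply, der_res, map_smul, map_sub]

theorem delb_res (e e' : OpenPartialHomeomorph M (Cn n)) (j : Fin n) (f : Sm (dom Q e)) :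
    Sm.delb j (res e e' f) = res e e' (Sm.delb j f) := by
  simp only [Sm.delb_apply, der_res, map_smul, map_add]

/-- Restriction to an overlap as a transition. -/
def resTransition (e e' : OpenPartialHomeomorph M (Cn n)) :
    Transition (Sm.diffRing (dom Q e)) (Sm.diffRing (ovl Q e e')) where
  φ := res e e'
  J := 1
  K := 1
  d_φ j f := by
    refine (del_res e e' j f).trans ?_
    rw [Finset.sum_eq_single j]
    · simp [Sm.diffRing]
    · intro b _ hb; simp [Matrix.one_apply_ne hb]
    · simp
  db_φ j f := by
    refine (delb_res e e' j f).trans ?_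
    rw [Finset.sum_eq_single j]
    · simp [Sm.diffRing]
    · intro b _ hb; simp [Matrix.one_apply_ne hb]
    · simp
  db_J k a j := by
    by_cases h : a = j
    · subst h; simp
    · simp [Matrix.one_apply_ne h]
  d_K k a j := by
    by_cases h : a = j
    · subst h; simp
    · simp [Matrix.one_apply_ne h]
  isUnit_J := by simp
  isUnit_K := by simp

/-- Pull-back along a change of coordinates. -/
def trans {e e' : OpenPartialHomeomorph M (Cn n)} (he : e ∈ atlas (Cn n) M)
    (he' : e' ∈ atlas (Cn n) M) : Sm (dom Q e') →ₐ[ℂ] Sm (ovl Q e e') :=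
  Sm.pull (pCoordChange e e') (contDiffOn_pCoordChange he he') ovl_mapsTo

theorem ext_trans {e e' : OpenPartialHomeomorph M (Cn n)} (he : e ∈ atlas (Cn n) M)
    (he' : e' ∈ atlas (Cn n) M) (f : Sm (dom Q e')) {x : PCn n} (hx : x ∈ ovl Q e e') :
    (trans he he' f).ext x = f.ext (pCoordChange e e' x) := Sm.ext_pull _ _ f hx

theorem ext_der_trans {e e' : OpenPartialHomeomorph M (Cn n)} (he : e ∈ atlas (Cn n) M)
    (he' : e' ∈ atlas (Cn n) M) (f : Sm (dom Q e')) (v : Cn n) {x : PCn n}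
    (hx : x ∈ ovl Q e e') : (Sm.der (0, v) (trans he he' f)).ext x
      = ((fderiv ℝ f.ext (pCoordChange e e' x)).comp (ContinuousLinearMap.inr ℝ (ℝ × ℝ) (Cn n)))
        ((jac e e' x.2).mulVec v) := by
  rw [trans, Sm.ext_der_pull _ _ f _ hx, fderiv_pCoordChange he he' hx]
  rfl

theorem mulVec_single_I (A : Matrix (Fin n) (Fin n) ℂ) (j : Fin n) :
    A.mulVec (Pi.single j Complex.I) = Complex.I • A.mulVec (Pi.single j 1) := by
  rw [← Matrix.mulVec_smul, ← Pi.single_smul]; simp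

/-- A holomorphic change of coordinates as a transition. -/
def chartTransition {e e' : OpenPartialHomeomorph M (Cn n)} (he : e ∈ atlas (Cn n) M)
    (he' : e' ∈ atlas (Cn n) M) :
    Transition (Sm.diffRing (dom Q e')) (Sm.diffRing (ovl Q e e')) where
  φ := trans he he'
  J := smJac he he'
  K := (smJac he he').map Sm.conj
  d_φ j f := by
    refine Sm.ext_eq fun x hx => ?_
    change (Sm.del j _).ext x = (∑ a, _ * trans he he' (Sm.del a f)).ext x
    rw [Sm.del_apply, Sm.ext_smul, Sm.ext_sub, Sm.ext_smul, ext_der_trans he he' f _ hx,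
      ext_der_trans he he' f _ hx, mulVec_single_I, wirtinger_sum, Sm.ext_sum]
    refine Finset.sum_congr rfl fun a _ => ?_
    rw [Sm.ext_mul, ext_smJac he he' a j hx, ext_trans he he' _ hx, Sm.del_apply, Sm.ext_smul,
      Sm.ext_sub, Sm.ext_smul, Sm.ext_der _ f (ovl_mapsTo hx), Sm.ext_der _ f (ovl_mapsTo hx)]
    simp
  db_φ j f := by
    refine Sm.ext_eq fun x hx => ?_
    change (Sm.delb j _).ext x = (∑ a, _ * trans he he' (Sm.delb a f)).ext x
    rw [Sm.delb_apply, Sm.ext_smul, Sm.ext_add, Sm.ext_smul, ext_der_trans he he' f _ hx,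
      ext_der_trans he he' f _ hx, mulVec_single_I, wirtinger_bar_sum, Sm.ext_sum]
    refine Finset.sum_congr rfl fun a _ => ?_
    rw [Sm.ext_mul, Matrix.map_apply, Sm.ext_conj _ hx, ext_smJac he he' a j hx,
      ext_trans he he' _ hx, Sm.delb_apply, Sm.ext_smul,
      Sm.ext_add, Sm.ext_smul, Sm.ext_der _ f (ovl_mapsTo hx), Sm.ext_der _ f (ovl_mapsTo hx)]
    simp
  db_J k a j := delb_smJac he he' k a j
  d_K k a j := by
    change Sm.del k (Sm.conj _) = 0
    rw [Sm.del_conj, delb_smJac, map_zero]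
  isUnit_J := isUnit_smJac he he'
  isUnit_K := by
    have := (isUnit_smJac (Q := Q) he he').map Sm.conj
    rwa [RingHom.map_det, RingHom.mapMatrix_apply] at this

end Transition

end Charts

end KahlerGeom
end

noncomputable section

set_option linter.unusedSectionVars false

namespace KahlerGeom

/-! ### Integration of smooth functions with parameters -/

section ChartIntegral

open TopologicalSpace MeasureTheory

variable {n : ℕ} {M : Type*} [TopologicalSpace M] [ChartedSpace (Cn n) M]
  {Q : Opens (ℝ × ℝ)} {e : OpenPartialHomeomorph M (Cn n)} {K : Set (Cn n)}

/-- The function vanishes outside `K`. -/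
def SuppIn (F : Sm (dom Q e)) (K : Set (Cn n)) : Prop := ∀ x : PCn n, x.2 ∉ K → F.ext x = 0

theorem ext_not_mem (F : Sm (dom Q e)) {x : PCn n} (hx : x ∉ dom Q e) : F.ext x = 0 := by
  simp [Sm.ext, hx]

namespace SuppIn

variable {F : Sm (dom Q e)} (hF : SuppIn F K)

include hF

theorem der (hK : IsCompact K) (v : PCn n) : SuppIn (Sm.der v F) K := fun x hx => by
  by_cases h : x ∈ dom Q e
  · exact F.ext_der_eq_zero v (hK.isClosed.preimage continuous_snd) (fun y _ hy => hF y hy) h hx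
  · exact ext_not_mem _ h

theorem mul_left (G : Sm (dom Q e)) : SuppIn (G * F) K := fun x hx => by
  rw [Sm.ext_mul, hF x hx, mul_zero]

/-- Away from the closed set `K` the extension by zero is locally zero, and on `K` it is smooth
because `K` lies in the chart. -/
theorem contDiffOn (hK : IsCompact K) (hKe : K ⊆ e.target) :
    ContDiffOn ℝ ∞ F.ext ((Q : Set (ℝ × ℝ)) ×ˢ Set.univ) := by
  rintro ⟨q, z⟩ ⟨hq, -⟩
  by_cases hz : z ∈ K
  · exact (F.contDiffAt_ext (x := (q, z)) ⟨hq, hKe hz⟩).contDiffWithinAt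
  · refine ContDiffAt.contDiffWithinAt ((contDiffAt_const (c := (0 : ℂ))).congr_of_eventuallyEq ?_)
    filter_upwards [(hK.isClosed.preimage continuous_snd).isOpen_compl.mem_nhds hz] with y hy
    exact hF y hy

theorem contDiff_slice (hK : IsCompact K) (hKe : K ⊆ e.target) {q : ℝ × ℝ} (hq : q ∈ Q) :
    ContDiff ℝ ∞ fun z => F.ext (q, z) := by
  rw [← contDiffOn_univ]
  exact (hF.contDiffOn hK hKe).comp (contDiffOn_const.prodMk contDiffOn_id)
    fun z _ => ⟨hq, trivial⟩

theorem hasCompactSupport (hK : IsCompact K) (q : ℝ × ℝ) :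
    HasCompactSupport fun z => F.ext (q, z) :=
  HasCompactSupport.intro hK fun z hz => hF (q, z) hz

theorem integrable (hK : IsCompact K) (hKe : K ⊆ e.target) {q : ℝ × ℝ} (hq : q ∈ Q) :
    Integrable fun z => F.ext (q, z) :=
  (hF.contDiff_slice hK hKe hq).continuous.integrable_of_hasCompactSupport
    (hF.hasCompactSupport hK q)

theorem integral_target (hKe : K ⊆ e.target) (q : ℝ × ℝ) :
    ∫ z in e.target, F.ext (q, z) = ∫ z in K, F.ext (q, z) := by
  rw [setIntegral_eq_integral_of_forall_compl_eq_zero fun z hz => hF (q, z) hz]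
  exact setIntegral_eq_integral_of_forall_compl_eq_zero fun z hz => hF (q, z) fun h => hz (hKe h)

/-- The fundamental theorem of calculus for compact support, obtained by integrating by parts
against the constant function `1`. -/
theorem integral_der (hK : IsCompact K) (hKe : K ⊆ e.target) {q : ℝ × ℝ} (hq : q ∈ Q) (v : Cn n) :
    ∫ z in e.target, (Sm.der (0, v) F).ext (q, z) = 0 := by
  rw [(hF.der hK _).integral_target hKe,
    setIntegral_eq_integral_of_forall_compl_eq_zero fun z hz => (hF.der hK (0, v)) (q, z) hz]
  have h1 : ∀ z, (Sm.der (0, v) F).ext (q, z) = fderiv ℝ (fun z => F.ext (q, z)) z v := fun z => by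
    by_cases hz : z ∈ e.target
    · have hx : (q, z) ∈ dom Q e := ⟨hq, hz⟩
      rw [Sm.ext_der _ _ hx, Sm.fderiv_slice _ hx]
    · have hzK : z ∉ K := fun h => hz (hKe h)
      rw [(hF.der hK (0, v)) (q, z) hzK]
      have : (fun z => F.ext (q, z)) =ᶠ[nhds z] fun _ => 0 := by
        filter_upwards [hK.isClosed.isOpen_compl.mem_nhds hzK] with y hy
        exact hF (q, y) hy
      rw [this.fderiv_eq]
      simp
  simp only [h1]
  have hd := (hF.contDiff_slice hK hKe hq)
  have hc := (hF.hasCompactSupport hK q).fderiv_apply ℝ v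
  have hi : Integrable (fun z => fderiv ℝ (fun z => F.ext (q, z)) z v) :=
    ((hd.continuous_fderiv (by simp)).clm_apply continuous_const).integrable_of_hasCompactSupport hc
  have h := integral_mul_fderiv_eq_neg_fderiv_mul_of_integrable (μ := volume) (f := fun _ : Cn n => (1 : ℂ))
    (g := fun z => F.ext (q, z)) (v := v) (by simp) (by simpa using hi)
    (by simpa using hF.integrable hK hKe hq) (fun _ _ => differentiableAt_const _)
    (fun z _ => hd.differentiable (by simp) z)
  simpa using h

theorem integral_del (hK : IsCompact K) (hKe : K ⊆ e.target) {q : ℝ × ℝ} (hq : q ∈ Q) (j : Fin n) :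
    ∫ z in e.target, (Sm.del j F).ext (q, z) = 0 := by
  have hi : ∀ v, IntegrableOn (fun z => (Sm.der v F).ext (q, z)) e.target := fun v =>
    ((hF.der hK v).integrable hK hKe hq).integrableOn
  simp only [Sm.del_apply, Sm.ext_smul, Sm.ext_sub]
  rw [integral_const_mul, integral_sub (hi _) ((hi _).const_mul _), integral_const_mul,
    hF.integral_der hK hKe hq, hF.integral_der hK hKe hq]
  simp

theorem integral_delb (hK : IsCompact K) (hKe : K ⊆ e.target) {q : ℝ × ℝ} (hq : q ∈ Q) (j : Fin n) :
    ∫ z in e.target, (Sm.delb j F).ext (q, z) = 0 := by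
  have hi : ∀ v, IntegrableOn (fun z => (Sm.der v F).ext (q, z)) e.target := fun v =>
    ((hF.der hK v).integrable hK hKe hq).integrableOn
  simp only [Sm.delb_apply, Sm.ext_smul, Sm.ext_add]
  rw [integral_const_mul, integral_add (hi _) ((hi _).const_mul _), integral_const_mul,
    hF.integral_der hK hKe hq, hF.integral_der hK hKe hq]
  simp

/-- Differentiation under the integral sign. -/
theorem hasFDerivAt_integral (hK : IsCompact K) (hKe : K ⊆ e.target) {q : ℝ × ℝ} (hq : q ∈ Q) :
    ∃ L : ℝ × ℝ →L[ℝ] ℂ, HasFDerivAt (fun p => ∫ z in e.target, F.ext (p, z)) L q ∧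
      ∀ v, L v = ∫ z in e.target, (Sm.dp v F).ext (q, z) := by
  have hinl : ∀ p z, p ∈ Q → HasFDerivAt (fun p => F.ext (p, z))
      ((fderiv ℝ F.ext (p, z)).comp (ContinuousLinearMap.inl ℝ (ℝ × ℝ) (Cn n))) p := fun p z hp => by
    have h1 : HasFDerivAt F.ext (fderiv ℝ F.ext (p, z)) (p, z) :=
      (((hF.contDiffOn hK hKe).contDiffAt ((Q.isOpen.prod isOpen_univ).mem_nhds
        ⟨hp, trivial⟩)).differentiableAt (by simp)).hasFDerivAt
    exact HasFDerivAt.comp (g := F.ext) p h1 (hasFDerivAt_prodMk_left p z)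
  have hcont : ContinuousOn (fderiv ℝ F.ext) ((Q : Set (ℝ × ℝ)) ×ˢ Set.univ) :=
    (hF.contDiffOn hK hKe).continuousOn_fderiv_of_isOpen (Q.isOpen.prod isOpen_univ) (by simp)
  obtain ⟨ε, hε, hB⟩ := Metric.nhds_basis_closedBall.mem_iff.1 (Q.isOpen.mem_nhds hq)
  -- The parameter derivative is bounded on the compact set (closed ball) × `K`. A constant is
  -- integrable on `K`, and this dominates the difference quotients.
  obtain ⟨C, hC⟩ := ((isCompact_closedBall q ε).prod hK).exists_bound_of_continuousOn
    (hcont.mono (Set.prod_mono hB (Set.subset_univ K)))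
  have : IsFiniteMeasure (volume.restrict K) := ⟨by
    rw [Measure.restrict_apply_univ]; exact hK.measure_lt_top⟩
  have hslice : ∀ p ∈ Q, Continuous fun z => fderiv ℝ F.ext (p, z) := fun p hp =>
    hcont.comp_continuous (Continuous.prodMk_right p) fun z => ⟨hp, trivial⟩
  have hsc : Continuous fun z => (fderiv ℝ F.ext (q, z)).comp
      (ContinuousLinearMap.inl ℝ (ℝ × ℝ) (Cn n)) := (hslice q hq).clm_comp continuous_const
  have key := hasFDerivAt_integral_of_dominated_of_fderiv_le (μ := volume.restrict K)
    (F := fun p z => F.ext (p, z)) (x₀ := q) (bound := fun _ => C *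
      ‖ContinuousLinearMap.inl ℝ (ℝ × ℝ) (Cn n)‖)
    (F' := fun p z => (fderiv ℝ F.ext (p, z)).comp (ContinuousLinearMap.inl ℝ (ℝ × ℝ) (Cn n)))
    (Metric.closedBall_mem_nhds q hε)
    (by
      filter_upwards [Q.isOpen.mem_nhds hq] with p hp
      exact (hF.contDiff_slice hK hKe hp).continuous.aestronglyMeasurable)
    (hF.integrable hK hKe hq).integrableOn hsc.aestronglyMeasurable
    (by
      filter_upwards [ae_restrict_mem hK.measurableSet] with z hz p hp
      exact (ContinuousLinearMap.opNorm_comp_le _ _).trans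
        (mul_le_mul_of_nonneg_right (hC (p, z) ⟨hp, hz⟩) (norm_nonneg _)))
    (integrable_const _)
    (Filter.Eventually.of_forall fun z p hp => hinl p z (hB hp))
  have heq : (fun p => ∫ z in e.target, F.ext (p, z)) = fun p => ∫ z in K, F.ext (p, z) :=
    funext fun p => hF.integral_target hKe p
  rw [heq]
  refine ⟨∫ z in K, (fderiv ℝ F.ext (q, z)).comp (ContinuousLinearMap.inl ℝ (ℝ × ℝ) (Cn n)), key,
    fun v => ?_⟩
  rw [ContinuousLinearMap.integral_apply (hsc.continuousOn.integrableOn_compact hK), Sm.dp,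
    (hF.der hK _).integral_target hKe]
  refine setIntegral_congr_fun hK.measurableSet fun z hz => ?_
  rw [Sm.ext_der (v, 0) F (x := (q, z)) ⟨hq, hKe hz⟩]
  rfl

end SuppIn

end ChartIntegral

/-! ### Integration over the manifold -/

section Integral

open TopologicalSpace MeasureTheory

variable {n : ℕ} {M : Type*} [TopologicalSpace M] [ChartedSpace (Cn n) M]

variable (n M) in
/-- Families of smooth functions on the coordinate domains, depending on parameters. -/
abbrev SmField (Q : Opens (ℝ × ℝ)) : Type _ := ∀ e : atlas (Cn n) M, Sm (dom Q e.1)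

variable (n) in
/-- The preferred coordinate system at a point. -/
def atChart (x : M) : atlas (Cn n) M := ⟨chartAt (Cn n) x, chart_mem_atlas (Cn n) x⟩

variable {Q : Opens (ℝ × ℝ)}

variable [IsManifold 𝓘(ℂ, Cn n) ω M]

theorem contDiffOn_locFun (φ : C^∞⟮𝓘(ℝ, Cn n), M; ℝ⟯) {e : OpenPartialHomeomorph M (Cn n)}
    (he : e ∈ atlas (Cn n) M) : ContDiffOn ℝ ∞ (locFun φ e) e.target := by
  have := isManifold_real n M
  have h1 : ContMDiffOn 𝓘(ℝ, Cn n) 𝓘(ℝ, Cn n) ∞ e.symm e.target :=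
    contMDiffOn_symm_of_mem_maximalAtlas (IsManifold.subset_maximalAtlas he)
  have h2 : ContMDiffOn 𝓘(ℝ, Cn n) 𝓘(ℝ, ℝ) ∞ (fun z => φ (e.symm z)) e.target :=
    φ.contMDiff.comp_contMDiffOn h1
  exact Complex.ofRealCLM.contDiff.comp_contDiffOn (contMDiffOn_iff_contDiffOn.1 h2)

/-- A smooth real function as a family of functions on the coordinate domains. -/
def fnField (Q : Opens (ℝ × ℝ)) (φ : C^∞⟮𝓘(ℝ, Cn n), M; ℝ⟯) : SmField n M Q := fun e =>
  Sm.of (fun x => locFun φ e.1 x.2) ((contDiffOn_locFun φ e.2).comp contDiffOn_snd fun _ hx => hx.2)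

theorem ext_fnField (φ : C^∞⟮𝓘(ℝ, Cn n), M; ℝ⟯) (e : atlas (Cn n) M) {x : PCn n}
    (hx : x ∈ dom Q e.1) : (fnField Q φ e).ext x = φ (e.1.symm x.2) := Sm.ext_of _ hx

/-- Families of functions that are densities. -/
def IsDensity (F : SmField n M Q) : Prop := ∀ (e e' : atlas (Cn n) M) (x : PCn n),
  x ∈ ovl Q e.1 e'.1 → (F e).ext x
    = ((‖(jac e.1 e'.1 x.2).det‖ ^ 2 : ℝ) : ℂ) * (F e').ext (pCoordChange e.1 e'.1 x)

/-- The real determinant of a complex-linear map is the squared modulus of its complex determinant.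
-/
theorem abs_det_fderiv_coordChange (e e' : OpenPartialHomeomorph M (Cn n)) (z : Cn n) :
    |((fderiv ℂ (coordChange e e') z).restrictScalars ℝ).det| = ‖(jac e e' z).det‖ ^ 2 := by
  have h : LinearMap.toMatrix' (fderiv ℂ (coordChange e e') z : Cn n →ₗ[ℂ] Cn n) = jac e e' z := by
    ext a j
    rw [LinearMap.toMatrix'_apply, jac, Matrix.of_apply]
    congr 2
  rw [ContinuousLinearMap.det, ContinuousLinearMap.coe_restrictScalars,
    LinearMap.det_restrictScalars, Algebra.norm_complex_apply, ← LinearMap.det_toMatrix', h,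
    Complex.normSq_eq_norm_sq, abs_of_nonneg (sq_nonneg _)]

theorem integral_overlap (e e' : atlas (Cn n) M) (g : Cn n → ℂ) :
    ∫ z in overlap e'.1 e.1, g z = ∫ z in overlap e.1 e'.1,
      ((‖(jac e.1 e'.1 z).det‖ ^ 2 : ℝ) : ℂ) * g (coordChange e.1 e'.1 z) := by
  have h1 : coordChange e.1 e'.1 '' overlap e.1 e'.1 = overlap e'.1 e.1 := by
    refine Set.Subset.antisymm ?_ fun w hw => ?_
    · rintro _ ⟨z, hz, rfl⟩
      exact coordChange_mem hz
    · exact ⟨coordChange e'.1 e.1 w, coordChange_mem hw, by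
        rw [coordChange_coordChange hw, coordChange_self hw.1]⟩
  have h2 : Set.InjOn (coordChange e.1 e'.1) (overlap e.1 e'.1) := fun z hz w hw h => by
    rw [← coordChange_self hz.1, ← coordChange_coordChange hz, h, coordChange_coordChange hw,
      coordChange_self hw.1]
  rw [← h1, integral_image_eq_integral_abs_det_fderiv_smul volume
    (isOpen_overlap e.1 e'.1).measurableSet (fun z hz =>
      ((hasFDerivAt_coordChange e.2 e'.2 hz).restrictScalars ℝ).hasFDerivWithinAt) h2]
  refine setIntegral_congr_fun (isOpen_overlap e.1 e'.1).measurableSet fun z _ => ?_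
  simp only [abs_det_fderiv_coordChange, Complex.real_smul]

variable [T2Space M] [CompactSpace M]

variable (n M) in
/-- The functions of the partition of unity that do not vanish. -/
theorem finite_partition : {x : M | (Function.support (partition n M x)).Nonempty}.Finite :=
  (partition n M).locallyFinite.finite_nonempty_of_compact

variable (n M) in
/-- The indices of the functions of the partition of unity that do not vanish. -/
def partIndex : Finset M := (finite_partition n M).toFinset

theorem partition_eq_zero {x : M} (hx : x ∉ partIndex n M) (y : M) : partition n M x y = 0 := by
  by_contra h
  exact hx ((finite_partition n M).mem_toFinset.2 ⟨y, h⟩)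

theorem sum_partition (y : M) : ∑ x ∈ partIndex n M, partition n M x y = 1 := by
  rw [← (partition n M).sum_eq_one (Set.mem_univ y)]
  refine (finsum_eq_sum_of_support_subset _ fun x hx => ?_).symm
  by_contra h
  exact hx (partition_eq_zero h y)

/-- The integral of a family of functions. -/
def mint (F : SmField n M Q) (q : ℝ × ℝ) : ℂ := ∑ x ∈ partIndex n M,
  ∫ z in (chartAt (Cn n) x).target,
    (fnField Q (partition n M x) (atChart n x) * F (atChart n x)).ext (q, z)

/-- On compact `M` only finitely many functions of the partition are nonzero, so the `finsum` is a
finite sum over `partIndex`. -/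
theorem integralForm_eq_mint (η : OpenPartialHomeomorph M (Cn n) → Cn n → Forms n)
    (F : SmField n M Q) {q : ℝ × ℝ} (hq : q ∈ Q) (h : ∀ (e : atlas (Cn n) M), ∀ z ∈ e.1.target,
      (-2 * Complex.I) ^ n * topCoeff (η e.1 z) = (F e).ext (q, z)) :
    integralForm η = mint F q := by
  rw [integralForm, mint, finsum_eq_sum_of_support_subset (s := partIndex n M)]
  · refine Finset.sum_congr rfl fun x _ => ?_
    refine setIntegral_congr_fun (chartAt (Cn n) x).open_target.measurableSet fun z hz => ?_
    rw [Sm.ext_mul, ext_fnField _ _ (x := (q, z)) ⟨hq, hz⟩, ← h _ _ hz]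
    rfl
  · intro x hx
    by_contra h
    refine hx ?_
    simp [partition_eq_zero h]

/-- The part of the coordinate domain where a function of the partition is supported. -/
def partSupport (x : M) : Set (Cn n) := chartAt (Cn n) x '' tsupport (partition n M x)

theorem tsupport_partition (x : M) : tsupport (partition n M x) ⊆ (chartAt (Cn n) x).source :=
  (exists_partition n M).choose_spec x

theorem isCompact_image {e : OpenPartialHomeomorph M (Cn n)} {S : Set M} (hS : IsClosed S)
    (hSe : S ⊆ e.source) : IsCompact (e '' S) :=
  hS.isCompact.image_of_continuousOn (e.continuousOn.mono hSe)

theorem image_subset_target {e : OpenPartialHomeomorph M (Cn n)} {S : Set M}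
    (hSe : S ⊆ e.source) : e '' S ⊆ e.target := by
  rintro _ ⟨y, hy, rfl⟩
  exact e.map_source (hSe hy)

theorem suppIn_image {e : OpenPartialHomeomorph M (Cn n)} {S : Set M} {F : Sm (dom Q e)}
    (h : ∀ x ∈ dom Q e, e.symm x.2 ∉ S → F.ext x = 0) : SuppIn F (e '' S) := fun x hx => by
  by_cases hxd : x ∈ dom Q e
  · exact h x hxd fun hS => hx ⟨_, hS, e.right_inv hxd.2⟩
  · exact ext_not_mem _ hxd

theorem suppIn_partition (x : M) (G : Sm (dom Q (atChart n x).1)) :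
    SuppIn (fnField Q (partition n M x) (atChart n x) * G) (partSupport (n := n) x) := by
  rw [mul_comm]
  refine SuppIn.mul_left (suppIn_image fun y hy hyS => ?_) G
  rw [ext_fnField _ _ hy]
  rw [image_eq_zero_of_notMem_tsupport hyS, Complex.ofReal_zero]

theorem isCompact_partSupport (x : M) : IsCompact (partSupport (n := n) x) :=
  isCompact_image (isClosed_tsupport _) (tsupport_partition x)

theorem partSupport_subset (x : M) : partSupport (n := n) x ⊆ (chartAt (Cn n) x).target :=
  image_subset_target (tsupport_partition x)

/-- The integral of a density supported in a coordinate domain. -/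
theorem mint_eq_integral {F : SmField n M Q} (hF : IsDensity F) (e : atlas (Cn n) M) {S : Set M}
    (hS : IsClosed S) (hSe : S ⊆ e.1.source)
    (hFS : ∀ (e' : atlas (Cn n) M), ∀ x ∈ dom Q e'.1, e'.1.symm x.2 ∉ S → (F e').ext x = 0)
    {q : ℝ × ℝ} (hq : q ∈ Q) : mint F q = ∫ z in e.1.target, (F e).ext (q, z) := by
  -- Each piece of the partition is cut down to the overlap, where density and partition function
  -- are both visible, and moved to the chart `e` by the change of variables. There the partition
  -- functions sum to `1`.
  have key : ∀ x : M, ∫ z in (chartAt (Cn n) x).target,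
      (fnField Q (partition n M x) (atChart n x) * F (atChart n x)).ext (q, z)
      = ∫ z in e.1.target, (fnField Q (partition n M x) e * F e).ext (q, z) := fun x => by
    have h1 : ∫ z in (chartAt (Cn n) x).target,
        (fnField Q (partition n M x) (atChart n x) * F (atChart n x)).ext (q, z)
        = ∫ z in overlap (atChart n x).1 e.1,
        (fnField Q (partition n M x) (atChart n x) * F (atChart n x)).ext (q, z) := by
      refine setIntegral_eq_of_subset_of_forall_sdiff_eq_zero
        (chartAt (Cn n) x).open_target.measurableSet Set.inter_subset_left fun z hz => ?_
      rw [Sm.ext_mul, hFS (atChart n x) (q, z) ⟨hq, hz.1⟩ fun h => hz.2 ⟨hz.1, hSe h⟩, mul_zero]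
    have h2 : ∫ z in e.1.target, (fnField Q (partition n M x) e * F e).ext (q, z)
        = ∫ z in overlap e.1 (atChart n x).1, (fnField Q (partition n M x) e * F e).ext (q, z) := by
      refine setIntegral_eq_of_subset_of_forall_sdiff_eq_zero
        e.1.open_target.measurableSet Set.inter_subset_left fun z hz => ?_
      have hz' : e.1.symm z ∉ tsupport (partition n M x) :=
        fun h => hz.2 ⟨hz.1, tsupport_partition x h⟩
      rw [Sm.ext_mul, ext_fnField _ _ (x := (q, z)) ⟨hq, hz.1⟩,
        image_eq_zero_of_notMem_tsupport hz', Complex.ofReal_zero, zero_mul]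
    rw [h1, h2, integral_overlap e (atChart n x)]
    refine setIntegral_congr_fun (isOpen_overlap _ _).measurableSet fun z hz => ?_
    have hz' := coordChange_mem hz
    rw [Sm.ext_mul, Sm.ext_mul, ext_fnField _ _ (x := (q, z)) ⟨hq, hz.1⟩,
      ext_fnField _ _ (x := (q, coordChange e.1 (atChart n x).1 z)) ⟨hq, hz'.1⟩,
      hF e (atChart n x) (q, z) ⟨hq, hz⟩, coordChange_symm hz]
    simp only [pCoordChange]
    ring
  have hsupp : SuppIn (F e) (e.1 '' S) := suppIn_image (hFS e)
  have hK := isCompact_image hS hSe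
  have hKe := image_subset_target hSe
  rw [mint, Finset.sum_congr rfl fun x _ => key x, ← integral_finsetSum _ fun x _ =>
    ((hsupp.mul_left _).integrable hK hKe hq).integrableOn]
  refine setIntegral_congr_fun e.1.open_target.measurableSet fun z hz => ?_
  simp only [Sm.ext_mul, ← Finset.sum_mul]
  rw [Finset.sum_congr rfl fun x _ => ext_fnField (partition n M x) e (x := (q, z)) ⟨hq, hz⟩,
    ← Complex.ofReal_sum, sum_partition, Complex.ofReal_one, one_mul]

theorem mint_add (F G : SmField n M Q) {q : ℝ × ℝ} (hq : q ∈ Q) :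
    mint (F + G) q = mint F q + mint G q := by
  rw [mint, mint, mint, ← Finset.sum_add_distrib]
  refine Finset.sum_congr rfl fun x _ => ?_
  have h := fun G : SmField n M Q => ((suppIn_partition x (G (atChart n x))).integrable
    (isCompact_partSupport x) (partSupport_subset x) hq).integrableOn
      (s := (chartAt (Cn n) x).target)
  rw [← integral_add (h F) (h G)]
  simp only [Pi.add_apply, mul_add, Sm.ext_add]

theorem mint_smul (c : ℂ) (F : SmField n M Q) (q : ℝ × ℝ) :
    mint (c • F) q = c * mint F q := by
  rw [mint, mint, Finset.mul_sum]
  refine Finset.sum_congr rfl fun x _ => ?_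
  rw [← integral_const_mul]
  simp only [Pi.smul_apply, mul_smul_comm, Sm.ext_smul]

theorem mint_zero (q : ℝ × ℝ) : mint (0 : SmField n M Q) q = 0 := by
  have := mint_smul (0 : ℂ) (0 : SmField n M Q) q
  rwa [smul_zero, zero_mul] at this

theorem mint_neg (F : SmField n M Q) (q : ℝ × ℝ) : mint (-F) q = -mint F q := by
  rw [show -F = (-1 : ℂ) • F by ext1 e; simp, mint_smul, neg_one_mul]

theorem mint_sub (F G : SmField n M Q) {q : ℝ × ℝ} (hq : q ∈ Q) :
    mint (F - G) q = mint F q - mint G q := by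
  rw [sub_eq_add_neg, mint_add _ _ hq, mint_neg, sub_eq_add_neg]

theorem mint_sum {α : Type*} (s : Finset α) (F : α → SmField n M Q) {q : ℝ × ℝ} (hq : q ∈ Q) :
    mint (∑ a ∈ s, F a) q = ∑ a ∈ s, mint (F a) q := by
  classical
  induction s using Finset.induction_on with
  | empty => simp [mint_zero]
  | insert a s ha ih => rw [Finset.sum_insert ha, Finset.sum_insert ha, mint_add _ _ hq, ih]

theorem mint_congr {F G : SmField n M Q} {q : ℝ × ℝ} (h : ∀ (e : atlas (Cn n) M), ∀ z ∈ e.1.target,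
    (F e).ext (q, z) = (G e).ext (q, z)) : mint F q = mint G q := by
  refine Finset.sum_congr rfl fun x _ => ?_
  refine setIntegral_congr_fun (chartAt (Cn n) x).open_target.measurableSet fun z hz => ?_
  rw [Sm.ext_mul, Sm.ext_mul, h (atChart n x) z hz]

theorem fnField_dp (φ : C^∞⟮𝓘(ℝ, Cn n), M; ℝ⟯) (v : ℝ × ℝ) (e : atlas (Cn n) M) :
    Sm.dp v (fnField Q φ e) = 0 := by
  refine Sm.ext_eq fun x hx => ?_
  have h : (fnField Q φ e).ext =ᶠ[nhds x] (locFun φ e.1 ∘ Prod.snd) := by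
    filter_upwards [(dom Q e.1).isOpen.mem_nhds hx] with y hy
    rw [ext_fnField _ _ hy]; rfl
  have h2 := ((((contDiffOn_locFun φ e.2).contDiffAt (e.1.open_target.mem_nhds
    hx.2)).differentiableAt (by simp)).hasFDerivAt.comp x (hasFDerivAt_snd (𝕜 := ℝ) (p := x))).fderiv
  rw [Sm.dp, Sm.ext_der _ _ hx, h.fderiv_eq, h2]
  simp [Sm.ext_zero]

/-- Differentiation of integrals with respect to parameters. -/
theorem hasFDerivAt_mint (F : SmField n M Q) {q : ℝ × ℝ} (hq : q ∈ Q) :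
    ∃ L : ℝ × ℝ →L[ℝ] ℂ, HasFDerivAt (mint F) L q ∧
      ∀ v, L v = mint (fun e => Sm.dp v (F e)) q := by
  choose L hL hLv using fun x : M => (suppIn_partition x (F (atChart n x))).hasFDerivAt_integral
    (isCompact_partSupport x) (partSupport_subset x) hq
  refine ⟨∑ x ∈ partIndex n M, L x, HasFDerivAt.fun_sum fun x _ => hL x, fun v => ?_⟩
  rw [sum_apply, mint]
  refine Finset.sum_congr rfl fun x _ => ?_
  rw [hLv]
  have h := fnField_dp (Q := Q) (partition n M x) v (atChart n x)
  simp only [Derivation.leibniz, h, mul_zero, add_zero, smul_eq_mul]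
  rfl

end Integral

end KahlerGeom
end

noncomputable section

set_option linter.unusedSectionVars false

namespace KahlerGeom

/-! ### Differential forms on the manifold, with parameters -/

section FormField

open TopologicalSpace MeasureTheory TensorProduct

variable {n : ℕ} {M : Type*} [TopologicalSpace M] [ChartedSpace (Cn n) M]

variable (n M) in
/-- Families of forms on the coordinate domains, depending on parameters. -/
abbrev FormField (Q : Opens (ℝ × ℝ)) : Type _ := ∀ e : atlas (Cn n) M, FA n (Sm (dom Q e.1))

variable (n M) in
/-- Families of matrices of functions on the coordinate domains, depending on parameters. -/
abbrev MatField (Q : Opens (ℝ × ℝ)) : Type _ :=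
  ∀ e : atlas (Cn n) M, Matrix (Fin n) (Fin n) (Sm (dom Q e.1))

variable {Q : Opens (ℝ × ℝ)}

/-- The families of local expressions of a form. -/
def IsForm (ζ : FormField n M Q) : Prop := ∀ (e e' : atlas (Cn n) M) (x : PCn n)
  (hx : x ∈ ovl Q e.1 e'.1), FA.ev (Sm.ev ⟨x, ovl_le hx⟩) (ζ e)
    = subst (jac e.1 e'.1 x.2) ((jac e.1 e'.1 x.2).map star)
      (FA.ev (Sm.ev ⟨pCoordChange e.1 e'.1 x, ovl_mapsTo hx⟩) (ζ e'))

theorem IsForm.mul {ζ η : FormField n M Q} (hζ : IsForm ζ) (hη : IsForm η) : IsForm (ζ * η) :=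
  fun e e' x hx => by
    simp only [Pi.mul_apply]
    rw [map_mul (FA.ev _), map_mul (FA.ev _), map_mul (subst _ _), hζ e e' x hx, hη e e' x hx]

theorem IsForm.add {ζ η : FormField n M Q} (hζ : IsForm ζ) (hη : IsForm η) : IsForm (ζ + η) :=
  fun e e' x hx => by simp only [Pi.add_apply, map_add, hζ e e' x hx, hη e e' x hx]

theorem isForm_one : IsForm (1 : FormField n M Q) := fun e e' x hx => by
  simp only [Pi.one_apply, map_one]

theorem isForm_zero : IsForm (0 : FormField n M Q) := fun e e' x hx => by
  simp only [Pi.zero_apply, map_zero]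

theorem IsForm.smul {ζ : FormField n M Q} (hζ : IsForm ζ) (c : ℂ) : IsForm (c • ζ) :=
  fun e e' x hx => by simp only [Pi.smul_apply, map_smul, hζ e e' x hx]

theorem IsForm.pow {ζ : FormField n M Q} (hζ : IsForm ζ) (k : ℕ) : IsForm (ζ ^ k) := by
  induction k with
  | zero => simpa using isForm_one
  | succ k ih => rw [pow_succ]; exact ih.mul hζ

theorem isForm_sum {α : Type*} (s : Finset α) {ζ : α → FormField n M Q}
    (hζ : ∀ a ∈ s, IsForm (ζ a)) : IsForm (∑ a ∈ s, ζ a) := by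
  classical
  induction s using Finset.induction_on with
  | empty => simpa using isForm_zero
  | insert a s ha ih =>
    rw [Finset.sum_insert ha]
    exact (hζ a (by simp)).add (ih fun b hb => hζ b (by simp [hb]))

variable [IsManifold 𝓘(ℂ, Cn n) ω M]

/-- The families of local expressions of a function. -/
def IsFn (f : SmField n M Q) : Prop :=
  ∀ e e' : atlas (Cn n) M, res e.1 e'.1 (f e) = trans e.2 e'.2 (f e')

theorem isFn_iff {f : SmField n M Q} : IsFn f ↔ ∀ (e e' : atlas (Cn n) M) (x : PCn n),
    x ∈ ovl Q e.1 e'.1 → (f e).ext x = (f e').ext (pCoordChange e.1 e'.1 x) := by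
  refine forall₂_congr fun e e' => ⟨fun h x hx => ?_, fun h => Sm.ext_eq fun x hx => ?_⟩
  · rw [← ext_res _ _ _ hx, h, ext_trans _ _ _ hx]
  · rw [ext_res _ _ _ hx, h x hx, ext_trans _ _ _ hx]

theorem isFn_fnField (φ : C^∞⟮𝓘(ℝ, Cn n), M; ℝ⟯) : IsFn (fnField Q φ) :=
  isFn_iff.2 fun e e' x hx => by
    rw [ext_fnField _ _ (x := x) (ovl_le hx), ext_fnField _ _ (ovl_mapsTo hx)]
    simp only [pCoordChange]
    rw [coordChange_symm hx.2]

theorem IsForm.fn_smul {f : SmField n M Q} {ζ : FormField n M Q} (hf : IsFn f) (hζ : IsForm ζ) :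
    IsForm (fun e => f e • ζ e) := fun e e' x hx => by
  have h := isFn_iff.1 hf e e' x hx
  rw [FA.ev_smul, FA.ev_smul, map_smul, hζ e e' x hx, Sm.ev_eq_ext, Sm.ev_eq_ext, h]

theorem ev_res {e e' : OpenPartialHomeomorph M (Cn n)} (f : Sm (dom Q e)) {x : PCn n}
    (hx : x ∈ ovl Q e e') : Sm.ev ⟨x, hx⟩ (res e e' f) = Sm.ev ⟨x, ovl_le hx⟩ f := by
  rw [Sm.ev_eq_ext, Sm.ev_eq_ext, ext_res _ _ _ hx]

theorem ev_trans {e e' : atlas (Cn n) M} (f : Sm (dom Q e'.1)) {x : PCn n}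
    (hx : x ∈ ovl Q e.1 e'.1) : Sm.ev ⟨x, hx⟩ (trans e.2 e'.2 f)
      = Sm.ev ⟨pCoordChange e.1 e'.1 x, ovl_mapsTo hx⟩ f := by
  rw [Sm.ev_eq_ext, Sm.ev_eq_ext, ext_trans _ _ _ hx]

/-- The Jacobian matrix of a change of coordinates in the atlas. -/
abbrev jacF (Q : Opens (ℝ × ℝ)) (e e' : atlas (Cn n) M) :
    Matrix (Fin n) (Fin n) (Sm (ovl Q e.1 e'.1)) := smJac e.2 e'.2

theorem ev_jacF (e e' : atlas (Cn n) M) (a j : Fin n) {x : PCn n} (hx : x ∈ ovl Q e.1 e'.1) :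
    Sm.ev ⟨x, hx⟩ (jacF Q e e' a j) = jac e.1 e'.1 x.2 a j := by
  rw [Sm.ev_eq_ext, ext_smJac e.2 e'.2 a j hx]

theorem ev_conj_jacF (e e' : atlas (Cn n) M) (a j : Fin n) {x : PCn n} (hx : x ∈ ovl Q e.1 e'.1) :
    Sm.ev ⟨x, hx⟩ (Sm.conj (jacF Q e e' a j)) = star (jac e.1 e'.1 x.2 a j) := by
  rw [Sm.ev_eq_ext, Sm.ext_conj _ hx, ext_smJac e.2 e'.2 a j hx]

/-- Forms from the transformation behaviour of their components. -/
theorem isForm_of {I : Type*} [Fintype I] (w : I → Forms n)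
    (c : ∀ e : atlas (Cn n) M, I → Sm (dom Q e.1))
    (m : ∀ e e' : atlas (Cn n) M, I → I → Sm (ovl Q e.1 e'.1))
    (hm : ∀ (e e' : atlas (Cn n) M) (x : PCn n) (hx : x ∈ ovl Q e.1 e'.1) (a : I),
      subst (jac e.1 e'.1 x.2) ((jac e.1 e'.1 x.2).map star) (w a)
        = ∑ i, Sm.ev ⟨x, hx⟩ (m e e' a i) • w i)
    (hc : ∀ (e e' : atlas (Cn n) M) (i : I), res e.1 e'.1 (c e i)
        = ∑ a, m e e' a i * trans e.2 e'.2 (c e' a)) :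
    IsForm (fun e => ∑ i, c e i ⊗ₜ[ℂ] w i) := fun e e' x hx => by
  have h : ∀ i, Sm.ev ⟨x, ovl_le hx⟩ (c e i) = ∑ a, Sm.ev ⟨x, hx⟩ (m e e' a i)
      * Sm.ev ⟨pCoordChange e.1 e'.1 x, ovl_mapsTo hx⟩ (c e' a) := fun i => by
    rw [← ev_res _ hx, hc, map_sum]
    simp only [map_mul, ev_trans _ hx]
  simp only [map_sum, FA.ev_tmul, map_smul, hm e e' x hx, h, Finset.sum_smul, Finset.smul_sum,
    smul_smul]
  rw [Finset.sum_comm]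
  simp only [mul_comm]

/-- The components of a `(1,0)`-form. -/
def IsCov10 (a : ∀ e : atlas (Cn n) M, Fin n → Sm (dom Q e.1)) : Prop :=
  ∀ (e e' : atlas (Cn n) M) (j : Fin n), res e.1 e'.1 (a e j)
    = ∑ b, jacF Q e e' b j * trans e.2 e'.2 (a e' b)

/-- The components of a `(0,1)`-form. -/
def IsCov01 (a : ∀ e : atlas (Cn n) M, Fin n → Sm (dom Q e.1)) : Prop :=
  ∀ (e e' : atlas (Cn n) M) (j : Fin n), res e.1 e'.1 (a e j)
    = ∑ b, Sm.conj (jacF Q e e' b j) * trans e.2 e'.2 (a e' b)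

/-- The components of a `(1,1)`-form. -/
def IsTens (A : MatField n M Q) : Prop :=
  ∀ (e e' : atlas (Cn n) M) (j k : Fin n), res e.1 e'.1 (A e j k)
    = ∑ a, ∑ b, jacF Q e e' a j * Sm.conj (jacF Q e e' b k) * trans e.2 e'.2 (A e' a b)

theorem isForm_form10 {a : ∀ e : atlas (Cn n) M, Fin n → Sm (dom Q e.1)} (ha : IsCov10 a) :
    IsForm (fun e => FA.form10 (a e)) := by
  refine isForm_of dz a (fun e e' b j => jacF Q e e' b j) (fun e e' x hx a => ?_) ha
  rw [subst_dz]
  simp only [ev_jacF _ _ _ _ hx]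

theorem isForm_form01 {a : ∀ e : atlas (Cn n) M, Fin n → Sm (dom Q e.1)} (ha : IsCov01 a) :
    IsForm (fun e => FA.form01 (a e)) := by
  refine isForm_of dzbar a (fun e e' b j => Sm.conj (jacF Q e e' b j)) (fun e e' x hx a => ?_) ha
  rw [subst_dzbar]
  simp only [ev_conj_jacF _ _ _ _ hx, Matrix.map_apply]

theorem isForm_form11 {A : MatField n M Q} (hA : IsTens A) :
    IsForm (fun e => FA.form11 (A e)) := by
  have h := isForm_of (fun i : Fin n × Fin n => dz i.1 * dzbar i.2) (fun e i => A e i.1 i.2)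
    (fun e e' a i => jacF Q e e' a.1 i.1 * Sm.conj (jacF Q e e' a.2 i.2))
    (fun e e' x hx a => by
      rw [map_mul (subst _ _), subst_dz, subst_dzbar, Finset.sum_mul_sum, Fintype.sum_prod_type]
      simp only [map_mul, ev_jacF _ _ _ _ hx, ev_conj_jacF _ _ _ _ hx, Matrix.map_apply,
        smul_mul_smul_comm])
    (fun e e' i => by rw [Fintype.sum_prod_type]; exact hA e e' i.1 i.2)
  simp only [Fintype.sum_prod_type] at h
  exact h

theorem isForm_form21 {c : ∀ e : atlas (Cn n) M, Fin n → Fin n → Fin n → Sm (dom Q e.1)}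
    (hc : ∀ (e e' : atlas (Cn n) M) (j l m : Fin n), res e.1 e'.1 (c e j l m)
      = ∑ a, ∑ b, ∑ d, jacF Q e e' a j * (jacF Q e e' b l * Sm.conj (jacF Q e e' d m))
        * trans e.2 e'.2 (c e' a b d)) :
    IsForm (fun e => FA.form21 (c e)) := by
  have h := isForm_of (fun i : Fin n × Fin n × Fin n => dz i.1 * (dz i.2.1 * dzbar i.2.2))
    (fun e i => c e i.1 i.2.1 i.2.2)
    (fun e e' a i => jacF Q e e' a.1 i.1 *
      (jacF Q e e' a.2.1 i.2.1 * Sm.conj (jacF Q e e' a.2.2 i.2.2)))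
    (fun e e' x hx a => by
      simp only [map_mul (subst _ _), subst_dz, subst_dzbar, Finset.sum_mul_sum,
        Fintype.sum_prod_type, map_mul, ev_jacF _ _ _ _ hx, ev_conj_jacF _ _ _ _ hx,
        Matrix.map_apply, ← smul_mul_smul_comm]
      simp only [Finset.mul_sum])
    (fun e e' i => by simp only [Fintype.sum_prod_type]; exact hc e e' i.1 i.2.1 i.2.2)
  simp only [Fintype.sum_prod_type] at h
  exact h

theorem isForm_form22 {c : ∀ e : atlas (Cn n) M, Fin n → Fin n → Fin n → Fin n → Sm (dom Q e.1)}
    (hc : ∀ (e e' : atlas (Cn n) M) (j k l m : Fin n), res e.1 e'.1 (c e j k l m)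
      = ∑ a, ∑ f, ∑ b, ∑ d, jacF Q e e' a j * Sm.conj (jacF Q e e' f k)
        * (jacF Q e e' b l * Sm.conj (jacF Q e e' d m)) * trans e.2 e'.2 (c e' a f b d)) :
    IsForm (fun e => FA.form22 (c e)) := by
  have h := isForm_of (fun i : Fin n × Fin n × Fin n × Fin n =>
      dz i.1 * dzbar i.2.1 * (dz i.2.2.1 * dzbar i.2.2.2))
    (fun e i => c e i.1 i.2.1 i.2.2.1 i.2.2.2)
    (fun e e' a i => jacF Q e e' a.1 i.1 * Sm.conj (jacF Q e e' a.2.1 i.2.1) *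
      (jacF Q e e' a.2.2.1 i.2.2.1 * Sm.conj (jacF Q e e' a.2.2.2 i.2.2.2)))
    (fun e e' x hx a => by
      simp only [map_mul (subst _ _), subst_dz, subst_dzbar, Finset.sum_mul_sum,
        Fintype.sum_prod_type, map_mul, ev_jacF _ _ _ _ hx, ev_conj_jacF _ _ _ _ hx,
        Matrix.map_apply, ← smul_mul_smul_comm]
      exact Finset.sum_congr rfl fun _ _ => Finset.sum_comm)
    (fun e e' i => by simp only [Fintype.sum_prod_type]; exact hc e e' i.1 i.2.1 i.2.2.1 i.2.2.2)
  simp only [Fintype.sum_prod_type] at h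
  exact h

/-- The density of the top degree part of a form. -/
def topF (ζ : FormField n M Q) : SmField n M Q := fun e => (-2 * Complex.I) ^ n • FA.top (ζ e)

/-- The substitutions in `dz` and `dz̄` contribute `det J` and its conjugate, whose product is the
real Jacobian `|det J|²`. -/
theorem isDensity_topF {ζ : FormField n M Q} (hζ : IsForm ζ) : IsDensity (topF ζ) :=
  fun e e' x hx => by
    have h1 : ∀ (e : atlas (Cn n) M) (y : dom Q e.1), (FA.top (ζ e)).ext y
        = topCoeff (FA.ev (Sm.ev y) (ζ e)) := fun e y => by rw [← FA.map_top, Sm.ev_eq_ext]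
    rw [topF, topF, Sm.ext_smul, Sm.ext_smul, h1 e ⟨x, ovl_le hx⟩,
      h1 e' ⟨pCoordChange e.1 e'.1 x, ovl_mapsTo hx⟩, hζ e e' x hx, topCoeff_subst]
    have h2 : ((jac e.1 e'.1 x.2).map star).det = star (jac e.1 e'.1 x.2).det :=
      ((starRingEnd ℂ).map_det _).symm
    have h3 := Complex.mul_conj' (jac e.1 e'.1 x.2).det
    rw [h2]
    push_cast
    rw [← h3]
    change _ = _ * (starRingEnd ℂ _) * _
    rw [show (starRingEnd ℂ) (jac e.1 e'.1 x.2).det = star (jac e.1 e'.1 x.2).det from rfl]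
    ring

theorem topF_add (ζ η : FormField n M Q) : topF (ζ + η) = topF ζ + topF η := by
  ext1 e; simp [topF]

theorem topF_sub (ζ η : FormField n M Q) : topF (ζ - η) = topF ζ - topF η := by
  ext1 e; simp [topF, smul_sub]

theorem topF_smul (c : ℂ) (ζ : FormField n M Q) : topF (c • ζ) = c • topF ζ := by
  ext1 e; simp [topF, smul_comm c]

theorem topF_sum {α : Type*} (s : Finset α) (ζ : α → FormField n M Q) :
    topF (∑ a ∈ s, ζ a) = ∑ a ∈ s, topF (ζ a) := by
  ext1 e; simp [topF, Finset.smul_sum]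

end FormField

end KahlerGeom
end

noncomputable section

set_option linter.unusedSectionVars false

namespace KahlerGeom

/-! ### Stokes' theorem -/

section Stokes

open TopologicalSpace MeasureTheory TensorProduct

variable {n : ℕ} {M : Type*} [TopologicalSpace M] [ChartedSpace (Cn n) M] {Q : Opens (ℝ × ℝ)}

/-- `∂ζ` -/
def delF (ζ : FormField n M Q) : FormField n M Q := fun e => FA.del (Sm.diffRing (dom Q e.1)) (ζ e)

/-- `∂̄ζ` -/
def delbF (ζ : FormField n M Q) : FormField n M Q :=
  fun e => FA.delb (Sm.diffRing (dom Q e.1)) (ζ e)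

variable [IsManifold 𝓘(ℂ, Cn n) ω M]

theorem IsFn.del {f : SmField n M Q} (hf : IsFn f) : IsCov10 fun e j => Sm.del j (f e) :=
  fun e e' j => by
    rw [← del_res, hf]
    exact (chartTransition e.2 e'.2).d_φ j (f e')

theorem IsFn.delb {f : SmField n M Q} (hf : IsFn f) : IsCov01 fun e j => Sm.delb j (f e) :=
  fun e e' j => by
    rw [← delb_res, hf]
    exact (chartTransition e.2 e'.2).db_φ j (f e')

theorem FA.sum_mul_der_fn_smul {C : Type*} [CommRing C] [Algebra ℂ C] (D : Fin n → Derivation ℂ C C)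
    (w : Fin n → Forms n) (f : C) (x : FA n C) :
    ∑ j, ((1 : C) ⊗ₜ[ℂ] w j) * FA.der (D j) (f • x)
      = (∑ j, D j f ⊗ₜ[ℂ] w j) * x + f • ∑ j, ((1 : C) ⊗ₜ[ℂ] w j) * FA.der (D j) x := by
  rw [Finset.smul_sum, Finset.sum_mul, ← Finset.sum_add_distrib]
  refine Finset.sum_congr rfl fun j _ => ?_
  rw [FA.der_smul, mul_add, mul_smul_comm, mul_smul_comm, ← smul_mul_assoc,
    TensorProduct.smul_tmul', smul_eq_mul, mul_one]

theorem FA.top_sum_mul_der {C : Type*} [CommRing C] [Algebra ℂ C] (D : Fin n → Derivation ℂ C C)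
    (w : Fin n → Forms n) (x : FA n C) :
    FA.top (∑ j, ((1 : C) ⊗ₜ[ℂ] w j) * FA.der (D j) x)
      = ∑ j, D j (FA.top (((1 : C) ⊗ₜ[ℂ] w j) * x)) := by
  rw [map_sum]
  refine Finset.sum_congr rfl fun j _ => ?_
  rw [FA.derivation_top, FA.der_mul, FA.der_tmul, Derivation.map_one_eq_zero, zero_tmul, zero_mul,
    zero_add]

variable [T2Space M] [CompactSpace M]

theorem sum_fnField_partition (e : atlas (Cn n) M) :
    ∑ x ∈ partIndex n M, fnField Q (partition n M x) e = 1 := by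
  refine Sm.ext_eq fun y hy => ?_
  rw [Sm.ext_sum, Sm.ext_one hy, Finset.sum_congr rfl fun x _ => ext_fnField _ _ hy,
    ← Complex.ofReal_sum, sum_partition, Complex.ofReal_one]

/-- Stokes' theorem, for `∂` and `∂̄` at once. Each `ρ_x ∂ζ` equals `∂(ρ_x ζ) - ∂ρ_x ∧ ζ`. The first
term is compactly supported in a chart and integrates to zero; the second terms sum to zero because
`∑ ρ_x = 1`. -/
theorem mint_topF_sum_mul_der (D : ∀ e : atlas (Cn n) M, Fin n →
      Derivation ℂ (Sm (dom Q e.1)) (Sm (dom Q e.1))) (w : Fin n → Forms n)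
    (hint : ∀ (e : atlas (Cn n) M) (K : Set (Cn n)) (F : Sm (dom Q e.1)), SuppIn F K → IsCompact K →
      K ⊆ e.1.target → ∀ q ∈ Q, ∀ j, SuppIn (D e j F) K ∧
        ∫ z in e.1.target, (D e j F).ext (q, z) = 0)
    (hform : ∀ f : SmField n M Q, IsFn f → IsForm fun e => ∑ j, D e j (f e) ⊗ₜ[ℂ] w j)
    (hloc : ∀ (e : atlas (Cn n) M) (j : Fin n) (f : Sm (dom Q e.1)) (K : Set (PCn n)), IsClosed K →
      (∀ x ∈ dom Q e.1, x ∉ K → f.ext x = 0) → ∀ x ∈ dom Q e.1, x ∉ K → (D e j f).ext x = 0)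
    {ζ : FormField n M Q} (hζ : IsForm ζ) {q : ℝ × ℝ} (hq : q ∈ Q) :
    mint (topF fun e => ∑ j, ((1 : Sm (dom Q e.1)) ⊗ₜ[ℂ] w j) * FA.der (D e j) (ζ e)) q = 0 := by
  set ρ : M → SmField n M Q := fun x => fnField Q (partition n M x) with hρ
  set θ : M → FormField n M Q := fun x e => (∑ j, D e j (ρ x e) ⊗ₜ[ℂ] w j) * ζ e with hθ
  have hθform : ∀ x, IsForm (θ x) := fun x => (hform _ (isFn_fnField _)).mul hζ
  have hθsum : ∑ x ∈ partIndex n M, θ x = 0 := by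
    ext1 e
    rw [Finset.sum_apply]
    simp only [hθ, hρ]
    rw [← Finset.sum_mul, Finset.sum_comm]
    simp only [← sum_tmul, ← map_sum, sum_fnField_partition, Derivation.map_one_eq_zero, zero_tmul,
      Finset.sum_const_zero, zero_mul, Pi.zero_apply]
  -- The terms `∂ρ_x ∧ ζ` are integrated in different charts. As densities supported in one chart
  -- they can be rewritten as integrals over all of `M`, where their sum makes sense.
  have hθint : ∀ x, mint (topF (θ x)) q = ∫ z in (atChart n x).1.target,
      (topF (θ x) (atChart n x)).ext (q, z) := fun x => by
    refine mint_eq_integral (isDensity_topF (hθform x)) (atChart n x) (isClosed_tsupport _)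
      (tsupport_partition x) (fun e y hy hyS => ?_) hq
    have h0 : ∀ j, (D e j (ρ x e)).ext y = 0 := fun j => by
      refine hloc e j (ρ x e) ((Prod.snd ⁻¹' (e.1.target ∩ e.1.symm ⁻¹'
        (tsupport (partition n M x))ᶜ))ᶜ : Set (PCn n)) ?_ (fun p hp hpK => ?_) y hy ?_
      · exact ((e.1.isOpen_inter_preimage_symm (isClosed_tsupport _).isOpen_compl).preimage
          continuous_snd).isClosed_compl
      · rw [Set.notMem_compl_iff] at hpK
        rw [hρ, ext_fnField _ _ hp, image_eq_zero_of_notMem_tsupport hpK.2, Complex.ofReal_zero]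
      · rw [Set.notMem_compl_iff]
        exact ⟨hy.2, hyS⟩
    rw [topF, Sm.ext_smul, ← Sm.ev_eq_ext ⟨y, hy⟩, FA.map_top]
    simp only [hθ]
    rw [map_mul (FA.ev _), map_sum]
    simp only [FA.ev_tmul, Sm.ev_eq_ext, h0, zero_smul, Finset.sum_const_zero, zero_mul, map_zero,
      mul_zero]
  have hsum : ∑ x ∈ partIndex n M, mint (topF (θ x)) q = 0 := by
    rw [← mint_sum _ _ hq, ← topF_sum, hθsum]
    have : topF (0 : FormField n M Q) = 0 := by ext1 e; simp [topF]
    rw [this, mint_zero]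
  rw [mint, ← neg_eq_zero, ← hsum, ← Finset.sum_neg_distrib]
  refine Finset.sum_congr rfl fun x _ => ?_
  rw [hθint x]
  set e := atChart n x
  set G : Fin n → Sm (dom Q e.1) := fun j => FA.top (((1 : Sm (dom Q e.1)) ⊗ₜ[ℂ] w j) * ζ e) with hG
  -- Leibniz in a single chart: a sum of coordinate derivatives of functions with compact support,
  -- minus the top part of `θ x`.
  have h1 : ρ x e * topF (fun e => ∑ j, ((1 : Sm (dom Q e.1)) ⊗ₜ[ℂ] w j) * FA.der (D e j) (ζ e)) e
      = (-2 * Complex.I) ^ n • (∑ j, D e j (ρ x e * G j)) - topF (θ x) e := by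
    have h2 := congrArg FA.top (FA.sum_mul_der_fn_smul (D e) w (ρ x e) (ζ e))
    rw [FA.top_sum_mul_der, map_add, FA.top_smul] at h2
    simp only [mul_smul_comm, FA.top_smul] at h2
    rw [hG, h2, topF, topF, smul_add, mul_smul_comm]
    simp only [hθ]
    ring
  have hs : ∀ j, SuppIn (ρ x e * G j) (partSupport (n := n) x) := fun j => suppIn_partition x (G j)
  have hK := isCompact_partSupport (n := n) x
  have hKe := partSupport_subset (n := n) x
  have h3 : ∫ z in e.1.target, ((-2 * Complex.I) ^ n • (∑ j, D e j (ρ x e * G j))).ext (q, z) = 0 := by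
    simp only [Sm.ext_smul, Sm.ext_sum]
    rw [integral_const_mul, integral_finsetSum]
    · rw [Finset.sum_eq_zero fun j _ => (hint e _ _ (hs j) hK hKe q hq j).2, mul_zero]
    · exact fun j _ => ((hint e _ _ (hs j) hK hKe q hq j).1.integrable hK hKe hq).integrableOn
  change -∫ z in e.1.target, (ρ x e * topF (fun e => ∑ j, ((1 : Sm (dom Q e.1)) ⊗ₜ[ℂ] w j)
    * FA.der (D e j) (ζ e)) e).ext (q, z) = _
  rw [h1]
  simp only [Sm.ext_sub]
  rw [integral_sub, h3, zero_sub, neg_neg]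
  · refine Integrable.integrableOn ?_
    simp only [Sm.ext_smul, Sm.ext_sum]
    exact (integrable_finsetSum _ fun j _ =>
      (hint e _ _ (hs j) hK hKe q hq j).1.integrable hK hKe hq).const_mul _
  · refine IntegrableOn.congr_fun (f := fun z => ((-2 * Complex.I) ^ n •
      (∑ j, D e j (ρ x e * G j)) - ρ x e * topF (fun e => ∑ j, ((1 : Sm (dom Q e.1)) ⊗ₜ[ℂ] w j)
      * FA.der (D e j) (ζ e)) e).ext (q, z)) ?_ (fun z _ => by rw [h1, sub_sub_cancel])
      e.1.open_target.measurableSet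
    simp only [Sm.ext_sub]
    refine Integrable.integrableOn (Integrable.sub ?_ ((suppIn_partition x _).integrable hK hKe hq))
    simp only [Sm.ext_smul, Sm.ext_sum]
    exact (integrable_finsetSum _ fun j _ =>
      (hint e _ _ (hs j) hK hKe q hq j).1.integrable hK hKe hq).const_mul _

theorem mint_topF_delF {ζ : FormField n M Q} (hζ : IsForm ζ) {q : ℝ × ℝ} (hq : q ∈ Q) :
    mint (topF (delF ζ)) q = 0 := by
  have h : delF ζ = fun e => ∑ j, ((1 : Sm (dom Q e.1)) ⊗ₜ[ℂ] dz j) * FA.der (Sm.del j) (ζ e) :=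
    funext fun e => FA.del_apply _ _
  rw [h]
  refine mint_topF_sum_mul_der (fun e j => Sm.del j) dz (fun e K F hF hK hKe q hq j => ⟨?_,
    hF.integral_del hK hKe hq j⟩) (fun f hf => isForm_form10 hf.del)
    (fun e j f K hK hf x hx hxK => f.ext_del_eq_zero j hK hf hx hxK) hζ hq
  intro x hx
  rw [Sm.del_apply, Sm.ext_smul, Sm.ext_sub, Sm.ext_smul, hF.der hK _ x hx, hF.der hK _ x hx]
  simp

theorem mint_topF_delbF {ζ : FormField n M Q} (hζ : IsForm ζ) {q : ℝ × ℝ} (hq : q ∈ Q) :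
    mint (topF (delbF ζ)) q = 0 := by
  have h : delbF ζ = fun e => ∑ j, ((1 : Sm (dom Q e.1)) ⊗ₜ[ℂ] dzbar j) * FA.der (Sm.delb j) (ζ e) :=
    funext fun e => FA.delb_apply _ _
  rw [h]
  refine mint_topF_sum_mul_der (fun e j => Sm.delb j) dzbar (fun e K F hF hK hKe q hq j => ⟨?_,
    hF.integral_delb hK hKe hq j⟩) (fun f hf => isForm_form01 hf.delb)
    (fun e j f K hK hf x hx hxK => f.ext_delb_eq_zero j hK hf hx hxK) hζ hq
  intro x hx
  rw [Sm.delb_apply, Sm.ext_smul, Sm.ext_add, Sm.ext_smul, hF.der hK _ x hx, hF.der hK _ x hx]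
  simp

end Stokes

end KahlerGeom
end

noncomputable section

set_option linter.unusedSectionVars false

namespace KahlerGeom

/-! ### Chern–Weil theory of the second Todd polynomial -/

section Todd

variable {n : ℕ} {C : Type*} [CommRing C] [Algebra ℂ C]

theorem td2_comm (X Y : Matrix (Fin n) (Fin n) C) : td2 X Y = td2 Y X := by
  rw [td2, td2, Matrix.trace_mul_comm, mul_comm X.trace]

theorem td2_add_left (X X' Y : Matrix (Fin n) (Fin n) C) :
    td2 (X + X') Y = td2 X Y + td2 X' Y := by
  rw [td2, td2, td2, ← smul_add]
  simp only [Matrix.trace_add, add_mul, smul_add]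
  module

theorem td2_neg_left (X Y : Matrix (Fin n) (Fin n) C) : td2 (-X) Y = -td2 X Y := by
  rw [td2, td2, ← smul_neg]
  simp only [Matrix.trace_neg, neg_mul, smul_neg]
  module

theorem td2_sub_left (X X' Y : Matrix (Fin n) (Fin n) C) :
    td2 (X - X') Y = td2 X Y - td2 X' Y := by
  rw [sub_eq_add_neg, td2_add_left, td2_neg_left, sub_eq_add_neg]

theorem td2_add_right (X Y Y' : Matrix (Fin n) (Fin n) C) :
    td2 X (Y + Y') = td2 X Y + td2 X Y' := by
  rw [td2_comm, td2_add_left, td2_comm Y, td2_comm Y']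

theorem td2_neg_right (X Y : Matrix (Fin n) (Fin n) C) : td2 X (-Y) = -td2 X Y := by
  rw [td2_comm, td2_neg_left, td2_comm]

/-- Infinitesimal conjugation invariance: cyclicity of the trace, and vanishing of the trace on
commutators. -/
theorem td2_commutator (X Y Z : Matrix (Fin n) (Fin n) C) :
    td2 X (Y * Z - Z * Y) = td2 (X * Y - Y * X) Z := by
  have h1 : (X * (Z * Y)).trace = (Y * X * Z).trace := by
    rw [← Matrix.mul_assoc, Matrix.trace_mul_comm, Matrix.mul_assoc]
  rw [td2, td2, Matrix.mul_sub, Matrix.sub_mul, Matrix.trace_sub, Matrix.trace_sub,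
    Matrix.trace_sub, Matrix.trace_sub, Matrix.trace_mul_comm Y Z, Matrix.trace_mul_comm X Y, h1,
    Matrix.mul_assoc X Y Z]
  simp

theorem derivation_td2 (D : Derivation ℂ C C) (X Y : Matrix (Fin n) (Fin n) C) :
    D (td2 X Y) = td2 (X.map D) Y + td2 X (Y.map D) := by
  rw [td2, td2, td2, ← smul_add, D.map_smul, D.map_sub, D.map_smul, D.leibniz,
    ← trace_map_derivation, ← trace_map_derivation, ← trace_map_derivation, map_mul_derivation,
    Matrix.trace_add]
  simp only [smul_eq_mul, smul_add]
  rw [mul_comm Y.trace]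
  module

theorem algHom_td2 {O : Type*} [CommRing O] [Algebra ℂ O] (φ : C →ₐ[ℂ] O)
    (X Y : Matrix (Fin n) (Fin n) C) : φ (td2 X Y) = td2 (X.map φ) (Y.map φ) := by
  have h : ∀ Z : Matrix (Fin n) (Fin n) C, φ Z.trace = (Z.map φ).trace := fun Z => by
    simp [Matrix.trace]
  rw [td2, td2, map_smul, map_sub, map_smul, map_mul, h, h, h, Matrix.map_mul]

variable (𝒟 : DiffRing (Fin n) C)

namespace DiffRing

theorem trace_cov (h : Matrix (Fin n) (Fin n) C) (j : Fin n) (X : Matrix (Fin n) (Fin n) C) :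
    (𝒟.cov h j X).trace = 𝒟.d j X.trace := by
  rw [cov, Matrix.trace_sub, Matrix.trace_add, Matrix.trace_mul_comm, trace_map_derivation,
    add_sub_cancel_right]

/-- By invariance the commutators with the connection cancel, so a derivative of `td2` may be
computed covariantly. -/
theorem d_td2 (h : Matrix (Fin n) (Fin n) C) (j : Fin n) (X Y : Matrix (Fin n) (Fin n) C) :
    𝒟.d j (td2 X Y) = td2 (𝒟.cov h j X) Y + td2 X (𝒟.cov h j Y) := by
  have h1 : td2 (X * 𝒟.conn h j - 𝒟.conn h j * X) Y + td2 X (Y * 𝒟.conn h j - 𝒟.conn h j * Y) = 0 := by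
    rw [← td2_commutator, ← td2_add_right]
    have : 𝒟.conn h j * Y - Y * 𝒟.conn h j + (Y * 𝒟.conn h j - 𝒟.conn h j * Y) = 0 := by abel
    rw [this]
    simp [td2]
  rw [derivation_td2, cov, cov, add_sub_assoc, add_sub_assoc, td2_add_left, td2_add_right,
    add_add_add_comm, h1, add_zero]

/-- The form `Td₂(U, R)`. -/
def toddVariation (h U : Matrix (Fin n) (Fin n) C) : Matrix (Fin n) (Fin n) C :=
  Matrix.of fun j k => td2 U (𝒟.curvature h j k)

/-- The form `Td₂(R, R)`. -/
def toddForm (h : Matrix (Fin n) (Fin n) C) : FA n C :=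
  FA.form22 fun j k l m => td2 (𝒟.curvature h j k) (𝒟.curvature h l m)

/-- The complex Hessian. -/
def hessian (f : C) : Matrix (Fin n) (Fin n) C := Matrix.of fun j k => 𝒟.d j (𝒟.db k f)

/-- The Ricci curvature. -/
def ric (h : Matrix (Fin n) (Fin n) C) : Matrix (Fin n) (Fin n) C :=
  Matrix.of fun j k => (𝒟.curvature h j k).trace

/-- The Kähler condition. -/
structure IsKahlerMatrix (h : Matrix (Fin n) (Fin n) C) : Prop where
  d_symm : ∀ j k l, 𝒟.d l (h j k) = 𝒟.d j (h l k)
  db_symm : ∀ j k l, 𝒟.db l (h j k) = 𝒟.db k (h j l)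

/-- The Bott–Chern identity: `U ↦ Td₂(U, R)` is closed on the space of metrics up to `∂`- and
`∂̄`-exact forms. Varying `R` produces `-∂̄∇U` and `-∂̄∇V`; exchanging `∇` and `∂̄` costs a
curvature commutator, which invariance turns into `Td₂([U, V], R)`, exactly the Maurer–Cartan term.
-/
theorem der_form11_toddVariation {h : Matrix (Fin n) (Fin n) C} (hh : IsUnit h.det)
    (D E : Derivation ℂ C C) (hD : ∀ j f, D (𝒟.d j f) = 𝒟.d j (D f))
    (hDb : ∀ j f, D (𝒟.db j f) = 𝒟.db j (D f)) (hE : ∀ j f, E (𝒟.d j f) = 𝒟.d j (E f))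
    (hEb : ∀ j f, E (𝒟.db j f) = 𝒟.db j (E f)) (hDE : ∀ f, D (E f) = E (D f)) :
    FA.der D (FA.form11 (𝒟.toddVariation h (h.map E * h⁻¹)))
        - FA.der E (FA.form11 (𝒟.toddVariation h (h.map D * h⁻¹)))
      = FA.del 𝒟 (FA.form01 fun k => td2 (h.map D * h⁻¹) ((h.map E * h⁻¹).map (𝒟.db k)))
        + FA.delb 𝒟 (FA.form10 fun j => td2 (𝒟.cov h j (h.map D * h⁻¹)) (h.map E * h⁻¹)) := by
  rw [FA.der_form11, FA.der_form11, ← FA.form11_sub, FA.del_form01, FA.delb_form10, ← sub_eq_add_neg,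
    ← FA.form11_sub]
  congr 1
  have hV := velocity_map_sub hh D E hDE
  set U := h.map D * h⁻¹
  set V := h.map E * h⁻¹
  ext j k
  simp only [toddVariation, Matrix.sub_apply, Matrix.map_apply, Matrix.of_apply]
  -- The curvature commutator from exchanging `∇_j` and `∂_k̄` is moved onto `U` by invariance.
  have e : td2 U (𝒟.cov h j (V.map (𝒟.db k))) = td2 U ((𝒟.cov h j V).map (𝒟.db k))
      + td2 (U * V - V * U) (𝒟.curvature h j k) := by
    rw [𝒟.cov_map_db, add_sub_assoc, td2_add_right, td2_commutator]
  rw [derivation_td2, derivation_td2, 𝒟.d_td2 h, derivation_td2 (𝒟.db k), e,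
    𝒟.curvature_map hh D j k (hD j) (hDb k), 𝒟.curvature_map hh E j k (hE j) (hEb k),
    td2_neg_right, td2_neg_right, ← hV, td2_sub_left, td2_comm V]
  abel

/-- Covariant differentiation gives one term per curvature factor. The Bianchi identity supplies the
symmetry for `∂`, commuting `∂̄`-derivatives the one for `∂̄`. -/
theorem isClosedEven_toddForm {h : Matrix (Fin n) (Fin n) C} (hh : IsUnit h.det) :
    FA.IsClosedEven 𝒟 (𝒟.toddForm h) := by
  refine FA.isClosedEven_form22
    (fun a j k l m => td2 (𝒟.cov h a (𝒟.curvature h j k)) (𝒟.curvature h l m))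
    (fun a j k l m => td2 (𝒟.curvature h j k) (𝒟.cov h a (𝒟.curvature h l m)))
    (fun a j k l m => td2 ((𝒟.curvature h j k).map (𝒟.db a)) (𝒟.curvature h l m))
    (fun a j k l m => td2 (𝒟.curvature h j k) ((𝒟.curvature h l m).map (𝒟.db a)))
    (fun a j k l m => 𝒟.d_td2 h a _ _) (fun a j k l m => ?_) (fun a j k l m => ?_)
    (fun a j k l m => derivation_td2 _ _ _) (fun a j k l m => ?_) (fun a j k l m => ?_)
  · rw [𝒟.bianchi hh]
  · rw [𝒟.bianchi hh]
  · rw [𝒟.curvature_map_db]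
  · rw [𝒟.curvature_map_db]

end DiffRing

theorem FA.form22_swap (τ : Fin n → Fin n → Fin n → Fin n → C) :
    FA.form22 τ = FA.form22 fun j k l m => τ l m j k := by
  simp only [FA.form22]
  rw [Finset.sum_congr rfl fun j _ => Finset.sum_comm, Finset.sum_comm]
  refine Finset.sum_congr rfl fun l _ => ?_
  rw [Finset.sum_congr rfl fun j _ => Finset.sum_congr rfl fun k _ => rfl]
  rw [Finset.sum_congr rfl fun j _ => Finset.sum_comm, Finset.sum_comm]
  refine Finset.sum_congr rfl fun m _ => Finset.sum_congr rfl fun j _ =>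
    Finset.sum_congr rfl fun k _ => ?_
  rw [(dz_mul_dzbar_central j k _).eq]

namespace DiffRing

/-- The two Leibniz terms coincide after exchanging the two (1,1)-factors, whence the factor `2`. -/
theorem der_toddForm {h : Matrix (Fin n) (Fin n) C} (hh : IsUnit h.det)
    (D : Derivation ℂ C C) (hD : ∀ j f, D (𝒟.d j f) = 𝒟.d j (D f))
    (hDb : ∀ j f, D (𝒟.db j f) = 𝒟.db j (D f)) :
    FA.der D (𝒟.toddForm h) = (2 : ℂ) • FA.form22 fun j k l m =>
      td2 (-(𝒟.cov h j (h.map D * h⁻¹)).map (𝒟.db k)) (𝒟.curvature h l m) := by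
  rw [toddForm, FA.der_form22, two_smul]
  nth_rewrite 3 [FA.form22_swap]
  rw [← FA.form22_add]
  congr 1
  ext j k l m
  simp only [Pi.add_apply]
  rw [derivation_td2, 𝒟.curvature_map hh D j k (hD j) (hDb k),
    𝒟.curvature_map hh D l m (hD l) (hDb m), td2_comm (𝒟.curvature h j k)]

/-- Integration by parts that carries `∂∂̄` from the velocity `U` to the function `f`. -/
theorem smul_form22_todd {h : Matrix (Fin n) (Fin n) C} (hh : IsUnit h.det)
    (U : Matrix (Fin n) (Fin n) C) (f : C) :
    (f • FA.form22 fun j k l m => td2 (-(𝒟.cov h j U).map (𝒟.db k)) (𝒟.curvature h l m))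
        + FA.form11 (𝒟.hessian f) * FA.form11 (𝒟.toddVariation h U)
      = FA.del 𝒟 (FA.form01 (fun k => 𝒟.db k f) * FA.form11 (𝒟.toddVariation h U))
        + FA.delb 𝒟 (FA.form21 fun j l m => f * td2 (𝒟.cov h j U) (𝒟.curvature h l m)) := by
  -- The terms in which `∂̄` or `∇` falls on the curvature vanish: their coefficients are symmetric,
  -- in the first case because `∂̄`-derivatives commute, in the second by Bianchi.
  have h1 : FA.form22 (fun j k l m => f * td2 (𝒟.cov h j U) ((𝒟.curvature h l m).map (𝒟.db k))) = 0 :=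
    FA.form22_eq_zero_of_symm_db _ fun j k l m => by rw [𝒟.curvature_map_db]
  have h2 : FA.form22 (fun j k l m => 𝒟.db k f * td2 U (𝒟.cov h j (𝒟.curvature h l m))) = 0 :=
    FA.form22_eq_zero_of_symm_d _ fun j k l m => by rw [𝒟.bianchi hh]
  rw [FA.form01_mul_form11, FA.del_form12, FA.delb_form21, ← FA.form22_smul, ← FA.form22_mul,
    ← FA.form22_add, ← sub_eq_add_neg, ← FA.form22_sub, ← sub_zero (FA.form22 _), ← h1,
    ← FA.form22_sub, ← add_zero (FA.form22 _), ← h2, ← FA.form22_add]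
  congr 1
  ext j k l m
  simp only [Pi.add_apply, Pi.sub_apply, Pi.smul_apply, smul_eq_mul, hessian, toddVariation,
    Matrix.of_apply, Derivation.leibniz]
  rw [𝒟.d_td2 h, derivation_td2 (𝒟.db k), td2_neg_left]
  ring

theorem smul_form11_hessian_sub (f g : C) :
    f • FA.form11 (𝒟.hessian g) - g • FA.form11 (𝒟.hessian f)
      = FA.del 𝒟 (f • FA.form01 fun k => 𝒟.db k g) + FA.delb 𝒟 (g • FA.form10 fun j => 𝒟.d j f) := by
  have h1 : (f • FA.form01 fun k => 𝒟.db k g) = FA.form01 fun k => f * 𝒟.db k g := by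
    simp [FA.form01, Finset.smul_sum, TensorProduct.smul_tmul']
  have h2 : (g • FA.form10 fun j => 𝒟.d j f) = FA.form10 fun j => g * 𝒟.d j f := by
    simp [FA.form10, Finset.smul_sum, TensorProduct.smul_tmul']
  rw [h1, h2, FA.del_form01, FA.delb_form10, ← FA.form11_smul, ← FA.form11_smul, ← FA.form11_sub,
    ← sub_eq_add_neg, ← FA.form11_sub]
  congr 1
  ext j k
  exact 𝒟.hess_symm f g j k

/-- The trace of the Bianchi identity; the trace of a covariant derivative is an ordinary
derivative. -/
theorem isClosedEven_ric {h : Matrix (Fin n) (Fin n) C} (hh : IsUnit h.det) :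
    FA.IsClosedEven 𝒟 (FA.form11 (𝒟.ric h)) := by
  refine FA.isClosedEven_form11 (fun j k l => ?_) fun j k l => ?_
  · simp only [ric, Matrix.of_apply]
    rw [← 𝒟.trace_cov h, 𝒟.bianchi hh, 𝒟.trace_cov]
  · simp only [ric, Matrix.of_apply]
    rw [← trace_map_derivation, 𝒟.curvature_map_db, trace_map_derivation]

theorem IsKahlerMatrix.isClosedEven {𝒟 : DiffRing (Fin n) C} {h : Matrix (Fin n) (Fin n) C}
    (hh : 𝒟.IsKahlerMatrix h) : FA.IsClosedEven 𝒟 (FA.form11 h) :=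
  FA.isClosedEven_form11 hh.d_symm hh.db_symm

theorem IsKahlerMatrix.add_hessian {𝒟 : DiffRing (Fin n) C} {h : Matrix (Fin n) (Fin n) C}
    (hh : 𝒟.IsKahlerMatrix h) (f : C) : 𝒟.IsKahlerMatrix (h + 𝒟.hessian f) where
  d_symm j k l := by
    simp only [Matrix.add_apply, map_add, hessian, Matrix.of_apply, hh.d_symm j k l]
    rw [𝒟.d_d]
  db_symm j k l := by
    simp only [Matrix.add_apply, map_add, hessian, Matrix.of_apply, hh.db_symm j k l]
    rw [← 𝒟.d_db, ← 𝒟.d_db, 𝒟.db_db]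

/-- The curvature with lowered index. -/
theorem curvature_mul {h : Matrix (Fin n) (Fin n) C} (hh : IsUnit h.det) (j k : Fin n) :
    𝒟.curvature h j k * h = h.map (𝒟.d j) * h⁻¹ * h.map (𝒟.db k) - (h.map (𝒟.d j)).map (𝒟.db k) := by
  have h1 : h.map (𝒟.d j) = 𝒟.conn h j * h := by
    rw [conn, Matrix.mul_assoc, Matrix.nonsing_inv_mul _ hh, Matrix.mul_one]
  have h2 := congrArg (fun X : Matrix (Fin n) (Fin n) C => X.map (𝒟.db k)) h1
  simp only [map_mul_derivation] at h2
  rw [h2, curvature, conn]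
  noncomm_ring

/-- With lowered index the curvature is `∂_j h · h⁻¹ · ∂_k̄ h - ∂_k̄ ∂_j h`, and the Kähler
condition exchanges `p` and `j` in each occurrence. -/
theorem IsKahlerMatrix.curvature_symm_d {𝒟 : DiffRing (Fin n) C} {h : Matrix (Fin n) (Fin n) C}
    (hK : 𝒟.IsKahlerMatrix h) (hh : IsUnit h.det) (p q j k : Fin n) :
    (𝒟.curvature h j k * h) p q = (𝒟.curvature h p k * h) j q := by
  rw [𝒟.curvature_mul hh, 𝒟.curvature_mul hh]
  simp only [Matrix.sub_apply, Matrix.mul_apply, Matrix.map_apply, hK.d_symm p _ j]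

theorem IsKahlerMatrix.curvature_symm_db {𝒟 : DiffRing (Fin n) C} {h : Matrix (Fin n) (Fin n) C}
    (hK : 𝒟.IsKahlerMatrix h) (hh : IsUnit h.det) (p q j k : Fin n) :
    (𝒟.curvature h j k * h) p q = (𝒟.curvature h j q * h) p k := by
  rw [𝒟.curvature_mul hh, 𝒟.curvature_mul hh]
  simp only [Matrix.sub_apply, Matrix.mul_apply, Matrix.map_apply, ← 𝒟.d_db, hK.db_symm _ q k]

end DiffRing

end Todd

end KahlerGeom
end

noncomputable section

set_option linter.unusedSectionVars false

namespace KahlerGeom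

/-! ### Transformation behaviour of curvature quantities -/

section Covariance

open TopologicalSpace

variable {n : ℕ} {C O : Type*} [CommRing C] [Algebra ℂ C] [CommRing O] [Algebra ℂ O]

theorem td2_smul_left (c : C) (X Y : Matrix (Fin n) (Fin n) C) :
    td2 (c • X) Y = c * td2 X Y := by
  simp only [td2, Matrix.smul_mul, Matrix.trace_smul, smul_eq_mul, mul_smul_comm, mul_sub, mul_assoc]

theorem td2_smul_right (c : C) (X Y : Matrix (Fin n) (Fin n) C) :
    td2 X (c • Y) = c * td2 X Y := by
  rw [td2_comm, td2_smul_left, td2_comm]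

theorem td2_sum_left {α : Type*} (s : Finset α) (X : α → Matrix (Fin n) (Fin n) C)
    (Y : Matrix (Fin n) (Fin n) C) : td2 (∑ a ∈ s, X a) Y = ∑ a ∈ s, td2 (X a) Y := by
  classical
  induction s using Finset.induction_on with
  | empty => simp [td2]
  | insert a s ha ih => rw [Finset.sum_insert ha, Finset.sum_insert ha, td2_add_left, ih]

theorem td2_sum_right {α : Type*} (s : Finset α) (X : Matrix (Fin n) (Fin n) C)
    (Y : α → Matrix (Fin n) (Fin n) C) : td2 X (∑ a ∈ s, Y a) = ∑ a ∈ s, td2 X (Y a) := by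
  rw [td2_comm, td2_sum_left]
  exact Finset.sum_congr rfl fun a _ => td2_comm _ _

theorem Transition.td2_endo {𝒟 : DiffRing (Fin n) C} {ℰ : DiffRing (Fin n) O} (T : Transition 𝒟 ℰ)
    (X Y : Matrix (Fin n) (Fin n) C) : td2 (T.endo X) (T.endo Y) = T.φ (td2 X Y) := by
  rw [td2, td2, ← T.endo_mul, T.trace_endo, T.trace_endo, T.trace_endo, map_smul, map_sub, map_smul,
    map_mul]

variable {M : Type*} [TopologicalSpace M] [ChartedSpace (Cn n) M] {Q : Opens (ℝ × ℝ)}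
  [IsManifold 𝓘(ℂ, Cn n) ω M]

theorem dp_res (e e' : OpenPartialHomeomorph M (Cn n)) (v : ℝ × ℝ) (f : Sm (dom Q e)) :
    Sm.dp v (res e e' f) = res e e' (Sm.dp v f) := der_res e e' _ f

theorem dp_trans (e e' : atlas (Cn n) M) (v : ℝ × ℝ) (f : Sm (dom Q e'.1)) :
    Sm.dp v (trans e.2 e'.2 f) = trans e.2 e'.2 (Sm.dp v f) := by
  refine Sm.ext_eq fun x hx => ?_
  have h1 := ((hasFDerivAt_coordChange e.2 e'.2 hx.2).restrictScalars ℝ).comp x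
    (hasFDerivAt_snd (𝕜 := ℝ) (p := x))
  have h2 : fderiv ℝ (pCoordChange e.1 e'.1) x = _ :=
    ((hasFDerivAt_fst (𝕜 := ℝ) (p := x)).prodMk h1).fderiv
  rw [ext_trans _ _ _ hx, Sm.dp, Sm.dp, trans, Sm.ext_der_pull _ _ f _ hx,
    Sm.ext_der (v, 0) f (ovl_mapsTo hx), h2]
  simp

theorem dp_jacF (e e' : atlas (Cn n) M) (v : ℝ × ℝ) (a j : Fin n) :
    Sm.dp v (jacF Q e e' a j) = 0 := by
  refine Sm.ext_eq fun x hx => ?_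
  have h : (jacF Q e e' a j).ext =ᶠ[nhds x] ((fun z => jac e.1 e'.1 z a j) ∘ Prod.snd) := by
    filter_upwards [(ovl Q e.1 e'.1).isOpen.mem_nhds hx] with y hy
    rw [ext_smJac _ _ _ _ hy]; rfl
  have h2 := ((((contDiffOn_jac e.2 e'.2 a j).contDiffAt ((isOpen_overlap _ _).mem_nhds
    hx.2)).differentiableAt (by simp)).hasFDerivAt.restrictScalars ℝ |>.comp x
      (hasFDerivAt_snd (𝕜 := ℝ) (p := x))).fderiv
  rw [Sm.dp, Sm.ext_der _ _ hx, h.fderiv_eq, h2]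
  simp [Sm.ext_zero]

theorem dp_conj_jacF (e e' : atlas (Cn n) M) (v : ℝ × ℝ) (a j : Fin n) :
    Sm.dp v (Sm.conj (jacF Q e e' a j)) = 0 := by
  have h := dp_jacF (Q := Q) e e' v a j
  rw [Sm.dp] at h ⊢
  rw [Sm.der_conj, h, map_zero]

theorem IsFn.dp {f : SmField n M Q} (hf : IsFn f) (v : ℝ × ℝ) : IsFn fun e => Sm.dp v (f e) :=
  fun e e' => by rw [← dp_res, hf, dp_trans]

theorem IsFn.mul {f g : SmField n M Q} (hf : IsFn f) (hg : IsFn g) : IsFn (f * g) :=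
  fun e e' => by rw [Pi.mul_apply, Pi.mul_apply, map_mul, map_mul, hf, hg]

theorem IsTens.dp {A : MatField n M Q} (hA : IsTens A) (v : ℝ × ℝ) :
    IsTens fun e => (A e).map (Sm.dp v) := fun e e' j k => by
  change res e.1 e'.1 (Sm.dp v (A e j k)) = _
  rw [← dp_res, hA]
  simp only [map_sum, Derivation.leibniz, dp_jacF, dp_conj_jacF, dp_trans, add_zero,
    smul_eq_mul, Matrix.map_apply, mul_zero]

theorem IsTens.add {A B : MatField n M Q} (hA : IsTens A) (hB : IsTens B) : IsTens (A + B) :=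
  fun e e' j k => by
    simp only [Pi.add_apply, Matrix.add_apply, map_add, hA e e' j k, hB e e' j k, mul_add,
      Finset.sum_add_distrib]

theorem IsTens.fn_smul {f : SmField n M Q} {A : MatField n M Q} (hf : IsFn f) (hA : IsTens A) :
    IsTens fun e => f e • A e := fun e e' j k => by
  simp only [Matrix.smul_apply, smul_eq_mul, map_mul, hA e e' j k, hf e e', Finset.mul_sum]
  exact Finset.sum_congr rfl fun a _ => Finset.sum_congr rfl fun b _ => by ring

theorem resTransition_tens (e e' : OpenPartialHomeomorph M (Cn n))
    (A : Matrix (Fin n) (Fin n) (Sm (dom Q e))) : (resTransition e e').tens A = A.map (res e e') := by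
  simp [Transition.tens, resTransition]

theorem resTransition_endo (e e' : OpenPartialHomeomorph M (Cn n))
    (A : Matrix (Fin n) (Fin n) (Sm (dom Q e))) : (resTransition e e').endo A = A.map (res e e') := by
  simp [Transition.endo, resTransition]

theorem isTens_iff {A : MatField n M Q} : IsTens A ↔ ∀ e e' : atlas (Cn n) M,
    (A e).map (res e.1 e'.1) = (chartTransition e.2 e'.2).tens (A e') := by
  have h : ∀ (e e' : atlas (Cn n) M) (j k : Fin n), (chartTransition e.2 e'.2).tens (A e') j k
      = ∑ a, ∑ b, jacF Q e e' a j * Sm.conj (jacF Q e e' b k) * trans e.2 e'.2 (A e' a b) := by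
    intro e e' j k
    rw [Transition.tens, Matrix.mul_apply]
    simp only [Matrix.mul_apply, Finset.sum_mul]
    rw [Finset.sum_comm]
    refine Finset.sum_congr rfl fun a _ => Finset.sum_congr rfl fun b _ => ?_
    simp only [chartTransition, Matrix.transpose_apply, Matrix.map_apply]
    ring
  refine forall₂_congr fun e e' => ⟨fun hA => ?_, fun hA j k => ?_⟩
  · ext j k
    rw [Matrix.map_apply, hA, h]
  · rw [← h, ← hA, Matrix.map_apply]

/-- Families of local expressions of an endomorphism of the tangent bundle. -/
def IsEndo (X : MatField n M Q) : Prop := ∀ e e' : atlas (Cn n) M,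
  (X e).map (res e.1 e'.1) = (chartTransition e.2 e'.2).endo (X e')

theorem IsTens.mul_inv {A H : MatField n M Q} (hA : IsTens A) (hH : IsTens H)
    (hu : ∀ e, IsUnit (H e).det) : IsEndo fun e => A e * (H e)⁻¹ := fun e e' => by
  have h1 := (resTransition e.1 e'.1).tens_mul_inv (hu e) (A e)
  have h2 := (chartTransition e.2 e'.2).tens_mul_inv (hu e') (A e')
  rw [resTransition_tens, resTransition_tens, resTransition_endo, isTens_iff.1 hA, isTens_iff.1 hH]
    at h1
  rw [← h1, h2]

theorem IsEndo.trace {X : MatField n M Q} (hX : IsEndo X) : IsFn fun e => (X e).trace :=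
  fun e e' => by
    have h1 := (resTransition e.1 e'.1).trace_endo (X e)
    rw [resTransition_endo, hX, Transition.trace_endo] at h1
    exact h1.symm

/-- The velocity of a family of metrics in a direction of the parameter space. -/
def velF (H : MatField n M Q) (v : ℝ × ℝ) : MatField n M Q :=
  fun e => (H e).map (Sm.dp v) * (H e)⁻¹

theorem isEndo_velF {H : MatField n M Q} (hH : IsTens H) (hu : ∀ e, IsUnit (H e).det)
    (v : ℝ × ℝ) : IsEndo (velF H v) := (hH.dp v).mul_inv hH hu

/-- The curvature of a family of metrics. -/
def curvF (H : MatField n M Q) (e : atlas (Cn n) M) (j k : Fin n) :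
    Matrix (Fin n) (Fin n) (Sm (dom Q e.1)) := (Sm.diffRing (dom Q e.1)).curvature (H e) j k

/-- The covariant derivative of endomorphisms. -/
def covF (H X : MatField n M Q) (e : atlas (Cn n) M) (j : Fin n) :
    Matrix (Fin n) (Fin n) (Sm (dom Q e.1)) := (Sm.diffRing (dom Q e.1)).cov (H e) j (X e)

/-- Restriction is itself a transition, with trivial Jacobian. Computing the curvature of the same
pulled-back metric through restriction and through the chart change gives the two sides. -/
theorem map_curvF {H : MatField n M Q} (hH : IsTens H) (hu : ∀ e, IsUnit (H e).det)
    (e e' : atlas (Cn n) M) (j k : Fin n) : (curvF H e j k).map (res e.1 e'.1)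
      = ∑ a, ∑ b, (jacF Q e e' a j * Sm.conj (jacF Q e e' b k)) •
        (chartTransition e.2 e'.2).endo (curvF H e' a b) := by
  have h1 := (resTransition e.1 e'.1).curvature_tens (hu e) j k
  rw [resTransition_tens, isTens_iff.1 hH, (chartTransition e.2 e'.2).curvature_tens (hu e')] at h1
  refine Eq.trans ?_ h1.symm
  rw [Finset.sum_eq_single j, Finset.sum_eq_single k, resTransition_endo]
  · simp [resTransition, curvF]
  · intro b _ hb
    simp [resTransition, Matrix.one_apply_ne hb]
  · simp
  · intro b _ hb
    simp [resTransition, Matrix.one_apply_ne hb]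
  · simp

theorem map_covF {H X : MatField n M Q} (hH : IsTens H) (hu : ∀ e, IsUnit (H e).det)
    (hX : IsEndo X) (e e' : atlas (Cn n) M) (j : Fin n) : (covF H X e j).map (res e.1 e'.1)
      = ∑ a, jacF Q e e' a j • (chartTransition e.2 e'.2).endo (covF H X e' a) := by
  have h1 := (resTransition e.1 e'.1).cov_endo (hu e) j (X e)
  rw [resTransition_tens, resTransition_endo, hX, isTens_iff.1 hH,
    (chartTransition e.2 e'.2).cov_endo (hu e')] at h1
  refine Eq.trans ?_ h1.symm
  rw [Finset.sum_eq_single j, resTransition_endo]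
  · simp [resTransition, covF]
  · intro b _ hb
    simp [resTransition, Matrix.one_apply_ne hb]
  · simp

theorem IsEndo.map_delb {X : MatField n M Q} (hX : IsEndo X) (e e' : atlas (Cn n) M) (k : Fin n) :
    ((X e).map (Sm.delb k)).map (res e.1 e'.1)
      = ∑ b, Sm.conj (jacF Q e e' b k) • (chartTransition e.2 e'.2).endo ((X e').map (Sm.delb b)) := by
  have h1 := (resTransition e.1 e'.1).endo_map_db (X e) k
  rw [resTransition_endo, hX, (chartTransition e.2 e'.2).endo_map_db] at h1
  refine Eq.trans ?_ h1.symm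
  rw [Finset.sum_eq_single k, resTransition_endo]
  · simp [resTransition, Sm.diffRing]
  · intro b _ hb
    simp [resTransition, Matrix.one_apply_ne hb]
  · simp

/-- The complex Hessian of a function. -/
def hessF (f : SmField n M Q) : MatField n M Q := fun e => (Sm.diffRing (dom Q e.1)).hessian (f e)

theorem isTens_hessF {f : SmField n M Q} (hf : IsFn f) : IsTens (hessF f) := fun e e' j k => by
  change res e.1 e'.1 (Sm.del j (Sm.delb k (f e))) = _
  rw [← del_res, ← delb_res, hf]
  refine ((chartTransition e.2 e'.2).hess_φ (f e') j k).trans ?_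
  refine Finset.sum_congr rfl fun a _ => Finset.sum_congr rfl fun b _ => ?_
  change smJac e.2 e'.2 a j * trans e.2 e'.2 _ * (smJac e.2 e'.2).map Sm.conj b k = _
  rw [Matrix.map_apply, mul_right_comm]
  rfl

/-- The Ricci curvature. -/
def ricF (H : MatField n M Q) : MatField n M Q := fun e => (Sm.diffRing (dom Q e.1)).ric (H e)

/-- The form `Td₂(U, R)`. -/
def toddVarF (H U : MatField n M Q) : MatField n M Q :=
  fun e => (Sm.diffRing (dom Q e.1)).toddVariation (H e) (U e)

/-- The form `Td₂(R, R)`. -/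
def toddF (H : MatField n M Q) : FormField n M Q := fun e => (Sm.diffRing (dom Q e.1)).toddForm (H e)

variable {H : MatField n M Q} (hH : IsTens H) (hu : ∀ e, IsUnit (H e).det)

include hH hu

theorem isTens_ricF : IsTens (ricF H) := fun e e' j k => by
  have h : ∀ (e : atlas (Cn n) M) (a b : Fin n), ricF H e a b = (curvF H e a b).trace :=
    fun _ _ _ => rfl
  have h2 : res e.1 e'.1 (curvF H e j k).trace = ((curvF H e j k).map (res e.1 e'.1)).trace := by
    simp [Matrix.trace]
  rw [h, h2, map_curvF hH hu]
  simp only [Matrix.trace_sum, Matrix.trace_smul, Transition.trace_endo, smul_eq_mul, h]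
  rfl

theorem isTens_toddVarF {U : MatField n M Q} (hU : IsEndo U) : IsTens (toddVarF H U) :=
  fun e e' j k => by
    change res e.1 e'.1 (td2 (U e) (curvF H e j k)) = _
    rw [algHom_td2, hU, map_curvF hH hu]
    simp only [td2_sum_right, td2_smul_right, Transition.td2_endo]
    rfl

theorem isCov01_td2 {U V : MatField n M Q} (hU : IsEndo U) (hV : IsEndo V) :
    IsCov01 fun e k => td2 (U e) ((V e).map (Sm.delb k)) := fun e e' k => by
  rw [algHom_td2, hU, hV.map_delb]
  simp only [td2_sum_right, td2_smul_right, Transition.td2_endo]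
  rfl

theorem isCov10_td2 {U V : MatField n M Q} (hU : IsEndo U) (hV : IsEndo V) :
    IsCov10 fun e j => td2 (covF H U e j) (V e) := fun e e' j => by
  rw [algHom_td2, hV, map_covF hH hu hU]
  simp only [td2_sum_left, td2_smul_left, Transition.td2_endo]
  rfl

theorem isForm_form21_td2 {U : MatField n M Q} (hU : IsEndo U) {f : SmField n M Q} (hf : IsFn f) :
    IsForm fun e => FA.form21 fun j l m => f e * td2 (covF H U e j) (curvF H e l m) :=
  isForm_form21 fun e e' j l m => by
    rw [map_mul, hf, algHom_td2, map_covF hH hu hU, map_curvF hH hu]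
    simp only [td2_sum_left, td2_smul_left]
    simp only [td2_sum_right, td2_smul_right, Transition.td2_endo,
      Finset.mul_sum, map_mul]
    refine Finset.sum_congr rfl fun a _ => Finset.sum_congr rfl fun b _ =>
      Finset.sum_congr rfl fun d _ => ?_
    simp only [chartTransition]
    ring

theorem isForm_toddF : IsForm (toddF H) := isForm_form22 fun e e' j k l m => by
  change res e.1 e'.1 (td2 (curvF H e j k) (curvF H e l m)) = _
  rw [algHom_td2, map_curvF hH hu, map_curvF hH hu]
  simp only [td2_sum_left, td2_smul_left]
  simp only [td2_sum_right, td2_smul_right, Transition.td2_endo,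
    Finset.mul_sum]
  refine Finset.sum_congr rfl fun a _ => Finset.sum_congr rfl fun f _ =>
    Finset.sum_congr rfl fun b _ => Finset.sum_congr rfl fun d _ => ?_
  simp only [chartTransition, curvF]
  ring

end Covariance

end KahlerGeom
end

noncomputable section

set_option linter.unusedSectionVars false

namespace KahlerGeom

/-! ### Variation of the Todd form, and contractions of the curvature of a Kähler metric -/

section KahlerAlgebra

variable {n : ℕ} {C : Type*} [CommRing C] [Algebra ℂ C]

/-- This is `∂/∂x` of `(x - y) ∑ xˢ yᵐ⁻¹⁻ˢ = xᵐ - yᵐ`. The summand is the difference of consecutive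
values of `s xˢ⁻¹ yᵐ⁻ˢ`, so the sum telescopes. -/
theorem sum_geom_derivative {A : Type*} [Ring A] [Algebra ℂ A] {x y : A} (hxy : Commute x y)
    (m : ℕ) : ∑ s ∈ Finset.range m, x ^ s * y ^ (m - 1 - s)
      + (x - y) * ∑ s ∈ Finset.range m, (s : ℂ) • (x ^ (s - 1) * y ^ (m - 1 - s))
      = (m : ℂ) • x ^ (m - 1) := by
  have h : ∀ s ∈ Finset.range m, x ^ s * y ^ (m - 1 - s)
      + (x - y) * ((s : ℂ) • (x ^ (s - 1) * y ^ (m - 1 - s)))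
      = ((s + 1 : ℕ) : ℂ) • (x ^ (s + 1 - 1) * y ^ (m - (s + 1)))
        - (s : ℂ) • (x ^ (s - 1) * y ^ (m - s)) := by
    intro s hs
    rw [Finset.mem_range] at hs
    have e1 : m - (s + 1) = m - 1 - s := by omega
    have e2 : m - s = m - 1 - s + 1 := by omega
    rw [e1, e2, Nat.add_sub_cancel]
    rcases s with _ | s
    · simp
    · rw [Nat.add_sub_cancel, mul_smul_comm, sub_mul, ← mul_assoc, ← pow_succ', ← mul_assoc y,
        ((hxy.symm).pow_right s).eq, mul_assoc, ← pow_succ' y]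
      push_cast
      module
  rw [Finset.mul_sum, ← Finset.sum_add_distrib, Finset.sum_congr rfl h, Finset.sum_range_sub
    (fun s => (s : ℂ) • (x ^ (s - 1) * y ^ (m - s)))]
  simp

namespace DiffRing

variable (𝒟 : DiffRing (Fin n) C)

/-- The pointwise variation of the second term of the functional. `D` hits `Td₂(R, R)`, the
potential `f`, or the powers of the moving form; exact terms absorb the integrations by parts. The
relation `i∂∂̄f = ω_H - ω_G` makes the geometric sums telescope to a difference of powers and to a
single power of `ω_H`. -/
theorem der_toddForm_mul {G : Matrix (Fin n) (Fin n) C} (hG : 𝒟.IsKahlerMatrix G) (f : C)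
    {H : Matrix (Fin n) (Fin n) C} (hGH : H = G + 𝒟.hessian f) (hH : IsUnit H.det)
    (D : Derivation ℂ C C) (hD : ∀ j f, D (𝒟.d j f) = 𝒟.d j (D f))
    (hDb : ∀ j f, D (𝒟.db j f) = 𝒟.db j (D f)) (hGD : G.map D = 0) (m : ℕ) :
    FA.der D (𝒟.toddForm H * ∑ s ∈ Finset.range m,
        f • ((Complex.I • FA.form11 H) ^ s * (Complex.I • FA.form11 G) ^ (m - 1 - s)))
      = (2 * Complex.I) • (FA.form11 (𝒟.toddVariation H (H.map D * H⁻¹)) *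
          ((Complex.I • FA.form11 H) ^ m - (Complex.I • FA.form11 G) ^ m))
        + (m : ℂ) • (D f • (𝒟.toddForm H * (Complex.I • FA.form11 H) ^ (m - 1)))
        + FA.del 𝒟 ((2 : ℂ) • (FA.form01 (fun k => 𝒟.db k f) *
              FA.form11 (𝒟.toddVariation H (H.map D * H⁻¹)) * ∑ s ∈ Finset.range m,
              ((Complex.I • FA.form11 H) ^ s * (Complex.I • FA.form11 G) ^ (m - 1 - s)))
            + Complex.I • ((f • FA.form01 fun k => 𝒟.db k (D f)) * (𝒟.toddForm H *
              ∑ s ∈ Finset.range m, (s : ℂ) • ((Complex.I • FA.form11 H) ^ (s - 1)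
                * (Complex.I • FA.form11 G) ^ (m - 1 - s)))))
        + FA.delb 𝒟 ((2 : ℂ) • ((FA.form21 fun j l m => f * td2 (𝒟.cov H j (H.map D * H⁻¹))
              (𝒟.curvature H l m)) * ∑ s ∈ Finset.range m,
              ((Complex.I • FA.form11 H) ^ s * (Complex.I • FA.form11 G) ^ (m - 1 - s)))
            + Complex.I • ((D f • FA.form10 fun j => 𝒟.d j f) * (𝒟.toddForm H *
              ∑ s ∈ Finset.range m, (s : ℂ) • ((Complex.I • FA.form11 H) ^ (s - 1)
                * (Complex.I • FA.form11 G) ^ (m - 1 - s))))) := by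
  have hHK : 𝒟.IsKahlerMatrix H := hGH ▸ hG.add_hessian f
  have hx := hHK.isClosedEven.smul Complex.I
  have hy := hG.isClosedEven.smul Complex.I
  have hTd := 𝒟.isClosedEven_toddForm hH
  have hxy : Complex.I • FA.form11 (𝒟.hessian f) = Complex.I • FA.form11 H - Complex.I • FA.form11 G := by
    rw [← smul_sub, ← FA.form11_sub, hGH, add_sub_cancel_left]
  have hhess : FA.form11 (𝒟.hessian f)
      = (-Complex.I) • (Complex.I • FA.form11 H - Complex.I • FA.form11 G) := by
    rw [← hxy, smul_smul]
    simp
  have hdx : FA.der D (Complex.I • FA.form11 H) = Complex.I • FA.form11 (𝒟.hessian (D f)) := by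
    rw [map_smul, FA.der_form11, hGH, map_add_derivation, hGD, zero_add]
    congr 2
    ext j k
    simp [hessian, hD, hDb]
  have hdy : FA.der D (Complex.I • FA.form11 G) = 0 := by
    rw [map_smul, FA.der_form11, hGD]
    simp [FA.form11]
  set x := Complex.I • FA.form11 H with hxdef
  set y := Complex.I • FA.form11 G with hydef
  set W := ∑ s ∈ Finset.range m, x ^ s * y ^ (m - 1 - s) with hW
  set W' := ∑ s ∈ Finset.range m, (s : ℂ) • (x ^ (s - 1) * y ^ (m - 1 - s)) with hW'
  have hWc : FA.IsClosedEven 𝒟 W :=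
    FA.isClosedEven_sum _ fun s _ => (hx.pow s).mul (hy.pow _)
  have hWc' : FA.IsClosedEven 𝒟 (𝒟.toddForm H * W') :=
    hTd.mul (FA.isClosedEven_sum _ fun s _ => ((hx.pow _).mul (hy.pow _)).smul _)
  set B := FA.form11 (𝒟.toddVariation H (H.map D * H⁻¹)) with hB
  have e1 : ∑ s ∈ Finset.range m, f • (x ^ s * y ^ (m - 1 - s)) = f • W := by
    rw [hW, Finset.smul_sum]
  have e2 : FA.der D W = FA.der D x * W' := by
    rw [hW, hW', map_sum, Finset.mul_sum]
    -- The form `y` of the base metric does not depend on the parameter, so only powers of `x` are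
    -- differentiated.
    refine Finset.sum_congr rfl fun s _ => ?_
    rw [FA.der_mul, FA.der_pow hx.central, FA.der_pow hy.central, hdy]
    simp [mul_assoc]
  -- Green's identity trades `f ∂∂̄(Df)` for `Df ∂∂̄f`, and `i∂∂̄f` is `x - y`.
  have e3 : f • FA.der D x = D f • (x - y) + Complex.I • (FA.del 𝒟 (f • FA.form01 fun k => 𝒟.db k (D f))
      + FA.delb 𝒟 (D f • FA.form10 fun j => 𝒟.d j f)) := by
    rw [← 𝒟.smul_form11_hessian_sub, hdx, ← hxy, smul_sub, smul_comm f Complex.I,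
      smul_comm (D f) Complex.I, add_sub_cancel]
  -- Here `∂∂̄` moves from the velocity to `f`, which again produces the factor `x - y`.
  have e4 : f • FA.der D (𝒟.toddForm H) = (2 : ℂ) • (Complex.I • ((x - y) * B)
      + (FA.del 𝒟 (FA.form01 (fun k => 𝒟.db k f) * B)
        + FA.delb 𝒟 (FA.form21 fun j l m => f * td2 (𝒟.cov H j (H.map D * H⁻¹))
          (𝒟.curvature H l m)))) := by
    rw [𝒟.der_toddForm hH D hD hDb, smul_comm, ← 𝒟.smul_form22_todd hH, hhess, smul_mul_assoc]
    congr 1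
    rw [neg_smul]
    abel
  have e5 : (x - y) * W = x ^ m - y ^ m := Commute.mul_geom_sum₂ (hx.central y) m
  have e6 := sum_geom_derivative (hx.central y) m
  rw [← hW, ← hW'] at e6
  have hc := hTd.central
  rw [e1, FA.der_mul, FA.der_smul, e2, map_add (FA.del 𝒟), map_add (FA.delb 𝒟),
    map_smul (FA.del 𝒟), map_smul (FA.del 𝒟), map_smul (FA.delb 𝒟), map_smul (FA.delb 𝒟), FA.del_mul hWc, FA.delb_mul hWc, FA.del_mul hWc', FA.delb_mul hWc']
  calc _ = f • FA.der D (𝒟.toddForm H) * W + D f • (𝒟.toddForm H * W)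
        + f • FA.der D x * (𝒟.toddForm H * W') := by
        rw [mul_smul_comm, mul_add, mul_smul_comm, mul_smul_comm, ← mul_assoc (𝒟.toddForm H),
          hc (FA.der D x), mul_assoc, smul_mul_assoc, smul_mul_assoc, add_assoc]
    _ = (2 * Complex.I) • ((x - y) * B * W) + D f • (𝒟.toddForm H * (W + (x - y) * W'))
        + (2 : ℂ) • (FA.del 𝒟 (FA.form01 (fun k => 𝒟.db k f) * B) * W)
        + Complex.I • (FA.del 𝒟 (f • FA.form01 fun k => 𝒟.db k (D f)) * (𝒟.toddForm H * W'))
        + (2 : ℂ) • (FA.delb 𝒟 (FA.form21 fun j l m => f * td2 (𝒟.cov H j (H.map D * H⁻¹))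
          (𝒟.curvature H l m)) * W)
        + Complex.I • (FA.delb 𝒟 (D f • FA.form10 fun j => 𝒟.d j f) * (𝒟.toddForm H * W')) := by
        rw [e3, e4]
        simp only [smul_add, add_mul, smul_mul_assoc, mul_add, smul_smul]
        rw [← mul_assoc (x - y) (𝒟.toddForm H), ← hc (x - y), mul_assoc (𝒟.toddForm H)]
        abel
    _ = _ := by
        have e7 : (x - y) * B * W = B * (x ^ m - y ^ m) := by
          rw [← e5, ← mul_assoc, FA.form11_central _ (x - y)]
        rw [e6, e7, mul_smul_comm, smul_comm (D f) (m : ℂ)]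
        abel

end DiffRing

end KahlerAlgebra

end KahlerGeom
end

noncomputable section

set_option linter.unusedSectionVars false

namespace KahlerGeom

/-! ### Contractions of the curvature of a Kähler metric -/

section Contraction

open TopologicalSpace

variable {n : ℕ} {C : Type*} [CommRing C] [Algebra ℂ C]

/-- The trace of a sesquilinear form with respect to a metric. -/
def trC (H A : Matrix (Fin n) (Fin n) C) : C := (H⁻¹ * A).trace

/-- The pairing of two sesquilinear forms with respect to a metric. -/
def pairC (H A B : Matrix (Fin n) (Fin n) C) : C := (H⁻¹ * A * H⁻¹ * B).trace

theorem trC_eq_sum (H A : Matrix (Fin n) (Fin n) C) : trC H A = ∑ j, ∑ k, H⁻¹ k j * A j k := by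
  rw [trC, Matrix.trace, Finset.sum_comm]
  simp [Matrix.mul_apply]

theorem FA.form22_sum {α : Type*} (s : Finset α)
    (τ : α → Fin n → Fin n → Fin n → Fin n → C) :
    FA.form22 (fun j k l m => ∑ a ∈ s, τ a j k l m) = ∑ a ∈ s, FA.form22 (τ a) := by
  classical
  induction s using Finset.induction_on with
  | empty => simp [FA.form22]
  | insert a s ha ih =>
    rw [Finset.sum_insert ha, ← ih, ← FA.form22_add]
    simp only [Finset.sum_insert ha]
    rfl

namespace DiffRing

variable (𝒟 : DiffRing (Fin n) C)

/-- The components `R_p^q` of the curvature as sesquilinear forms. -/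
def curvComp (h : Matrix (Fin n) (Fin n) C) (p q : Fin n) : Matrix (Fin n) (Fin n) C :=
  Matrix.of fun j k => 𝒟.curvature h j k p q

/-- The square of the norm of the curvature. -/
def curvNorm (h : Matrix (Fin n) (Fin n) C) : C :=
  ∑ p, ∑ q, pairC h (𝒟.curvComp h p q) (𝒟.curvComp h q p)

/-- The scalar curvature. -/
def scalar (h : Matrix (Fin n) (Fin n) C) : C := trC h (𝒟.ric h)

variable {𝒟} {h : Matrix (Fin n) (Fin n) C}

/-- The Kähler symmetries exchange the form indices with the endomorphism indices, so tracing the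
former also gives the Ricci curvature. -/
theorem IsKahlerMatrix.sum_curvature (hK : 𝒟.IsKahlerMatrix h) (hh : IsUnit h.det) :
    ∑ j, ∑ k, h⁻¹ k j • 𝒟.curvature h j k = 𝒟.ric h * h⁻¹ := by
  have h1 : (∑ j, ∑ k, h⁻¹ k j • 𝒟.curvature h j k) * h = 𝒟.ric h := by
    ext p q
    simp only [Finset.sum_mul, Matrix.smul_mul, Matrix.sum_apply, Matrix.smul_apply, smul_eq_mul]
    have h2 : ∀ j k, (𝒟.curvature h j k * h) p q = (𝒟.curvature h p q * h) j k := fun j k => by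
      rw [hK.curvature_symm_d hh, hK.curvature_symm_db hh]
    have h3 : 𝒟.curvature h p q = 𝒟.curvature h p q * h * h⁻¹ := by
      rw [Matrix.mul_assoc, Matrix.mul_nonsing_inv _ hh, Matrix.mul_one]
    rw [ric, Matrix.of_apply, h3, Matrix.trace]
    simp only [h2, Matrix.diag_apply, Matrix.mul_apply (M := 𝒟.curvature h p q * h)]
    exact Finset.sum_congr rfl fun j _ => Finset.sum_congr rfl fun k _ => mul_comm _ _
  rw [← h1, Matrix.mul_assoc, Matrix.mul_nonsing_inv _ hh, Matrix.mul_one]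

theorem IsKahlerMatrix.trC_toddVariation (hK : 𝒟.IsKahlerMatrix h) (hh : IsUnit h.det)
    (A : Matrix (Fin n) (Fin n) C) : trC h (𝒟.toddVariation h (A * h⁻¹))
      = (1 / 24 : ℂ) • (pairC h A (𝒟.ric h) - (3 : ℂ) • (trC h A * 𝒟.scalar h)) := by
  have h1 : trC h (𝒟.toddVariation h (A * h⁻¹))
      = td2 (A * h⁻¹) (∑ j, ∑ k, h⁻¹ k j • 𝒟.curvature h j k) := by
    rw [trC_eq_sum]
    simp only [td2_sum_right, td2_smul_right, toddVariation, Matrix.of_apply]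
  have h2 : (A * h⁻¹ * (𝒟.ric h * h⁻¹)).trace = pairC h A (𝒟.ric h) := by
    rw [← Matrix.mul_assoc, Matrix.trace_mul_comm, pairC]
    simp only [Matrix.mul_assoc]
  rw [h1, hK.sum_curvature hh, td2, h2, Matrix.trace_mul_comm A, Matrix.trace_mul_comm (𝒟.ric h)]
  rfl

/-- By `sum_curvature` the contraction of `R_p^q` over its form indices is the Ricci endomorphism,
and the sum is the trace of its square. -/
theorem IsKahlerMatrix.sum_trC_curvComp (hK : 𝒟.IsKahlerMatrix h) (hh : IsUnit h.det) :
    ∑ p, ∑ q, trC h (𝒟.curvComp h p q) * trC h (𝒟.curvComp h q p)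
      = pairC h (𝒟.ric h) (𝒟.ric h) := by
  have h1 : ∀ p q, trC h (𝒟.curvComp h p q) = (𝒟.ric h * h⁻¹) p q := fun p q => by
    rw [← hK.sum_curvature hh, trC_eq_sum]
    simp [Matrix.sum_apply, curvComp]
  have h2 : pairC h (𝒟.ric h) (𝒟.ric h) = (𝒟.ric h * h⁻¹ * (𝒟.ric h * h⁻¹)).trace := by
    rw [← Matrix.mul_assoc, Matrix.trace_mul_comm, pairC]
    simp only [Matrix.mul_assoc]
  simp only [h1, h2, Matrix.trace, Matrix.diag_apply]
  exact Finset.sum_congr rfl fun p _ => (Matrix.mul_apply ..).symm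

variable (𝒟 h) in
-- Expanding the traces gives sums of products of two (1,1)-forms, to which the top-degree formulas
-- apply.
theorem toddForm_eq : 𝒟.toddForm h = (1 / 24 : ℂ) • (∑ p, ∑ q,
      FA.form11 (𝒟.curvComp h p q) * FA.form11 (𝒟.curvComp h q p)
    - (3 : ℂ) • (FA.form11 (𝒟.ric h) * FA.form11 (𝒟.ric h))) := by
  have h1 : 𝒟.toddForm h = FA.form22 (algebraMap ℂ C (1 / 24) •
      ((fun j k l m => ∑ p, ∑ q, 𝒟.curvComp h p q j k * 𝒟.curvComp h q p l m) -
        algebraMap ℂ C 3 • fun j k l m => 𝒟.ric h j k * 𝒟.ric h l m)) := by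
    rw [toddForm]
    congr 1
    ext j k l m
    simp only [Pi.smul_apply, Pi.sub_apply, algebraMap_smul, td2, Matrix.trace, Matrix.diag_apply,
      Matrix.mul_apply, curvComp, ric, Matrix.of_apply]
  rw [h1, FA.form22_smul, FA.form22_sub, FA.form22_smul, FA.form22_mul, FA.form22_sum,
    algebraMap_smul, algebraMap_smul]
  congr 2
  refine Finset.sum_congr rfl fun p _ => ?_
  rw [FA.form22_sum]
  exact Finset.sum_congr rfl fun q _ => FA.form22_mul _ _

end DiffRing

/-! #### Top degree parts -/

section Top

variable {W : Opens (PCn n)} {H : Matrix (Fin n) (Fin n) (Sm W)} (hH : IsUnit H.det)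

/-- The volume density. -/
def vol (H : Matrix (Fin n) (Fin n) (Sm W)) : Sm W := (2 ^ n : ℂ) • H.det

theorem map_trace {R S : Type*} [CommRing R] [CommRing S] (φ : R →+* S)
    (A : Matrix (Fin n) (Fin n) R) : φ A.trace = (A.map φ).trace := by
  simp [Matrix.trace]

theorem map_trC {R S : Type*} [CommRing R] [CommRing S] (φ : R →+* S)
    {H : Matrix (Fin n) (Fin n) R} (hH : IsUnit H.det) (A : Matrix (Fin n) (Fin n) R) :
    φ (trC H A) = trC (H.map φ) (A.map φ) := by
  rw [trC, trC, ← map_nonsing_inv φ hH, ← Matrix.map_mul, map_trace]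

theorem map_pairC {R S : Type*} [CommRing R] [CommRing S] (φ : R →+* S)
    {H : Matrix (Fin n) (Fin n) R} (hH : IsUnit H.det) (A B : Matrix (Fin n) (Fin n) R) :
    φ (pairC H A B) = pairC (H.map φ) (A.map φ) (B.map φ) := by
  rw [pairC, pairC, ← map_nonsing_inv φ hH, ← Matrix.map_mul, ← Matrix.map_mul, ← Matrix.map_mul,
    map_trace]

include hH

theorem det_map_ev_ne_zero (x : W) : (H.map (Sm.ev x)).det ≠ 0 := by
  have := (hH.map (Sm.ev x)).ne_zero
  rwa [AlgHom.map_det, AlgHom.mapMatrix_apply] at this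

theorem top_form11_mul_fund_pow (A : Matrix (Fin n) (Fin n) (Sm W)) :
    (-2 * Complex.I) ^ n • FA.top (FA.form11 A * (Complex.I • FA.form11 H) ^ (n - 1))
      = (-Complex.I * ((n - 1).factorial : ℂ)) • (vol H * trC H A) := by
  refine Sm.ev_ext fun x => ?_
  have h0 := det_map_ev_ne_zero hH x
  have h1 := top_form11_mul_pow (A.map (Sm.ev x)) (H.map (Sm.ev x)) h0
  rw [tr_eq_trace] at h1
  have h2 : Sm.ev x (trC H A) = ((H.map (Sm.ev x))⁻¹ * A.map (Sm.ev x)).trace :=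
    map_trC (Sm.ev x).toRingHom hH A
  rw [map_smul, FA.map_top, map_mul (FA.ev _), map_pow (FA.ev _), map_smul, FA.ev_form11,
    FA.ev_form11, smul_pow, mul_smul_comm, map_smul, h1, map_smul, map_mul, h2, vol, map_smul,
    AlgHom.map_det, AlgHom.mapMatrix_apply]
  simp only [smul_eq_mul]
  rcases n with _ | n
  · simp [Matrix.trace]
  -- The constant is `(-2i)ⁿ iⁿ⁻¹ = -i 2ⁿ`: orientation factor against the `i` of each fundamental
  -- form.
  · have e : (-2 * Complex.I) ^ (n + 1) * Complex.I ^ n = -Complex.I * 2 ^ (n + 1) := by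
      rw [pow_succ, mul_right_comm, ← mul_pow, mul_assoc (-2 : ℂ), Complex.I_mul_I, pow_succ]
      ring
    rw [Nat.add_sub_cancel, ← mul_assoc, e]
    ring

theorem top_form11_mul_mul_fund_pow (A B : Matrix (Fin n) (Fin n) (Sm W)) :
    ((n - 1 : ℕ) : ℂ) • (-2 * Complex.I) ^ n •
        FA.top (FA.form11 A * FA.form11 B * (Complex.I • FA.form11 H) ^ (n - 1 - 1))
      = (-((n - 1).factorial : ℂ)) • (vol H * (trC H A * trC H B - pairC H A B)) := by
  refine Sm.ev_ext fun x => ?_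
  have h0 := det_map_ev_ne_zero hH x
  have h1 := top_form11_mul_mul_pow (A.map (Sm.ev x)) (B.map (Sm.ev x)) (H.map (Sm.ev x)) h0
  rw [tr_eq_trace, tr_eq_trace, pairing_eq_trace] at h1
  have h2 : ∀ A, Sm.ev x (trC H A) = ((H.map (Sm.ev x))⁻¹ * A.map (Sm.ev x)).trace :=
    map_trC (Sm.ev x).toRingHom hH
  have h3 : Sm.ev x (pairC H A B) = ((H.map (Sm.ev x))⁻¹ * A.map (Sm.ev x) * (H.map (Sm.ev x))⁻¹
    * B.map (Sm.ev x)).trace := map_pairC (Sm.ev x).toRingHom hH A B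
  rw [map_smul, map_smul, FA.map_top, map_mul (FA.ev _), map_mul (FA.ev _), map_pow (FA.ev _),
    map_smul, FA.ev_form11,
    FA.ev_form11, FA.ev_form11, smul_pow, mul_smul_comm, map_smul, map_smul, map_mul (Sm.ev x),
    map_sub, map_mul (Sm.ev x), h2, h2, h3, vol, map_smul, AlgHom.map_det, AlgHom.mapMatrix_apply]
  simp only [smul_eq_mul]
  rw [Nat.sub_sub, mul_left_comm, mul_left_comm _ (Complex.I ^ _), h1, mul_assoc ((2 : ℂ) ^ n)]
  generalize ((H.map (Sm.ev x))⁻¹ * A.map (Sm.ev x)).trace * ((H.map (Sm.ev x))⁻¹ *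
    B.map (Sm.ev x)).trace - ((H.map (Sm.ev x))⁻¹ * A.map (Sm.ev x) * (H.map (Sm.ev x))⁻¹ *
    B.map (Sm.ev x)).trace = d₀ at h1 ⊢
  generalize (H.map (Sm.ev x)).det * d₀ = d at h1 ⊢
  rcases n with _ | _ | n
  -- For `n ≤ 1` the factor `n - 1` is zero, and the pointwise identity `h1` then forces the other
  -- side to vanish as well.
  · have : d = 0 := by simpa using h1.symm
    simp [this]
  · have : d = 0 := by simpa using h1.symm
    simp [this]
  -- Here one factor `i` fewer occurs: `(-2i)ⁿ iⁿ⁻² = -2ⁿ`.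
  · have e : (-2 * Complex.I) ^ (n + 1 + 1) * Complex.I ^ n = -2 ^ (n + 1 + 1) := by
      rw [pow_succ, pow_succ, mul_right_comm, mul_right_comm _ _ (Complex.I ^ n), ← mul_pow,
        mul_assoc (-2 : ℂ), Complex.I_mul_I, pow_succ, pow_succ,
        show (-2 * -1 : ℂ) = 2 by norm_num]
      linear_combination 2 ^ n * 4 * Complex.I_mul_I
    rw [show n + 1 + 1 - (1 + 1) = n by omega, ← mul_assoc, e]
    ring

end Top

end Contraction

end KahlerGeom
end

noncomputable section

set_option linter.unusedSectionVars false

namespace KahlerGeom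

/-! ### Integrated variation formulas -/

section Variation

open TopologicalSpace

variable {n : ℕ} {M : Type*} [TopologicalSpace M] [ChartedSpace (Cn n) M] {Q : Opens (ℝ × ℝ)}
  [IsManifold 𝓘(ℂ, Cn n) ω M]

/-- Derivatives of forms with respect to parameters. -/
def derF (v : ℝ × ℝ) (ζ : FormField n M Q) : FormField n M Q := fun e => FA.der (Sm.dp v) (ζ e)

/-- Derivatives of functions with respect to parameters. -/
def dpF (v : ℝ × ℝ) (f : SmField n M Q) : SmField n M Q := fun e => Sm.dp v (f e)

theorem dpF_topF (v : ℝ × ℝ) (ζ : FormField n M Q) : dpF v (topF ζ) = topF (derF v ζ) := by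
  ext1 e
  rw [dpF, topF, topF, derF, (Sm.dp v).map_smul, FA.derivation_top]

/-- The fundamental form. -/
def fundF (H : MatField n M Q) : FormField n M Q := fun e => Complex.I • FA.form11 (H e)

theorem isForm_fundF {H : MatField n M Q} (hH : IsTens H) : IsForm (fundF H) :=
  (isForm_form11 hH).smul Complex.I

/-- The form `Td₂(U, R)`, where `U` is the velocity in a direction of the parameter space. -/
def bcForm (H : MatField n M Q) (v : ℝ × ℝ) : FormField n M Q :=
  fun e => FA.form11 (toddVarF H (velF H v) e)

theorem isForm_bcForm {H : MatField n M Q} (hH : IsTens H) (hu : ∀ e, IsUnit (H e).det)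
    (v : ℝ × ℝ) : IsForm (bcForm H v) :=
  isForm_form11 (isTens_toddVarF hH hu (isEndo_velF hH hu v))

theorem dp_del (W : Opens (PCn n)) (v : ℝ × ℝ) (j : Fin n) (f : Sm W) :
    Sm.dp v ((Sm.diffRing W).d j f) = (Sm.diffRing W).d j (Sm.dp v f) := (Sm.del_der j _ f).symm

theorem dp_delb (W : Opens (PCn n)) (v : ℝ × ℝ) (j : Fin n) (f : Sm W) :
    Sm.dp v ((Sm.diffRing W).db j f) = (Sm.diffRing W).db j (Sm.dp v f) := (Sm.delb_der j _ f).symm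

/-- The metrics are Kähler. -/
def IsKahlerF (H : MatField n M Q) : Prop :=
  ∀ e, (Sm.diffRing (dom Q e.1)).IsKahlerMatrix (H e)

theorem IsKahlerF.isClosedEven {H : MatField n M Q} (hK : IsKahlerF H) (e : atlas (Cn n) M) :
    FA.IsClosedEven (Sm.diffRing (dom Q e.1)) (fundF H e) := (hK e).isClosedEven.smul _

variable [T2Space M] [CompactSpace M]

/-- The exact terms of `der_form11_toddVariation` stay exact after wedging with the closed
parameter-independent form `W`, so Stokes removes them. This is closedness of the 1-form `v ↦ ∫
Td₂(U_v, R) ∧ W` in the parameters. -/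
theorem mint_dpF_bcForm_symm {H : MatField n M Q} (hH : IsTens H) (hu : ∀ e, IsUnit (H e).det)
    {W : FormField n M Q} (hW : IsForm W)
    (hWc : ∀ e, FA.IsClosedEven (Sm.diffRing (dom Q e.1)) (W e)) (v v' : ℝ × ℝ)
    (hv : derF v W = 0) (hv' : derF v' W = 0) {q : ℝ × ℝ} (hq : q ∈ Q) :
    mint (dpF v (topF (bcForm H v' * W))) q = mint (dpF v' (topF (bcForm H v * W))) q := by
  have hU := isEndo_velF hH hu v
  have hV := isEndo_velF hH hu v'
  have h1 : ∀ (v v' : ℝ × ℝ), derF v W = 0 → derF v (bcForm H v' * W)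
      = fun e => FA.der (Sm.dp v) (bcForm H v' e) * W e := fun v v' hv => by
    ext1 e
    have : FA.der (Sm.dp v) (W e) = 0 := congrFun hv e
    rw [derF, Pi.mul_apply, FA.der_mul, this, mul_zero, add_zero]
  have h2 : derF v (bcForm H v' * W) - derF v' (bcForm H v * W)
      = delF ((fun e => FA.form01 fun k => td2 (velF H v e) ((velF H v' e).map (Sm.delb k))) * W)
        + delbF ((fun e => FA.form10 fun j => td2 (covF H (velF H v) e j) (velF H v' e)) * W) := by
    rw [h1 v v' hv, h1 v' v hv']
    ext1 e
    have h3 := (Sm.diffRing (dom Q e.1)).der_form11_toddVariation (hu e) (Sm.dp v) (Sm.dp v')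
      (dp_del _ v) (dp_delb _ v) (dp_del _ v') (dp_delb _ v') (Sm.der_comm _ _)
    simp only [Pi.sub_apply, Pi.add_apply, delF, delbF, Pi.mul_apply]
    rw [FA.del_mul (hWc e), FA.delb_mul (hWc e), ← sub_mul, ← add_mul]
    exact congrArg (· * W e) h3
  rw [← sub_eq_zero, ← mint_sub _ _ hq, dpF_topF, dpF_topF, ← topF_sub, h2, topF_add, mint_add _ _ hq,
    mint_topF_delF ((isForm_form01 (isCov01_td2 hH hu hU hV)).mul hW) hq,
    mint_topF_delbF ((isForm_form10 (isCov10_td2 hH hu hU hV)).mul hW) hq, add_zero]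

variable {G H : MatField n M Q} (hG : IsTens G) (hGK : IsKahlerF G) {f : SmField n M Q} (hf : IsFn f)
  (hGH : H = G + hessF f) (hu : ∀ e, IsUnit (H e).det)

theorem IsKahlerF.add_hessF {G : MatField n M Q} (hGK : IsKahlerF G) (f : SmField n M Q) :
    IsKahlerF (G + hessF f) := fun e => (hGK e).add_hessian (f e)

/-- The form `Td₂(R, R) ∧ ∑ f ω_Hˢ ∧ ω_Gᵐ⁻¹⁻ˢ`. -/
def toddSum (G H : MatField n M Q) (f : SmField n M Q) (m : ℕ) : FormField n M Q := fun e =>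
  toddF H e * ∑ s ∈ Finset.range m, f e • (fundF H e ^ s * fundF G e ^ (m - 1 - s))

include hG hGK hf hGH hu

/-- Integrated form of `der_toddForm_mul`: `ζ` and `η` are globally defined, so their derivatives
integrate to zero. -/
theorem mint_dpF_toddSum (v : ℝ × ℝ) (hGv : ∀ e, (G e).map (Sm.dp v) = 0) (m : ℕ) {q : ℝ × ℝ}
    (hq : q ∈ Q) : mint (dpF v (topF (toddSum G H f m))) q
      = 2 * Complex.I * (mint (topF (bcForm H v * fundF H ^ m)) q
          - mint (topF (bcForm H v * fundF G ^ m)) q)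
        + m * mint (topF fun e => Sm.dp v (f e) • (toddF H e * fundF H e ^ (m - 1))) q := by
  have hHt : IsTens H := hGH ▸ hG.add (isTens_hessF hf)
  have hU := isEndo_velF hHt hu v
  have hxF := isForm_fundF hHt
  have hyF := isForm_fundF hG
  set W : FormField n M Q := ∑ s ∈ Finset.range m, fundF H ^ s * fundF G ^ (m - 1 - s) with hW
  set W' : FormField n M Q := toddF H * ∑ s ∈ Finset.range m,
    (s : ℂ) • (fundF H ^ (s - 1) * fundF G ^ (m - 1 - s)) with hW'
  have hWf : IsForm W := isForm_sum _ fun s _ => (hxF.pow s).mul (hyF.pow _)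
  have hWf' : IsForm W' := (isForm_toddF hHt hu).mul
    (isForm_sum _ fun s _ => ((hxF.pow _).mul (hyF.pow _)).smul _)
  have hWe : ∀ e, W e = ∑ s ∈ Finset.range m, fundF H e ^ s * fundF G e ^ (m - 1 - s) := fun e => by
    rw [hW, Finset.sum_apply]; rfl
  have hWe' : ∀ e, W' e = toddF H e * ∑ s ∈ Finset.range m,
      (s : ℂ) • (fundF H e ^ (s - 1) * fundF G e ^ (m - 1 - s)) := fun e => by
    rw [hW', Pi.mul_apply, Finset.sum_apply]; rfl
  set ζ : FormField n M Q := (2 : ℂ) • ((fun e => FA.form01 fun k => Sm.delb k (f e)) * bcForm H v * W)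
    + Complex.I • ((fun e => f e • FA.form01 fun k => Sm.delb k (Sm.dp v (f e))) * W') with hζ
  set η : FormField n M Q := (2 : ℂ) • ((fun e => FA.form21 fun j l m =>
      f e * td2 (covF H (velF H v) e j) (curvF H e l m)) * W)
    + Complex.I • ((fun e => Sm.dp v (f e) • FA.form10 fun j => Sm.del j (f e)) * W') with hη
  have hζf : IsForm ζ := ((((isForm_form01 hf.delb).mul (isForm_bcForm hHt hu v)).mul hWf).smul _).add
    (((IsForm.fn_smul hf (isForm_form01 (hf.dp v).delb)).mul hWf').smul _)
  have hηf : IsForm η := (((isForm_form21_td2 hHt hu hU hf).mul hWf).smul _).add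
    (((IsForm.fn_smul (hf.dp v) (isForm_form10 hf.del)).mul hWf').smul _)
  have key : derF v (toddSum G H f m)
      = (2 * Complex.I) • (bcForm H v * fundF H ^ m - bcForm H v * fundF G ^ m)
        + (m : ℂ) • (fun e => Sm.dp v (f e) • (toddF H e * fundF H e ^ (m - 1))) + delF ζ + delbF η := by
    ext1 e
    have h := (Sm.diffRing (dom Q e.1)).der_toddForm_mul (hGK e) (f e) (H := H e)
      (by rw [hGH]; rfl) (hu e) (Sm.dp v) (dp_del _ v) (dp_delb _ v) (hGv e) m
    rw [mul_sub] at h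
    simp only [Pi.add_apply, Pi.smul_apply, Pi.sub_apply, Pi.mul_apply, Pi.pow_apply, delF, delbF, hζ,
      hη, hWe, hWe']
    exact h
  rw [dpF_topF, key, topF_add, topF_add, topF_add, mint_add _ _ hq, mint_add _ _ hq, mint_add _ _ hq,
    mint_topF_delF hζf hq, mint_topF_delbF hηf hq, topF_smul, topF_smul, mint_smul, mint_smul,
    topF_sub, mint_sub _ _ hq, add_zero, add_zero]

omit hG hGK hf hGH hu

/-- The density of `ψ (ΔS / 6 - (|R|² - 4 |Ric|² + 3 S²) / 24)`. -/
def gammaDensity (H : MatField n M Q) (ψ : SmField n M Q) : SmField n M Q := fun e =>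
  vol (H e) * (ψ e * ((1 / 6 : ℂ) • trC (H e) ((Sm.diffRing (dom Q e.1)).hessian
      ((Sm.diffRing (dom Q e.1)).scalar (H e)))
    - (1 / 24 : ℂ) • ((Sm.diffRing (dom Q e.1)).curvNorm (H e)
      - (4 : ℂ) • pairC (H e) (ricF H e) (ricF H e)
      + (3 : ℂ) • (Sm.diffRing (dom Q e.1)).scalar (H e) ^ 2)))

end Variation

end KahlerGeom
end

noncomputable section

set_option linter.unusedSectionVars false

namespace KahlerGeom

/-! ### The first variation as an integral against `ψ` -/

section Gamma

open TopologicalSpace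

variable {n : ℕ}

/-- Each product of (1,1)-forms contributes a product of traces minus a pairing. Summed over the
components `R_p^q` this is `|Ric|² - |R|²`, and for the Ricci form it is `S² - |Ric|²`. -/
theorem top_fn_smul_toddForm {W : Opens (PCn n)} {H : Matrix (Fin n) (Fin n) (Sm W)}
    (hK : (Sm.diffRing W).IsKahlerMatrix H) (hH : IsUnit H.det) (ψ : Sm W) :
    ((n - 1 : ℕ) : ℂ) • (-2 * Complex.I) ^ n • FA.top (ψ • ((Sm.diffRing W).toddForm H
        * (Complex.I • FA.form11 H) ^ (n - 1 - 1)))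
      = (-((n - 1).factorial : ℂ) * (1 / 24)) • (ψ * (vol H *
        (pairC H ((Sm.diffRing W).ric H) ((Sm.diffRing W).ric H) - (Sm.diffRing W).curvNorm H
          - (3 : ℂ) • ((Sm.diffRing W).scalar H ^ 2
            - pairC H ((Sm.diffRing W).ric H) ((Sm.diffRing W).ric H))))) := by
  have h := fun A B => top_form11_mul_mul_fund_pow hH A B
  rw [FA.top_smul, ← mul_smul_comm, ← mul_smul_comm, DiffRing.toddForm_eq, smul_mul_assoc, sub_mul,
    smul_mul_assoc, Finset.sum_mul]
  simp only [Finset.sum_mul, map_smul, map_sub, map_sum]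
  rw [smul_comm _ (1 / 24 : ℂ), smul_comm _ (1 / 24 : ℂ), smul_sub, smul_sub, smul_comm _ (3 : ℂ),
    smul_comm _ (3 : ℂ), h]
  simp only [Finset.smul_sum]
  simp only [h]
  have e : ∑ p, ∑ q, (-((n - 1).factorial : ℂ)) • (vol H * (trC H ((Sm.diffRing W).curvComp H p q)
      * trC H ((Sm.diffRing W).curvComp H q p)
        - pairC H ((Sm.diffRing W).curvComp H p q) ((Sm.diffRing W).curvComp H q p)))
      = (-((n - 1).factorial : ℂ)) • (vol H * (pairC H ((Sm.diffRing W).ric H) ((Sm.diffRing W).ric H)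
        - (Sm.diffRing W).curvNorm H)) := by
    rw [← hK.sum_trC_curvComp hH, DiffRing.curvNorm]
    simp only [← Finset.smul_sum, ← Finset.mul_sum, ← Finset.sum_sub_distrib]
  refine Sm.ev_ext fun x => ?_
  have e' := congrArg (Sm.ev x) e
  simp only [map_sub, map_smul, map_mul, map_sum, map_pow, smul_eq_mul, Finset.mul_sum, mul_sub] at e' ⊢
  have e2 := congrArg (Sm.ev x ψ * (1 / 24) * ·) e'
  simp only [Finset.mul_sum, mul_sub] at e2
  have hs : trC H ((Sm.diffRing W).ric H) = (Sm.diffRing W).scalar H := rfl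
  rw [hs]
  refine (congrArg (· - _) ((Finset.sum_congr rfl fun p _ => Finset.sum_congr rfl fun q _ => ?_).trans
    e2)).trans ?_ <;> ring

variable {M : Type*} [TopologicalSpace M] [ChartedSpace (Cn n) M] {Q : Opens (ℝ × ℝ)}
  [IsManifold 𝓘(ℂ, Cn n) ω M] [T2Space M] [CompactSpace M]

theorem isFn_scalar {H : MatField n M Q} (hH : IsTens H) (hu : ∀ e, IsUnit (H e).det) :
    IsFn fun e => (Sm.diffRing (dom Q e.1)).scalar (H e) := by
  have h := ((isTens_ricF hH hu).mul_inv hH hu).trace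
  have e : ∀ e, (Sm.diffRing (dom Q e.1)).scalar (H e) = (ricF H e * (H e)⁻¹).trace :=
    fun e => Matrix.trace_mul_comm (H e)⁻¹ (ricF H e)
  simpa only [e] using h

/-- Pointwise, the left side differs from the density of the 1-form by multiples of two Green-type
expressions, each with integral zero. The truncated exponent `n - 1 - 1` matters only when `n ≤ 1`,
where its coefficient `n - 1` is zero. -/
theorem mint_gammaDensity {H : MatField n M Q} (hH : IsTens H) (hu : ∀ e, IsUnit (H e).det)
    (hK : IsKahlerF H) {ψ : SmField n M Q} (hψ : IsFn ψ) {q : ℝ × ℝ} (hq : q ∈ Q) :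
    -2 * Complex.I * mint (topF ((fun e => FA.form11 (toddVarF H (fun e => hessF ψ e * (H e)⁻¹) e))
          * fundF H ^ (n - 1))) q
        - ((n - 1 : ℕ) : ℂ) * mint (topF fun e => ψ e • (toddF H e * fundF H e ^ (n - 1 - 1))) q
      = ((n - 1).factorial : ℂ) * mint (gammaDensity H ψ) q := by
  have hx := isForm_fundF hH
  have hS := isFn_scalar hH hu
  set S : SmField n M Q := fun e => (Sm.diffRing (dom Q e.1)).scalar (H e) with hSdef
  set one : SmField n M Q := fun e => 1
  have hone : IsFn one := fun e e' => by rw [map_one, map_one]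
  set W : FormField n M Q := (fun e => FA.form11 (ricF H e)) * fundF H ^ (n - 1 - 1) with hW
  have hWf : IsForm W := (isForm_form11 (isTens_ricF hH hu)).mul (hx.pow _)
  have hWc : ∀ e, FA.IsClosedEven (Sm.diffRing (dom Q e.1)) (W e) := fun e =>
    (DiffRing.isClosedEven_ric _ (hu e)).mul ((hK.isClosedEven e).pow _)
  have stokes : ∀ {f g : SmField n M Q}, IsFn f → IsFn g → ∀ {W : FormField n M Q}, IsForm W →
      (∀ e, FA.IsClosedEven (Sm.diffRing (dom Q e.1)) (W e)) →
      mint (topF fun e => (f e • FA.form11 (hessF g e) - g e • FA.form11 (hessF f e)) * W e) q = 0 := by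
    intro f g hf hg W hWf hWc
    have h : (fun e => (f e • FA.form11 (hessF g e) - g e • FA.form11 (hessF f e)) * W e)
        = delF ((fun e => f e • FA.form01 fun k => Sm.delb k (g e)) * W)
          + delbF ((fun e => g e • FA.form10 fun j => Sm.del j (f e)) * W) := by
      ext1 e
      simp only [Pi.add_apply, Pi.mul_apply, delF, delbF]
      rw [FA.del_mul (hWc e), FA.delb_mul (hWc e), ← add_mul]
      exact congrArg (· * W e) ((Sm.diffRing (dom Q e.1)).smul_form11_hessian_sub (f e) (g e))
    rw [h, topF_add, mint_add _ _ hq,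
      mint_topF_delF ((IsForm.fn_smul hf (isForm_form01 hg.delb)).mul hWf) hq,
      mint_topF_delbF ((IsForm.fn_smul hg (isForm_form10 hf.del)).mul hWf) hq, add_zero]
  -- Green's identity with `f = 1` against the closed form `Ric ∧ ωⁿ⁻²`: it replaces `∫ ⟨∂∂̄ψ, Ric⟩`
  -- by `∫ S Δψ`.
  have s1 := stokes hone hψ hWf hWc
  -- Self-adjointness of the Laplacian: `∫ S Δψ = ∫ ψ ΔS`.
  have s2 := stokes hS hψ (hx.pow (n - 1)) fun e => (hK.isClosedEven e).pow _
  have key : (-2 * Complex.I) • topF ((fun e => FA.form11 (toddVarF H (fun e => hessF ψ e * (H e)⁻¹) e))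
          * fundF H ^ (n - 1))
        - ((n - 1 : ℕ) : ℂ) • (topF fun e => ψ e • (toddF H e * fundF H e ^ (n - 1 - 1)))
      = ((n - 1).factorial : ℂ) • gammaDensity H ψ
        - (1 / 12 * ((n - 1 : ℕ) : ℂ)) • (topF fun e => (one e • FA.form11 (hessF ψ e)
          - ψ e • FA.form11 (hessF one e)) * W e)
        + (Complex.I / 6) • (topF fun e => (S e • FA.form11 (hessF ψ e)
          - ψ e • FA.form11 (hessF S e)) * (fundF H ^ (n - 1)) e) := by
    ext1 e
    have t0 : FA.form11 (hessF one e) = 0 := by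
      simp [FA.form11, hessF, DiffRing.hessian, one]
    have t1 := top_form11_mul_fund_pow (hu e) (toddVarF H (fun e => hessF ψ e * (H e)⁻¹) e)
    have t2 := top_form11_mul_mul_fund_pow (hu e) (hessF ψ e) (ricF H e)
    have t3 := top_form11_mul_fund_pow (hu e) (S e • hessF ψ e - ψ e • hessF S e)
    have t4 := top_fn_smul_toddForm (hK e) (hu e) (ψ e)
    have t5 : trC (H e) (toddVarF H (fun e => hessF ψ e * (H e)⁻¹) e) = _ :=
      (hK e).trC_toddVariation (hu e) (hessF ψ e)
    have t6 : trC (H e) (S e • hessF ψ e - ψ e • hessF S e)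
        = S e * trC (H e) (hessF ψ e) - ψ e * trC (H e) (hessF S e) := by
      simp [trC, Matrix.mul_sub, Matrix.trace_sub, Matrix.trace_smul]
    have t7 : trC (H e) (ricF H e) = S e := rfl
    rw [t5] at t1
    rw [t6, FA.form11_sub, FA.form11_smul, FA.form11_smul] at t3
    rw [t7] at t2
    simp only [Pi.sub_apply, Pi.add_apply, Pi.smul_apply, topF, hW, Pi.mul_apply, Pi.pow_apply, t0,
      smul_zero, sub_zero, one, one_smul, gammaDensity, ← mul_assoc]
    simp only [fundF] at *
    change _ • _ • FA.top (FA.form11 _ * _) - _ • _ • FA.top (ψ e • (DiffRing.toddForm _ (H e) * _)) = _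
    rw [t1, t4, mul_smul (1 / 12 : ℂ), t2, t3]
    refine Sm.ev_ext fun x => ?_
    simp only [map_sub, map_add, map_smul, map_mul, map_pow, smul_eq_mul]
    have hS' : (Sm.diffRing (dom Q e.1)).scalar (H e) = S e := rfl
    have hR : (Sm.diffRing (dom Q e.1)).ric (H e) = ricF H e := rfl
    have hL : (Sm.diffRing (dom Q e.1)).hessian (S e) = hessF S e := rfl
    rw [hS', hR, hL]
    -- The two sides differ only by the rule `i² = -1`, applied to the products of `-2i` and `i/6`
    -- with the `-i` of `top_form11_mul_fund_pow`.
    linear_combination (((n - 1).factorial : ℂ) * Sm.ev x (vol (H e)) * (1 / 12 *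
      (Sm.ev x (pairC (H e) (hessF ψ e) (ricF H e)) - 3 * (Sm.ev x (trC (H e) (hessF ψ e)) * Sm.ev x (S e)))
      + 1 / 6 * (Sm.ev x (S e) * Sm.ev x (trC (H e) (hessF ψ e))
        - Sm.ev x (ψ e) * Sm.ev x (trC (H e) (hessF S e))))) * Complex.I_mul_I
  have hm := congrArg (fun F => mint F q) key
  rw [mint_sub _ _ hq, mint_add _ _ hq, mint_sub _ _ hq, mint_smul, mint_smul, mint_smul, mint_smul,
    mint_smul, s1, s2, mul_zero, mul_zero, sub_zero, add_zero] at hm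
  exact hm

end Gamma

end KahlerGeom
end

noncomputable section

set_option linter.unusedSectionVars false

namespace KahlerGeom

/-! ### Parameter integrals of closed forms -/

section Parameter

open TopologicalSpace MeasureTheory

/-- If `A dt + B ds` is closed, then the derivative of `∫₀¹ A dt` is given by the boundary values
of `B`. -/
theorem hasDerivAt_integral_of_closed {A B A' : ℝ × ℝ → ℂ} {Q : Set (ℝ × ℝ)} (hQ : IsOpen Q)
    (hA : ContinuousOn A Q) (hA' : ContinuousOn A' Q)
    (h1 : ∀ q ∈ Q, HasDerivAt (fun s => A (s, q.2)) (A' q) q.1)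
    (h2 : ∀ q ∈ Q, HasDerivAt (fun t => B (q.1, t)) (A' q) q.2) {s₀ : ℝ}
    (hs : ∀ t ∈ Set.Icc (0 : ℝ) 1, (s₀, t) ∈ Q) :
    HasDerivAt (fun s => ∫ t in (0 : ℝ)..1, A (s, t)) (B (s₀, 1) - B (s₀, 0)) s₀ := by
  -- The tube lemma gives a ball around `s₀` whose product with `[0, 1]` stays in the domain;
  -- compactness then bounds `A'` uniformly.
  obtain ⟨U, V, hU, hV, hsU, hVI, hUV⟩ := generalized_tube_lemma (isCompact_singleton (x := s₀))
    (isCompact_Icc (a := (0 : ℝ)) (b := 1)) hQ (by rintro ⟨s, t⟩ ⟨rfl, ht⟩; exact hs t ht)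
  obtain ⟨ε, hε, hB⟩ := Metric.nhds_basis_closedBall.mem_iff.1 (hU.mem_nhds (hsU rfl))
  have hmem : ∀ s ∈ Metric.closedBall s₀ ε, ∀ t ∈ Set.Icc (0 : ℝ) 1, (s, t) ∈ Q :=
    fun s hs t ht => hUV ⟨hB hs, hVI ht⟩
  obtain ⟨C, hC⟩ := ((isCompact_closedBall s₀ ε).prod (isCompact_Icc (a := (0 : ℝ))
    (b := 1))).exists_bound_of_continuousOn (hA'.mono fun q hq => hmem q.1 hq.1 q.2 hq.2)
  have hcont : ∀ {A : ℝ × ℝ → ℂ}, ContinuousOn A Q → ∀ s ∈ Metric.closedBall s₀ ε,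
      ContinuousOn (fun t => A (s, t)) (Set.Icc (0 : ℝ) 1) := fun hA s hs =>
    hA.comp (by fun_prop) fun t ht => hmem s hs t ht
  have hint : ∀ {A : ℝ × ℝ → ℂ}, ContinuousOn A Q → ∀ s ∈ Metric.closedBall s₀ ε,
      IntervalIntegrable (fun t => A (s, t)) volume 0 1 := fun hA s hs =>
    (hcont hA s hs).intervalIntegrable_of_Icc zero_le_one
  have hs₀ : s₀ ∈ Metric.closedBall s₀ ε := Metric.mem_closedBall_self hε.le
  have hIoc : ∀ t ∈ Set.uIoc (0 : ℝ) 1, t ∈ Set.Icc (0 : ℝ) 1 := fun t ht => by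
    rw [Set.uIoc_of_le zero_le_one] at ht
    exact Set.Ioc_subset_Icc_self ht
  have key := (intervalIntegral.hasDerivAt_integral_of_dominated_loc_of_deriv_le (μ := volume)
    (F := fun s t => A (s, t)) (F' := fun s t => A' (s, t)) (x₀ := s₀) (a := 0) (b := 1)
    (bound := fun _ => C) (Metric.closedBall_mem_nhds s₀ hε)
    (by
      filter_upwards [Metric.closedBall_mem_nhds s₀ hε] with s hs
      exact (hint hA s hs).aestronglyMeasurable_restrict_uIoc)
    (hint hA s₀ hs₀) (hint hA' s₀ hs₀).aestronglyMeasurable_restrict_uIoc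
    (Filter.Eventually.of_forall fun t ht s hs => hC (s, t) ⟨hs, hIoc t ht⟩)
    intervalIntegrable_const
    (Filter.Eventually.of_forall fun t ht s hs => h1 (s, t) (hmem s hs t (hIoc t ht)))).2
  -- By closedness `A'` is also the `t`-derivative of `B`, so the integral is a difference of
  -- boundary values.
  rwa [intervalIntegral.integral_eq_sub_of_hasDerivAt (f := fun t => B (s₀, t))
    (fun t ht => h2 (s₀, t) (hs t (by rwa [Set.uIcc_of_le zero_le_one] at ht)))
    (hint hA' s₀ hs₀)] at key

variable {n : ℕ} {M : Type*} [TopologicalSpace M] [ChartedSpace (Cn n) M] {Q : Opens (ℝ × ℝ)}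
  [IsManifold 𝓘(ℂ, Cn n) ω M] [T2Space M] [CompactSpace M]

theorem continuousOn_mint (F : SmField n M Q) : ContinuousOn (mint F) Q := fun _ hq =>
  (hasFDerivAt_mint F hq).choose_spec.1.continuousAt.continuousWithinAt

theorem hasDerivAt_mint_fst (F : SmField n M Q) {q : ℝ × ℝ} (hq : q ∈ Q) :
    HasDerivAt (fun s => mint F (s, q.2)) (mint (dpF (1, 0) F) q) q.1 := by
  obtain ⟨L, hL, hLv⟩ := hasFDerivAt_mint F hq
  have h := hL.comp_hasDerivAt q.1 (f := fun s => (s, q.2)) (f' := (1, 0))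
    ((hasDerivAt_id _).prodMk (hasDerivAt_const _ _))
  rw [hLv] at h
  exact h

theorem hasDerivAt_mint_snd (F : SmField n M Q) {q : ℝ × ℝ} (hq : q ∈ Q) :
    HasDerivAt (fun t => mint F (q.1, t)) (mint (dpF (0, 1) F) q) q.2 := by
  obtain ⟨L, hL, hLv⟩ := hasFDerivAt_mint F hq
  have h := hL.comp_hasDerivAt q.2 (f := fun t => (q.1, t)) (f' := (0, 1))
    ((hasDerivAt_const _ _).prodMk (hasDerivAt_id _))
  rw [hLv] at h
  exact h

/-- The variation of the integrated Bott–Chern form. -/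
theorem hasDerivAt_integral_bcForm {H : MatField n M Q} (hH : IsTens H)
    (hu : ∀ e, IsUnit (H e).det) {W : FormField n M Q} (hW : IsForm W)
    (hWc : ∀ e, FA.IsClosedEven (Sm.diffRing (dom Q e.1)) (W e)) (hWv : ∀ v, derF v W = 0) {s₀ : ℝ}
    (hs : ∀ t ∈ Set.Icc (0 : ℝ) 1, (s₀, t) ∈ Q) :
    HasDerivAt (fun s => ∫ t in (0 : ℝ)..1, mint (topF (bcForm H (0, 1) * W)) (s, t))
      (mint (topF (bcForm H (1, 0) * W)) (s₀, 1) - mint (topF (bcForm H (1, 0) * W)) (s₀, 0)) s₀ := by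
  refine hasDerivAt_integral_of_closed Q.isOpen (continuousOn_mint _)
    (continuousOn_mint (dpF (1, 0) (topF (bcForm H (0, 1) * W))))
    (fun q hq => hasDerivAt_mint_fst _ hq) (fun q hq => ?_) hs
  rw [mint_dpF_bcForm_symm hH hu hW hWc _ _ (hWv _) (hWv _) hq]
  exact hasDerivAt_mint_snd _ hq

theorem ev_bcForm (H : MatField n M Q) (v : ℝ × ℝ) (e : atlas (Cn n) M) (x : dom Q e.1) :
    FA.ev (Sm.ev x) (bcForm H v e) = form11 (Matrix.of fun j k =>
      td2 ((velF H v e).map (Sm.ev x)) ((curvF H e j k).map (Sm.ev x))) := by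
  rw [bcForm, FA.ev_form11]
  congr 1
  ext j k
  exact algHom_td2 (Sm.ev x) (velF H v e) (curvF H e j k)

theorem ext_topF (ζ : FormField n M Q) (e : atlas (Cn n) M) (x : dom Q e.1) :
    (topF ζ e).ext x = (-2 * Complex.I) ^ n * topCoeff (FA.ev (Sm.ev x) (ζ e)) := by
  rw [topF, Sm.ext_smul, ← Sm.ev_eq_ext, FA.map_top]

/-- The form is linear in the velocity. It removes the boundary terms at ends of paths where the
metric does not move. -/
theorem mint_topF_bcForm_mul_eq_zero {H : MatField n M Q} (v : ℝ × ℝ) (W : FormField n M Q)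
    {q : ℝ × ℝ} (hq : q ∈ Q) (h : ∀ (e : atlas (Cn n) M), ∀ z ∈ e.1.target, ∀ j k,
      (Sm.dp v (H e j k)).ext (q, z) = 0) : mint (topF (bcForm H v * W)) q = 0 := by
  rw [← mint_zero (n := n) (M := M) (Q := Q) q]
  refine mint_congr fun e z hz => ?_
  have hx : (q, z) ∈ dom Q e.1 := ⟨hq, hz⟩
  have h0 : (velF H v e).map (Sm.ev ⟨(q, z), hx⟩) = 0 := by
    rw [velF, Matrix.map_mul]
    have : ((H e).map (Sm.dp v)).map (Sm.ev ⟨(q, z), hx⟩) = 0 := by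
      ext j k
      simp only [Matrix.map_apply, Sm.ev_eq_ext, h e z hz j k, Matrix.zero_apply]
    rw [this, Matrix.zero_mul]
  have h1 : FA.ev (Sm.ev ⟨(q, z), hx⟩) (bcForm H v e) = 0 := by
    rw [ev_bcForm, h0]
    simp [td2, form11]
  have h2 := ext_topF (bcForm H v * W) e ⟨(q, z), hx⟩
  rw [Pi.mul_apply, map_mul (FA.ev _), h1, zero_mul, map_zero, mul_zero] at h2
  rw [h2, Pi.zero_apply, Sm.ext_zero]

theorem derF_fundF_pow {G : MatField n M Q} (hGK : IsKahlerF G) {v : ℝ × ℝ}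
    (hGv : ∀ e, (G e).map (Sm.dp v) = 0) (k : ℕ) : derF v (fundF G ^ k) = 0 := by
  ext1 e
  have h : FA.der (Sm.dp v) (fundF G e) = 0 := by
    rw [fundF, map_smul, FA.der_form11, hGv]
    simp [FA.form11]
  rw [derF, Pi.pow_apply, FA.der_pow (hGK.isClosedEven e).central, h]
  simp

/-- The variation of the functional along a family of potentials `f` that vary in the first
parameter and are joined to `0` in the second parameter. -/
theorem hasDerivAt_functional {G H : MatField n M Q} (hG : IsTens G) (hGK : IsKahlerF G)
    (hGv : ∀ v e, (G e).map (Sm.dp v) = 0) {f : SmField n M Q}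
    (hf : IsFn f) (hGH : H = G + hessF f)
    (hu : ∀ e, IsUnit (H e).det) {s₀ : ℝ} (hs : ∀ t ∈ Set.Icc (0 : ℝ) 1, (s₀, t) ∈ Q)
    (h0 : ∀ (e : atlas (Cn n) M), ∀ z ∈ e.1.target, ∀ j k,
      (Sm.dp (1, 0) (H e j k)).ext ((s₀, 0), z) = 0) :
    HasDerivAt (fun s => -2 * Complex.I * (∫ t in (0 : ℝ)..1,
        mint (topF (bcForm H (0, 1) * fundF G ^ (n - 1))) (s, t))
          - mint (topF (toddSum G H f (n - 1))) (s, 1))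
      (((n - 1).factorial : ℂ) * mint (gammaDensity H (dpF (1, 0) f)) (s₀, 1)) s₀ := by
  have hHt : IsTens H := hGH ▸ hG.add (isTens_hessF hf)
  have hHK : IsKahlerF H := hGH ▸ hGK.add_hessF f
  have h1 : ((s₀, 1) : ℝ × ℝ) ∈ Q := hs 1 (by simp)
  have hWv : ∀ v, derF v (fundF G ^ (n - 1)) = 0 := fun v => derF_fundF_pow hGK (hGv v) _
  -- The base metric is constant and parameter derivatives commute with `∂∂̄`, so the metric varies
  -- by the Hessian of the varied potential.
  have hvel : velF H (1, 0) = fun e => hessF (dpF (1, 0) f) e * (H e)⁻¹ := by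
    ext1 e
    rw [velF]
    congr 1
    ext j k
    have h := congrFun (congrFun (hGv (1, 0) e) j) k
    rw [Matrix.map_apply, Matrix.zero_apply] at h
    rw [Matrix.map_apply, hGH, Pi.add_apply, Matrix.add_apply, map_add, h, zero_add]
    change Sm.dp (1, 0) ((Sm.diffRing _).d j ((Sm.diffRing _).db k (f e))) = _
    rw [dp_del, dp_delb]
    rfl
  have ha := (hasDerivAt_integral_bcForm hHt hu ((isForm_fundF hG).pow (n - 1))
    (fun e => (hGK.isClosedEven e).pow _) hWv hs).const_mul (-2 * Complex.I)
  have hb := hasDerivAt_mint_fst (topF (toddSum G H f (n - 1))) h1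
  -- All paths start at the fixed metric, so only the boundary term at `t = 1` survives. Its power
  -- of the base form is exchanged for one of the moving form by the next step.
  rw [mint_topF_bcForm_mul_eq_zero _ _ (hs 0 (by simp)) h0, sub_zero] at ha
  rw [mint_dpF_toddSum hG hGK hf hGH hu (1, 0) (hGv _) (n - 1) h1] at hb
  have hc := mint_gammaDensity hHt hu hHK (hf.dp (1, 0)) h1
  refine (ha.sub hb).congr_deriv ?_
  change -2 * Complex.I * mint (topF ((fun e => FA.form11 (toddVarF H (fun e =>
    hessF (dpF (1, 0) f) e * (H e)⁻¹) e)) * fundF H ^ (n - 1))) (s₀, 1) - _ = _ at hc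
  rw [← hvel] at hc
  change -2 * Complex.I * mint (topF (bcForm H (1, 0) * fundF H ^ (n - 1))) (s₀, 1) - _ = _ at hc
  rw [show dpF (1, 0) f = fun e => Sm.dp (1, 0) (f e) from rfl, ← hc]
  ring

end Parameter

end KahlerGeom
end

noncomputable section

set_option linter.unusedSectionVars false

namespace KahlerGeom

/-! ### Hermitian metrics in coordinates -/

section Metric

open TopologicalSpace

variable {n : ℕ} {M : Type*} [TopologicalSpace M] [ChartedSpace (Cn n) M]
  [IsManifold 𝓘(ℂ, Cn n) ω M]

variable (n M) in
theorem isManifold_one : IsManifold 𝓘(ℂ, Cn n) 1 M := IsManifold.of_le (n := ω) le_top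

/-- The differential of the inverse of a coordinate system. -/
def frame (e : OpenPartialHomeomorph M (Cn n)) (z : Cn n) : Cn n →L[ℂ] Cn n :=
  mfderiv 𝓘(ℂ, Cn n) 𝓘(ℂ, Cn n) e.symm z

theorem frame_coordChange {e e' : OpenPartialHomeomorph M (Cn n)} (he : e ∈ atlas (Cn n) M)
    (he' : e' ∈ atlas (Cn n) M) {z : Cn n} (hz : z ∈ overlap e e') (v : Cn n) :
    frame e z v = frame e' (coordChange e e' z) ((jac e e' z).mulVec v) := by
  have := isManifold_one n M
  have h1 : e.symm =ᶠ[nhds z] e'.symm ∘ coordChange e e' := by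
    filter_upwards [(isOpen_overlap e e').mem_nhds hz] with w hw
    exact (coordChange_symm hw).symm
  have h2 : MDifferentiableAt 𝓘(ℂ, Cn n) 𝓘(ℂ, Cn n) e'.symm (coordChange e e' z) :=
    mdifferentiableAt_atlas_symm he' (coordChange_mem hz).1
  have h3 := hasFDerivAt_coordChange he he' hz
  have h4 : mfderiv 𝓘(ℂ, Cn n) 𝓘(ℂ, Cn n) (e'.symm ∘ coordChange e e') z
      = (mfderiv 𝓘(ℂ, Cn n) 𝓘(ℂ, Cn n) e'.symm (coordChange e e' z)).comp
        (mfderiv 𝓘(ℂ, Cn n) 𝓘(ℂ, Cn n) (coordChange e e') z) :=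
    mfderiv_comp z h2 h3.differentiableAt.mdifferentiableAt
  have h5 : (mfderiv 𝓘(ℂ, Cn n) 𝓘(ℂ, Cn n) e.symm z : Cn n →L[ℂ] Cn n)
      = mfderiv 𝓘(ℂ, Cn n) 𝓘(ℂ, Cn n) (e'.symm ∘ coordChange e e') z := h1.mfderiv_eq
  have h6 := DFunLike.congr_fun h5 v
  refine h6.trans ?_
  rw [h4, mfderiv_eq_fderiv, ← fderiv_coordChange_apply]
  rfl

theorem frame_ne_zero {e : OpenPartialHomeomorph M (Cn n)} (he : e ∈ atlas (Cn n) M)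
    {z : Cn n} (hz : z ∈ e.target) {v : Cn n} (hv : v ≠ 0) : frame e z v ≠ 0 := fun h => by
  have := isManifold_one n M
  have h1 := (mdifferentiable_of_mem_atlas (I := 𝓘(ℂ, Cn n)) he).comp_symm_deriv hz
  have h2 := DFunLike.congr_fun h1 v
  refine hv (h2.symm.trans ?_)
  exact (congrArg (mfderiv 𝓘(ℂ, Cn n) 𝓘(ℂ, Cn n) e (e.symm z)) h).trans (map_zero _)

/-- Families of sesquilinear forms on the holomorphic tangent spaces. -/
abbrev SesqForms (n : ℕ) (M : Type*) [TopologicalSpace M] [ChartedSpace (Cn n) M] : Type _ :=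
  ∀ x : M, TangentSpace 𝓘(ℂ, Cn n) x →ₗ[ℂ] TangentSpace 𝓘(ℂ, Cn n) x →ₗ⋆[ℂ] ℂ

/-- The sesquilinear form at a point, in terms of the model space. -/
def SesqForms.at (B : SesqForms n M) (x : M) : Cn n →ₗ[ℂ] Cn n →ₗ⋆[ℂ] ℂ := B x

theorem sesq_sum (B : Cn n →ₗ[ℂ] Cn n →ₗ⋆[ℂ] ℂ) (L : Cn n →L[ℂ] Cn n) (v w : Cn n) :
    B (L v) (L w) = ∑ j, ∑ k, v j * star (w k) * B (L (Pi.single j 1)) (L (Pi.single k 1)) := by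
  have h : ∀ v : Cn n, L v = ∑ j, v j • L (Pi.single j 1) := fun v => by
    conv_lhs => rw [show v = ∑ j, v j • (Pi.single j 1 : Cn n) by
      ext b; simp [Finset.sum_apply, Pi.single_apply]]
    simp
  conv_lhs => rw [h v, h w]
  simp only [map_sum, map_smulₛₗ, LinearMap.sum_apply, LinearMap.smul_apply, smul_eq_mul,
    Finset.mul_sum, RingHom.id_apply]
  refine (Finset.sum_comm).trans (Finset.sum_congr rfl fun j _ => Finset.sum_congr rfl fun k _ => ?_)
  simp only [starRingEnd_apply]
  ring

theorem localMatrix_apply (B : SesqForms n M) (e : OpenPartialHomeomorph M (Cn n)) (z : Cn n)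
    (j k : Fin n) : localMatrix B e z j k
      = B.at (e.symm z) (frame e z (Pi.single j 1)) (frame e z (Pi.single k 1)) := rfl

/-- The transformation behaviour of the matrices of sesquilinear forms. -/
theorem localMatrix_coordChange (B : SesqForms n M) {e e' : OpenPartialHomeomorph M (Cn n)}
    (he : e ∈ atlas (Cn n) M) (he' : e' ∈ atlas (Cn n) M) {z : Cn n} (hz : z ∈ overlap e e')
    (j k : Fin n) : localMatrix B e z j k = ∑ a, ∑ b, jac e e' z a j * star (jac e e' z b k)
      * localMatrix B e' (coordChange e e' z) a b := by
  have h := sesq_sum (B.at (e.symm z)) (frame e' (coordChange e e' z))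
    ((jac e e' z).mulVec (Pi.single j 1)) ((jac e e' z).mulVec (Pi.single k 1))
  rw [← frame_coordChange he he' hz, ← frame_coordChange he he' hz] at h
  simp only [Matrix.mulVec_single_one, Matrix.col_apply] at h
  simp only [localMatrix_apply, coordChange_symm hz, h]

theorem HermitianMetric.posDef (g : HermitianMetric n M) {e : OpenPartialHomeomorph M (Cn n)}
    (he : e ∈ atlas (Cn n) M) {z : Cn n} (hz : z ∈ e.target) : (g.mat e z).PosDef := by
  refine Matrix.PosDef.of_dotProduct_mulVec_pos ?_ fun v hv => ?_
  · ext j k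
    exact g.conj_symm _ _ _
  -- The Hermitian form is linear in its first argument, whereas the quadratic form of a matrix
  -- conjugates the left vector; hence `star v`.
  · have h : 0 < SesqForms.at g.form (e.symm z) (frame e z (star v)) (frame e z (star v)) :=
      g.pos (e.symm z) _ (frame_ne_zero he hz (v := star v) (by simpa using hv))
    rw [sesq_sum] at h
    refine h.trans_eq ?_
    simp only [dotProduct, Matrix.mulVec, Finset.mul_sum]
    refine Finset.sum_congr rfl fun j _ => Finset.sum_congr rfl fun k _ => ?_
    simp only [Pi.star_apply, star_star]
    rw [mul_assoc, mul_comm (v k)]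
    rfl

/-! ### Matrices of functions from their values -/

variable {Q : Opens (ℝ × ℝ)}

/-- Matrices of functions on the coordinate domains, given by their values. -/
def MatField.of (A : ℝ × ℝ → OpenPartialHomeomorph M (Cn n) → Cn n → Matrix (Fin n) (Fin n) ℂ)
    (hA : ∀ e ∈ atlas (Cn n) M, ∀ j k,
      ContDiffOn ℝ ∞ (fun x : PCn n => A x.1 e x.2 j k) (dom Q e)) : MatField n M Q :=
  fun e => Matrix.of fun j k => Sm.of (fun x => A x.1 e.1 x.2 j k) (hA e.1 e.2 j k)

theorem MatField.ext_of
    {A : ℝ × ℝ → OpenPartialHomeomorph M (Cn n) → Cn n → Matrix (Fin n) (Fin n) ℂ}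
    (hA : ∀ e ∈ atlas (Cn n) M, ∀ j k,
      ContDiffOn ℝ ∞ (fun x : PCn n => A x.1 e x.2 j k) (dom Q e)) (e : atlas (Cn n) M)
    {q : ℝ × ℝ} (hq : q ∈ Q) {z : Cn n} (hz : z ∈ e.1.target) (j k : Fin n) :
    (MatField.of A hA e j k).ext (q, z) = A q e.1 z j k :=
  Sm.ext_of (hA e.1 e.2 j k) (x := (q, z)) ⟨hq, hz⟩

theorem isTens_iff_ext {A : MatField n M Q} : IsTens A ↔ ∀ (e e' : atlas (Cn n) M),
    ∀ q ∈ Q, ∀ z ∈ overlap e.1 e'.1, ∀ j k, (A e j k).ext (q, z)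
      = ∑ a, ∑ b, jac e.1 e'.1 z a j * star (jac e.1 e'.1 z b k)
        * (A e' a b).ext (q, coordChange e.1 e'.1 z) := by
  have key : ∀ (e e' : atlas (Cn n) M) (x : PCn n) (hx : x ∈ ovl Q e.1 e'.1) (j k : Fin n),
      (∑ a, ∑ b, jacF Q e e' a j * Sm.conj (jacF Q e e' b k) * trans e.2 e'.2 (A e' a b)).ext x
      = ∑ a, ∑ b, jac e.1 e'.1 x.2 a j * star (jac e.1 e'.1 x.2 b k)
        * (A e' a b).ext (pCoordChange e.1 e'.1 x) := fun e e' x hx j k => by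
    simp only [Sm.ext_sum, Sm.ext_mul, Sm.ext_conj _ hx, ext_smJac e.2 e'.2 _ _ hx,
      ext_trans _ _ _ hx]
  constructor
  · intro h e e' q hq z hz j k
    have hx : (q, z) ∈ ovl Q e.1 e'.1 := ⟨hq, hz⟩
    rw [← ext_res _ _ _ hx, h, key e e' _ hx]
    rfl
  · intro h e e' j k
    refine Sm.ext_eq fun x hx => ?_
    rw [ext_res _ _ _ hx, key e e' x hx]
    exact h e e' x.1 hx.1 x.2 hx.2 j k

theorem isUnit_det_of_ext {H : MatField n M Q} {e : atlas (Cn n) M}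
    (h : ∀ q ∈ Q, ∀ z ∈ e.1.target, ((H e).map fun f => f.ext (q, z)).PosDef) :
    IsUnit (H e).det := by
  refine Sm.isUnit fun x => ?_
  rw [AlgHom.map_det, AlgHom.mapMatrix_apply]
  have h1 := (h x.1.1 x.2.1 x.1.2 x.2.2).isUnit
  have h2 : (H e).map (Sm.ev x) = (H e).map fun f => f.ext (x.1.1, x.1.2) := by
    ext j k; exact Sm.ev_eq_ext x _
  rw [h2]
  exact ((Matrix.isUnit_iff_isUnit_det _).1 h1).ne_zero

end Metric

end KahlerGeom
end

noncomputable section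

set_option linter.unusedSectionVars false

namespace KahlerGeom

/-! ### The local formulas in terms of rings of smooth functions -/

section Local

open TopologicalSpace

theorem sum_reorder {n : ℕ} (F : Fin n → Fin n → Fin n → Fin n → Fin n → Fin n → Fin n → Fin n → ℂ) :
    ∑ p, ∑ q, ∑ j, ∑ k, ∑ a, ∑ b, ∑ c, ∑ d, F p q j k a b c d
      = ∑ p, ∑ b, ∑ j, ∑ c, ∑ d, ∑ k, ∑ q, ∑ a, F p q j k a b c d := by
  have h := Fintype.sum_equiv (⟨fun ⟨p, q, j, k, a, b, c, d⟩ => (p, b, j, c, d, k, q, a),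
    fun ⟨p, b, j, c, d, k, q, a⟩ => (p, q, j, k, a, b, c, d), fun _ => rfl, fun _ => rfl⟩ :
    (Fin n × Fin n × Fin n × Fin n × Fin n × Fin n × Fin n × Fin n) ≃
      (Fin n × Fin n × Fin n × Fin n × Fin n × Fin n × Fin n × Fin n))
    (fun ⟨p, q, j, k, a, b, c, d⟩ => F p q j k a b c d)
    (fun ⟨p, b, j, c, d, k, q, a⟩ => F p q j k a b c d) fun _ => rfl
  simpa only [Fintype.sum_prod_type] using h

/-- Evaluation at a point of a coordinate domain. -/
abbrev evAt {n : ℕ} {M : Type*} [TopologicalSpace M] {Q : Opens (ℝ × ℝ)}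
    {e : OpenPartialHomeomorph M (Cn n)} {q : ℝ × ℝ} (hq : q ∈ Q) {z : Cn n} (hz : z ∈ e.target) :
    Sm (dom Q e) →ₐ[ℂ] ℂ := Sm.ev (W := dom Q e) ⟨(q, z), hq, hz⟩

variable {n : ℕ} {M : Type*} [TopologicalSpace M] [ChartedSpace (Cn n) M] {Q : Opens (ℝ × ℝ)}
  {e : OpenPartialHomeomorph M (Cn n)} {H : Matrix (Fin n) (Fin n) (Sm (dom Q e))}
  {h : Cn n → Matrix (Fin n) (Fin n) ℂ} {q : ℝ × ℝ} (hq : q ∈ Q) (hu : IsUnit H.det)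
  (hh : ∀ z ∈ e.target, ∀ j k, h z j k = (H j k).ext (q, z))

include hq hh

theorem map_ev_eq {z : Cn n} (hz : z ∈ e.target) :
    H.map (evAt hq hz) = h z := by
  ext j k
  rw [Matrix.map_apply, Sm.ev_eq_ext, hh z hz]

include hu

/-- The algebraic connection, evaluated at a fixed parameter, is the explicit local formula.
Agreement of `h` with `H` on the whole coordinate domain is needed because derivatives are taken. -/
theorem chern_eq_ev {z : Cn n} (hz : z ∈ e.target) (j : Fin n) :
    chern h j z = ((Sm.diffRing (dom Q e)).conn H j).map (evAt hq hz) := by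
  have h1 := map_nonsing_inv (evAt hq hz).toRingHom hu
  rw [chern, DiffRing.conn, Matrix.map_mul]
  congr 1
  · ext p r
    rw [Matrix.map_apply, Matrix.map_apply, Sm.ev_eq_ext, Matrix.of_apply]
    exact Sm.dd_eq_ext j _ ⟨hq, hz⟩ fun w hw => hh w hw.2 p r
  · refine Eq.trans ?_ h1.symm
    exact congrArg _ (map_ev_eq hq hh hz).symm

theorem curv_eq_ev {z : Cn n} (hz : z ∈ e.target) (j k : Fin n) :
    curv h z j k = ((Sm.diffRing (dom Q e)).curvature H j k).map (evAt hq hz) := by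
  ext p r
  rw [curv, Matrix.of_apply, DiffRing.curvature, Matrix.map_apply, Matrix.neg_apply, map_neg,
    Matrix.map_apply, Sm.ev_eq_ext]
  congr 1
  refine Sm.ddbar_eq_ext k _ ⟨hq, hz⟩ fun w hw => ?_
  rw [chern_eq_ev hq hu hh hw.2, Matrix.map_apply, Sm.ev_eq_ext]

theorem ricci_eq_ev {z : Cn n} (hz : z ∈ e.target) :
    ricci h z = ((Sm.diffRing (dom Q e)).ric H).map (evAt hq hz) := by
  ext j k
  rw [ricci, Matrix.of_apply, curv_eq_ev hq hu hh hz, Matrix.map_apply, DiffRing.ric, Matrix.of_apply]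
  exact (map_trace (evAt hq hz).toRingHom _).symm

theorem tr_eq_ev {A : Matrix (Fin n) (Fin n) (Sm (dom Q e))} {z : Cn n} (hz : z ∈ e.target) :
    tr (h z) (A.map (evAt hq hz)) = evAt hq hz (trC H A) := by
  rw [tr_eq_trace]
  refine Eq.trans ?_ (map_trC (evAt hq hz).toRingHom hu A).symm
  rw [← map_ev_eq hq hh hz]
  rfl

theorem scal_eq_ev {z : Cn n} (hz : z ∈ e.target) :
    scal h z = evAt hq hz ((Sm.diffRing (dom Q e)).scalar H) := by
  rw [scal, ricci_eq_ev hq hu hh hz, tr_eq_ev hq hu hh hz]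
  rfl

omit hu hh in
theorem hess_eq_ev {f : Cn n → ℂ} {F : Sm (dom Q e)} (hf : ∀ z ∈ e.target, f z = F.ext (q, z))
    {z : Cn n} (hz : z ∈ e.target) :
    hess f z = ((Sm.diffRing (dom Q e)).hessian F).map (evAt hq hz) := by
  ext j k
  rw [hess, Matrix.of_apply, Matrix.map_apply, Sm.ev_eq_ext]
  refine Sm.dd_eq_ext j _ ⟨hq, hz⟩ fun w hw => ?_
  exact Sm.ddbar_eq_ext k _ ⟨hq, hw.2⟩ fun w hw => hf w hw.2

theorem lap_eq_ev {f : Cn n → ℂ} {F : Sm (dom Q e)} (hf : ∀ z ∈ e.target, f z = F.ext (q, z))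
    {z : Cn n} (hz : z ∈ e.target) : lap h f z
      = evAt hq hz (trC H ((Sm.diffRing (dom Q e)).hessian F)) := by
  rw [lap, hess_eq_ev hq hf hz, tr_eq_ev hq hu hh hz]

theorem pairing_eq_ev {A B : Matrix (Fin n) (Fin n) (Sm (dom Q e))} {z : Cn n}
    (hz : z ∈ e.target) : pairing (h z) (A.map (evAt hq hz))
      (B.map (evAt hq hz)) = evAt hq hz (pairC H A B) := by
  rw [pairing_eq_trace]
  refine Eq.trans ?_ (map_pairC (evAt hq hz).toRingHom hu A B).symm
  rw [← map_ev_eq hq hh hz]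
  rfl

omit hq hh

/-- The Hermitian symmetry of the curvature. -/
theorem conj_curvature_mul (hH : ∀ j k, Sm.conj (H j k) = H k j) (j k p r : Fin n) :
    Sm.conj (((Sm.diffRing (dom Q e)).curvature H j k * H) p r)
      = ((Sm.diffRing (dom Q e)).curvature H k j * H) r p := by
  have hi : ∀ j k, Sm.conj (H⁻¹ j k) = H⁻¹ k j := fun j k => by
    have h1 := map_nonsing_inv (Sm.conj (W := dom Q e)) hu
    have h2 : H.map Sm.conj = H.transpose := by ext j k; exact hH j k
    rw [h2, ← Matrix.transpose_nonsing_inv] at h1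
    exact congrFun (congrFun h1 j) k
  have hd : ∀ j p r, Sm.conj ((Sm.diffRing (dom Q e)).d j (H p r))
      = (Sm.diffRing (dom Q e)).db j (H r p) := fun j p r => by
    rw [← hH p r]; exact (Sm.delb_conj j (H p r)).symm
  have hdb : ∀ j p r, Sm.conj ((Sm.diffRing (dom Q e)).db j (H p r))
      = (Sm.diffRing (dom Q e)).d j (H r p) := fun j p r => by
    rw [← hH p r]; exact (Sm.del_conj j (H p r)).symm
  have hddb : Sm.conj ((Sm.diffRing (dom Q e)).db k ((Sm.diffRing (dom Q e)).d j (H p r)))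
      = (Sm.diffRing (dom Q e)).db j ((Sm.diffRing (dom Q e)).d k (H r p)) := by
    rw [← DiffRing.d_db _ k j, ← hd j p r]
    exact (Sm.del_conj k _).symm
  rw [DiffRing.curvature_mul _ hu, DiffRing.curvature_mul _ hu]
  simp only [Matrix.sub_apply, Matrix.mul_apply, Matrix.map_apply, map_sub, map_sum, map_mul, hi, hd,
    hdb, Finset.sum_mul, hddb]
  congr 1
  refine Finset.sum_comm.trans (Finset.sum_congr rfl fun a _ => Finset.sum_congr rfl fun b _ => ?_)
  ring

include hq hh

/-- Hermitian symmetry of the lowered curvature replaces the conjugate by a transposed component;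
two of the inverse metrics then raise indices and leave the pairing of `R_p^q` with `R_q^p`. -/
theorem normSqCurv_eq_ev (hH : ∀ j k, Sm.conj (H j k) = H k j) {z : Cn n} (hz : z ∈ e.target) :
    normSqCurv h z = evAt hq hz ((Sm.diffRing (dom Q e)).curvNorm H) := by
  have hdet : IsUnit (h z).det := by
    have := hu.map (evAt hq hz)
    rwa [AlgHom.map_det, AlgHom.mapMatrix_apply, map_ev_eq hq hh hz] at this
  have hL : ∀ a b c d, star (curvLow h z a b c d) = curvLow h z b a d c := fun a b c d => by
    have hl : ∀ a b c d, curvLow h z a b c d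
        = evAt hq hz (((Sm.diffRing (dom Q e)).curvature H c d * H) a b) := fun a b c d => by
      rw [curvLow, curv_eq_ev hq hu hh hz, ← map_ev_eq hq hh hz, ← Matrix.map_mul]
      rfl
    rw [hl, hl, ← conj_curvature_mul hu hH, Sm.ev_eq_ext, Sm.ev_eq_ext, Sm.ext_conj _ (by exact ⟨hq, hz⟩), star_star]
  have hR : ∀ j k p r, ∑ a, curvLow h z p a j k * (h z)⁻¹ a r = curv h z j k p r :=
    fun j k p r => by
    have : curv h z j k * h z * (h z)⁻¹ = curv h z j k := by
      rw [Matrix.mul_assoc, Matrix.mul_nonsing_inv _ hdet, Matrix.mul_one]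
    rw [← this]; rfl
  have hC : ∀ p r, ((Sm.diffRing (dom Q e)).curvComp H p r).map (evAt hq hz)
      = Matrix.of fun j k => curv h z j k p r := fun p r => by
    ext j k
    rw [Matrix.of_apply, curv_eq_ev hq hu hh hz]
    rfl
  rw [DiffRing.curvNorm, map_sum]
  simp only [map_sum, ← pairing_eq_ev hq hu hh hz, hC]
  rw [normSqCurv]
  simp only [hL, pairing, Matrix.of_apply, ← hR, Finset.mul_sum, Finset.sum_mul]
  rw [sum_reorder]
  refine Finset.sum_congr rfl fun p _ => Finset.sum_congr rfl fun b _ => Finset.sum_congr rfl fun j _ =>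
    Finset.sum_congr rfl fun c _ => Finset.sum_congr rfl fun d _ => Finset.sum_congr rfl fun k _ => ?_
  rw [Finset.sum_comm]
  refine Finset.sum_congr rfl fun q' _ => Finset.sum_congr rfl fun a _ => ?_
  ring

end Local

end KahlerGeom
end

noncomputable section

set_option linter.unusedSectionVars false

namespace KahlerGeom

/-! ### The integrals in terms of families of metrics -/

section Linking

open TopologicalSpace MeasureTheory

variable {n : ℕ} {M : Type*} [TopologicalSpace M] [ChartedSpace (Cn n) M] {Q : Opens (ℝ × ℝ)}

/-- The factors `i` of the fundamental form cancel those of the orientation: `(-2i)ⁿ iⁿ = 2ⁿ`. -/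
theorem topCoeff_fundForm_pow (H : Matrix (Fin n) (Fin n) ℂ) :
    (-2 * Complex.I) ^ n * topCoeff ((1 / (n.factorial : ℂ)) • fundForm H ^ n)
      = 2 ^ n * H.det := by
  have h : fundForm H = Complex.I • form11 H := by
    simp [fundForm, form11, Finset.smul_sum, smul_smul]
  have hf : (n.factorial : ℂ) ≠ 0 := by exact_mod_cast n.factorial_ne_zero
  have hI : (-2 * Complex.I) ^ n * Complex.I ^ n = 2 ^ n := by
    rw [← mul_pow, mul_assoc, Complex.I_mul_I]
    norm_num
  rw [h, smul_pow, map_smul, map_smul, topCoeff_form11_pow, ← hI]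
  simp only [smul_eq_mul]
  field_simp

theorem fundForm_eq_ev {e : atlas (Cn n) M} {H : MatField n M Q} {h : Matrix (Fin n) (Fin n) ℂ}
    {q : ℝ × ℝ} (hq : q ∈ Q) {z : Cn n} (hz : z ∈ e.1.target)
    (hh : ∀ j k, h j k = (H e j k).ext (q, z)) :
    fundForm h = FA.ev (evAt hq hz) (fundF H e) := by
  rw [fundF, map_smul, FA.ev_form11, fundForm]
  have : h = (H e).map (evAt hq hz) := by
    ext j k; rw [hh, Matrix.map_apply, Sm.ev_eq_ext]
  rw [← this]
  simp [form11, Finset.smul_sum, smul_smul]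

theorem td2_curvForm (h : Cn n → Matrix (Fin n) (Fin n) ℂ) (z : Cn n) :
    td2 (curvForm h z) (curvForm h z) = (1 / 24 : ℂ) • ((∑ p, ∑ q,
      form11 (Matrix.of fun j k => curv h z j k p q) * form11 (Matrix.of fun j k => curv h z j k q p))
        - (3 : ℂ) • (form11 (ricci h z) * form11 (ricci h z))) := by
  have h1 : (curvForm h z).trace = form11 (ricci h z) := by
    simp only [Matrix.trace, Matrix.diag_apply, curvForm, Matrix.of_apply, form11, ricci,
      Finset.sum_smul]
    rw [Finset.sum_comm]
    exact Finset.sum_congr rfl fun j _ => Finset.sum_comm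
  rw [td2, h1]
  simp only [Matrix.trace, Matrix.diag_apply, Matrix.mul_apply, curvForm, Matrix.of_apply]

variable [IsManifold 𝓘(ℂ, Cn n) ω M]

theorem td2_curvForm_eq_ev {e : atlas (Cn n) M} {H : MatField n M Q} (hu : IsUnit (H e).det)
    {h : Cn n → Matrix (Fin n) (Fin n) ℂ} {q : ℝ × ℝ} (hq : q ∈ Q)
    (hh : ∀ z ∈ e.1.target, ∀ j k, h z j k = (H e j k).ext (q, z)) {z : Cn n}
    (hz : z ∈ e.1.target) :
    td2 (curvForm h z) (curvForm h z) = FA.ev (evAt hq hz) (toddF H e) := by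
  have hC : ∀ p r, ((Sm.diffRing (dom Q e.1)).curvComp (H e) p r).map (evAt hq hz)
      = Matrix.of fun j k => curv h z j k p r := fun p r => by
    ext j k
    rw [Matrix.of_apply, curv_eq_ev hq hu hh hz]
    rfl
  rw [td2_curvForm, toddF, DiffRing.toddForm_eq, map_smul, map_sub, map_smul, map_mul (FA.ev _),
    FA.ev_form11, ricci_eq_ev hq hu hh hz]
  simp only [map_sum, map_mul (FA.ev _), FA.ev_form11, hC]

variable [T2Space M] [CompactSpace M]

theorem gamma_eq_mint {g : HermitianMetric n M} {φ ψ : C^∞⟮𝓘(ℝ, Cn n), M; ℝ⟯} {H : MatField n M Q}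
    (hu : ∀ e, IsUnit (H e).det) {f : SmField n M Q} {q : ℝ × ℝ} (hq : q ∈ Q)
    (hherm : ∀ e j k, Sm.conj (H e j k) = H e k j)
    (hh : ∀ (e : atlas (Cn n) M), ∀ z ∈ e.1.target, ∀ j k, g.matPot φ e z j k = (H e j k).ext (q, z))
    (hf : ∀ (e : atlas (Cn n) M), ∀ z ∈ e.1.target, locFun ψ e z = (f e).ext (q, z)) :
    g.gamma φ ψ = mint (gammaDensity H f) q := by
  refine integralForm_eq_mint _ _ hq fun e z hz => ?_
  simp only
  have hS : ∀ z ∈ e.1.target, scal (g.matPot φ e) z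
      = ((Sm.diffRing (dom Q e.1)).scalar (H e)).ext (q, z) := fun z hz => by
    rw [scal_eq_ev hq (hu e) (hh e) hz, Sm.ev_eq_ext]
  have hdet : (g.matPot φ e z).det = evAt hq hz (H e).det := by
    rw [AlgHom.map_det, AlgHom.mapMatrix_apply, map_ev_eq hq (hh e) hz]
  rw [map_smul, smul_eq_mul, mul_left_comm, topCoeff_fundForm_pow, hdet,
    lap_eq_ev hq (hu e) (hh e) hS hz, normSqCurv_eq_ev hq (hu e) (hh e) (hherm e) hz,
    ricci_eq_ev hq (hu e) (hh e) hz, pairing_eq_ev hq (hu e) (hh e) hz,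
    scal_eq_ev hq (hu e) (hh e) hz, hf e z hz]
  refine Eq.trans ?_ (Sm.ev_eq_ext (⟨(q, z), hq, hz⟩ : dom Q e.1) (gammaDensity H f e))
  rw [gammaDensity, vol]
  simp only [map_mul, map_sub, map_smul, map_add, map_pow, smul_eq_mul]
  rw [Sm.ev_eq_ext _ (f e)]
  change _ = 2 ^ n * _ * (_ * (_ - _ * (_ - 4 * evAt hq hz (pairC (H e) ((Sm.diffRing (dom Q e.1)).ric (H e)) ((Sm.diffRing (dom Q e.1)).ric (H e))) + _)))
  ring

/-- Fubini on the compact set `K × [0, 1]`, where the integrand is continuous. -/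
theorem SuppIn.integral_swap {e : OpenPartialHomeomorph M (Cn n)} {F : Sm (dom Q e)}
    {K : Set (Cn n)} (hF : SuppIn F K) (hK : IsCompact K) (hKe : K ⊆ e.target) {s₀ : ℝ}
    (hs : ∀ t ∈ Set.Icc (0 : ℝ) 1, (s₀, t) ∈ Q) :
    IntegrableOn (fun z => ∫ t in (0 : ℝ)..1, F.ext ((s₀, t), z)) e.target ∧
      ∫ z in e.target, ∫ t in (0 : ℝ)..1, F.ext ((s₀, t), z)
        = ∫ t in (0 : ℝ)..1, ∫ z in e.target, F.ext ((s₀, t), z) := by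
  have hc : ContinuousOn (fun p : Cn n × ℝ => F.ext ((s₀, p.2), p.1)) (K ×ˢ Set.Icc 0 1) :=
    (hF.contDiffOn hK hKe).continuousOn.comp (by fun_prop) fun p hp => ⟨hs p.2 hp.2, trivial⟩
  have hi : Integrable (fun p : Cn n × ℝ => F.ext ((s₀, p.2), p.1))
      ((volume.restrict K).prod (volume.restrict (Set.Ioc 0 1))) := by
    rw [Measure.prod_restrict]
    exact (hc.integrableOn_compact (hK.prod isCompact_Icc)).mono_set
      (Set.prod_mono_right Set.Ioc_subset_Icc_self)
  have h0 : ∀ z ∉ K, ∫ t in (0 : ℝ)..1, F.ext ((s₀, t), z) = 0 := fun z hz => by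
    simp only [hF (_, z) hz, intervalIntegral.integral_zero]
  constructor
  · have h1 : IntegrableOn (fun z => ∫ t in (0 : ℝ)..1, F.ext ((s₀, t), z)) K := by
      simp only [intervalIntegral.integral_of_le zero_le_one]
      exact hi.integral_prod_left
    exact h1.of_forall_sdiff_eq_zero e.open_target.measurableSet fun z hz => h0 z hz.2
  · simp only [hF.integral_target hKe]
    rw [setIntegral_eq_of_subset_of_forall_sdiff_eq_zero e.open_target.measurableSet hKe
      fun z hz => h0 z hz.2]
    simp only [intervalIntegral.integral_of_le zero_le_one]
    exact integral_integral_swap hi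

theorem topCoeff_form11_integral {A : ℝ → Matrix (Fin n) (Fin n) ℂ}
    (hA : ∀ j k, ContinuousOn (fun t => A t j k) (Set.Icc 0 1)) (w : Forms n) :
    topCoeff (form11 (Matrix.of fun j k => ∫ t in (0 : ℝ)..1, A t j k) * w)
      = ∫ t in (0 : ℝ)..1, topCoeff (form11 (A t) * w) := by
  have hi : ∀ j k, IntervalIntegrable (fun t => A t j k) volume 0 1 := fun j k =>
    (hA j k).intervalIntegrable_of_Icc zero_le_one
  simp only [form11, Finset.sum_mul, smul_mul_assoc, map_sum, map_smul, smul_eq_mul, Matrix.of_apply]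
  rw [intervalIntegral.integral_finsetSum fun j _ => ?_]
  · refine Finset.sum_congr rfl fun j _ => ?_
    rw [intervalIntegral.integral_finsetSum fun k _ => (hi j k).mul_const _]
    exact Finset.sum_congr rfl fun k _ => (intervalIntegral.integral_mul_const _ _).symm
  · have h := IntervalIntegrable.sum Finset.univ fun k _ =>
      (hi j k).mul_const (topCoeff (dz j * dzbar k * w))
    have he : (fun t => ∑ k, A t j k * topCoeff (dz j * dzbar k * w))
        = ∑ k, fun t => A t j k * topCoeff (dz j * dzbar k * w) := by
      ext t
      rw [Finset.sum_apply]
    rw [he]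
    exact h

/-- Interchange of the integrals over the manifold and over a parameter. -/
theorem integralForm_eq_integral_mint {Q' : Opens (ℝ × ℝ)}
    (η : OpenPartialHomeomorph M (Cn n) → Cn n → Forms n) (c : ℂ)
    (F : SmField n M Q) (K : SmField n M Q') {s₀ : ℝ} (hs : ∀ t ∈ Set.Icc (0 : ℝ) 1, (s₀, t) ∈ Q)
    {q : ℝ × ℝ} (hq : q ∈ Q') (h : ∀ (e : atlas (Cn n) M), ∀ z ∈ e.1.target,
      (-2 * Complex.I) ^ n * topCoeff (η e.1 z)
        = c * (∫ t in (0 : ℝ)..1, (F e).ext ((s₀, t), z)) + (K e).ext (q, z)) :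
    integralForm η = c * (∫ t in (0 : ℝ)..1, mint F (s₀, t)) + mint K q := by
  have hsw := fun x : M => (suppIn_partition x (F (atChart n x))).integral_swap
    (isCompact_partSupport x) (partSupport_subset x) hs
  have hK := fun x : M => ((suppIn_partition x (K (atChart n x))).integrable
    (isCompact_partSupport x) (partSupport_subset x) hq).integrableOn
      (s := (chartAt (Cn n) x).target)
  have hint : ∀ x ∈ partIndex n M, IntervalIntegrable (fun t => ∫ z in (chartAt (Cn n) x).target,
      (fnField Q (partition n M x) (atChart n x) * F (atChart n x)).ext ((s₀, t), z)) volume 0 1 :=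
    fun x _ => by
    refine ContinuousOn.intervalIntegrable_of_Icc zero_le_one fun t ht => ?_
    obtain ⟨L, hL, -⟩ := (suppIn_partition x (F (atChart n x))).hasFDerivAt_integral
      (isCompact_partSupport x) (partSupport_subset x) (hs t ht)
    exact (hL.continuousAt.comp (f := fun t : ℝ => (s₀, t))
      (by fun_prop : Continuous fun t : ℝ => (s₀, t)).continuousAt).continuousWithinAt
  rw [integralForm, finsum_eq_sum_of_support_subset (s := partIndex n M)]
  · simp only [mint]
    rw [intervalIntegral.integral_finsetSum hint, Finset.mul_sum, ← Finset.sum_add_distrib]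
    refine Finset.sum_congr rfl fun x _ => ?_
    have e2 := (hsw x).2
    change (∫ z in (chartAt (Cn n) x).target, _) = ∫ t in (0 : ℝ)..1,
      ∫ z in (chartAt (Cn n) x).target, _ at e2
    rw [← e2, ← integral_const_mul, ← integral_add (μ := volume.restrict (chartAt (Cn n) x).target)
      ((hsw x).1.const_mul c) (hK x)]
    refine setIntegral_congr_fun (chartAt (Cn n) x).open_target.measurableSet fun z hz => ?_
    have h1 : ∫ t in (0 : ℝ)..1, (fnField Q (partition n M x) (atChart n x)
        * F (atChart n x)).ext ((s₀, t), z)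
        = (partition n M x ((chartAt (Cn n) x).symm z) : ℂ)
          * ∫ t in (0 : ℝ)..1, (F (atChart n x)).ext ((s₀, t), z) := by
      rw [← intervalIntegral.integral_const_mul]
      refine intervalIntegral.integral_congr fun t ht => ?_
      rw [Set.uIcc_of_le zero_le_one] at ht
      simp only [Sm.ext_mul]
      rw [ext_fnField _ _ (x := ((s₀, t), z)) ⟨hs t ht, hz⟩]
      rfl
    have h2 := h (atChart n x) z hz
    have h3 := ext_fnField (Q := Q') (partition n M x) (atChart n x) (x := (q, z)) ⟨hq, hz⟩
    simp only [h1]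
    rw [Sm.ext_mul, h3]
    change _ * ((-2 * Complex.I) ^ n * topCoeff (η (atChart n x).1 z)) = _
    rw [h2, mul_add]
    exact congrArg₂ (· + ·) (mul_left_comm _ _ _) rfl
  · intro x hx
    by_contra h
    refine hx ?_
    simp [partition_eq_zero h]

end Linking

end KahlerGeom
end

/-! ### The Bott–Chern functional as an integral over a family of metrics -/

noncomputable section

set_option linter.unusedSectionVars false

namespace KahlerGeom

section Functional

open TopologicalSpace MeasureTheory

variable {n : ℕ} {M : Type*} [TopologicalSpace M] [ChartedSpace (Cn n) M] {Q : Opens (ℝ × ℝ)}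
  [IsManifold 𝓘(ℂ, Cn n) ω M] {g : HermitianMetric n M} {φ : C^∞⟮𝓘(ℝ, Cn n), M; ℝ⟯}

theorem MetricPath.velocity_eq_ev (P : MetricPath g φ) {H : MatField n M Q}
    (hu : ∀ e, IsUnit (H e).det) {s₀ : ℝ} (hs : ∀ t : ℝ, (s₀, t) ∈ Q)
    (hH : ∀ (e : atlas (Cn n) M) (t : ℝ), ∀ z ∈ e.1.target, ∀ j k,
      (P.metric t).mat e z j k = (H e j k).ext ((s₀, t), z)) (e : atlas (Cn n) M) (t : ℝ)
    {z : Cn n} (hz : z ∈ e.1.target) :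
    P.velocity e z t = (velF H (0, 1) e).map (evAt (hs t) hz) := by
  have h1 := map_nonsing_inv (evAt (hs t) hz).toRingHom (hu e)
  have hx : ((s₀, t), z) ∈ dom Q e.1 := ⟨hs t, hz⟩
  rw [velocity, velF, Matrix.map_mul]
  congr 1
  · ext p r
    rw [Matrix.of_apply, Matrix.map_apply, Matrix.map_apply, Sm.ev_eq_ext, Sm.dp, Sm.ext_der _ _ hx]
    have h2 : (fun s => (P.metric s).mat e z p r) = fun s => (H e p r).ext ((s₀, s), z) :=
      funext fun s => hH e s z hz p r
    rw [h2]
    have h3 := ((H e p r).differentiableAt_ext hx).hasFDerivAt.comp_hasDerivAt t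
      (f := fun s : ℝ => (((s₀, s), z) : PCn n)) (f' := ((0, 1), 0))
      (((hasDerivAt_const _ _).prodMk (hasDerivAt_id _)).prodMk (hasDerivAt_const _ _))
    exact h3.deriv
  · refine Eq.trans ?_ h1.symm
    exact congrArg _ (map_ev_eq (hs t) (hH e t) hz).symm

/-- Symmetry of the polarization merges the two terms of the integrand, whence the factor `2`. -/
theorem MetricPath.bottChern_eq (P : MetricPath g φ) {H : MatField n M Q}
    (hu : ∀ e, IsUnit (H e).det) {s₀ : ℝ} (hs : ∀ t : ℝ, (s₀, t) ∈ Q)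
    (hH : ∀ (e : atlas (Cn n) M) (t : ℝ), ∀ z ∈ e.1.target, ∀ j k,
      (P.metric t).mat e z j k = (H e j k).ext ((s₀, t), z)) (e : atlas (Cn n) M)
    {z : Cn n} (hz : z ∈ e.1.target) :
    P.bottChern e z = form11 (Matrix.of fun j k => ∫ t in (0 : ℝ)..1,
      2 * (toddVarF H (velF H (0, 1)) e j k).ext ((s₀, t), z)) := by
  rw [bottChern]
  congr 1
  ext j k
  rw [Matrix.of_apply, Matrix.of_apply]
  refine intervalIntegral.integral_congr fun t _ => ?_
  have h2 := algHom_td2 (evAt (hs t) hz) (velF H (0, 1) e)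
    ((Sm.diffRing (dom Q e.1)).curvature (H e) j k)
  rw [← P.velocity_eq_ev hu hs hH e t hz, ← curv_eq_ev (hs t) (hu e) (hH e t) hz, Sm.ev_eq_ext] at h2
  change td2 _ _ + td2 _ _ = 2 * _
  rw [td2_comm (curv _ _ _ _), ← h2, ← two_mul]
  rfl

variable [T2Space M] [CompactSpace M]

/-- The Bott–Chern functional in terms of families of metrics. -/
theorem MetricPath.functional_eq (P : MetricPath g φ) {G H : MatField n M Q}
    (hu : ∀ e, IsUnit (H e).det) {s₀ : ℝ} (hs : ∀ t : ℝ, (s₀, t) ∈ Q)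
    (hH : ∀ (e : atlas (Cn n) M) (t : ℝ), ∀ z ∈ e.1.target, ∀ j k,
      (P.metric t).mat e z j k = (H e j k).ext ((s₀, t), z))
    (hG : ∀ (e : atlas (Cn n) M), ∀ q ∈ Q, ∀ z ∈ e.1.target, ∀ j k,
      g.mat e z j k = (G e j k).ext (q, z))
    {Q' : Opens (ℝ × ℝ)} {G' H' : MatField n M Q'} {f : SmField n M Q'}
    (hu' : ∀ e, IsUnit (H' e).det) {q : ℝ × ℝ} (hq : q ∈ Q')
    (hG' : ∀ (e : atlas (Cn n) M), ∀ z ∈ e.1.target, ∀ j k,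
      g.mat e z j k = (G' e j k).ext (q, z))
    (hH' : ∀ (e : atlas (Cn n) M), ∀ z ∈ e.1.target, ∀ j k,
      g.matPot φ e z j k = (H' e j k).ext (q, z))
    (hf : ∀ (e : atlas (Cn n) M), ∀ z ∈ e.1.target, locFun φ e z = (f e).ext (q, z)) :
    P.functional = (1 / ((n - 1).factorial : ℂ)) * (-2 * Complex.I * (∫ t in (0 : ℝ)..1,
        mint (topF (bcForm H (0, 1) * fundF G ^ (n - 1))) (s₀, t))
          - mint (topF (toddSum G' H' f (n - 1))) q) := by
  -- The path of metrics and the endpoint potential are described by separate families with separate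
  -- parameter domains, since an arbitrary path need not come from potentials.
  have key := integralForm_eq_integral_mint (M := M) (fun e z =>
    let h := g.matPot φ e
    (-Complex.I) • (P.bottChern e z *
        ((1 / ((n - 1).factorial : ℂ)) • fundForm (g.mat e z) ^ (n - 1))) +
      td2 (curvForm h z) (curvForm h z) *
        ((-1 / ((n - 1).factorial : ℂ)) • ∑ s ∈ Finset.range (n - 1),
          locFun φ e z • (fundForm (h z) ^ s * fundForm (g.mat e z) ^ (n - 2 - s))))
    (-2 * Complex.I / ((n - 1).factorial : ℂ))
    (topF (bcForm H (0, 1) * fundF G ^ (n - 1)))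
    ((-1 / ((n - 1).factorial : ℂ)) • topF (toddSum G' H' f (n - 1))) (s₀ := s₀) (fun t _ => hs t) hq
    fun e z hz => ?_
  · rw [functional, key, mint_smul]
    ring
  simp only
  set w := fundForm (g.mat e.1 z) with hw
  have hw1 : ∀ t, FA.ev (evAt (hs t) hz) (fundF G e) = w := fun t =>
    (fundForm_eq_ev (hs t) hz (hG e _ (hs t) z hz)).symm
  have hw2 : FA.ev (evAt hq hz) (fundF G' e) = w := (fundForm_eq_ev hq hz (hG' e z hz)).symm
  have hw3 : FA.ev (evAt hq hz) (fundF H' e) = fundForm (g.matPot φ e z) :=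
    (fundForm_eq_ev hq hz (hH' e z hz)).symm
  have hT : ∀ j k, Continuous fun t => (toddVarF H (velF H (0, 1)) e j k).ext ((s₀, t), z) :=
    fun j k => (Sm.contDiffOn_ext _).continuousOn.comp_continuous (by fun_prop)
      fun t => ⟨hs t, hz⟩
  have h1 : topCoeff (P.bottChern e z * w ^ (n - 1)) = ∫ t in (0 : ℝ)..1,
      2 * topCoeff (FA.ev (evAt (hs t) hz) (bcForm H (0, 1) e) * w ^ (n - 1)) := by
    rw [P.bottChern_eq hu hs hH e hz]
    refine (topCoeff_form11_integral (A := fun t => Matrix.of fun j k =>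
      2 * (toddVarF H (velF H (0, 1)) e j k).ext ((s₀, t), z))
      (fun j k => ((hT j k).const_mul 2).continuousOn) _).trans ?_
    refine intervalIntegral.integral_congr fun t _ => ?_
    have h2 : form11 (Matrix.of fun j k => 2 * (toddVarF H (velF H (0, 1)) e j k).ext ((s₀, t), z))
        = (2 : ℂ) • FA.ev (evAt (hs t) hz) (bcForm H (0, 1) e) := by
      rw [bcForm, FA.ev_form11]
      simp only [form11, Finset.smul_sum, smul_smul, Matrix.map_apply, Matrix.of_apply, Sm.ev_eq_ext]
    refine (congrArg (fun x => topCoeff (x * w ^ (n - 1))) h2).trans ?_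
    rw [smul_mul_assoc, map_smul, smul_eq_mul]
  have h3 : ∀ t, (topF (bcForm H (0, 1) * fundF G ^ (n - 1)) e).ext ((s₀, t), z)
      = (-2 * Complex.I) ^ n * topCoeff (FA.ev (evAt (hs t) hz) (bcForm H (0, 1) e) * w ^ (n - 1)) :=
    fun t => by
    have := ext_topF (bcForm H (0, 1) * fundF G ^ (n - 1)) e ⟨((s₀, t), z), hs t, hz⟩
    rw [Pi.mul_apply, Pi.pow_apply, map_mul (FA.ev _), map_pow (FA.ev _), hw1] at this
    exact this
  have h4 : ((((-1 / ((n - 1).factorial : ℂ)) • topF (toddSum G' H' f (n - 1))) : SmField n M Q') e).ext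
      (q, z) = (-2 * Complex.I) ^ n * topCoeff (td2 (curvForm (g.matPot φ e) z)
        (curvForm (g.matPot φ e) z) * ((-1 / ((n - 1).factorial : ℂ)) • ∑ s ∈ Finset.range (n - 1),
          locFun φ e z • (fundForm (g.matPot φ e z) ^ s * w ^ (n - 2 - s)))) := by
    have := ext_topF (toddSum G' H' f (n - 1)) e ⟨(q, z), hq, hz⟩
    rw [Pi.smul_apply, Sm.ext_smul, this, toddSum, map_mul (FA.ev _), map_sum,
      td2_curvForm_eq_ev (hu' e) hq (hH' e) hz, mul_smul_comm, map_smul]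
    simp only [FA.ev_smul, map_mul (FA.ev _), map_pow (FA.ev _), hw2, hw3, Sm.ev_eq_ext _ (f e),
      ← hf e z hz, Nat.sub_sub, smul_eq_mul, Nat.reduceAdd]
    ring
  have h5 : topCoeff ((-Complex.I) • (P.bottChern e z *
      ((1 / ((n - 1).factorial : ℂ)) • w ^ (n - 1)))) = -Complex.I * (1 / ((n - 1).factorial : ℂ)
        * topCoeff (P.bottChern e z * w ^ (n - 1))) := by
    rw [mul_smul_comm, map_smul, map_smul, smul_eq_mul, smul_eq_mul]
  rw [map_add, mul_add, h4, h5, h1]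
  congr 1
  simp only [h3, intervalIntegral.integral_const_mul]
  ring

end Functional

end KahlerGeom
end

noncomputable section

set_option linter.unusedSectionVars false

namespace KahlerGeom

/-! ### Families of Kähler potentials -/

section Potential

open TopologicalSpace

variable {n : ℕ} {M : Type*} [TopologicalSpace M] [ChartedSpace (Cn n) M] {Q : Opens (ℝ × ℝ)}
  [IsManifold 𝓘(ℂ, Cn n) ω M] (g : HermitianMetric n M)

variable (Q) in
/-- The constant family of metrics. -/
def baseF : MatField n M Q := MatField.of (fun _ e z => g.mat e z) fun e he j k =>
  (g.smooth e he j k).comp contDiffOn_snd fun _ hx => hx.2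

theorem ext_baseF (e : atlas (Cn n) M) {q : ℝ × ℝ} (hq : q ∈ Q) {z : Cn n} (hz : z ∈ e.1.target)
    (j k : Fin n) : (baseF Q g e j k).ext (q, z) = g.mat e.1 z j k := MatField.ext_of _ e hq hz j k

theorem isTens_baseF : IsTens (baseF Q g) := isTens_iff_ext.2 fun e e' q hq z hz j k => by
  simp only [ext_baseF g e hq hz.1, ext_baseF g e' hq (coordChange_mem hz).1]
  exact localMatrix_coordChange g.form e.2 e'.2 hz j k

theorem conj_baseF (e : atlas (Cn n) M) (j k : Fin n) :
    Sm.conj (baseF Q g e j k) = baseF Q g e k j := Sm.ext_eq fun x hx => by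
  rw [Sm.ext_conj _ hx, ext_baseF g e hx.1 hx.2, ext_baseF g e hx.1 hx.2]
  exact g.conj_symm _ _ _

theorem dp_baseF (v : ℝ × ℝ) (e : atlas (Cn n) M) : (baseF Q g e).map (Sm.dp v) = 0 := by
  ext1 j k
  refine Sm.ext_eq fun x hx => ?_
  have h : (baseF Q g e j k).ext =ᶠ[nhds x] ((fun z => g.mat e.1 z j k) ∘ Prod.snd) := by
    filter_upwards [(dom Q e.1).isOpen.mem_nhds hx] with y hy
    exact ext_baseF g e hy.1 hy.2 j k
  have h2 := ((((g.smooth e.1 e.2 j k).contDiffAt (e.1.open_target.mem_nhds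
    hx.2)).differentiableAt (by simp)).hasFDerivAt.comp x (hasFDerivAt_snd (𝕜 := ℝ) (p := x))).fderiv
  rw [Matrix.map_apply, Sm.dp, Sm.ext_der _ _ hx, h.fderiv_eq, Matrix.zero_apply, Sm.ext_zero]
  refine (DFunLike.congr_fun h2 _).trans ?_
  simp

variable {g}

/-- Only the `∂`-symmetry is given; the `∂̄`-symmetry is its complex conjugate, by Hermitian
symmetry of the metric. -/
theorem isKahlerF_baseF (hg : g.IsKahler) : IsKahlerF (baseF Q g) := fun e => by
  have h : ∀ j k l, Sm.del l (baseF Q g e j k) = Sm.del j (baseF Q g e l k) := fun j k l =>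
    Sm.ext_eq fun ⟨q, z⟩ hx => by
      rw [← Sm.dd_eq_ext l (baseF Q g e j k) hx fun w hw => (ext_baseF g e hw.1 hw.2 j k).symm,
        ← Sm.dd_eq_ext j (baseF Q g e l k) hx fun w hw => (ext_baseF g e hw.1 hw.2 l k).symm]
      exact hg e.1 e.2 z hx.2 j k l
  refine ⟨h, fun j k l => ?_⟩
  change Sm.delb l _ = Sm.delb k _
  rw [← conj_baseF g e k j, ← conj_baseF g e l j, Sm.delb_conj, Sm.delb_conj, h]

variable (g)

variable (n M Q) in
/-- A function of the parameters. -/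
def parF (a : ℝ × ℝ → ℝ) (ha : ContDiff ℝ ∞ a) : SmField n M Q := fun _ =>
  Sm.of (fun x => (a x.1 : ℂ)) (Complex.ofRealCLM.contDiff.comp (ha.comp contDiff_fst)).contDiffOn

theorem ext_parF (a : ℝ × ℝ → ℝ) (ha : ContDiff ℝ ∞ a) (e : atlas (Cn n) M) {q : ℝ × ℝ}
    (hq : q ∈ Q) {z : Cn n} (hz : z ∈ e.1.target) : (parF n M Q a ha e).ext (q, z) = a q :=
  Sm.ext_of _ (x := (q, z)) ⟨hq, hz⟩

theorem isFn_parF (a : ℝ × ℝ → ℝ) (ha : ContDiff ℝ ∞ a) : IsFn (parF n M Q a ha) :=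
  isFn_iff.2 fun e e' x hx => by
    obtain ⟨q, z⟩ := x
    rw [ext_parF a ha e hx.1 hx.2.1]
    exact (ext_parF a ha e' hx.1 (coordChange_mem hx.2).1).symm

theorem ext_dp_parF (a : ℝ × ℝ → ℝ) (ha : ContDiff ℝ ∞ a) (v : ℝ × ℝ) (e : atlas (Cn n) M)
    {q : ℝ × ℝ} (hq : q ∈ Q) {z : Cn n} (hz : z ∈ e.1.target) :
    (Sm.dp v (parF n M Q a ha e)).ext (q, z) = fderiv ℝ a q v := by
  have hx : (q, z) ∈ dom Q e.1 := ⟨hq, hz⟩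
  have h : (parF n M Q a ha e).ext =ᶠ[nhds (q, z)] fun x => Complex.ofRealCLM (a x.1) := by
    filter_upwards [(dom Q e.1).isOpen.mem_nhds hx] with y hy
    exact ext_parF a ha e hy.1 hy.2
  have h2 : HasFDerivAt (fun x : PCn n => Complex.ofRealCLM (a x.1))
      (Complex.ofRealCLM.comp ((fderiv ℝ a q).comp (ContinuousLinearMap.fst ℝ _ _))) (q, z) :=
    Complex.ofRealCLM.hasFDerivAt.comp (q, z)
      (HasFDerivAt.comp (g := a) (q, z) (ha.differentiable (by simp) q).hasFDerivAt hasFDerivAt_fst)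
  rw [Sm.dp, Sm.ext_der _ _ hx, h.fderiv_eq, h2.fderiv]
  rfl

theorem IsFn.add {f f' : SmField n M Q} (hf : IsFn f) (hf' : IsFn f') : IsFn (f + f') :=
  fun e e' => by simp only [Pi.add_apply, map_add, hf e e', hf' e e']

theorem conj_hessF {f : SmField n M Q} (hf : ∀ e, Sm.conj (f e) = f e) (e : atlas (Cn n) M)
    (j k : Fin n) : Sm.conj (hessF f e j k) = hessF f e k j := by
  change Sm.conj (Sm.del j (Sm.delb k (f e))) = (Sm.diffRing _).d k ((Sm.diffRing _).db j (f e))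
  rw [← Sm.delb_conj, ← Sm.del_conj, hf, DiffRing.d_db]
  rfl

/-- A family of metrics with varying Kähler potential. -/
theorem ext_add_hessF {f : SmField n M Q} {φ : C^∞⟮𝓘(ℝ, Cn n), M; ℝ⟯} (e : atlas (Cn n) M)
    {q : ℝ × ℝ} (hq : q ∈ Q) (hf : ∀ z ∈ e.1.target, locFun φ e.1 z = (f e).ext (q, z)) {z : Cn n}
    (hz : z ∈ e.1.target) (j k : Fin n) :
    ((baseF Q g + hessF f) e j k).ext (q, z) = g.matPot φ e.1 z j k := by
  rw [Pi.add_apply, Matrix.add_apply, Sm.ext_add, ext_baseF g e hq hz, HermitianMetric.matPot,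
    Matrix.add_apply, hess_eq_ev hq hf hz, Matrix.map_apply, Sm.ev_eq_ext]
  rfl

theorem hess_locFun_add (φ ψ : C^∞⟮𝓘(ℝ, Cn n), M; ℝ⟯) {e : OpenPartialHomeomorph M (Cn n)}
    (he : e ∈ atlas (Cn n) M) {z : Cn n} (hz : z ∈ e.target) :
    hess (locFun (φ + ψ) e) z = hess (locFun φ e) z + hess (locFun ψ e) z := by
  have hq : (0 : ℝ × ℝ) ∈ (⊤ : Opens (ℝ × ℝ)) := trivial
  have h : ∀ φ : C^∞⟮𝓘(ℝ, Cn n), M; ℝ⟯, ∀ z ∈ e.target, locFun φ e z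
      = (fnField ⊤ φ ⟨e, he⟩).ext (0, z) := fun φ z hz => (ext_fnField φ ⟨e, he⟩ (x := (0, z)) ⟨hq, hz⟩).symm
  rw [hess_eq_ev hq (F := fnField ⊤ φ ⟨e, he⟩ + fnField ⊤ ψ ⟨e, he⟩) (fun z hz => by
    rw [Sm.ext_add, ← h φ z hz, ← h ψ z hz]
    simp [locFun]) hz, hess_eq_ev hq (h φ) hz, hess_eq_ev hq (h ψ) hz]
  ext j k
  simp [DiffRing.hessian]

theorem hess_locFun_smul (a : ℝ) (φ : C^∞⟮𝓘(ℝ, Cn n), M; ℝ⟯) {e : OpenPartialHomeomorph M (Cn n)}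
    (he : e ∈ atlas (Cn n) M) {z : Cn n} (hz : z ∈ e.target) :
    hess (locFun (a • φ) e) z = (a : ℂ) • hess (locFun φ e) z := by
  have hq : (0 : ℝ × ℝ) ∈ (⊤ : Opens (ℝ × ℝ)) := trivial
  have h : ∀ z ∈ e.target, locFun φ e z
      = (fnField ⊤ φ ⟨e, he⟩).ext (0, z) := fun z hz => (ext_fnField φ ⟨e, he⟩ (x := (0, z)) ⟨hq, hz⟩).symm
  rw [hess_eq_ev hq (F := (a : ℂ) • fnField ⊤ φ ⟨e, he⟩) (fun z hz => by
    rw [Sm.ext_smul, ← h z hz]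
    simp [locFun]) hz, hess_eq_ev hq h hz]
  ext j k
  simp only [Matrix.map_apply, DiffRing.hessian, Matrix.of_apply, Matrix.smul_apply,
    Derivation.map_smul, map_smul]

theorem matPot_zero {e : OpenPartialHomeomorph M (Cn n)} (he : e ∈ atlas (Cn n) M) {z : Cn n}
    (hz : z ∈ e.target) : g.matPot 0 e z = g.mat e z := by
  have h := hess_locFun_smul (n := n) (M := M) 0 0 he hz
  rw [zero_smul, Complex.ofReal_zero, zero_smul] at h
  rw [HermitianMetric.matPot, h, add_zero]

theorem posDef_convex {A B : Matrix (Fin n) (Fin n) ℂ} (hA : A.PosDef) (hB : B.PosDef) {a : ℝ}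
    (h0 : 0 ≤ a) (h1 : a ≤ 1) : (((1 - a : ℝ) : ℂ) • A + (a : ℂ) • B).PosDef := by
  rcases h0.eq_or_lt with rfl | h0
  · simpa using hA
  rcases h1.eq_or_lt with rfl | h1
  · simpa using hB
  exact (hA.smul (by exact_mod_cast sub_pos.2 h1)).add (hB.smul (by exact_mod_cast h0))

theorem matPot_convex (φ ψ : C^∞⟮𝓘(ℝ, Cn n), M; ℝ⟯) (a : ℝ) {e : OpenPartialHomeomorph M (Cn n)}
    (he : e ∈ atlas (Cn n) M) {z : Cn n} (hz : z ∈ e.target) :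
    g.matPot ((1 - a) • φ + a • ψ) e z
      = ((1 - a : ℝ) : ℂ) • g.matPot φ e z + (a : ℂ) • g.matPot ψ e z := by
  simp only [HermitianMetric.matPot]
  rw [hess_locFun_add _ _ he hz, hess_locFun_smul _ _ he hz, hess_locFun_smul _ _ he hz]
  push_cast
  module

variable {g}

theorem zero_mem_potentials : (0 : C^∞⟮𝓘(ℝ, Cn n), M; ℝ⟯) ∈ g.potentials := fun e he z hz => by
  rw [matPot_zero g he hz]
  exact g.posDef he hz

theorem convex_mem_potentials {φ ψ : C^∞⟮𝓘(ℝ, Cn n), M; ℝ⟯} (hφ : φ ∈ g.potentials)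
    (hψ : ψ ∈ g.potentials) {a : ℝ} (h0 : 0 ≤ a) (h1 : a ≤ 1) :
    (1 - a) • φ + a • ψ ∈ g.potentials := fun e he z hz => by
  rw [matPot_convex g φ ψ a he hz]
  exact posDef_convex (hφ e he z hz) (hψ e he z hz) h0 h1

theorem smul_mem_potentials {φ : C^∞⟮𝓘(ℝ, Cn n), M; ℝ⟯} (hφ : φ ∈ g.potentials) {a : ℝ}
    (h0 : 0 ≤ a) (h1 : a ≤ 1) : a • φ ∈ g.potentials := by
  simpa using convex_mem_potentials zero_mem_potentials hφ h0 h1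

variable (Q) in
/-- A family of potentials depending on the parameters through coefficients. -/
def potF (a b c : ℝ × ℝ → ℝ) (ha : ContDiff ℝ ∞ a) (hb : ContDiff ℝ ∞ b) (hc : ContDiff ℝ ∞ c)
    (φ ψ₁ ψ₂ : C^∞⟮𝓘(ℝ, Cn n), M; ℝ⟯) : SmField n M Q :=
  parF n M Q a ha * fnField Q φ + parF n M Q b hb * fnField Q ψ₁ + parF n M Q c hc * fnField Q ψ₂

section PotF

variable {a b c : ℝ × ℝ → ℝ} (ha : ContDiff ℝ ∞ a) (hb : ContDiff ℝ ∞ b) (hc : ContDiff ℝ ∞ c)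
  (φ ψ₁ ψ₂ : C^∞⟮𝓘(ℝ, Cn n), M; ℝ⟯)

theorem isFn_potF : IsFn (potF Q a b c ha hb hc φ ψ₁ ψ₂) :=
  (((isFn_parF a ha).mul (isFn_fnField φ)).add ((isFn_parF b hb).mul (isFn_fnField ψ₁))).add
    ((isFn_parF c hc).mul (isFn_fnField ψ₂))

theorem ext_potF (e : atlas (Cn n) M) {q : ℝ × ℝ} (hq : q ∈ Q) {z : Cn n} (hz : z ∈ e.1.target) :
    locFun (a q • φ + b q • ψ₁ + c q • ψ₂) e.1 z = (potF Q a b c ha hb hc φ ψ₁ ψ₂ e).ext (q, z) := by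
  have h := fun φ : C^∞⟮𝓘(ℝ, Cn n), M; ℝ⟯ => ext_fnField (Q := Q) φ e (x := (q, z)) ⟨hq, hz⟩
  simp only [potF, Pi.add_apply, Pi.mul_apply, Sm.ext_add, Sm.ext_mul, h, ext_parF _ _ e hq hz]
  simp [locFun]

theorem conj_potF (e : atlas (Cn n) M) : Sm.conj (potF Q a b c ha hb hc φ ψ₁ ψ₂ e)
    = potF Q a b c ha hb hc φ ψ₁ ψ₂ e := Sm.ext_eq fun ⟨q, z⟩ hx => by
  rw [Sm.ext_conj _ hx, ← ext_potF ha hb hc φ ψ₁ ψ₂ e hx.1 hx.2]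
  exact Complex.conj_ofReal _

theorem ext_dp_potF [T2Space M] [CompactSpace M] (v : ℝ × ℝ) (e : atlas (Cn n) M) {q : ℝ × ℝ} (hq : q ∈ Q) {z : Cn n}
    (hz : z ∈ e.1.target) : locFun (fderiv ℝ a q v • φ + fderiv ℝ b q v • ψ₁ + fderiv ℝ c q v • ψ₂) e.1 z
      = (dpF v (potF Q a b c ha hb hc φ ψ₁ ψ₂) e).ext (q, z) := by
  have h := fun φ : C^∞⟮𝓘(ℝ, Cn n), M; ℝ⟯ => ext_fnField (Q := Q) φ e (x := (q, z)) ⟨hq, hz⟩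
  have h0 := fun φ : C^∞⟮𝓘(ℝ, Cn n), M; ℝ⟯ => fnField_dp (Q := Q) φ v e
  simp only [dpF, potF, Pi.add_apply, Pi.mul_apply, map_add, Derivation.leibniz, smul_eq_mul,
    Sm.ext_add, Sm.ext_mul, h, h0, mul_zero, zero_add, ext_dp_parF _ _ v e hq hz]
  simp [locFun, mul_comm]

end PotF

end Potential

end KahlerGeom
end

noncomputable section

set_option linter.unusedSectionVars false

namespace KahlerGeom

/-! ### Construction of metrics, and openness of the space of potentials -/

section Construction

open TopologicalSpace

variable {n : ℕ} {M : Type*} [TopologicalSpace M] [ChartedSpace (Cn n) M]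
  [IsManifold 𝓘(ℂ, Cn n) ω M]

/-- The differential of a coordinate system. -/
def coframe (e : OpenPartialHomeomorph M (Cn n)) (x : M) : Cn n →L[ℂ] Cn n :=
  mfderiv 𝓘(ℂ, Cn n) 𝓘(ℂ, Cn n) e x

theorem coframe_frame {e : OpenPartialHomeomorph M (Cn n)} (he : e ∈ atlas (Cn n) M) {z : Cn n}
    (hz : z ∈ e.target) (v : Cn n) : coframe e (e.symm z) (frame e z v) = v := by
  have := isManifold_one n M
  exact DFunLike.congr_fun ((mdifferentiable_of_mem_atlas (I := 𝓘(ℂ, Cn n)) he).comp_symm_deriv hz) v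

theorem coframe_ne_zero {e : OpenPartialHomeomorph M (Cn n)} (he : e ∈ atlas (Cn n) M) {x : M}
    (hx : x ∈ e.source) {v : Cn n} (hv : v ≠ 0) : coframe e x v ≠ 0 := fun h => by
  have := isManifold_one n M
  have h1 := (mdifferentiable_of_mem_atlas (I := 𝓘(ℂ, Cn n)) he).symm_comp_deriv hx
  have h2 := DFunLike.congr_fun h1 v
  refine hv (h2.symm.trans ?_)
  exact (congrArg (mfderiv 𝓘(ℂ, Cn n) 𝓘(ℂ, Cn n) e.symm (e x)) h).trans (map_zero _)

/-- The sesquilinear form of a matrix. -/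
def matSesq (A : Matrix (Fin n) (Fin n) ℂ) : Cn n →ₗ[ℂ] Cn n →ₗ⋆[ℂ] ℂ :=
  LinearMap.mk₂'ₛₗ (RingHom.id ℂ) (starRingEnd ℂ) (fun v w => ∑ j, ∑ k, v j * star (w k) * A j k)
    (fun v v' w => by simp [add_mul, Finset.sum_add_distrib])
    (fun c v w => by simp [Finset.mul_sum, mul_assoc])
    (fun v w w' => by simp [mul_add, add_mul, Finset.sum_add_distrib])
    (fun c v w => by
      simp only [Pi.smul_apply, smul_eq_mul, star_mul', Finset.mul_sum, starRingEnd_apply]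
      exact Finset.sum_congr rfl fun _ _ => Finset.sum_congr rfl fun _ _ => by ring)

theorem matSesq_apply (A : Matrix (Fin n) (Fin n) ℂ) (v w : Cn n) :
    matSesq A v w = ∑ j, ∑ k, v j * star (w k) * A j k := rfl

theorem matSesq_pos {A : Matrix (Fin n) (Fin n) ℂ} (hA : A.PosDef) {v : Cn n} (hv : v ≠ 0) :
    0 < matSesq A v v := by
  have h := hA.dotProduct_mulVec_pos (x := star v) (by simpa using hv)
  refine h.trans_eq ?_
  rw [matSesq_apply]
  simp only [dotProduct, Matrix.mulVec, Finset.mul_sum, Pi.star_apply, star_star]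
  exact Finset.sum_congr rfl fun _ _ => Finset.sum_congr rfl fun _ _ => by ring

theorem matSesq_conj {A : Matrix (Fin n) (Fin n) ℂ} (hA : A.IsHermitian) (v w : Cn n) :
    star (matSesq A v w) = matSesq A w v := by
  simp only [matSesq_apply, star_sum, star_mul', star_star]
  rw [Finset.sum_comm]
  refine Finset.sum_congr rfl fun j _ => Finset.sum_congr rfl fun k _ => ?_
  rw [show star (A k j) = A j k from hA.apply j k]
  ring

/-- The pull-back of a sesquilinear form. -/
def sesqComp (B : Cn n →ₗ[ℂ] Cn n →ₗ⋆[ℂ] ℂ) (L : Cn n →L[ℂ] Cn n) : Cn n →ₗ[ℂ] Cn n →ₗ⋆[ℂ] ℂ :=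
  LinearMap.mk₂'ₛₗ (RingHom.id ℂ) (starRingEnd ℂ) (fun v w => B (L v) (L w))
    (fun v v' w => by simp) (fun c v w => by simp) (fun v w w' => by simp) (fun c v w => by simp)

/-- The sesquilinear form on a tangent space given by matrices in the coordinate systems. -/
def chartSesq (A : OpenPartialHomeomorph M (Cn n) → Cn n → Matrix (Fin n) (Fin n) ℂ) (x : M) :
    Cn n →ₗ[ℂ] Cn n →ₗ⋆[ℂ] ℂ :=
  sesqComp (matSesq (A (chartAt (Cn n) x) (chartAt (Cn n) x x))) (coframe (chartAt (Cn n) x) x)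

theorem chartSesq_apply (A : OpenPartialHomeomorph M (Cn n) → Cn n → Matrix (Fin n) (Fin n) ℂ)
    (x : M) (v w : Cn n) : chartSesq A x v w = matSesq (A (chartAt (Cn n) x) (chartAt (Cn n) x x))
      (coframe (chartAt (Cn n) x) x v) (coframe (chartAt (Cn n) x) x w) := rfl

/-- The form is defined through the preferred chart at each point. The transformation law says that
any other chart reads off its own prescribed matrix. -/
theorem chartSesq_frame {A : OpenPartialHomeomorph M (Cn n) → Cn n → Matrix (Fin n) (Fin n) ℂ}
    (ht : ∀ e ∈ atlas (Cn n) M, ∀ e' ∈ atlas (Cn n) M, ∀ z ∈ overlap e e', ∀ j k,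
      A e z j k = ∑ a, ∑ b, jac e e' z a j * star (jac e e' z b k) * A e' (coordChange e e' z) a b)
    {e : OpenPartialHomeomorph M (Cn n)} (he : e ∈ atlas (Cn n) M) {z : Cn n} (hz : z ∈ e.target)
    (j k : Fin n) :
    chartSesq A (e.symm z) (frame e z (Pi.single j 1)) (frame e z (Pi.single k 1)) = A e z j k := by
  set x := e.symm z with hx
  have he' := chart_mem_atlas (Cn n) x
  have hz' : z ∈ overlap e (chartAt (Cn n) x) := ⟨hz, mem_chart_source (Cn n) x⟩
  have h1 := coordChange_mem hz'
  have h2 : ∀ u, coframe (chartAt (Cn n) x) x (frame (chartAt (Cn n) x)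
      (coordChange e (chartAt (Cn n) x) z) u) = u := fun u => by
    have := coframe_frame he' h1.1 u
    rwa [coordChange_symm hz'] at this
  have h3 : coordChange e (chartAt (Cn n) x) z = chartAt (Cn n) x x := rfl
  rw [chartSesq_apply, frame_coordChange he he' hz', frame_coordChange he he' hz', h2, h2,
    ht e he _ he' z hz', matSesq_apply, h3]
  simp only [Matrix.mulVec_single_one, Matrix.col_apply]

/-- The family of sesquilinear forms given by matrices in the coordinate systems. -/
def chartForms (A : OpenPartialHomeomorph M (Cn n) → Cn n → Matrix (Fin n) (Fin n) ℂ) :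
    SesqForms n M :=
  fun x => chartSesq A x

theorem localMatrix_chartForms
    {A : OpenPartialHomeomorph M (Cn n) → Cn n → Matrix (Fin n) (Fin n) ℂ}
    (ht : ∀ e ∈ atlas (Cn n) M, ∀ e' ∈ atlas (Cn n) M, ∀ z ∈ overlap e e', ∀ j k,
      A e z j k = ∑ a, ∑ b, jac e e' z a j * star (jac e e' z b k) * A e' (coordChange e e' z) a b)
    {e : OpenPartialHomeomorph M (Cn n)} (he : e ∈ atlas (Cn n) M) {z : Cn n} (hz : z ∈ e.target) :
    localMatrix (chartForms A) e z = A e z := by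
  ext j k
  rw [← chartSesq_frame ht he hz j k]
  rfl

theorem chartSesq_conj {A : OpenPartialHomeomorph M (Cn n) → Cn n → Matrix (Fin n) (Fin n) ℂ}
    {x : M} (hA : (A (chartAt (Cn n) x) (chartAt (Cn n) x x)).PosDef) (v w : Cn n) :
    star (chartSesq A x v w) = chartSesq A x w v := by
  rw [chartSesq_apply, chartSesq_apply, matSesq_conj hA.isHermitian]

theorem chartSesq_pos {A : OpenPartialHomeomorph M (Cn n) → Cn n → Matrix (Fin n) (Fin n) ℂ}
    {x : M} (hA : (A (chartAt (Cn n) x) (chartAt (Cn n) x x)).PosDef) {v : Cn n} (hv : v ≠ 0) :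
    0 < chartSesq A x v v := by
  rw [chartSesq_apply]
  exact matSesq_pos hA
    (coframe_ne_zero (chart_mem_atlas (Cn n) x) (mem_chart_source (Cn n) x) hv)

/-- A metric from its matrices in the coordinate systems. -/
theorem exists_hermitianMetric
    (A : OpenPartialHomeomorph M (Cn n) → Cn n → Matrix (Fin n) (Fin n) ℂ)
    (hs : ∀ e ∈ atlas (Cn n) M, ∀ j k, ContDiffOn ℝ ∞ (fun z => A e z j k) e.target)
    (hp : ∀ e ∈ atlas (Cn n) M, ∀ z ∈ e.target, (A e z).PosDef)
    (ht : ∀ e ∈ atlas (Cn n) M, ∀ e' ∈ atlas (Cn n) M, ∀ z ∈ overlap e e', ∀ j k,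
      A e z j k = ∑ a, ∑ b, jac e e' z a j * star (jac e e' z b k) * A e' (coordChange e e' z) a b) :
    ∃ h : HermitianMetric n M, ∀ e ∈ atlas (Cn n) M, ∀ z ∈ e.target, h.mat e z = A e z := by
  have hpos : ∀ x : M, (A (chartAt (Cn n) x) (chartAt (Cn n) x x)).PosDef := fun x =>
    hp _ (chart_mem_atlas (Cn n) x) _ (mem_chart_target (Cn n) x)
  have h3 : ∀ e ∈ atlas (Cn n) M, ∀ z ∈ e.target, localMatrix (chartForms A) e z = A e z :=
    fun e he z hz => localMatrix_chartForms ht he hz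
  have h4 : ∀ e ∈ atlas (Cn n) M, ∀ j k,
      ContDiffOn ℝ ∞ (fun z => localMatrix (chartForms A) e z j k) e.target := fun e he j k =>
    (hs e he j k).congr fun z hz => congrFun (congrFun (h3 e he z hz) j) k
  exact ⟨⟨chartForms A, fun x v w => chartSesq_conj (hpos x) v w,
    fun x v hv => chartSesq_pos (hpos x) hv, h4⟩, h3⟩

variable {g : HermitianMetric n M}

theorem matPot_coordChange (φ : C^∞⟮𝓘(ℝ, Cn n), M; ℝ⟯) {e e' : OpenPartialHomeomorph M (Cn n)}
    (he : e ∈ atlas (Cn n) M) (he' : e' ∈ atlas (Cn n) M) {z : Cn n} (hz : z ∈ overlap e e')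
    (j k : Fin n) : g.matPot φ e z j k = ∑ a, ∑ b, jac e e' z a j * star (jac e e' z b k)
      * g.matPot φ e' (coordChange e e' z) a b := by
  have hq : (0 : ℝ × ℝ) ∈ (⊤ : Opens (ℝ × ℝ)) := trivial
  have hf : ∀ (e : atlas (Cn n) M), ∀ z ∈ e.1.target, locFun φ e.1 z = (fnField ⊤ φ e).ext (0, z) :=
    fun e z hz => (ext_fnField φ e (x := (0, z)) ⟨hq, hz⟩).symm
  have h := isTens_iff_ext.1 ((isTens_baseF g).add (isTens_hessF (isFn_fnField (Q := ⊤) φ)))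
    ⟨e, he⟩ ⟨e', he'⟩ 0 hq z hz j k
  rw [ext_add_hessF g ⟨e, he⟩ hq (hf ⟨e, he⟩) hz.1] at h
  rw [h]
  refine Finset.sum_congr rfl fun a _ => Finset.sum_congr rfl fun b _ => ?_
  exact congrArg _ (ext_add_hessF g ⟨e', he'⟩ hq (hf ⟨e', he'⟩) (coordChange_mem hz).1 a b)

/-- The two matrices are congruent through the invertible conjugate Jacobian. -/
theorem posDef_matPot_coordChange {φ : C^∞⟮𝓘(ℝ, Cn n), M; ℝ⟯}
    {e e' : OpenPartialHomeomorph M (Cn n)} (he : e ∈ atlas (Cn n) M) (he' : e' ∈ atlas (Cn n) M)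
    {z : Cn n} (hz : z ∈ overlap e e') (h : (g.matPot φ e' (coordChange e e' z)).PosDef) :
    (g.matPot φ e z).PosDef := by
  set B := (jac e e' z).map star with hB
  have hdet : IsUnit B := by
    rw [Matrix.isUnit_iff_isUnit_det]
    have h1 : B.det = star (jac e e' z).det := (RingHom.map_det (starRingEnd ℂ) _).symm
    rw [h1]
    exact (star_ne_zero.2 (det_jac_ne_zero he he' hz)).isUnit
  have h2 : g.matPot φ e z = B.conjTranspose * g.matPot φ e' (coordChange e e' z) * B := by
    ext j k
    rw [matPot_coordChange φ he he' hz, Matrix.mul_apply]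
    simp only [Matrix.mul_apply, Finset.sum_mul, Matrix.conjTranspose_apply, hB, Matrix.map_apply,
      star_star]
    rw [Finset.sum_comm]
    exact Finset.sum_congr rfl fun _ _ => Finset.sum_congr rfl fun _ _ => by ring
  rw [h2]
  exact h.conjTranspose_mul_mul_same (Matrix.mulVec_injective_iff_isUnit.2 hdet)

theorem isHermitian_matPot (φ : C^∞⟮𝓘(ℝ, Cn n), M; ℝ⟯) {e : OpenPartialHomeomorph M (Cn n)}
    (he : e ∈ atlas (Cn n) M) {z : Cn n} (hz : z ∈ e.target) : (g.matPot φ e z).IsHermitian := by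
  have hq : (0 : ℝ × ℝ) ∈ (⊤ : Opens (ℝ × ℝ)) := trivial
  have hx : (((0 : ℝ × ℝ), z) : PCn n) ∈ dom ⊤ e := ⟨hq, hz⟩
  have hf : ∀ z ∈ e.target, locFun φ e z = (fnField ⊤ φ ⟨e, he⟩).ext (0, z) :=
    fun z hz => (ext_fnField φ ⟨e, he⟩ (x := (0, z)) ⟨hq, hz⟩).symm
  have hc : ∀ e, Sm.conj (fnField ⊤ φ e) = fnField (n := n) ⊤ φ e := fun e => Sm.ext_eq fun x hx => by
    rw [Sm.ext_conj _ hx, ext_fnField _ _ hx]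
    exact Complex.conj_ofReal _
  ext j k
  rw [Matrix.conjTranspose_apply, ← ext_add_hessF g ⟨e, he⟩ hq hf hz j k,
    ← ext_add_hessF g ⟨e, he⟩ hq hf hz k j, ← Sm.ext_conj _ hx]
  congr 1
  rw [Pi.add_apply, Matrix.add_apply, map_add]
  exact congrArg₂ (· + ·) (conj_baseF g ⟨e, he⟩ k j) (conj_hessF hc ⟨e, he⟩ k j)

/-- Positivity is an open condition on Hermitian matrices. -/
theorem eventually_posDef {X : Type*} [TopologicalSpace X] {A : X → Matrix (Fin n) (Fin n) ℂ}
    {x₀ : X} (hA : ContinuousAt A x₀) (hx : (A x₀).PosDef) :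
    ∀ᶠ x in nhds x₀, (A x).IsHermitian → (A x).PosDef := by
  -- Positivity is open near each unit vector, and compactness of the unit sphere makes the
  -- neighbourhood uniform; general vectors follow by scaling.
  have h1 : ∀ v ∈ Metric.sphere (0 : Cn n) 1, ∀ᶠ p : X × Cn n in nhds (x₀, v),
      0 < (matSesq (A p.1) p.2 p.2).re := fun v hv => by
    have hv0 : v ≠ 0 := fun h => by simp [h] at hv
    have h2 : ContinuousAt (fun p : X × Cn n => (matSesq (A p.1) p.2 p.2).re) (x₀, v) := by
      simp only [matSesq_apply]
      have hA' : ContinuousAt (fun p : X × Cn n => A p.1) (x₀, v) :=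
        ContinuousAt.comp (g := A) hA continuousAt_fst
      have : ∀ j k, ContinuousAt (fun p : X × Cn n => A p.1 j k) (x₀, v) := fun j k =>
        ((continuous_id.matrix_elem j k).continuousAt).comp hA'
      refine Complex.continuous_re.continuousAt.comp (f := fun p : X × Cn n =>
        ∑ j, ∑ k, p.2 j * star (p.2 k) * A p.1 j k) ?_
      refine tendsto_finsetSum _ fun j _ => tendsto_finsetSum _ fun k _ => ?_
      have hv' : ContinuousAt (fun p : X × Cn n => p.2 j * star (p.2 k)) (x₀, v) := by fun_prop
      exact hv'.mul (this j k)
    exact h2.eventually_const_lt (Complex.pos_iff.1 (matSesq_pos hx hv0)).1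
  have h3 : ∀ᶠ x in nhds x₀, ∀ v ∈ Metric.sphere (0 : Cn n) 1, 0 < (matSesq (A x) v v).re :=
    (isCompact_sphere (0 : Cn n) 1).eventually_forall_of_forall_eventually h1
  filter_upwards [h3] with x hx hH
  refine Matrix.PosDef.of_dotProduct_mulVec_pos hH fun v hv => ?_
  have hw : star v ≠ 0 := by simpa using hv
  have hn : 0 < ‖star v‖ := norm_pos_iff.2 hw
  have h4 : star v ⬝ᵥ (A x).mulVec v = matSesq (A x) (star v) (star v) := by
    rw [matSesq_apply]
    simp only [dotProduct, Matrix.mulVec, Finset.mul_sum, Pi.star_apply, star_star]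
    exact Finset.sum_congr rfl fun _ _ => Finset.sum_congr rfl fun _ _ => by ring
  rw [h4, Complex.pos_iff]
  constructor
  · have h5 := hx (((‖star v‖⁻¹ : ℝ) : ℂ) • star v) (by
      rw [mem_sphere_zero_iff_norm, norm_smul, Complex.norm_real, norm_inv, norm_norm,
        inv_mul_cancel₀ hn.ne'])
    rw [map_smulₛₗ, map_smulₛₗ, LinearMap.smul_apply, RingHom.id_apply, Complex.conj_ofReal,
      smul_eq_mul, smul_eq_mul, ← mul_assoc, ← Complex.ofReal_mul, Complex.re_ofReal_mul] at h5
    exact pos_of_mul_pos_right h5 (by positivity)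
  · exact (Complex.conj_eq_iff_im.1 (matSesq_conj hH _ _)).symm

variable [CompactSpace M]

/-- The space of potentials is open in finite-dimensional families. -/
theorem eventually_mem_potentials {φ : C^∞⟮𝓘(ℝ, Cn n), M; ℝ⟯} (hφ : φ ∈ g.potentials)
    (ψ₁ ψ₂ : C^∞⟮𝓘(ℝ, Cn n), M; ℝ⟯) :
    ∀ᶠ q : ℝ × ℝ in nhds 0, φ + q.1 • ψ₁ + q.2 • ψ₂ ∈ g.potentials := by
  have hQ : ∀ q : ℝ × ℝ, q ∈ (⊤ : Opens (ℝ × ℝ)) := fun _ => trivial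
  set f := potF (n := n) (M := M) ⊤ (fun _ => 1) Prod.fst Prod.snd contDiff_const contDiff_fst
    contDiff_snd φ ψ₁ ψ₂ with hf
  have hH : ∀ (e : atlas (Cn n) M) (q : ℝ × ℝ), ∀ z ∈ e.1.target, ∀ j k,
      ((baseF ⊤ g + hessF f) e j k).ext (q, z)
        = g.matPot (φ + q.1 • ψ₁ + q.2 • ψ₂) e.1 z j k := fun e q z hz j k => by
    refine ext_add_hessF g e (hQ q) (fun z hz => ?_) hz j k
    rw [hf, ← ext_potF _ _ _ φ ψ₁ ψ₂ e (hQ q) hz, one_smul]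
  -- Only positivity in some chart near each point is asked for, so that compactness of `M` applies;
  -- the other charts follow by congruence at the end.
  have h1 : ∀ x ∈ (Set.univ : Set M), ∀ᶠ p : (ℝ × ℝ) × M in nhds (0, x), ∃ e ∈ atlas (Cn n) M,
      p.2 ∈ e.source ∧ (g.matPot (φ + p.1.1 • ψ₁ + p.1.2 • ψ₂) e (e p.2)).PosDef := fun x _ => by
    have hx := mem_chart_source (Cn n) x
    have hA : ∀ p : (ℝ × ℝ) × M, p.2 ∈ (chartAt (Cn n) x).source →
        (Matrix.of fun j k => ((baseF ⊤ g + hessF f) (atChart n x) j k).ext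
          (p.1, chartAt (Cn n) x p.2)) = g.matPot (φ + p.1.1 • ψ₁ + p.1.2 • ψ₂)
            (chartAt (Cn n) x) (chartAt (Cn n) x p.2) := fun p hp => by
      ext j k
      exact hH (atChart n x) p.1 _ ((chartAt (Cn n) x).map_source hp) j k
    have hc : ContinuousAt (fun p : (ℝ × ℝ) × M => (Matrix.of fun j k =>
        ((baseF ⊤ g + hessF f) (atChart n x) j k).ext (p.1, chartAt (Cn n) x p.2))) (0, x) := by
      refine continuousAt_pi.2 fun j => continuousAt_pi.2 fun k => ?_
      have h2 : ContinuousAt (fun p : (ℝ × ℝ) × M => ((p.1, chartAt (Cn n) x p.2) : PCn n)) (0, x) :=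
        continuousAt_fst.prodMk (((chartAt (Cn n) x).continuousAt hx).comp
          (f := fun p : (ℝ × ℝ) × M => p.2) continuousAt_snd)
      have h5 := (((baseF ⊤ g + hessF f) (atChart n x) j k).contDiffAt_ext
        (x := (0, chartAt (Cn n) x x)) ⟨hQ 0, (chartAt (Cn n) x).map_source hx⟩).continuousAt
      exact ContinuousAt.comp (g := ((baseF ⊤ g + hessF f) (atChart n x) j k).ext)
        (f := fun p : (ℝ × ℝ) × M => ((p.1, chartAt (Cn n) x p.2) : PCn n)) (x := (0, x)) h5 h2
    have h3 := eventually_posDef hc (by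
      rw [hA (0, x) hx]
      simpa using hφ _ (chart_mem_atlas (Cn n) x) _ ((chartAt (Cn n) x).map_source hx))
    filter_upwards [h3, continuousAt_snd.eventually_mem ((chartAt (Cn n) x).open_source.mem_nhds hx)]
      with p hp hps
    refine ⟨_, chart_mem_atlas (Cn n) x, hps, ?_⟩
    rw [hA p hps] at hp
    exact hp (isHermitian_matPot _ (chart_mem_atlas (Cn n) x) ((chartAt (Cn n) x).map_source hps))
  have h4 : ∀ᶠ q : ℝ × ℝ in nhds 0, ∀ x ∈ (Set.univ : Set M), ∃ e ∈ atlas (Cn n) M,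
      x ∈ e.source ∧ (g.matPot (φ + q.1 • ψ₁ + q.2 • ψ₂) e (e x)).PosDef :=
    isCompact_univ.eventually_forall_of_forall_eventually h1
  filter_upwards [h4] with q hq e he z hz
  obtain ⟨e', he', hx, hp⟩ := hq (e.symm z) trivial
  exact posDef_matPot_coordChange he he' ⟨hz, hx⟩ hp

end Construction

end KahlerGeom
end

noncomputable section

set_option linter.unusedSectionVars false

namespace KahlerGeom

/-! ### Paths of metrics and the Bott–Chern functional -/

section Functional

open TopologicalSpace

variable {n : ℕ} {M : Type*} [TopologicalSpace M] [ChartedSpace (Cn n) M] {Q : Opens (ℝ × ℝ)}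

theorem ext_dp_fst {e : OpenPartialHomeomorph M (Cn n)} (F : Sm (dom Q e)) {q : ℝ × ℝ} (hq : q ∈ Q)
    {z : Cn n} (hz : z ∈ e.target) {d : ℂ}
    (h : HasDerivAt (fun s => F.ext ((s, q.2), z)) d q.1) : (Sm.dp (1, 0) F).ext (q, z) = d := by
  have hx : (q, z) ∈ dom Q e := ⟨hq, hz⟩
  have h1 := (F.differentiableAt_ext hx).hasFDerivAt.comp_hasDerivAt q.1
    (f := fun s : ℝ => (((s, q.2), z) : PCn n)) (f' := ((1, 0), 0))
    (((hasDerivAt_id _).prodMk (hasDerivAt_const _ _)).prodMk (hasDerivAt_const _ _))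
  rw [Sm.dp, Sm.ext_der _ _ hx]
  exact h1.unique h

theorem fderiv_fst_apply {b : ℝ × ℝ → ℝ} (hb : ContDiff ℝ ∞ b) {q : ℝ × ℝ} {d : ℝ}
    (h : HasDerivAt (fun s => b (s, q.2)) d q.1) : fderiv ℝ b q (1, 0) = d := by
  have h1 := (hb.differentiable (by simp) q).hasFDerivAt.comp_hasDerivAt q.1
    (f := fun s : ℝ => (s, q.2)) (f' := (1, 0)) ((hasDerivAt_id _).prodMk (hasDerivAt_const _ _))
  exact h1.unique h

variable [IsManifold 𝓘(ℂ, Cn n) ω M] {g : HermitianMetric n M}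

variable (g Q) in
/-- A family of Kähler potentials together with its local expressions. -/
structure IsPotentialFamily (Φ : ℝ × ℝ → C^∞⟮𝓘(ℝ, Cn n), M; ℝ⟯) (f : SmField n M Q) : Prop where
  mem : ∀ q ∈ Q, Φ q ∈ g.potentials
  isFn : IsFn f
  conj : ∀ e, Sm.conj (f e) = f e
  ext : ∀ (e : atlas (Cn n) M), ∀ q ∈ Q, ∀ z ∈ e.1.target, locFun (Φ q) e.1 z = (f e).ext (q, z)

theorem isPotentialFamily_potF {a b c : ℝ × ℝ → ℝ} (ha : ContDiff ℝ ∞ a) (hb : ContDiff ℝ ∞ b)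
    (hc : ContDiff ℝ ∞ c) {φ ψ₁ ψ₂ : C^∞⟮𝓘(ℝ, Cn n), M; ℝ⟯}
    (h : ∀ q ∈ Q, a q • φ + b q • ψ₁ + c q • ψ₂ ∈ g.potentials) :
    IsPotentialFamily Q g (fun q => a q • φ + b q • ψ₁ + c q • ψ₂)
      (potF Q a b c ha hb hc φ ψ₁ ψ₂) where
  mem := h
  isFn := isFn_potF ha hb hc φ ψ₁ ψ₂
  conj := conj_potF ha hb hc φ ψ₁ ψ₂
  ext e _ hq _ hz := ext_potF ha hb hc φ ψ₁ ψ₂ e hq hz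

namespace IsPotentialFamily

variable {Φ : ℝ × ℝ → C^∞⟮𝓘(ℝ, Cn n), M; ℝ⟯} {f : SmField n M Q} (hf : IsPotentialFamily Q g Φ f)

include hf

theorem ext_metric (e : atlas (Cn n) M) {q : ℝ × ℝ} (hq : q ∈ Q) {z : Cn n} (hz : z ∈ e.1.target)
    (j k : Fin n) : ((baseF Q g + hessF f) e j k).ext (q, z) = g.matPot (Φ q) e.1 z j k :=
  ext_add_hessF g e hq (hf.ext e q hq) hz j k

theorem isUnit_det (e : atlas (Cn n) M) : IsUnit ((baseF Q g + hessF f) e).det :=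
  isUnit_det_of_ext fun q hq z hz => by
    have h : ((baseF Q g + hessF f) e).map (fun f => f.ext (q, z)) = g.matPot (Φ q) e.1 z := by
      ext j k; exact hf.ext_metric e hq hz j k
    rw [h]
    exact hf.mem q hq _ e.2 z hz

theorem conj_metric (e : atlas (Cn n) M) (j k : Fin n) :
    Sm.conj ((baseF Q g + hessF f) e j k) = (baseF Q g + hessF f) e k j := by
  rw [Pi.add_apply, Matrix.add_apply, map_add, conj_baseF, conj_hessF hf.conj]
  rfl

theorem gamma_eq [T2Space M] [CompactSpace M] {q : ℝ × ℝ} (hq : q ∈ Q)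
    {ψ : C^∞⟮𝓘(ℝ, Cn n), M; ℝ⟯} {u : SmField n M Q}
    (hu : ∀ (e : atlas (Cn n) M), ∀ z ∈ e.1.target, locFun ψ e z = (u e).ext (q, z)) :
    g.gamma (Φ q) ψ = mint (gammaDensity (baseF Q g + hessF f) u) q :=
  gamma_eq_mint hf.isUnit_det hq hf.conj_metric
    (fun e _ hz j k => (hf.ext_metric e hq hz j k).symm) hu

/-- The path of metrics of a family of potentials. -/
theorem exists_path {s₀ : ℝ} (hs : ∀ t, (s₀, t) ∈ Q) (h0 : Φ (s₀, 0) = 0) :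
    ∃ P : MetricPath g (Φ (s₀, 1)), ∀ (t : ℝ), ∀ e ∈ atlas (Cn n) M, ∀ z ∈ e.target,
      (P.metric t).mat e z = g.matPot (Φ (s₀, t)) e z := by
  have hsm : ∀ e ∈ atlas (Cn n) M, ∀ j k, ContDiffOn ℝ ∞
      (fun p : ℝ × Cn n => g.matPot (Φ (s₀, p.1)) e p.2 j k) (Set.univ ×ˢ e.target) :=
    fun e he j k => by
      refine (((baseF Q g + hessF f) ⟨e, he⟩ j k).contDiffOn_ext.comp
        (f := fun p : ℝ × Cn n => (((s₀, p.1), p.2) : PCn n)) (by fun_prop)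
        fun p hp => ⟨hs p.1, hp.2⟩).congr fun p hp => ?_
      exact (hf.ext_metric ⟨e, he⟩ (hs p.1) hp.2 j k).symm
  have hex := fun t : ℝ => exists_hermitianMetric (fun e z => g.matPot (Φ (s₀, t)) e z)
    (fun e he j k => (hsm e he j k).comp (f := fun z : Cn n => (t, z)) (by fun_prop)
      fun z hz => ⟨trivial, hz⟩)
    (fun e he z hz => hf.mem _ (hs t) e he z hz)
    (fun e he e' he' z hz j k => matPot_coordChange _ he he' hz j k)
  choose h hh using hex
  refine ⟨⟨h, fun e he j k => (hsm e he j k).congr fun p hp => ?_, fun e he z hz => ?_,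
    fun e he z hz => hh 1 e he z hz⟩, hh⟩
  · exact congrFun (congrFun (hh p.1 e he p.2 hp.2) j) k
  · rw [hh 0 e he z hz, h0, matPot_zero g he hz]

end IsPotentialFamily

/-- A potential as a constant family. -/
theorem isPotentialFamily_const {φ : C^∞⟮𝓘(ℝ, Cn n), M; ℝ⟯} (hφ : φ ∈ g.potentials) :
    IsPotentialFamily Q g (fun _ => φ) (fnField Q φ) where
  mem _ _ := hφ
  isFn := isFn_fnField φ
  conj e := Sm.ext_eq fun x hx => by
    rw [Sm.ext_conj _ hx, ext_fnField _ _ hx]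
    exact Complex.conj_ofReal _
  ext e q hq z hz := (ext_fnField φ e (x := (q, z)) ⟨hq, hz⟩).symm

/-- A path of metrics as a family. -/
def MetricPath.field {φ : C^∞⟮𝓘(ℝ, Cn n), M; ℝ⟯} (P : MetricPath g φ) : MatField n M ⊤ :=
  MatField.of (fun q e z => (P.metric q.2).mat e z) fun e he j k =>
    (P.smooth e he j k).comp (f := fun x : PCn n => (x.1.2, x.2)) (by fun_prop)
      fun x hx => ⟨trivial, hx.2⟩

theorem MetricPath.ext_field {φ : C^∞⟮𝓘(ℝ, Cn n), M; ℝ⟯} (P : MetricPath g φ) (e : atlas (Cn n) M)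
    (q : ℝ × ℝ) {z : Cn n} (hz : z ∈ e.1.target) (j k : Fin n) :
    (P.field e j k).ext (q, z) = (P.metric q.2).mat e z j k :=
  MatField.ext_of (Q := ⊤) _ e (q := q) trivial hz j k

theorem MetricPath.isTens_field {φ : C^∞⟮𝓘(ℝ, Cn n), M; ℝ⟯} (P : MetricPath g φ) :
    IsTens P.field := isTens_iff_ext.2 fun e e' q hq z hz j k => by
  simp only [P.ext_field e q hz.1, P.ext_field e' q (coordChange_mem hz).1]
  exact localMatrix_coordChange (P.metric q.2).form e.2 e'.2 hz j k

theorem contDiff_smoothTransition_fst :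
    ContDiff ℝ ∞ fun q : ℝ × ℝ => Real.smoothTransition q.1 :=
  Real.smoothTransition.contDiff.comp contDiff_fst

theorem contDiff_one_sub_smoothTransition_fst :
    ContDiff ℝ ∞ fun q : ℝ × ℝ => 1 - Real.smoothTransition q.1 :=
  contDiff_const.sub contDiff_smoothTransition_fst

/-- The interpolation between two paths of metrics. -/
def MetricPath.interpolation {φ : C^∞⟮𝓘(ℝ, Cn n), M; ℝ⟯} (P P' : MetricPath g φ) : MatField n M ⊤ :=
  (fun e => parF n M ⊤ _ contDiff_one_sub_smoothTransition_fst e • P.field e)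
    + fun e => parF n M ⊤ _ contDiff_smoothTransition_fst e • P'.field e

theorem MetricPath.isTens_interpolation {φ : C^∞⟮𝓘(ℝ, Cn n), M; ℝ⟯} (P P' : MetricPath g φ) :
    IsTens (P.interpolation P') :=
  (IsTens.fn_smul (isFn_parF _ _) P.isTens_field).add (IsTens.fn_smul (isFn_parF _ _) P'.isTens_field)

theorem MetricPath.ext_interpolation {φ : C^∞⟮𝓘(ℝ, Cn n), M; ℝ⟯} (P P' : MetricPath g φ)
    (e : atlas (Cn n) M) (q : ℝ × ℝ) {z : Cn n} (hz : z ∈ e.1.target) (j k : Fin n) :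
    (P.interpolation P' e j k).ext (q, z)
      = ((1 - Real.smoothTransition q.1 : ℝ) : ℂ) * (P.metric q.2).mat e z j k
        + (Real.smoothTransition q.1 : ℂ) * (P'.metric q.2).mat e z j k := by
  rw [← P.ext_field e q hz, ← P'.ext_field e q hz,
    ← ext_parF (Q := ⊤) _ contDiff_one_sub_smoothTransition_fst e (q := q) trivial hz,
    ← ext_parF (Q := ⊤) _ contDiff_smoothTransition_fst e (q := q) trivial hz,
    ← Sm.ext_mul, ← Sm.ext_mul, ← Sm.ext_add]
  rfl

theorem MetricPath.isUnit_interpolation {φ : C^∞⟮𝓘(ℝ, Cn n), M; ℝ⟯} (P P' : MetricPath g φ)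
    (e : atlas (Cn n) M) : IsUnit (P.interpolation P' e).det :=
  isUnit_det_of_ext fun q _ z hz => by
    have h : (P.interpolation P' e).map (fun f => f.ext (q, z))
        = ((1 - Real.smoothTransition q.1 : ℝ) : ℂ) • (P.metric q.2).mat e z
          + (Real.smoothTransition q.1 : ℂ) • (P'.metric q.2).mat e z := by
      ext j k; exact P.ext_interpolation P' e q hz j k
    rw [h]
    -- `Real.smoothTransition` takes values in `[0, 1]` on all of `ℝ`, so the interpolation is a
    -- convex combination for every parameter value.
    exact posDef_convex ((P.metric q.2).posDef e.2 hz) ((P'.metric q.2).posDef e.2 hz)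
      (Real.smoothTransition.nonneg _) (Real.smoothTransition.le_one _)

variable [T2Space M] [CompactSpace M]

/-- The functional does not depend on the path of metrics. -/
theorem MetricPath.functional_congr (hg : g.IsKahler) {φ : C^∞⟮𝓘(ℝ, Cn n), M; ℝ⟯}
    (hφ : φ ∈ g.potentials) (P P' : MetricPath g φ) : P.functional = P'.functional := by
  have hfam := isPotentialFamily_const (Q := ⊤) hφ
  have hT : ∀ q : ℝ × ℝ, q ∈ (⊤ : Opens (ℝ × ℝ)) := fun _ => trivial
  set H := P.interpolation P' with hH
  have hGK : IsKahlerF (baseF ⊤ g) := isKahlerF_baseF hg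
  -- Where the two paths agree the interpolation does not depend on `s`, so the boundary terms at `t
  -- = 0` and `t = 1` vanish and the integral is constant in `s`.
  have hb : ∀ t : ℝ, (∀ e ∈ atlas (Cn n) M, ∀ z ∈ e.target,
      (P.metric t).mat e z = (P'.metric t).mat e z) → ∀ s : ℝ,
      mint (topF (bcForm H (1, 0) * fundF (baseF ⊤ g) ^ (n - 1))) (s, t) = 0 := fun t ht s => by
    refine mint_topF_bcForm_mul_eq_zero _ _ (hT _) fun e z hz j k => ?_
    refine ext_dp_fst _ (hT _) hz ?_
    have h : (fun s : ℝ => (H e j k).ext ((s, t), z)) = fun _ => (P.metric t).mat e z j k :=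
      funext fun s => by
        rw [P.ext_interpolation P' e _ hz, ← ht e e.2 z hz]
        push_cast
        ring
    change HasDerivAt (fun s : ℝ => (H e j k).ext ((s, t), z)) 0 s
    rw [h]
    exact hasDerivAt_const _ _
  have hd : ∀ s, HasDerivAt (fun s => ∫ t in (0 : ℝ)..1,
      mint (topF (bcForm H (0, 1) * fundF (baseF ⊤ g) ^ (n - 1))) (s, t)) 0 s := fun s => by
    have h := hasDerivAt_integral_bcForm (P.isTens_interpolation P') (P.isUnit_interpolation P')
      ((isForm_fundF (isTens_baseF g)).pow (n - 1)) (fun e => (hGK.isClosedEven e).pow _)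
      (fun v => derF_fundF_pow hGK (dp_baseF g v) _) (s₀ := s) (fun t _ => hT _)
    rw [hb 1 (fun e he z hz => (P.finish e he z hz).trans (P'.finish e he z hz).symm),
      hb 0 (fun e he z hz => (P.start e he z hz).trans (P'.start e he z hz).symm), sub_zero] at h
    exact h
  have hc := is_const_of_deriv_eq_zero (fun s => (hd s).differentiableAt) (fun s => (hd s).deriv) 0 1
  rw [P.functional_eq (P.isUnit_interpolation P') (s₀ := 0) (fun t => hT _) (fun e t z hz j k => by
      rw [P.ext_interpolation P' e _ hz]; simp) (fun e q _ z hz j k => (ext_baseF g e (hT q) hz j k).symm)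
      hfam.isUnit_det (hT 0) (fun e z hz j k => (ext_baseF g e (hT _) hz j k).symm)
      (fun e z hz j k => (hfam.ext_metric e (hT _) hz j k).symm) (fun e z hz => hfam.ext e _ (hT _) z hz),
    P'.functional_eq (P.isUnit_interpolation P') (s₀ := 1) (fun t => hT _) (fun e t z hz j k => by
      rw [P.ext_interpolation P' e _ hz]; simp) (fun e q _ z hz j k => (ext_baseF g e (hT q) hz j k).symm)
      hfam.isUnit_det (hT 0) (fun e z hz j k => (ext_baseF g e (hT _) hz j k).symm)
      (fun e z hz j k => (hfam.ext_metric e (hT _) hz j k).symm) (fun e z hz => hfam.ext e _ (hT _) z hz)]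
  exact congrArg (fun c => 1 / ((n - 1).factorial : ℂ) * (-2 * Complex.I * c
    - mint (topF (toddSum (baseF ⊤ g) (baseF ⊤ g + hessF (fnField ⊤ φ)) (fnField ⊤ φ) (n - 1))) 0)) hc

theorem contDiff_smoothTransition_snd :
    ContDiff ℝ ∞ fun q : ℝ × ℝ => Real.smoothTransition q.2 :=
  Real.smoothTransition.contDiff.comp contDiff_snd

/-- The metrics of the potentials `smoothTransition t • φ`: the potentials are convex and contain
`0`, and the cut-off keeps the factor in `[0, 1]` for all real `t`. -/
theorem exists_metricPath {φ : C^∞⟮𝓘(ℝ, Cn n), M; ℝ⟯} (hφ : φ ∈ g.potentials) :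
    Nonempty (MetricPath g φ) := by
  have h : IsPotentialFamily ⊤ g _ _ := isPotentialFamily_potF (g := g) (Q := ⊤) (φ := φ) (ψ₁ := 0)
    (ψ₂ := 0) contDiff_smoothTransition_snd (contDiff_const (c := 0)) (contDiff_const (c := 0))
    fun q _ => by
      simpa using smul_mem_potentials hφ (Real.smoothTransition.nonneg q.2)
        (Real.smoothTransition.le_one q.2)
  obtain ⟨P, -⟩ := h.exists_path (s₀ := 0) (fun t => trivial) (by simp)
  simpa using (⟨P⟩ : Nonempty _)

open Classical in
variable (g) in
/-- The Bott–Chern functional. -/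
def bcFunctional (φ : C^∞⟮𝓘(ℝ, Cn n), M; ℝ⟯) : ℂ :=
  if h : Nonempty (MetricPath g φ) then h.some.functional else 0

theorem bcFunctional_eq (hg : g.IsKahler) {φ : C^∞⟮𝓘(ℝ, Cn n), M; ℝ⟯} (hφ : φ ∈ g.potentials)
    (P : MetricPath g φ) : bcFunctional g φ = P.functional := by
  rw [bcFunctional, dif_pos ⟨P⟩]
  exact MetricPath.functional_congr hg hφ _ P

/-- The first variation of the Bott–Chern functional. -/
theorem hasDerivAt_bcFunctional (hg : g.IsKahler) {φ : C^∞⟮𝓘(ℝ, Cn n), M; ℝ⟯}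
    (hφ : φ ∈ g.potentials) (ψ : C^∞⟮𝓘(ℝ, Cn n), M; ℝ⟯) :
    HasDerivAt (fun s : ℝ => bcFunctional g (φ + s • ψ)) (g.gamma φ ψ) 0 := by
  obtain ⟨U, hU, hUo, h0U⟩ : ∃ U : Set ℝ, (∀ s ∈ U, φ + s • ψ ∈ g.potentials) ∧ IsOpen U ∧ 0 ∈ U := by
    have h := (Continuous.prodMk_left (0 : ℝ)).continuousAt (x := (0 : ℝ))
      |>.eventually (eventually_mem_potentials hφ ψ 0)
    simpa [eventually_nhds_iff] using h
  set Q : Opens (ℝ × ℝ) := ⟨U ×ˢ Set.univ, hUo.prod isOpen_univ⟩ with hQ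
  have hQm : ∀ s ∈ U, ∀ t : ℝ, (s, t) ∈ Q := fun s hs t => ⟨hs, trivial⟩
  -- The family consists of the potentials `smoothTransition t • (φ + s • ψ)`. Its second
  -- coefficient depends on both parameters; the third is zero.
  have hcb : ContDiff ℝ ∞ fun q : ℝ × ℝ => Real.smoothTransition q.2 * q.1 :=
    contDiff_smoothTransition_snd.mul contDiff_fst
  have hfam := isPotentialFamily_potF (g := g) (Q := Q) (φ := φ) (ψ₁ := ψ) (ψ₂ := 0)
    contDiff_smoothTransition_snd hcb (contDiff_const (c := 0)) fun q hq => by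
      have h := smul_mem_potentials (hU q.1 hq.1) (Real.smoothTransition.nonneg q.2)
        (Real.smoothTransition.le_one q.2)
      rwa [smul_add, smul_smul, ← add_zero (_ + _), ← smul_zero (0 : ℝ)] at h
  set f := potF (n := n) (M := M) Q _ _ _ contDiff_smoothTransition_snd hcb
    (contDiff_const (c := 0)) φ ψ 0 with hf
  set H := baseF Q g + hessF f with hH
  have hΦ0 : ∀ s : ℝ, Real.smoothTransition ((s, 0) : ℝ × ℝ).2 • φ
      + (Real.smoothTransition ((s, 0) : ℝ × ℝ).2 * ((s, 0) : ℝ × ℝ).1) • ψ + (0 : ℝ) • 0 = 0 :=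
    fun s => by simp
  have hΦ1 : ∀ s : ℝ, Real.smoothTransition ((s, 1) : ℝ × ℝ).2 • φ
      + (Real.smoothTransition ((s, 1) : ℝ × ℝ).2 * ((s, 1) : ℝ × ℝ).1) • ψ + (0 : ℝ) • 0
      = φ + s • ψ := fun s => by simp
  have hval : ∀ s ∈ U, bcFunctional g (φ + s • ψ) = (1 / ((n - 1).factorial : ℂ)) *
      (-2 * Complex.I * (∫ t in (0 : ℝ)..1,
        mint (topF (bcForm H (0, 1) * fundF (baseF Q g) ^ (n - 1))) (s, t))
          - mint (topF (toddSum (baseF Q g) H f (n - 1))) (s, 1)) := fun s hs => by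
    obtain ⟨P, hP⟩ := hfam.exists_path (hQm s hs) (hΦ0 s)
    rw [← hΦ1 s, bcFunctional_eq hg (hfam.mem _ (hQm s hs 1)) P]
    refine P.functional_eq hfam.isUnit_det (hQm s hs) (fun e t z hz j k => ?_)
      (fun e q hq z hz j k => (ext_baseF g e hq hz j k).symm) hfam.isUnit_det (hQm s hs 1)
      (fun e z hz j k => (ext_baseF g e (hQm s hs 1) hz j k).symm)
      (fun e z hz j k => (hfam.ext_metric e (hQm s hs 1) hz j k).symm)
      (fun e z hz => hfam.ext e _ (hQm s hs 1) z hz)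
    rw [hP t e e.2 z hz]
    exact (hfam.ext_metric e (hQm s hs t) hz j k).symm
  -- At `t = 0` the potential vanishes for all `s`, so the metric does not move there, as
  -- `hasDerivAt_functional` requires.
  have hder := (hasDerivAt_functional (isTens_baseF g) (isKahlerF_baseF hg) (fun v e => dp_baseF g v e)
    hfam.isFn hH hfam.isUnit_det (s₀ := 0) (fun t _ => hQm 0 h0U t) (fun e z hz j k => by
      refine ext_dp_fst _ (hQm 0 h0U 0) hz ((hasDerivAt_const (0 : ℝ) (g.mat e z j k)).congr_of_eventuallyEq ?_)
      filter_upwards [hUo.mem_nhds h0U] with s hs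
      refine (hfam.ext_metric e (hQm s hs 0) hz j k).trans ?_
      rw [hΦ0 s, matPot_zero g e.2 hz])).const_mul (1 / ((n - 1).factorial : ℂ))
  refine (hder.congr_of_eventuallyEq ?_).congr_deriv ?_
  · filter_upwards [hUo.mem_nhds h0U] with s hs
    exact hval s hs
  · rw [← mul_assoc, one_div_mul_cancel (by exact_mod_cast (n - 1).factorial_ne_zero), one_mul]
    have h1 := hfam.gamma_eq (hQm 0 h0U 1) (ψ := ψ) (u := dpF (1, 0) f) fun e z hz => by
      rw [← ext_dp_potF _ _ _ φ ψ 0 (1, 0) e (hQm 0 h0U 1) hz]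
      -- At `t = 1` the coefficient of `ψ` is `s`, while that of `φ` is constant, so the
      -- `s`-derivative of the family is exactly `ψ`.
      rw [fderiv_fst_apply (d := 0) contDiff_smoothTransition_snd
          (hasDerivAt_const (0 : ℝ) (Real.smoothTransition 1)),
        fderiv_fst_apply hcb (d := 1) (by simpa using hasDerivAt_id' (0 : ℝ)),
        fderiv_fst_apply (d := 0) contDiff_const (hasDerivAt_const (0 : ℝ) (0 : ℝ))]
      simp
    refine h1.symm.trans ?_
    congr 1
    simp

end Functional

end KahlerGeom
end

noncomputable section

set_option linter.unusedSectionVars false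

namespace KahlerGeom

/-! ### Reality of the variational density -/

section Reality

open TopologicalSpace MeasureTheory

variable {n : ℕ}

theorem sum_pair_comm {R : Type*} [AddCommMonoid R] (F : Fin n → Fin n → Fin n → Fin n → Fin n → Fin n → R) :
    ∑ p, ∑ q, ∑ a, ∑ b, ∑ c, ∑ d, F p q a b c d = ∑ a, ∑ b, ∑ c, ∑ d, ∑ p, ∑ q, F p q a b c d := by
  have h : ∀ G : Fin n → Fin n → Fin n → Fin n → Fin n → R,
      ∑ p, ∑ a, ∑ b, ∑ c, ∑ d, G p a b c d = ∑ a, ∑ b, ∑ c, ∑ d, ∑ p, G p a b c d := fun G => by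
    rw [Finset.sum_comm]
    refine Finset.sum_congr rfl fun a _ => ?_
    rw [Finset.sum_comm]
    refine Finset.sum_congr rfl fun b _ => ?_
    rw [Finset.sum_comm]
    refine Finset.sum_congr rfl fun c _ => ?_
    rw [Finset.sum_comm]
  rw [← h (fun p a b c d => ∑ q, F p q a b c d)]
  exact Finset.sum_congr rfl fun p _ => h _

theorem pairC_eq_sum {C : Type*} [CommRing C] (H A B : Matrix (Fin n) (Fin n) C) : pairC H A B
    = ∑ a, ∑ b, ∑ c, ∑ d, H⁻¹ a b * H⁻¹ c d * (A b c * B d a) := by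
  rw [pairC, Matrix.trace]
  simp only [Matrix.diag_apply, Matrix.mul_apply, Finset.sum_mul]
  refine Finset.sum_congr rfl fun a _ => ?_
  rw [Finset.sum_comm_cycle]
  refine Finset.sum_congr rfl fun b _ => ?_
  rw [Finset.sum_comm]
  refine Finset.sum_congr rfl fun c _ => Finset.sum_congr rfl fun d _ => ?_
  ring

theorem DiffRing.curvNorm_eq_sum {C : Type*} [CommRing C] [Algebra ℂ C] (𝒟 : DiffRing (Fin n) C)
    (H : Matrix (Fin n) (Fin n) C) : 𝒟.curvNorm H = ∑ a, ∑ b, ∑ c, ∑ d,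
      H⁻¹ a b * H⁻¹ c d * (𝒟.curvature H b c * 𝒟.curvature H d a).trace := by
  simp only [curvNorm, pairC_eq_sum]
  rw [sum_pair_comm]
  refine Finset.sum_congr rfl fun _ _ => Finset.sum_congr rfl fun _ _ =>
    Finset.sum_congr rfl fun _ _ => Finset.sum_congr rfl fun _ _ => ?_
  simp only [Matrix.trace, Matrix.diag_apply, Matrix.mul_apply, Finset.mul_sum]
  rfl

variable {C : Type*} [CommRing C] {σ : C →+* C} {H : Matrix (Fin n) (Fin n) C}

/-- Here `σ` plays the role of complex conjugation, and `hH` says that `H` is Hermitian. -/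
theorem map_inv_of_transpose (hu : IsUnit H.det) (hH : H.map σ = H.transpose) :
    H⁻¹.map σ = H⁻¹.transpose := by
  rw [map_nonsing_inv σ hu, hH, Matrix.transpose_nonsing_inv]

theorem map_trC_of_transpose (hu : IsUnit H.det) (hH : H.map σ = H.transpose)
    {A : Matrix (Fin n) (Fin n) C} (hA : A.map σ = A.transpose) : σ (trC H A) = trC H A := by
  rw [trC, map_trace, Matrix.map_mul, map_inv_of_transpose hu hH, hA, ← Matrix.transpose_mul,
    Matrix.trace_transpose, Matrix.trace_mul_comm]

theorem map_pairC_of_transpose (hu : IsUnit H.det) (hH : H.map σ = H.transpose)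
    {A : Matrix (Fin n) (Fin n) C} (hA : A.map σ = A.transpose) :
    σ (pairC H A A) = pairC H A A := by
  rw [pairC, map_trace, Matrix.map_mul, Matrix.map_mul, Matrix.map_mul,
    map_inv_of_transpose hu hH, hA, ← Matrix.transpose_mul, ← Matrix.transpose_mul,
    ← Matrix.transpose_mul, Matrix.trace_transpose, ← Matrix.mul_assoc, ← Matrix.mul_assoc,
    Matrix.trace_mul_comm, ← Matrix.mul_assoc, ← Matrix.mul_assoc]

variable {M : Type*} [TopologicalSpace M] [ChartedSpace (Cn n) M] {Q : Opens (ℝ × ℝ)}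
  [IsManifold 𝓘(ℂ, Cn n) ω M]

section Local

variable {e : OpenPartialHomeomorph M (Cn n)} {H : Matrix (Fin n) (Fin n) (Sm (dom Q e))}
  (hu : IsUnit H.det) (hH : ∀ j k, Sm.conj (H j k) = H k j)

include hu hH

/-- The curvature is Hermitian only after lowering an index; raising it again conjugates by `H`. -/
theorem conj_curvature (j k : Fin n) : ((Sm.diffRing (dom Q e)).curvature H j k).map Sm.conj
    = (H⁻¹ * (Sm.diffRing (dom Q e)).curvature H k j * H).transpose := by
  have h1 : (Sm.diffRing (dom Q e)).curvature H j k
      = (Sm.diffRing (dom Q e)).curvature H j k * H * H⁻¹ := by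
    rw [Matrix.mul_assoc, Matrix.mul_nonsing_inv _ hu, Matrix.mul_one]
  have h2 : ((Sm.diffRing (dom Q e)).curvature H j k * H).map Sm.conj
      = ((Sm.diffRing (dom Q e)).curvature H k j * H).transpose := by
    ext p r
    exact conj_curvature_mul hu hH j k p r
  rw [h1, Matrix.map_mul, h2, map_inv_of_transpose hu (by ext j k; exact hH j k),
    ← Matrix.transpose_mul, Matrix.mul_assoc]

theorem conj_ric : ((Sm.diffRing (dom Q e)).ric H).map Sm.conj
    = ((Sm.diffRing (dom Q e)).ric H).transpose := by
  ext1 j k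
  rw [Matrix.map_apply, DiffRing.ric, Matrix.of_apply, map_trace, conj_curvature hu hH,
    Matrix.trace_transpose, Matrix.trace_mul_comm, ← Matrix.mul_assoc, Matrix.mul_nonsing_inv _ hu,
    Matrix.one_mul]
  rfl

/-- The conjugation by `H` in `conj_curvature` cancels inside the traces, and the remaining exchange
of indices is a relabelling of the sum. -/
theorem conj_curvNorm : Sm.conj ((Sm.diffRing (dom Q e)).curvNorm H)
    = (Sm.diffRing (dom Q e)).curvNorm H := by
  have h0 : H.map (Sm.conj (W := dom Q e)) = H.transpose := by ext j k; exact hH j k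
  have hi : ∀ a b, Sm.conj (H⁻¹ a b) = H⁻¹ b a := fun a b =>
    congrFun (congrFun (map_inv_of_transpose hu h0) a) b
  have ht : ∀ X Y : Matrix (Fin n) (Fin n) (Sm (dom Q e)),
      (H⁻¹ * X * H * (H⁻¹ * Y * H)).trace = (X * Y).trace := fun X Y => by
    rw [show H⁻¹ * X * H * (H⁻¹ * Y * H) = H⁻¹ * (X * (H * H⁻¹) * Y * H) by
      simp only [Matrix.mul_assoc], Matrix.mul_nonsing_inv _ hu, Matrix.mul_one,
      Matrix.trace_mul_comm, Matrix.mul_assoc, Matrix.mul_nonsing_inv _ hu, Matrix.mul_one]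
  have hterm : ∀ a b c d, Sm.conj (((Sm.diffRing (dom Q e)).curvature H b c
      * (Sm.diffRing (dom Q e)).curvature H d a).trace) = ((Sm.diffRing (dom Q e)).curvature H a d
      * (Sm.diffRing (dom Q e)).curvature H c b).trace := fun a b c d => by
    rw [map_trace, Matrix.map_mul, conj_curvature hu hH, conj_curvature hu hH,
      ← Matrix.transpose_mul, Matrix.trace_transpose, ht]
  rw [DiffRing.curvNorm_eq_sum]
  generalize hR : (Sm.diffRing (dom Q e)).curvature H = R at hterm ⊢
  simp only [map_sum, map_mul, hi, hterm]
  rw [Finset.sum_comm]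
  refine Finset.sum_congr rfl fun b _ => Finset.sum_congr rfl fun a _ => ?_
  rw [Finset.sum_comm]

end Local

variable {H : MatField n M Q} (hu : ∀ e, IsUnit (H e).det)
  (hH : ∀ e j k, Sm.conj (H e j k) = H e k j)

include hu hH

theorem conj_gammaDensity {f : SmField n M Q} (hf : ∀ e, Sm.conj (f e) = f e) (e : atlas (Cn n) M) :
    Sm.conj (gammaDensity H f e) = gammaDensity H f e := by
  have h0 : (H e).map (Sm.conj (W := dom Q e.1)) = (H e).transpose := by ext j k; exact hH e j k
  have hr := conj_ric (hu e) (hH e)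
  have hS : ∀ e, Sm.conj ((Sm.diffRing (dom Q e.1)).scalar (H e))
      = (Sm.diffRing (dom Q e.1)).scalar (H e) := fun e =>
    map_trC_of_transpose (hu e) (by ext j k; exact hH e j k) (conj_ric (hu e) (hH e))
  have hL : Sm.conj (trC (H e) ((Sm.diffRing (dom Q e.1)).hessian
      ((Sm.diffRing (dom Q e.1)).scalar (H e)))) = trC (H e) ((Sm.diffRing (dom Q e.1)).hessian
      ((Sm.diffRing (dom Q e.1)).scalar (H e))) :=
    map_trC_of_transpose (hu e) h0 (by ext j k; exact conj_hessF hS e j k)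
  have hP : Sm.conj (pairC (H e) (ricF H e) (ricF H e)) = pairC (H e) (ricF H e) (ricF H e) :=
    map_pairC_of_transpose (hu e) h0 hr
  have hd : Sm.conj (H e).det = (H e).det := by
    rw [RingHom.map_det, RingHom.mapMatrix_apply, h0, Matrix.det_transpose]
  have hv : Sm.conj (vol (H e)) = vol (H e) := by
    rw [vol, Sm.conj_smul, hd]
    simp
  have hc := conj_curvNorm (hu e) (hH e)
  rw [gammaDensity, map_mul, hv, map_mul, hf, map_sub, Sm.conj_smul, hL, Sm.conj_smul, map_add,
    map_sub, hc, Sm.conj_smul, hP, Sm.conj_smul, map_pow, hS]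
  simp

variable [T2Space M] [CompactSpace M]

omit hu hH in
theorem mint_conj {F : SmField n M Q} (hF : ∀ e, Sm.conj (F e) = F e) {q : ℝ × ℝ} (hq : q ∈ Q) :
    star (mint F q) = mint F q := by
  rw [mint, star_sum]
  refine Finset.sum_congr rfl fun x _ => ?_
  refine integral_conj.symm.trans ?_
  refine setIntegral_congr_fun (chartAt (Cn n) x).open_target.measurableSet fun z hz => ?_
  have hx : (q, z) ∈ dom Q (atChart n x).1 := ⟨hq, hz⟩
  simp only [Sm.ext_mul, map_mul, ext_fnField _ _ hx, Complex.conj_ofReal]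
  congr 1
  conv_rhs => rw [← hF, Sm.ext_conj _ hx]
  rfl

omit H hu hH in
/-- The one-form is real. -/
theorem star_gamma {g : HermitianMetric n M} {φ : C^∞⟮𝓘(ℝ, Cn n), M; ℝ⟯} (hφ : φ ∈ g.potentials)
    (ψ : C^∞⟮𝓘(ℝ, Cn n), M; ℝ⟯) : star (g.gamma φ ψ) = g.gamma φ ψ := by
  have h := isPotentialFamily_const (Q := ⊤) hφ
  have hq : (0 : ℝ × ℝ) ∈ (⊤ : Opens (ℝ × ℝ)) := trivial
  rw [h.gamma_eq hq (u := fnField ⊤ ψ) fun e z hz =>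
    (ext_fnField ψ e (x := ((0 : ℝ × ℝ), z)) ⟨hq, hz⟩).symm]
  exact mint_conj (conj_gammaDensity h.isUnit_det h.conj_metric fun e => Sm.ext_eq fun x hx => by
    rw [Sm.ext_conj _ hx, ext_fnField _ _ hx]
    exact Complex.conj_ofReal _) hq

end Reality

end KahlerGeom
end

noncomputable section

set_option linter.unusedSectionVars false

namespace KahlerGeom

/-! ### Closedness and exactness -/

section Exactness

open TopologicalSpace Filter

/-- Symmetry of the mixed partial derivatives of a function with given first partial derivatives. -/
theorem mixed_partials_symm {Q : Set (ℝ × ℝ)} (hQ : IsOpen Q) {U A B : ℝ × ℝ → ℂ}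
    (h1 : ∀ q ∈ Q, HasDerivAt (fun s => U (s, q.2)) (A q) q.1)
    (h2 : ∀ q ∈ Q, HasDerivAt (fun t => U (q.1, t)) (B q) q.2)
    (hA : ContinuousOn A Q) (hB : ContinuousOn B Q) {q : ℝ × ℝ} (hq : q ∈ Q)
    {LA LB : ℝ × ℝ →L[ℝ] ℂ} (hLA : HasFDerivAt A LA q) (hLB : HasFDerivAt B LB q) :
    LB (1, 0) = LA (0, 1) := by
  set T := fun c : ℂ => ContinuousLinearMap.toSpanSingleton ℝ c
  have hT : Continuous T := by
    have : T = fun c => ContinuousLinearMap.smulRightL ℝ ℝ ℂ (ContinuousLinearMap.id ℝ ℝ) c := by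
      ext c; simp [T]
    rw [this]
    fun_prop
  have hU : ∀ y ∈ Q, HasFDerivAt U
      (ContinuousLinearMap.smulRightL ℝ (ℝ × ℝ) ℂ (ContinuousLinearMap.fst ℝ ℝ ℝ) (A y)
        + ContinuousLinearMap.smulRightL ℝ (ℝ × ℝ) ℂ (ContinuousLinearMap.snd ℝ ℝ ℝ) (B y)) y :=
    fun y hy => by
      -- Continuous partial derivatives give Fréchet differentiability, so the symmetry theorem for
      -- second derivatives applies.
      have h := (hasStrictFDerivAt_uncurry_coprod (𝕜 := ℝ) (u := y) (f := fun s t => U (s, t))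
        (f₁ := fun s t => T (A (s, t))) (f₂ := fun s t => T (B (s, t)))
        (eventually_of_mem (hQ.mem_nhds hy) fun v hv => (h1 v hv).hasFDerivAt)
        (eventually_of_mem (hQ.mem_nhds hy) fun v hv => (h2 v hv).hasFDerivAt)
        (hT.continuousAt.comp (hA.continuousAt (hQ.mem_nhds hy)))
        (hT.continuousAt.comp (hB.continuousAt (hQ.mem_nhds hy)))).hasFDerivAt
      refine h.congr_fderiv ?_
      ext <;> simp [T, Function.HasUncurry.uncurry]
  have h := second_derivative_symmetric_of_eventually_of_real
    (eventually_of_mem (hQ.mem_nhds hq) hU)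
    (((ContinuousLinearMap.smulRightL ℝ (ℝ × ℝ) ℂ
      (ContinuousLinearMap.fst ℝ ℝ ℝ)).hasFDerivAt.comp q hLA).add
    ((ContinuousLinearMap.smulRightL ℝ (ℝ × ℝ) ℂ
      (ContinuousLinearMap.snd ℝ ℝ ℝ)).hasFDerivAt.comp q hLB)) (1, 0) (0, 1)
  simpa using h

variable {n : ℕ} {M : Type*} [TopologicalSpace M] [ChartedSpace (Cn n) M]
  [IsManifold 𝓘(ℂ, Cn n) ω M] [T2Space M] [CompactSpace M] {g : HermitianMetric n M}

theorem add_smul_mem_potentials {φ : C^∞⟮𝓘(ℝ, Cn n), M; ℝ⟯} (hφ : φ ∈ g.potentials)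
    (ψ : C^∞⟮𝓘(ℝ, Cn n), M; ℝ⟯) : ∀ᶠ s : ℝ in nhds 0, φ + s • ψ ∈ g.potentials := by
  have h := (Continuous.prodMk_left (0 : ℝ)).continuousAt (x := (0 : ℝ))
    |>.eventually (eventually_mem_potentials hφ ψ 0)
  simpa using h

/-- Evaluate on the constant path: its velocity is zero, and the other term carries the potential
`0` as a factor. -/
theorem bcFunctional_zero (hg : g.IsKahler) : bcFunctional g 0 = 0 := by
  let P : MetricPath g 0 := ⟨fun _ => g,
    fun e he j k => (g.smooth e he j k).comp contDiffOn_snd fun _ hx => hx.2,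
    fun _ _ _ _ => rfl, fun e he z hz => (matPot_zero g he hz).symm⟩
  have hv : ∀ e z t, P.velocity e z t = 0 := fun e z t => by
    rw [MetricPath.velocity]
    have : (Matrix.of fun p q => deriv (fun s => (P.metric s).mat e z p q) t) = 0 := by
      ext p q
      exact deriv_const t (g.mat e z p q)
    rw [this, Matrix.zero_mul]
  have hb : ∀ e z, P.bottChern e z = 0 := fun e z => by
    simp [MetricPath.bottChern, hv, td2, form11]
  rw [bcFunctional_eq hg zero_mem_potentials P, MetricPath.functional]
  simp [hb, locFun, integralForm]

/-- The Bott–Chern functional is real. -/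
theorem im_bcFunctional (hg : g.IsKahler) {φ : C^∞⟮𝓘(ℝ, Cn n), M; ℝ⟯} (hφ : φ ∈ g.potentials) :
    (bcFunctional g φ).im = 0 := by
  -- The segment `τ • φ` stays among the potentials, and the one-form is real on it, so the
  -- imaginary part of the functional keeps its value `0` from `τ = 0`.
  have hd : ∀ τ ∈ Set.Icc (0 : ℝ) 1, HasDerivAt (fun τ : ℝ => (bcFunctional g (τ • φ)).im) 0 τ :=
    fun τ hτ => by
      have hm := smul_mem_potentials hφ hτ.1 hτ.2
      have h := hasDerivAt_bcFunctional hg hm φ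
      rw [← sub_self τ] at h
      have h1 := HasDerivAt.comp_sub_const τ τ h
      have h2 := Complex.imCLM.hasFDerivAt.comp_hasDerivAt τ h1
      have h3 : (g.gamma (τ • φ) φ).im = 0 := Complex.conj_eq_iff_im.1 (star_gamma hm φ)
      refine (h2.congr_deriv (by simpa using h3)).congr_of_eventuallyEq (.of_eq (funext fun s => ?_))
      simp [← add_smul]
  have h := constant_of_has_deriv_right_zero (fun τ hτ => (hd τ hτ).continuousAt.continuousWithinAt)
    (fun τ hτ => (hd τ ⟨hτ.1, hτ.2.le⟩).hasDerivWithinAt) 1 (by simp)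
  simpa [bcFunctional_zero hg] using h

/-- The one-form is closed. -/
theorem exists_hasDerivAt_gamma (hg : g.IsKahler) {φ : C^∞⟮𝓘(ℝ, Cn n), M; ℝ⟯}
    (hφ : φ ∈ g.potentials) (ψ₁ ψ₂ : C^∞⟮𝓘(ℝ, Cn n), M; ℝ⟯) :
    ∃ D : ℝ, HasDerivAt (fun t : ℝ => g.gamma (φ + t • ψ₁) ψ₂) (D : ℂ) 0 ∧
      HasDerivAt (fun t : ℝ => g.gamma (φ + t • ψ₂) ψ₁) (D : ℂ) 0 := by
  obtain ⟨V, hV, hVo, h0⟩ := eventually_nhds_iff.1 (eventually_mem_potentials hφ ψ₁ ψ₂)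
  set Q : Opens (ℝ × ℝ) := ⟨V, hVo⟩
  have hfam : IsPotentialFamily Q g _ _ := isPotentialFamily_potF (Q := Q) (g := g) (φ := φ)
    (ψ₁ := ψ₁) (ψ₂ := ψ₂) (contDiff_const (c := (1 : ℝ))) contDiff_fst contDiff_snd fun q hq => by
      rw [one_smul]
      exact hV q hq
  simp only [one_smul] at hfam
  set H := baseF Q g + hessF (potF Q (fun _ => (1 : ℝ)) Prod.fst Prod.snd contDiff_const contDiff_fst
    contDiff_snd φ ψ₁ ψ₂) with hH
  have hγ : ∀ (ψ : C^∞⟮𝓘(ℝ, Cn n), M; ℝ⟯) (q : ℝ × ℝ), q ∈ V →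
      g.gamma (φ + q.1 • ψ₁ + q.2 • ψ₂) ψ = mint (gammaDensity H (fnField Q ψ)) q := fun ψ q hq =>
    hfam.gamma_eq hq fun e z hz => (ext_fnField ψ e (x := (q, z)) ⟨hq, hz⟩).symm
  -- A primitive of the one-form restricted to the plane through `φ`: closedness becomes the
  -- symmetry of its mixed partials.
  set U := fun q : ℝ × ℝ => bcFunctional g (φ + q.1 • ψ₁ + q.2 • ψ₂) with hU
  have h1 : ∀ q ∈ V, HasDerivAt (fun s => U (s, q.2)) (mint (gammaDensity H (fnField Q ψ₁)) q) q.1 :=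
    fun q hq => by
      have h := hasDerivAt_bcFunctional hg (hV q hq) ψ₁
      rw [← sub_self q.1] at h
      refine ((HasDerivAt.comp_sub_const q.1 q.1 h).congr_of_eventuallyEq (.of_eq (funext fun s => ?_))).congr_deriv
        (hγ ψ₁ q hq)
      refine congrArg (bcFunctional g) ?_
      module
  have h2 : ∀ q ∈ V, HasDerivAt (fun t => U (q.1, t)) (mint (gammaDensity H (fnField Q ψ₂)) q) q.2 :=
    fun q hq => by
      have h := hasDerivAt_bcFunctional hg (hV q hq) ψ₂
      rw [← sub_self q.2] at h
      refine ((HasDerivAt.comp_sub_const q.2 q.2 h).congr_of_eventuallyEq (.of_eq (funext fun s => ?_))).congr_deriv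
        (hγ ψ₂ q hq)
      refine congrArg (bcFunctional g) ?_
      module
  obtain ⟨LA, hLA, -⟩ := hasFDerivAt_mint (gammaDensity H (fnField Q ψ₁)) (show (0 : ℝ × ℝ) ∈ Q from h0)
  obtain ⟨LB, hLB, -⟩ := hasFDerivAt_mint (gammaDensity H (fnField Q ψ₂)) (show (0 : ℝ × ℝ) ∈ Q from h0)
  have hsymm := mixed_partials_symm hVo h1 h2 (continuousOn_mint (Q := Q) _)
    (continuousOn_mint (Q := Q) _) h0 hLA hLB
  have e1 : HasDerivAt (fun t : ℝ => g.gamma (φ + t • ψ₁) ψ₂) (LB (1, 0)) 0 := by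
    refine (hLB.comp_hasDerivAt (0 : ℝ) (f := fun t : ℝ => ((t, 0) : ℝ × ℝ))
      ((hasDerivAt_id _).prodMk (hasDerivAt_const _ _))).congr_of_eventuallyEq ?_
    have hc : ContinuousAt (fun t : ℝ => ((t, 0) : ℝ × ℝ)) 0 := by fun_prop
    filter_upwards [hc.eventually_mem (hVo.mem_nhds h0)] with t ht
    simpa using hγ ψ₂ (t, 0) ht
  have e2 : HasDerivAt (fun t : ℝ => g.gamma (φ + t • ψ₂) ψ₁) (LB (1, 0)) 0 := by
    rw [hsymm]
    refine (hLA.comp_hasDerivAt (0 : ℝ) (f := fun t : ℝ => ((0, t) : ℝ × ℝ))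
      ((hasDerivAt_const _ _).prodMk (hasDerivAt_id _))).congr_of_eventuallyEq ?_
    have hc : ContinuousAt (fun t : ℝ => ((0, t) : ℝ × ℝ)) 0 := by fun_prop
    filter_upwards [hc.eventually_mem (hVo.mem_nhds h0)] with t ht
    simpa using hγ ψ₁ (0, t) ht
  -- The derivative of a function that is real near `0` is real.
  have him : (LB (1, 0)).im = 0 := by
    have h3 := Complex.imCLM.hasFDerivAt.comp_hasDerivAt (0 : ℝ) e1
    refine h3.unique ((hasDerivAt_const (0 : ℝ) (0 : ℝ)).congr_of_eventuallyEq ?_)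
    filter_upwards [add_smul_mem_potentials hφ ψ₁] with t ht
    exact Complex.conj_eq_iff_im.1 (star_gamma ht ψ₂)
  have hre : ((LB (1, 0)).re : ℂ) = LB (1, 0) := Complex.ext (by simp) (by simp [him])
  exact ⟨(LB (1, 0)).re, by rwa [hre], by rwa [hre]⟩

end Exactness

end KahlerGeom
end

/-! ### The theorem: closedness and exactness -/

theorem mainTheorem5 {n : ℕ} {M : Type*} [TopologicalSpace M] [T2Space M] [CompactSpace M]
    [ChartedSpace (KahlerGeom.Cn n) M] [IsManifold 𝓘(ℂ, KahlerGeom.Cn n) ω M]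
    (g : KahlerGeom.HermitianMetric n M) (hg : g.IsKahler) :
    -- the 1-form is closed: the derivative of `γ(ψ₂)` along `ψ₁` is symmetric in `ψ₁`, `ψ₂`
    (∀ φ ∈ g.potentials, ∀ ψ₁ ψ₂ : C^∞⟮𝓘(ℝ, KahlerGeom.Cn n), M; ℝ⟯,
      ∃ D : ℝ, HasDerivAt (fun t : ℝ => g.gamma (φ + t • ψ₁) ψ₂) (D : ℂ) 0 ∧
        HasDerivAt (fun t : ℝ => g.gamma (φ + t • ψ₂) ψ₁) (D : ℂ) 0) ∧
    -- it is exact, with the Bott–Chern functional as a primitive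
    ∃ S : C^∞⟮𝓘(ℝ, KahlerGeom.Cn n), M; ℝ⟯ → ℝ,
      (∀ φ ∈ g.potentials, Nonempty (KahlerGeom.MetricPath g φ) ∧
        ∀ P : KahlerGeom.MetricPath g φ, (S φ : ℂ) = P.functional) ∧
      ∀ φ ∈ g.potentials, ∀ ψ : C^∞⟮𝓘(ℝ, KahlerGeom.Cn n), M; ℝ⟯,
        HasDerivAt (fun t : ℝ => (S (φ + t • ψ) : ℂ)) (g.gamma φ ψ) 0 := by
  have hS : ∀ φ ∈ g.potentials, ((KahlerGeom.bcFunctional g φ).re : ℂ) = KahlerGeom.bcFunctional g φ :=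
    fun φ hφ => Complex.ext (by simp) (by simp [KahlerGeom.im_bcFunctional hg hφ])
  refine ⟨fun φ hφ ψ₁ ψ₂ => KahlerGeom.exists_hasDerivAt_gamma hg hφ ψ₁ ψ₂,
    fun φ => (KahlerGeom.bcFunctional g φ).re, fun φ hφ => ⟨KahlerGeom.exists_metricPath hφ,
      fun P => (hS φ hφ).trans (KahlerGeom.bcFunctional_eq hg hφ P)⟩, fun φ hφ ψ => ?_⟩
  -- The real part agrees with the functional only on potentials, which suffices because `φ + t • ψ`
  -- is a potential for small `t`.
  refine (KahlerGeom.hasDerivAt_bcFunctional hg hφ ψ).congr_of_eventuallyEq ?_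
  filter_upwards [KahlerGeom.add_smul_mem_potentials hφ ψ] with t ht
  exact hS _ ht
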